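/- Fix the following conventions. For integers $b\ge 2$ and $d\ge 1$ let $\Sigma_{b,d}=\{0,\dots,b-1\}^d\cup\{\star\}$. An $\omega$-word over $\Sigma_{b,d}$ is an encoding in $b$'s-complement if it has the form $\mathbf a\,\mathbf v\star\mathbf u$ with $\mathbf a\in\{0,b-1\}^d$, $\mathbf v$ a finite and $\mathbf u$ an infinite word over $\{0,\dots,b-1\}^d$; it encodes the vector $r\in\mathbb R^d$ with $$r_i=\varepsilon_i+\sum_{k<|\mathbf v|}b^{|\mathbf v|-1-k}\,(\mathbf v[k])_i+\sum_{k\ge 0}b^{-k-1}(\mathbf u[k])_i,\qquad \varepsilon_i=\begin{cases}0&\text{if }a_i=0,\\-b^{|\mathbf v|}&\text{if }a_i=b-1.\end{cases}$$ A set $L$ of $\omega$-words over $\Sigma_{b,d}$ is saturated in $b$'s-complement if every word of $L$ is an encoding and, for every $r\in\mathbb R^d$ with an encoding in $L$, all encodings of $r$ belong to $L$. A deterministic Büchi automaton over $\Sigma_{b,d}$ is a Real Vector Automaton (RVA) if the language it recognizes is saturated. It is weak if its set of accepting states is a union of strongly connected components (a state lying on no cycle being a component on its own), and minimal if distinct states,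 taken as initial states, recognize distinct languages. Complexity is measured on programs with integer variables and arrays of integers: arithmetic operations (addition, subtraction, multiplication, comparison), reading and editing an array position, creating an array, and evaluating the transition function of the input automaton take constant time; each integer takes constant space; the input automaton is read-only and is not counted in the space. 1. There is an algorithm that, given $b\ge 2$, $d\ge 1$ and a weak deterministic Büchi automaton $\mathcal A$ over $\Sigma_{b,d}$ with $n$ states, decides whether $\mathcal A$ is an RVA (with respect to $b$'s-complement) in time $O(n\log(n+1)\,d\,b^d)$ and space $O(n b^d)$. 2. There is an algorithm that, given $b\ge 2$ and a minimal weak deterministic Büchi automaton $\mathcal A$ over $\Sigma_{b,1}$ with $n$ states, decides whether the language recognized by $\mathcal A$ is saturated in $b$'s-complement in time $O(nb)$ and space $O(n)$. The constants in the $O(\cdot)$ are absolute. -/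

import Mathlib

/-! ## Deterministic Büchi automata -/

/-- A (complete) deterministic Büchi automaton with states `Q` over the alphabet `A`. -/
structure DBA (Q A : Type) where
  init : Q
  trans : Q → A → Q
  acc : Finset Q

namespace DBA

variable {Q A : Type}

/-- The run on the `ω`-word `w` starting in the state `q`. -/
def run (M : DBA Q A) (q : Q) (w : ℕ → A) : ℕ → Q
  | 0 => q
  | i + 1 => M.trans (M.run q w i) (w i)

/-- `w` is accepted from `q`: some accepting state occurs infinitely often in the run. -/
def AcceptsFrom (M : DBA Q A) (q : Q) (w : ℕ → A) : Prop :=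
  ∃ p ∈ M.acc, ∃ᶠ i in Filter.atTop, M.run q w i = p

def Accepts (M : DBA Q A) (w : ℕ → A) : Prop := M.AcceptsFrom M.init w

/-- `q` is accessible from `p` by a non-empty finite word. -/
def Accessible (M : DBA Q A) (p q : Q) : Prop :=
  ∃ u : List A, u ≠ [] ∧ u.foldl M.trans p = q

/-- The accepting set is a union of strongly connected components. A state lying on no cycle
forms a component on its own. -/
def Weak (M : DBA Q A) : Prop :=
  ∀ p q, M.Accessible p q → M.Accessible q p → (p ∈ M.acc ↔ q ∈ M.acc)

/-- Distinct states accept distinct languages. -/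
def Minimal (M : DBA Q A) : Prop :=
  ∀ p q, p ≠ q → {w | M.AcceptsFrom p w} ≠ {w | M.AcceptsFrom q w}

end DBA

/-! ## Vectors of reals in `b`'s-complement, parallel encoding -/

/-- The `d`-parallel alphabet: a `d`-vector of digits, or the separator `none` (the dot). -/
abbrev Letter (b d : ℕ) : Type := Option (Fin d → Fin b)

/-- Concatenation of a finite word and an `ω`-word. -/
def concatWord {A : Type} (v : List A) (w : ℕ → A) : ℕ → A :=
  fun i => if h : i < v.length then v[i] else w (i - v.length)

/-- A sign digit is `0` or `b - 1`. -/
def IsSignDigit {b : ℕ} (a : Fin b) : Prop := a.val = 0 ∨ a.val = b - 1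

/-- The natural number written by `v` in base `b`, most significant digit first. -/
def natValue {b : ℕ} (v : List (Fin b)) : ℕ := Nat.ofDigits b (v.reverse.map Fin.val)

/-- The number encoded in `b`'s-complement by the sign digit `a`, followed by the digits `v`,
the dot, and the fractional digits `u`. (Used for sign digits `a` only.) -/
noncomputable def complementValue {b : ℕ} (a : Fin b) (v : List (Fin b)) (u : ℕ → Fin b) : ℝ :=
  (if a.val = 0 then 0 else -(b : ℝ) ^ v.length) + natValue v + Real.ofDigits u

/-- The `ω`-word `w` encodes the vector `r`: it has the form `a v ⋆ u` with `a` a vector of sign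
digits, `v` a finite and `u` an infinite sequence of vectors of digits, and in each component
its value is that of `r`. -/
def Encodes {b d : ℕ} (w : ℕ → Letter b d) (r : Fin d → ℝ) : Prop :=
  ∃ (a : Fin d → Fin b) (v : List (Fin d → Fin b)) (u : ℕ → Fin d → Fin b),
    (∀ i, IsSignDigit (a i)) ∧
    w = concatWord (some a :: v.map some ++ [none]) (fun j => some (u j)) ∧
    ∀ i, r i = complementValue (a i) (v.map (fun x => x i)) (fun j => u j i)

/-- A language is saturated in `b`'s-complement if it contains only encodings of vectors of reals
and, with one encoding of a vector, it contains all encodings of this vector. -/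
def SaturatedLanguage {b d : ℕ} (L : Set (ℕ → Letter b d)) : Prop :=
  (∀ w ∈ L, ∃ r, Encodes w r) ∧
  ∀ (r : Fin d → ℝ) (w w' : ℕ → Letter b d), Encodes w r → Encodes w' r → w ∈ L → w' ∈ L

/-- Real Vector Automaton: the recognized language is saturated. -/
def DBA.IsRVA {Q : Type} {b d : ℕ} (M : DBA Q (Letter b d)) : Prop :=
  SaturatedLanguage {w | M.Accepts w}

/-! ## The machine model

A program is a fixed finite command over finitely many integer variables and finitely many
arrays of integers. Arithmetic, comparisons, array accesses, the creation of an array and the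
evaluation of the transition function of the input automaton have unit cost, and each integer
takes one unit of space. -/

/-- The input automaton, as a program can access it: number of states, base, dimension, initial
state, transition function, accepting states (`1` if accepting, `0` if not). -/
structure Input where
  states : ℕ
  base : ℕ
  dim : ℕ
  init : ℕ
  trans : ℕ → ℕ → ℕ
  acc : ℕ → ℕ

/-- The states are the numbers `0, …, n - 1`. The digit vector `a` is given to the program as the
number `∑ i, a i * b ^ i < b ^ d`, and the dot as the number `b ^ d`. Values of the transition
function outside of its domain are `0`. -/
def DBA.toInput {n b d : ℕ} (M : DBA (Fin n) (Letter b d)) : Input where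
  states := n
  base := b
  dim := d
  init := M.init
  trans := fun q x =>
    if hq : q < n then
      if hx : x < b ^ d then M.trans ⟨q, hq⟩ (some (finFunctionFinEquiv.symm ⟨x, hx⟩))
      else if x = b ^ d then M.trans ⟨q, hq⟩ none else 0
    else 0
  acc := fun q => if hq : q < n then (if ⟨q, hq⟩ ∈ M.acc then 1 else 0) else 0

/-- Expressions over `k` variables and `m` arrays. -/
inductive Expr (k m : ℕ) : Type
  | const (c : ℕ)
  | var (x : Fin k)
  | read (a : Fin m) (i : Expr k m)
  | length (a : Fin m)
  | add (e f : Expr k m)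
  | sub (e f : Expr k m)
  | mul (e f : Expr k m)
  | lt (e f : Expr k m)
  | eq (e f : Expr k m)
  | states
  | base
  | dim
  | init
  | trans (q x : Expr k m)
  | acc (q : Expr k m)

inductive Cmd (k m : ℕ) : Type
  | skip
  | assign (x : Fin k) (e : Expr k m)
  | create (a : Fin m) (size : Expr k m)
  | write (a : Fin m) (i e : Expr k m)
  | seq (c₁ c₂ : Cmd k m)
  | ite (e : Expr k m) (c₁ c₂ : Cmd k m)
  | loop (e : Expr k m) (c : Cmd k m)

/-- A memory: the values of the variables and the contents of the arrays. -/
structure Memory (k m : ℕ) where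
  var : Fin k → ℕ
  arr : Fin m → List ℕ

namespace Memory

variable {k m : ℕ}

/-- All variables are `0` and all arrays are empty. -/
def initial (k m : ℕ) : Memory k m := ⟨fun _ => 0, fun _ => []⟩

/-- Number of integers held in memory. -/
def size (σ : Memory k m) : ℕ := k + ∑ a, (σ.arr a).length

def setVar (σ : Memory k m) (x : Fin k) (v : ℕ) : Memory k m :=
  { σ with var := Function.update σ.var x v }

def setArr (σ : Memory k m) (a : Fin m) (l : List ℕ) : Memory k m :=
  { σ with arr := Function.update σ.arr a l }

end Memory

namespace Expr

variable {k m : ℕ}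

/-- Value of an expression. Subtraction is truncated at `0`, the comparisons return `1` or `0`,
reading outside of an array returns `0`. -/
def eval (I : Input) (σ : Memory k m) : Expr k m → ℕ
  | const c => c
  | var x => σ.var x
  | read a i => (σ.arr a).getD (i.eval I σ) 0
  | length a => (σ.arr a).length
  | add e f => e.eval I σ + f.eval I σ
  | sub e f => e.eval I σ - f.eval I σ
  | mul e f => e.eval I σ * f.eval I σ
  | lt e f => if e.eval I σ < f.eval I σ then 1 else 0
  | eq e f => if e.eval I σ = f.eval I σ then 1 else 0
  | states => I.states
  | base => I.base
  | dim => I.dim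
  | init => I.init
  | trans q x => I.trans (q.eval I σ) (x.eval I σ)
  | acc q => I.acc (q.eval I σ)

/-- Number of operations in an expression. -/
def cost : Expr k m → ℕ
  | const _ | var _ | length _ | states | base | dim | init => 1
  | read _ i => i.cost + 1
  | acc q => q.cost + 1
  | add e f | sub e f | mul e f | lt e f | eq e f | trans e f => e.cost + f.cost + 1

end Expr

/-- `Exec I c σ σ' t s`: on the input `I`, the command `c` started in the memory `σ` halts in the
memory `σ'` after `t` steps, and the memory has never held more than `s` integers.
A new array is filled with `0`; writing outside of an array has no effect. -/
inductive Exec (I : Input) {k m : ℕ} :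
    Cmd k m → Memory k m → Memory k m → ℕ → ℕ → Prop
  | skip (σ) : Exec I .skip σ σ 1 σ.size
  | assign (σ x e) : Exec I (.assign x e) σ (σ.setVar x (e.eval I σ)) (e.cost + 1) σ.size
  | create (σ a e) :
      Exec I (.create a e) σ (σ.setArr a (List.replicate (e.eval I σ) 0)) (e.cost + 1)
        (max σ.size (σ.setArr a (List.replicate (e.eval I σ) 0)).size)
  | write (σ a i e) :
      Exec I (.write a i e) σ (σ.setArr a ((σ.arr a).set (i.eval I σ) (e.eval I σ)))
        (i.cost + e.cost + 1) σ.size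
  | seq {c₁ c₂ σ σ' σ'' t₁ t₂ s₁ s₂} :
      Exec I c₁ σ σ' t₁ s₁ → Exec I c₂ σ' σ'' t₂ s₂ →
      Exec I (.seq c₁ c₂) σ σ'' (t₁ + t₂) (max s₁ s₂)
  | iteTrue {e c₁ c₂ σ σ' t s} : e.eval I σ ≠ 0 → Exec I c₁ σ σ' t s →
      Exec I (.ite e c₁ c₂) σ σ' (e.cost + 1 + t) s
  | iteFalse {e c₁ c₂ σ σ' t s} : e.eval I σ = 0 → Exec I c₂ σ σ' t s →
      Exec I (.ite e c₁ c₂) σ σ' (e.cost + 1 + t) s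
  | loopFalse {e c σ} : e.eval I σ = 0 → Exec I (.loop e c) σ σ (e.cost + 1) σ.size
  | loopTrue {e c σ σ' σ'' t₁ t₂ s₁ s₂} : e.eval I σ ≠ 0 →
      Exec I c σ σ' t₁ s₁ → Exec I (.loop e c) σ' σ'' t₂ s₂ →
      Exec I (.loop e c) σ σ'' (e.cost + 1 + t₁ + t₂) (max s₁ s₂)

/-- On the input `I`, the program `P` halts within `T` steps, using space for at most `S` integers
besides its read-only input, and then its variable number `0` holds the truth value of `p`. -/
def DecidesWithin {k m : ℕ} (P : Cmd (k + 1) m) (I : Input) (p : Prop) (T S : ℝ) : Prop :=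
  ∃ (σ : Memory (k + 1) m) (t s : ℕ), Exec I P (Memory.initial (k + 1) m) σ t s ∧
    (p → σ.var 0 = 1) ∧ (¬ p → σ.var 0 = 0) ∧ (t : ℝ) ≤ T ∧ (s : ℝ) ≤ S

/-! Saturation is first reduced to local conditions. If the sign 0 is replaced by the digit 1 and
the sign b-1 by the digit 0, an encoding with m digits between sign and dot has the value b^m (b x -
1), where x is an ordinary base-b expansion beginning with the replaced sign (`encodes_iff`). Two
expansions of one number are equal or differ by a carry: a digit k followed by b-1, b-1, … against
k+1 followed by zeros. Changing one component at a time, and repeating signs to equalise lengths,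
one sees that a language is saturated iff it contains only encodings, is invariant under repetition
of the sign letter, and is invariant under a carry in a single component (`saturatedLanguage_iff`).

For the first algorithm each condition becomes the equivalence of two states of a weak automaton
with 4n+3 states. Its letters come with an optional flag that marks the place of the carry; there is
one automaton per component and one for the encoding and sign conditions together
(`carryTable_sameLanguage`, `signTable_sameLanguage`, `DBA.isRVA_iff`). To decide whether s and s'
are equivalent, the least congruence identifying them is computed by the Hopcroft–Karp closure;
union by rank costs the logarithmic factor. If s and s' are equivalent, this congruence identifies
only equivalent states. Then two states on cycles whose classes lie in one strongly connected
component of the quotient have the same acceptance: pumping the two cycles alternately, with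
connecting paths between them, must finally close up to a single cycle that meets both acceptances
(`WeakTable.acc_eq_of_cycles`). Conversely, runs from s and s' on one word stay congruent and settle
in the same component, so agreement of the cycle states there gives agreement of the runs. States on
cycles are replaced by the states that survive the repeated removal of nodes without incoming edges
inside their block (component and acceptance); behind each survivor there is a cycle in the same
block, and states visited infinitely often survive (`WeakTable.sameLanguage_iff`). There are d+1
such tests, with N = 4n+3 states and K = 2(b^d+1) letters.

For the second algorithm no table may be stored and the logarithm has to disappear. Minimality turns
statements about languages into equalities of states: a state that rejects everything is a sink, and
invariance under repetition of a sign x means t (t s0 x) x = t s0 x. In one dimension the word after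
a carry is forced, so a carry before the dot compares, for all l, the acceptance of c^l ⋆ c c c …
from two states, with c = b-1 on one side and c = 0 on the other (`LocalCriterion`,
`WordCriterion.of_local`, `WordCriterion.local`). The successors by the digits 0 and b-1 form a
functional graph on 2n nodes, each carrying one bit, and two nodes have to be compared by their
infinite sequences of bits. Such a sequence, read in base 3, is a rational number; it is computed as
an exact fraction with a bounded number of operations per node, and equal numbers mean equal
sequences (`code_eq_iff`). This relies on integers having unit cost and unit size. One constant-time
test per node and letter remains (`localCriterion_iff`).

Time is handled by a program logic with potentials. Space needs no bookkeeping: all arrays are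
created before the main body, which creates none (`decidesWithin_of_wp`). -/

set_option linter.unusedSimpArgs false

open Function

/-! ## A program logic with running times -/

namespace Memory

variable {k m : ℕ}

/-- The contents of an array, as a total function. -/
def rd (σ : Memory k m) (a : Fin m) : ℕ → ℕ := fun j => (σ.arr a).getD j 0

/-- The length of an array. -/
def len (σ : Memory k m) (a : Fin m) : ℕ := (σ.arr a).length

/-- Writing one array position. -/
def wr (σ : Memory k m) (a : Fin m) (i v : ℕ) : Memory k m := σ.setArr a ((σ.arr a).set i v)

/-- Replacing an array by zeros. -/
def mk0 (σ : Memory k m) (a : Fin m) (N : ℕ) : Memory k m := σ.setArr a (List.replicate N 0)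

@[simp] theorem var_setVar (σ : Memory k m) (x y : Fin k) (v : ℕ) :
    (σ.setVar x v).var y = if y = x then v else σ.var y := by
  simp [setVar, update_apply]

@[simp] theorem rd_setVar (σ : Memory k m) (x : Fin k) (v : ℕ) (a : Fin m) :
    (σ.setVar x v).rd a = σ.rd a := rfl

@[simp] theorem len_setVar (σ : Memory k m) (x : Fin k) (v : ℕ) (a : Fin m) :
    (σ.setVar x v).len a = σ.len a := rfl

@[simp] theorem var_wr (σ : Memory k m) (a : Fin m) (i v : ℕ) (x : Fin k) :
    (σ.wr a i v).var x = σ.var x := rfl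

@[simp] theorem len_wr (σ : Memory k m) (a : Fin m) (i v : ℕ) (c : Fin m) :
    (σ.wr a i v).len c = σ.len c := by
  by_cases h : c = a
  · subst h; simp [wr, len, setArr]
  · simp [wr, len, setArr, h]

@[simp] theorem rd_wr (σ : Memory k m) (a : Fin m) (i v : ℕ) (c : Fin m) :
    (σ.wr a i v).rd c =
      if c = a then (if i < σ.len a then update (σ.rd a) i v else σ.rd a)
      else σ.rd c := by
  by_cases h : c = a
  · subst h
    by_cases hi : i < σ.len c
    · funext j
      simp only [if_true, hi]
      by_cases hj : j = i
      · subst hj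
        simp [rd, wr, setArr, List.getD_eq_getElem?_getD, show j < (σ.arr c).length from hi]
      · simp [rd, wr, setArr, List.getD_eq_getElem?_getD, hj, Ne.symm hj]
    · have : (σ.arr c).set i v = σ.arr c := List.set_eq_of_length_le (not_lt.1 hi)
      simp [wr, setArr, this, hi]
  · funext j; simp [rd, wr, setArr, h]

theorem rd_wr_self (σ : Memory k m) {a : Fin m} {i : ℕ} (v : ℕ) (h : i < σ.len a) :
    (σ.wr a i v).rd a = update (σ.rd a) i v := by
  rw [rd_wr, if_pos rfl, if_pos h]

@[simp] theorem len_mk0 (σ : Memory k m) (a : Fin m) (N : ℕ) (c : Fin m) :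
    (σ.mk0 a N).len c = if c = a then N else σ.len c := by
  by_cases h : c = a
  · subst h; simp [mk0, len, setArr]
  · simp [mk0, len, setArr, h]

theorem size_eq (σ : Memory k m) : σ.size = k + ∑ a, σ.len a := rfl

end Memory

open Memory

@[simp] theorem Expr.eval_read {k m : ℕ} (I : Input) (σ : Memory k m) (a : Fin m) (i : Expr k m) :
    (Expr.read a i).eval I σ = σ.rd a (i.eval I σ) := rfl

@[simp] theorem Expr.eval_length {k m : ℕ} (I : Input) (σ : Memory k m) (a : Fin m) :
    (Expr.length a : Expr k m).eval I σ = σ.len a := rfl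

namespace Expr

variable {k m : ℕ} (I : Input) (σ : Memory k m) (e f : Expr k m)

@[simp] theorem eval_const (c : ℕ) : (const c : Expr k m).eval I σ = c := rfl
@[simp] theorem eval_var (x : Fin k) : (var x : Expr k m).eval I σ = σ.var x := rfl
@[simp] theorem eval_add : (add e f).eval I σ = e.eval I σ + f.eval I σ := rfl
@[simp] theorem eval_sub : (sub e f).eval I σ = e.eval I σ - f.eval I σ := rfl
@[simp] theorem eval_mul : (mul e f).eval I σ = e.eval I σ * f.eval I σ := rfl
@[simp] theorem eval_lt :
    (lt e f).eval I σ = if e.eval I σ < f.eval I σ then 1 else 0 := rfl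
@[simp] theorem eval_eq :
    (eq e f).eval I σ = if e.eval I σ = f.eval I σ then 1 else 0 := rfl
@[simp] theorem eval_states : (states : Expr k m).eval I σ = I.states := rfl
@[simp] theorem eval_base : (base : Expr k m).eval I σ = I.base := rfl
@[simp] theorem eval_dim : (dim : Expr k m).eval I σ = I.dim := rfl
@[simp] theorem eval_init : (init : Expr k m).eval I σ = I.init := rfl
@[simp] theorem eval_trans : (trans e f).eval I σ = I.trans (e.eval I σ) (f.eval I σ) := rfl
@[simp] theorem eval_acc : (acc e).eval I σ = I.acc (e.eval I σ) := rfl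

attribute [simp] cost

end Expr

open Expr

namespace Cmd

variable {k m : ℕ}

/-- No array is created. -/
def createFree : Cmd k m → Prop
  | skip | assign _ _ | write _ _ _ => True
  | create _ _ => False
  | seq c1 c2 | ite _ c1 c2 => c1.createFree ∧ c2.createFree
  | loop _ c => c.createFree

/-- The variables a command may modify. -/
def mv : Cmd k m → List (Fin k)
  | skip | create _ _ | write _ _ _ => []
  | assign x _ => [x]
  | seq c1 c2 | ite _ c1 c2 => c1.mv ++ c2.mv
  | loop _ c => c.mv

/-- The arrays a command may modify. -/
def ma : Cmd k m → List (Fin m)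
  | skip | assign _ _ => []
  | create a _ | write a _ _ => [a]
  | seq c1 c2 | ite _ c1 c2 => c1.ma ++ c2.ma
  | loop _ c => c.ma

attribute [simp] createFree mv ma

end Cmd

/-! ### Frames, preconditions and loop rules -/

section Logic

variable {k m : ℕ} {I : Input}

theorem Exec.var_eq {c : Cmd k m} {σ τ : Memory k m} {t s : ℕ} (h : Exec I c σ τ t s) :
    ∀ x, x ∉ c.mv → τ.var x = σ.var x := by
  induction h with
  | skip σ => intros; rfl
  | assign σ x e => intro y hy; simp [Cmd.mv] at hy; simp [var_setVar, hy]
  | create => intros; rfl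
  | write => intros; rfl
  | seq _ _ h1 h2 => intro y hy; simp [Cmd.mv] at hy; rw [h2 y hy.2, h1 y hy.1]
  | iteTrue _ _ h => intro y hy; simp [Cmd.mv] at hy; exact h y hy.1
  | iteFalse _ _ h => intro y hy; simp [Cmd.mv] at hy; exact h y hy.2
  | loopFalse => intros; rfl
  | loopTrue _ _ _ h1 h2 => intro y hy; rw [h2 y hy, h1 y hy]

theorem Exec.arr_eq {c : Cmd k m} {σ τ : Memory k m} {t s : ℕ} (h : Exec I c σ τ t s) :
    ∀ a, a ∉ c.ma → τ.arr a = σ.arr a := by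
  induction h with
  | skip σ => intros; rfl
  | assign σ x e => intros; rfl
  | create => intro y hy; simp [Cmd.ma] at hy; simp [setArr, hy]
  | write => intro y hy; simp [Cmd.ma] at hy; simp [setArr, hy]
  | seq _ _ h1 h2 => intro y hy; simp [Cmd.ma] at hy; rw [h2 y hy.2, h1 y hy.1]
  | iteTrue _ _ h => intro y hy; simp [Cmd.ma] at hy; exact h y hy.1
  | iteFalse _ _ h => intro y hy; simp [Cmd.ma] at hy; exact h y hy.2
  | loopFalse => intros; rfl
  | loopTrue _ _ _ h1 h2 => intro y hy; rw [h2 y hy, h1 y hy]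

/-- Only the creation of an array changes a length. Hence the space of such a command is the size of
its initial memory, and the logic below tracks time alone. -/
theorem Exec.len_eq {c : Cmd k m} {σ τ : Memory k m} {t s : ℕ} (h : Exec I c σ τ t s)
    (hc : c.createFree) : (∀ a, τ.len a = σ.len a) ∧ s = σ.size := by
  induction h with
  | skip σ => simp
  | assign σ x e => simp [len_setVar]
  | create => exact hc.elim
  | write σ a i e => exact ⟨fun c => len_wr σ a _ _ c, rfl⟩
  | @seq c1 c2 σ τ υ t1 t2 s1 s2 _ _ h1 h2 =>
    obtain ⟨a1, b1⟩ := h1 hc.1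
    obtain ⟨a2, b2⟩ := h2 hc.2
    have : τ.size = σ.size := by simp [size_eq, a1]
    exact ⟨fun a => (a2 a).trans (a1 a), by rw [b1, b2, this, max_self]⟩
  | iteTrue _ _ h => exact h hc.1
  | iteFalse _ _ h => exact h hc.2
  | loopFalse => simp
  | @loopTrue e c σ τ υ t1 t2 s1 s2 _ _ _ h1 h2 =>
    obtain ⟨a1, b1⟩ := h1 hc
    obtain ⟨a2, b2⟩ := h2 hc
    have : τ.size = σ.size := by simp [size_eq, a1]
    exact ⟨fun a => (a2 a).trans (a1 a), by rw [b1, b2, this, max_self]⟩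

/-- The command halts, and the final memory and the running time satisfy `Q`. -/
def wp (I : Input) (c : Cmd k m) (Q : Memory k m → ℕ → Prop) (σ : Memory k m) : Prop :=
  ∃ τ t s, Exec I c σ τ t s ∧ Q τ t

theorem wp.mono {c : Cmd k m} {Q R : Memory k m → ℕ → Prop} {σ : Memory k m}
    (h : wp I c Q σ) (hQR : ∀ τ t, Q τ t → R τ t) : wp I c R σ := by
  obtain ⟨τ, t, s, he, hq⟩ := h
  exact ⟨τ, t, s, he, hQR _ _ hq⟩

/-- The part of the memory that a command leaves unchanged. -/
structure Frame (xs : List (Fin k)) (as : List (Fin m)) (σ τ : Memory k m) : Prop where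
  var : ∀ x, (_ : x ∉ xs := by simp) → τ.var x = σ.var x
  rd : ∀ a, (_ : a ∉ as := by simp) → τ.rd a = σ.rd a
  len : ∀ a, τ.len a = σ.len a

/-- What a command leaves unchanged is read off its syntax, so specifications need not mention it
and it can be added afterwards. -/
theorem wp.frame {c : Cmd k m} {Q R : Memory k m → ℕ → Prop} {σ : Memory k m}
    (h : wp I c Q σ) (hc : c.createFree)
    (hQR : ∀ τ t, Frame c.mv c.ma σ τ → Q τ t → R τ t) : wp I c R σ := by
  obtain ⟨τ, t, s, he, hq⟩ := h
  refine ⟨τ, t, s, he, hQR _ _ ⟨he.var_eq, fun a ha => ?_, (he.len_eq hc).1⟩ hq⟩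
  unfold Memory.rd; rw [he.arr_eq a ha]

@[simp] theorem wp_skip {Q : Memory k m → ℕ → Prop} {σ : Memory k m} :
    wp I .skip Q σ ↔ Q σ 1 :=
  ⟨fun ⟨_, _, _, he, hq⟩ => by cases he; exact hq, fun h => ⟨_, _, _, .skip σ, h⟩⟩

@[simp] theorem wp_assign {Q : Memory k m → ℕ → Prop} {σ : Memory k m} {x : Fin k} {e : Expr k m} :
    wp I (.assign x e) Q σ ↔ Q (σ.setVar x (e.eval I σ)) (e.cost + 1) :=
  ⟨fun ⟨_, _, _, he, hq⟩ => by cases he; exact hq, fun h => ⟨_, _, _, .assign σ x e, h⟩⟩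

@[simp] theorem wp_write {Q : Memory k m → ℕ → Prop} {σ : Memory k m} {a : Fin m} {i e : Expr k m} :
    wp I (.write a i e) Q σ ↔ Q (σ.wr a (i.eval I σ) (e.eval I σ)) (i.cost + e.cost + 1) :=
  ⟨fun ⟨_, _, _, he, hq⟩ => by cases he; exact hq, fun h => ⟨_, _, _, .write σ a i e, h⟩⟩

@[simp] theorem wp_seq {Q : Memory k m → ℕ → Prop} {σ : Memory k m} {c1 c2 : Cmd k m} :
    wp I (.seq c1 c2) Q σ ↔ wp I c1 (fun τ t => wp I c2 (fun υ t' => Q υ (t + t')) τ) σ := by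
  constructor
  · rintro ⟨_, _, _, he, hq⟩
    cases he with
    | seq h1 h2 => exact ⟨_, _, _, h1, _, _, _, h2, hq⟩
  · rintro ⟨_, _, _, h1, _, _, _, h2, hq⟩
    exact ⟨_, _, _, .seq h1 h2, hq⟩

@[simp] theorem wp_ite {Q : Memory k m → ℕ → Prop} {σ : Memory k m} {e : Expr k m} {c1 c2 : Cmd k m} :
    wp I (.ite e c1 c2) Q σ ↔
      if e.eval I σ = 0 then wp I c2 (fun τ t => Q τ (e.cost + 1 + t)) σ
      else wp I c1 (fun τ t => Q τ (e.cost + 1 + t)) σ := by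
  split_ifs with h0
  · constructor
    · rintro ⟨_, _, _, he, hq⟩
      cases he with
      | iteTrue h h1 => exact absurd h0 h
      | iteFalse h h1 => exact ⟨_, _, _, h1, hq⟩
    · rintro ⟨_, _, _, he, hq⟩
      exact ⟨_, _, _, .iteFalse h0 he, hq⟩
  · constructor
    · rintro ⟨_, _, _, he, hq⟩
      cases he with
      | iteTrue h h1 => exact ⟨_, _, _, h1, hq⟩
      | iteFalse h h1 => exact absurd h h0
    · rintro ⟨_, _, _, he, hq⟩
      exact ⟨_, _, _, .iteTrue h0 he, hq⟩

/-- The rules that evaluate expressions. -/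
theorem evals {k m : ℕ} {I : Input} {σ : Memory k m} :
    (∀ c, (const c : Expr k m).eval I σ = c) ∧ (∀ x, (var x : Expr k m).eval I σ = σ.var x) ∧
    (∀ e f : Expr k m, (add e f).eval I σ = e.eval I σ + f.eval I σ) ∧
    (∀ e f : Expr k m, (sub e f).eval I σ = e.eval I σ - f.eval I σ) ∧
    (∀ e f : Expr k m, (mul e f).eval I σ = e.eval I σ * f.eval I σ) ∧
    (∀ e f : Expr k m, (lt e f).eval I σ = if e.eval I σ < f.eval I σ then 1 else 0) ∧
    (∀ e f : Expr k m, (eq e f).eval I σ = if e.eval I σ = f.eval I σ then 1 else 0) ∧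
    (∀ a (e : Expr k m), (read a e).eval I σ = σ.rd a (e.eval I σ)) ∧
    (∀ e : Expr k m, (acc e).eval I σ = I.acc (e.eval I σ)) ∧
    (∀ e f : Expr k m, (trans e f).eval I σ = I.trans (e.eval I σ) (f.eval I σ)) ∧
    (states : Expr k m).eval I σ = I.states ∧ (base : Expr k m).eval I σ = I.base := by
  simp

/-- The rules that execute commands without branching, and look up variables and arrays. -/
theorem steps {k m : ℕ} {I : Input} {σ : Memory k m} :
    (∀ (Q : Memory k m → ℕ → Prop) c c', wp I (.seq c c') Q σ ↔
      wp I c (fun τ t => wp I c' (fun υ t' => Q υ (t + t')) τ) σ) ∧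
    (∀ (Q : Memory k m → ℕ → Prop) x e, wp I (.assign x e) Q σ ↔
      Q (σ.setVar x (e.eval I σ)) (e.cost + 1)) ∧
    (∀ (Q : Memory k m → ℕ → Prop) a i e, wp I (.write a i e) Q σ ↔
      Q (σ.wr a (i.eval I σ) (e.eval I σ)) (i.cost + e.cost + 1)) ∧
    (∀ Q : Memory k m → ℕ → Prop, wp I .skip Q σ ↔ Q σ 1) ∧
    (∀ x y v, (σ.setVar x v).var y = if y = x then v else σ.var y) ∧
    (∀ x v a, (σ.setVar x v).rd a = σ.rd a) ∧ (∀ a i v x, (σ.wr a i v).var x = σ.var x) ∧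
    (∀ {α : Type} (a b : α), (if True then a else b) = a) ∧
    (∀ {α : Type} (a b : α), (if False then a else b) = b) ∧ (1 : ℕ) ≠ 0 := by
  simp

/-- Loop rule: `Φ` is a potential that pays for the remaining iterations. -/
theorem wp_loop {Inv : Memory k m → Prop} {Φ : Memory k m → ℕ} {e : Expr k m} {c : Cmd k m}
    (hbody : ∀ σ, Inv σ → e.eval I σ ≠ 0 →
      wp I c (fun τ t => Inv τ ∧ t + e.cost + 1 + Φ τ ≤ Φ σ) σ)
    {σ : Memory k m} (h0 : Inv σ) :
    wp I (.loop e c) (fun τ t => Inv τ ∧ e.eval I τ = 0 ∧ t + Φ τ ≤ Φ σ + e.cost + 1) σ := by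
  induction hn : Φ σ using Nat.strong_induction_on generalizing σ with
  | _ n ih =>
    subst hn
    by_cases he : e.eval I σ = 0
    · exact ⟨_, _, _, .loopFalse he, h0, he, by omega⟩
    · obtain ⟨τ, t, s, hx, hi, ht⟩ := hbody σ h0 he
      obtain ⟨υ, t', s', hx', hi', he', ht'⟩ := ih (Φ τ) (by omega) hi rfl
      exact ⟨_, _, _, .loopTrue he hx hx', hi', he', by omega⟩

/-- Count the variable `x` from `0` up to the value of `hi`. -/
def Cmd.for (x : Fin k) (hi : Expr k m) (c : Cmd k m) : Cmd k m :=
  .seq (.assign x (.const 0))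
    (.loop (.lt (.var x) hi) (.seq c (.assign x (.add (.var x) (.const 1)))))

@[simp] theorem Cmd.createFree_for (x : Fin k) (hi : Expr k m) (c : Cmd k m) :
    (Cmd.for x hi c).createFree ↔ c.createFree := by simp [Cmd.for]

@[simp] theorem Cmd.mv_for (x : Fin k) (hi : Expr k m) (c : Cmd k m) :
    (Cmd.for x hi c).mv = x :: (c.mv ++ [x]) := by simp [Cmd.for]

@[simp] theorem Cmd.ma_for (x : Fin k) (hi : Expr k m) (c : Cmd k m) :
    (Cmd.for x hi c).ma = c.ma := by simp [Cmd.for]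

/-- Rule for counting loops; the invariant is indexed by the number of iterations done, `Φ` is
a potential for amortization, `T` is the amortized time of one iteration. -/
theorem wp_for_amortized {Inv : ℕ → Memory k m → Prop} {Φ : Memory k m → ℕ} {x : Fin k}
    {hi : Expr k m} {c : Cmd k m} {H T : ℕ} {σ : Memory k m}
    (h0 : Inv 0 (σ.setVar x 0)) (hΦ0 : Φ (σ.setVar x 0) = Φ σ)
    (hH : ∀ j σ, Inv j σ → hi.eval I σ = H)
    (hx : ∀ j σ, Inv j σ → σ.var x = j)
    (hbody : ∀ j σ, j < H → Inv j σ →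
      wp I c (fun τ t => τ.var x = j ∧ Inv (j + 1) (τ.setVar x (j + 1)) ∧
        t + Φ (τ.setVar x (j + 1)) ≤ T + Φ σ) σ) :
    wp I (.for x hi c)
      (fun τ t => Inv H τ ∧ t + Φ τ ≤ H * (T + hi.cost + 7) + hi.cost + 5 + Φ σ) σ := by
  rw [Cmd.for, wp_seq, wp_assign]
  -- One iteration pays `hi.cost + 3` for the test and 4 for the increment. The last, failing test
  -- and the initial assignment make up `hi.cost + 5`.
  refine (wp_loop (Inv := fun σ => ∃ j ≤ H, Inv j σ)
    (Φ := fun σ => (H - σ.var x) * (T + hi.cost + 7) + Φ σ) ?_ ⟨0, by omega, h0⟩).mono ?_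
  · rintro σ ⟨j, hj, hI⟩ hlt
    have hxj := hx j σ hI
    have hHj := hH j σ hI
    simp only [evals, hxj, hHj, ne_eq, ite_eq_right_iff, one_ne_zero, imp_false, not_not] at hlt
    rw [wp_seq]
    refine (hbody j σ hlt hI).mono ?_
    rintro τ t ⟨h1, h2, h3⟩
    rw [wp_assign]
    simp only [eval_add, eval_var, eval_const, h1, cost]
    refine ⟨⟨j + 1, hlt, h2⟩, ?_⟩
    rw [hx _ _ h2, hxj]
    obtain ⟨r, rfl⟩ : ∃ r, H = j + 1 + r := ⟨H - (j + 1), by omega⟩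
    have e1 : j + 1 + r - (j + 1) = r := by omega
    have e2 : j + 1 + r - j = r + 1 := by omega
    rw [e1, e2, add_mul]
    omega
  · rintro τ t ⟨⟨j, hj, hI⟩, he, ht⟩
    have hxj := hx j τ hI
    have hHj := hH j τ hI
    simp only [evals, steps, hxj, hHj, ite_eq_right_iff, imp_false] at he
    obtain rfl : j = H := by omega
    refine ⟨hI, ?_⟩
    simp only [steps, hxj, hΦ0, cost] at ht ⊢
    simp at ht
    omega

theorem wp_for {Inv : ℕ → Memory k m → Prop} {x : Fin k}
    {hi : Expr k m} {c : Cmd k m} {H T : ℕ} {σ : Memory k m}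
    (h0 : Inv 0 (σ.setVar x 0))
    (hH : ∀ j σ, Inv j σ → hi.eval I σ = H)
    (hx : ∀ j σ, Inv j σ → σ.var x = j)
    (hbody : ∀ j σ, j < H → Inv j σ →
      wp I c (fun τ t => τ.var x = j ∧ Inv (j + 1) (τ.setVar x (j + 1)) ∧ t ≤ T) σ) :
    wp I (.for x hi c)
      (fun τ t => Inv H τ ∧ t ≤ H * (T + hi.cost + 7) + hi.cost + 5) σ :=
  wp_for_amortized (Φ := fun _ => 0) h0 rfl hH hx hbody

end Logic

/-- Memories, expressions and commands with `40` variables and `20` arrays. -/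
abbrev Mem := Memory 40 20
abbrev Exp := Expr 40 20
abbrev Prog := Cmd 40 20


/-! ## Union-find and the Hopcroft–Karp congruence closure -/


notation "vN" => (7 : Fin 40)
notation "vK" => (8 : Fin 40)
notation "vS" => (9 : Fin 40)
notation "vS'" => (10 : Fin 40)
notation "vq" => (11 : Fin 40)
notation "vx" => (12 : Fin 40)
notation "vu" => (13 : Fin 40)
notation "vw" => (14 : Fin 40)
notation "vr" => (15 : Fin 40)
notation "vr'" => (16 : Fin 40)
notation "vtop" => (17 : Fin 40)
notation "vh" => (18 : Fin 40)
notation "aT" => (0 : Fin 20)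
notation "aF" => (1 : Fin 20)
notation "aPar" => (2 : Fin 20)
notation "aRk" => (3 : Fin 20)
notation "aA" => (4 : Fin 20)
notation "aB" => (5 : Fin 20)
notation "aCls" => (6 : Fin 20)

/-- `par` is a union-find forest with ranks `rk` on `0, …, N - 1`, and `ρ` maps every node to its
root. -/
structure UnionFind (N : ℕ) (par rk ρ : ℕ → ℕ) : Prop where
  par_lt : ∀ q < N, par q < N
  root_lt : ∀ q < N, ρ q < N
  root_par : ∀ q < N, ρ (par q) = ρ q
  par_root : ∀ q < N, par (ρ q) = ρ q
  root_of_par : ∀ q < N, par q = q → ρ q = q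
  rank_lt : ∀ q < N, par q ≠ q → rk q < rk (par q)
  rank_le : ∀ q < N, rk q ≤ rk (ρ q)
  size : ∀ q < N, 2 ^ rk (ρ q) ≤ ((Finset.range N).filter (fun p => ρ p = ρ q)).card

namespace UnionFind

variable {N : ℕ} {par rk ρ : ℕ → ℕ}

/-- A root of rank r has at least 2^r nodes below it, and there are only N nodes. This is the source
of the logarithm in the running time. -/
theorem rank_le_log (h : UnionFind N par rk ρ) {q : ℕ} (hq : q < N) :
    rk (ρ q) ≤ Nat.log 2 N := by
  refine Nat.le_log_of_pow_le (by norm_num) ((h.size q hq).trans ?_)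
  simpa using Finset.card_filter_le (Finset.range N) (fun p => ρ p = ρ q)

theorem discrete (N : ℕ) {par rk : ℕ → ℕ} (hp : ∀ q < N, par q = q) (hr : ∀ q < N, rk q = 0) :
    UnionFind N par rk id where
  par_lt := by grind
  root_lt := by grind
  root_par := by grind
  par_root := by grind
  root_of_par := by grind
  rank_lt := by grind
  rank_le := by grind
  size q hq := by
    rw [show rk (id q) = 0 from hr q hq, pow_zero, Nat.one_le_iff_ne_zero, Finset.card_ne_zero]
    exact ⟨q, by simp [hq]⟩

theorem root_root (h : UnionFind N par rk ρ) {q : ℕ} (hq : q < N) : ρ (ρ q) = ρ q :=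
  h.root_of_par _ (h.root_lt q hq) (h.par_root q hq)

/-- Linking the root `a` to the root `c` of no smaller rank. -/
theorem link (h : UnionFind N par rk ρ) {a c : ℕ} (ha : a < N) (hc : c < N) (pa : par a = a)
    (pc : par c = c) (hac : a ≠ c) {rk' : ℕ → ℕ} (hle : rk a ≤ rk c)
    (hrk' : ∀ q, q ≠ c → rk' q = rk q)
    (hrkc : rk' c = if rk a = rk c then rk c + 1 else rk c) :
    UnionFind N (update par a c) rk' (fun q => if ρ q = a then c else ρ q) := by
  have ra : ρ a = a := h.root_of_par a ha pa
  have rc : ρ c = c := h.root_of_par c hc pc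
  have hcr : rk c ≤ rk' c := by rw [hrkc]; split_ifs <;> omega
  have hle' : ∀ q, rk q ≤ rk' q := by grind
  have hlt : rk a < rk' c := by rw [hrkc]; split_ifs <;> omega
  refine ⟨?_, ?_, ?_, ?_, ?_, ?_, ?_, ?_⟩
  · have := h.par_lt; grind
  · have := h.root_lt; grind
  · have := h.root_par; grind
  · have := h.par_root; grind
  · have := h.root_of_par; grind
  · have := h.rank_lt; grind
  · have := h.rank_le; grind
  · intro q hq
    have hsub : ∀ r, r ≠ a → ((Finset.range N).filter (fun p => ρ p = r)) ⊆
        (Finset.range N).filter (fun p => (if ρ p = a then c else ρ p) = r) := by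
      intro r hr p hp
      simp only [Finset.mem_filter] at hp ⊢
      refine ⟨hp.1, ?_⟩
      rw [hp.2, if_neg hr]
    -- The rank of `c` grows only if both ranks are equal; then the two disjoint classes, each with
    -- at least 2^rank nodes, are joined and the size doubles as required.
    have hc' : 2 ^ rk' c ≤
        ((Finset.range N).filter (fun p => (if ρ p = a then c else ρ p) = c)).card := by
      have s1 := h.size a ha
      have s2 := h.size c hc
      rw [ra] at s1
      rw [rc] at s2
      have hdis : Disjoint ((Finset.range N).filter (fun p => ρ p = a))
          ((Finset.range N).filter (fun p => ρ p = c)) := by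
        rw [Finset.disjoint_filter]
        intro p _ h1 h2
        exact hac (h1.symm.trans h2)
      have hun : ((Finset.range N).filter (fun p => ρ p = a)) ∪
          ((Finset.range N).filter (fun p => ρ p = c)) ⊆
          (Finset.range N).filter (fun p => (if ρ p = a then c else ρ p) = c) := by
        refine Finset.union_subset ?_ (hsub c hac.symm)
        intro p hp
        simp only [Finset.mem_filter] at hp ⊢
        exact ⟨hp.1, by rw [if_pos hp.2]⟩
      have := Finset.card_le_card hun
      rw [Finset.card_union_of_disjoint hdis] at this
      refine le_trans ?_ this
      rw [hrkc]
      split_ifs with he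
      · rw [pow_succ]; rw [he] at s1; omega
      · omega
    by_cases hqa : ρ q = a
    · simpa [hqa] using hc'
    · by_cases hqc : ρ q = c
      · simpa [hqa, hqc, hac.symm] using hc'
      · simp only [hqa, if_false]
        rw [hrk' _ hqc]
        exact (h.size q hq).trans (Finset.card_le_card (hsub _ hqa))

end UnionFind

/-- The state of the Hopcroft–Karp algorithm: the union-find forest holds the equivalence relation
generated by the `top` pairs that were merged. -/
structure HopcroftKarp (N : ℕ) (par rk : ℕ → ℕ) (A B : ℕ → ℕ) (top : ℕ) (ρ : ℕ → ℕ) : Prop where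
  uf : UnionFind N par rk ρ
  count : ((Finset.range N).filter (fun q => par q = q)).card + top = N
  pair_lt : ∀ j < top, A j < N ∧ B j < N
  pair_eq : ∀ j < top, ρ (A j) = ρ (B j)
  gen : ∀ E : ℕ → ℕ → Prop, Equivalence E → (∀ j < top, E (A j) (B j)) →
    ∀ p < N, ∀ q < N, ρ p = ρ q → E p q

/-- The hypothesis `huv` allows both orientations, because the ranks and not the order of the pair
decide which root is attached. One root is lost for each recorded pair, so `count` keeps the number
of pairs below N. -/
theorem HopcroftKarp.link {N : ℕ} {par rk A B : ℕ → ℕ} {top : ℕ} {ρ : ℕ → ℕ}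
    (h : HopcroftKarp N par rk A B top ρ) {u v a c : ℕ} (hu : u < N) (hv : v < N)
    (huv : (ρ u = a ∧ ρ v = c) ∨ (ρ u = c ∧ ρ v = a)) (hac : a ≠ c) {rk' : ℕ → ℕ}
    (hle : rk a ≤ rk c) (hrk' : ∀ q, q ≠ c → rk' q = rk q)
    (hrkc : rk' c = if rk a = rk c then rk c + 1 else rk c) :
    HopcroftKarp N (update par a c) rk' (update A top u)
      (update B top v) (top + 1) (fun q => if ρ q = a then c else ρ q) := by
  have ha : a < N := by
    rcases huv with ⟨e, _⟩ | ⟨_, e⟩ <;> rw [← e] <;> apply h.uf.root_lt <;> assumption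
  have hc : c < N := by
    rcases huv with ⟨_, e⟩ | ⟨e, _⟩ <;> rw [← e] <;> apply h.uf.root_lt <;> assumption
  have pa : par a = a := by
    rcases huv with ⟨e, _⟩ | ⟨_, e⟩ <;> rw [← e] <;> apply h.uf.par_root <;> assumption
  have pc : par c = c := by
    rcases huv with ⟨_, e⟩ | ⟨e, _⟩ <;> rw [← e] <;> apply h.uf.par_root <;> assumption
  refine ⟨h.uf.link ha hc pa pc hac hle hrk' hrkc, ?_, ?_, ?_, ?_⟩
  · have : (Finset.range N).filter (fun q => update par a c q = q) =
        ((Finset.range N).filter (fun q => par q = q)).erase a := by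
      ext q
      by_cases hq : q = a
      · subst hq; simp [hac.symm]
      · simp [hq]
    rw [this, Finset.card_erase_of_mem (by simp [ha, pa])]
    have h1 := h.count
    have : 0 < ((Finset.range N).filter (fun q => par q = q)).card :=
      Finset.card_pos.2 ⟨a, by simp [ha, pa]⟩
    omega
  · intro j hj
    by_cases hjt : j = top
    · subst hjt; simp [hu, hv]
    · simp [hjt]; exact h.pair_lt j (by omega)
  · intro j hj
    by_cases hjt : j = top
    · subst hjt
      rcases huv with ⟨e1, e2⟩ | ⟨e1, e2⟩ <;> simp [e1, e2]
    · simp [hjt, h.pair_eq j (by omega)]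
  · intro E hE hEp
    have h0 : ∀ p < N, ∀ q < N, ρ p = ρ q → E p q := h.gen E hE fun j hj => by
      have := hEp j (by omega)
      simpa [show j ≠ top by omega] using this
    have huv' : E u v := by simpa using hEp top (by omega)
    -- Any newly identified pair is joined through the recorded pair: p ~ u ~ v ~ q, or the same
    -- with u and v exchanged.
    have hac' : ∀ p < N, ∀ q < N, ρ p = a → ρ q = c → E p q := by
      intro p hp q hq e1 e2
      rcases huv with ⟨e3, e4⟩ | ⟨e3, e4⟩
      · exact hE.trans (h0 p hp u hu (e1.trans e3.symm))
          (hE.trans huv' (h0 v hv q hq (e4.trans e2.symm)))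
      · exact hE.trans (h0 p hp v hv (e1.trans e4.symm))
          (hE.trans (hE.symm huv') (h0 u hu q hq (e3.trans e2.symm)))
    intro p hp q hq hpq
    split_ifs at hpq with h1 h2 h2
    · exact h0 p hp q hq (h1.trans h2.symm)
    · exact hac' p hp q hq h1 hpq.symm
    · exact hE.symm (hac' q hq p hp h2 hpq)
    · exact h0 p hp q hq hpq

section Program

variable {I : Input}

/-- Store the root of the value of `e` in `r`. -/
def findRoot (r : Fin 40) (e : Exp) : Prog :=
  .seq (.assign r e)
    (.loop (.lt (.const 0) (.sub (.const 1) (.eq (.read aPar (.var r)) (.var r))))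
      (.assign r (.read aPar (.var r))))

@[simp] theorem createFree_findRoot (r : Fin 40) (e : Exp) :
    (findRoot r e).createFree := by simp [findRoot]

@[simp] theorem mv_findRoot (r : Fin 40) (e : Exp) :
    (findRoot r e).mv = [r, r] := by simp [findRoot]

@[simp] theorem ma_findRoot (r : Fin 40) (e : Exp) :
    (findRoot r e).ma = [] := by simp [findRoot]

/-- Ranks strictly increase towards the root and are at most log N, so the potential is the
remaining distance in rank, with weight 13 for one round of the loop. Path compression is not needed
for the bound. -/
theorem wp_findRoot {N : ℕ} {σ : Mem} {ρ : ℕ → ℕ} {r : Fin 40} {e : Exp} {u : ℕ}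
    (huf : UnionFind N (σ.rd aPar) (σ.rd aRk) ρ) (he : e.eval I σ = u) (hu : u < N) :
    wp I (findRoot r e) (fun τ t => τ.var r = ρ u ∧ Frame [r] [] σ τ ∧
      t ≤ e.cost + 20 * (Nat.log 2 N + 1)) σ := by
  have key := wp_loop (I := I) (e := Expr.lt (.const 0) (.sub (.const 1)
      (.eq (.read aPar (.var r)) (.var r)))) (c := Cmd.assign r (.read aPar (.var r)))
    (Inv := fun τ => Frame [r] [] σ τ ∧ τ.var r < N ∧ ρ (τ.var r) = ρ u)
    (Φ := fun τ => 13 * (Nat.log 2 N - σ.rd aRk (τ.var r)))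
    (σ := σ.setVar r u) ?_ ⟨⟨?_, ?_, ?_⟩, ?_, ?_⟩
  · simp only [steps, findRoot, he]
    refine key.mono ?_
    rintro τ t ⟨⟨h1, h2, h3⟩, h4, h5⟩
    have hp : τ.rd aPar = σ.rd aPar := h1.rd _
    simp [hp] at h4
    rw [huf.root_of_par _ h2 h4] at h3
    refine ⟨h3, h1, ?_⟩
    simp at h5
    omega
  · rintro τ ⟨h1, h2, h3⟩ h4
    have hp : τ.rd aPar = σ.rd aPar := h1.rd _
    simp [hp] at h4
    rw [wp_assign]
    simp only [evals, hp]
    have hlt := huf.par_lt _ h2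
    refine ⟨⟨⟨fun x hx => ?_, fun a ha => h1.rd a ha, h1.len⟩, by simpa using hlt, ?_⟩, ?_⟩
    · simp at hx; simp [hx, h1.var x (by simpa using hx)]
    · simpa [h3] using huf.root_par _ h2
    · have a1 := huf.rank_lt _ h2 h4
      have a2 := huf.rank_le _ hlt
      have a3 := huf.rank_le_log hlt
      simp
      omega
  · intro x hx; simp at hx; simp [hx]
  · intro a _; rfl
  · intro a; rfl
  · simpa using hu
  · simp

end Program


/-! ### Transition tables, frames and the union of two classes -/

/-- The memory holds a transition table with `N` states and `K` letters. -/
structure HasTable (N K : ℕ) (δ : ℕ → ℕ → ℕ) (σ : Mem) : Prop where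
  var_N : σ.var vN = N
  var_K : σ.var vK = K
  table : ∀ q < N, ∀ x < K, σ.rd aT (q * K + x) = δ q x
  lt : ∀ q < N, ∀ x < K, δ q x < N
  len : ∀ a, N ≤ σ.len a

theorem HasTable.of_same {N K : ℕ} {δ : ℕ → ℕ → ℕ} {σ τ : Mem}
    (h : HasTable N K δ σ) {xs : List (Fin 40)} {as : List (Fin 20)} (hs : Frame xs as σ τ)
    (h1 : vN ∉ xs := by simp) (h2 : vK ∉ xs := by simp) (h3 : aT ∉ as := by simp) : HasTable N K δ τ where
  var_N := by rw [hs.var _ h1, h.var_N]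
  var_K := by rw [hs.var _ h2, h.var_K]
  table := by rw [hs.rd _ h3]; exact h.table
  lt := h.lt
  len a := by rw [hs.len]; exact h.len a

section Same

variable {k m : ℕ} {xs : List (Fin k)} {as : List (Fin m)} {σ τ υ : Memory k m}

theorem Frame.rfl : Frame xs as σ σ := ⟨fun _ _ => .refl _, fun _ _ => .refl _, fun _ => .refl _⟩

theorem Frame.refl (xs : List (Fin k)) (as : List (Fin m)) (σ : Memory k m) :
    Frame xs as σ σ := .rfl

theorem Frame.trans {ys : List (Fin k)} {bs : List (Fin m)} (h : Frame xs as σ τ)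
    (h' : Frame ys bs τ υ) (hx : xs ⊆ ys := by simp)
    (ha : as ⊆ bs := by simp) : Frame ys bs σ υ where
  var x h1 := by rw [h'.var x h1, h.var x (fun h2 => h1 (hx h2))]
  rd a h1 := by rw [h'.rd a h1, h.rd a (fun h2 => h1 (ha h2))]
  len a := by rw [h'.len, h.len]

theorem Frame.setVar (h : Frame xs as σ τ) {x : Fin k} {v : ℕ}
    (hx : x ∈ xs := by simp) :
    Frame xs as σ (τ.setVar x v) where
  var y hy := by
    rw [var_setVar, if_neg (fun e => hy (by rw [e]; exact hx)), h.var y hy]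
  rd a ha := h.rd a ha
  len := h.len

theorem Frame.wr (h : Frame xs as σ τ) {a : Fin m} {i v : ℕ}
    (ha : a ∈ as := by simp) :
    Frame xs as σ (τ.wr a i v) where
  var x hx := h.var x hx
  rd c hc := by
    rw [rd_wr, if_neg (fun e => hc (by rw [e]; exact ha)), h.rd c hc]
  len c := by rw [len_wr, h.len]

theorem Frame.weaken {ys : List (Fin k)} {bs : List (Fin m)} (h : Frame xs as σ τ)
    (hx : xs ⊆ ys := by decide) (ha : as ⊆ bs := by decide) : Frame ys bs σ τ where
  var x hn := h.var x fun hc => hn (hx hc)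
  rd a hn := h.rd a fun hc => hn (ha hc)
  len := h.len

/-- Filling an array in one pass. -/
theorem wp_fill {I : Input} {x : Fin k} {a : Fin m} {hi e : Expr k m} {H : ℕ} {g : ℕ → ℕ}
    {σ : Memory k m}
    (hH : ∀ τ, Frame [x] [a] σ τ → hi.eval I τ = H)
    (he : ∀ j < H, ∀ τ, Frame [x] [a] σ τ → τ.var x = j → (∀ i < j, τ.rd a i = g i) →
      (∀ i, j ≤ i → τ.rd a i = σ.rd a i) → e.eval I τ = g j) (hl : H ≤ σ.len a) :
    wp I (.for x hi (.write a (.var x) e)) (fun τ t => Frame [x] [a] σ τ ∧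
      (∀ i < H, τ.rd a i = g i) ∧ (∀ i, H ≤ i → τ.rd a i = σ.rd a i) ∧
      t ≤ H * (e.cost + hi.cost + 9) + hi.cost + 5) σ := by
  refine (wp_for (H := H) (T := e.cost + 2) (Inv := fun j τ => τ.var x = j ∧
    Frame [x] [a] σ τ ∧ (∀ i < j, τ.rd a i = g i) ∧ ∀ i, j ≤ i → τ.rd a i = σ.rd a i)
    ⟨by simp, Frame.rfl.setVar, by simp, fun _ _ => rfl⟩
    (fun j τ h => hH τ h.2.1) (fun j τ h => h.1) ?_).mono ?_
  · rintro j τ hj ⟨h1, h2, h3, h4⟩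
    rw [wp_write, he j hj τ h2 h1 h3 h4, eval_var, h1]
    have l : j < τ.len a := by rw [h2.len]; omega
    refine ⟨h1, ⟨by simp, h2.wr.setVar, fun i hi => ?_, fun i hi => ?_⟩,
      by simp; omega⟩
    · rw [rd_setVar, rd_wr_self _ _ l]
      by_cases hij : i = j
      · rw [hij, update_self]
      · rw [update_of_ne hij, h3 i (by omega)]
    · rw [rd_setVar, rd_wr_self _ _ l, update_of_ne (by omega), h4 i (by omega)]
  · rintro τ t ⟨⟨h1, h2, h3, h4⟩, ht⟩
    exact ⟨h2, h3, h4, ht.trans (by rw [show e.cost + 2 + hi.cost + 7 = e.cost + hi.cost + 9 by ring])⟩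

end Same

section Program

variable {I : Input}

/-- Merge the classes of `vu` and `vw`, and record the pair if they were distinct. -/
def unite : Prog :=
  .seq (findRoot vr (.var vu)) <| .seq (findRoot vr' (.var vw)) <|
  .ite (.eq (.var vr) (.var vr')) .skip <|
  .seq
    (.ite (.lt (.read aRk (.var vr)) (.read aRk (.var vr')))
      (.write aPar (.var vr) (.var vr'))
      (.seq (.write aPar (.var vr') (.var vr))
        (.ite (.eq (.read aRk (.var vr)) (.read aRk (.var vr')))
          (.write aRk (.var vr) (.add (.read aRk (.var vr)) (.const 1))) .skip))) <|
  .seq (.write aA (.var vtop) (.var vu)) <| .seq (.write aB (.var vtop) (.var vw)) <|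
  .assign vtop (.add (.var vtop) (.const 1))

@[simp] theorem createFree_unite : unite.createFree := by simp [unite]

@[simp] theorem mv_unite : unite.mv = [vr, vr, vr', vr', vtop] := by simp [unite]

@[simp] theorem ma_unite : unite.ma = [aPar, aPar, aRk, aA, aB] := by simp [unite]

/-- The memory holds a state of the Hopcroft–Karp algorithm. -/
def HKState (N : ℕ) (ρ : ℕ → ℕ) (σ : Mem) : Prop :=
  HopcroftKarp N (σ.rd aPar) (σ.rd aRk) (σ.rd aA) (σ.rd aB) (σ.var vtop) ρ

theorem HKState.of_same {N : ℕ} {ρ : ℕ → ℕ} {σ τ : Mem} (h : HKState N ρ σ)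
    {xs : List (Fin 40)} {as : List (Fin 20)} (hs : Frame xs as σ τ)
    (h1 : vtop ∉ xs := by simp) (h2 : aPar ∉ as := by simp) (h3 : aRk ∉ as := by simp)
    (h4 : aA ∉ as := by simp) (h5 : aB ∉ as := by simp) : HKState N ρ τ := by
  unfold HKState
  rw [hs.rd _ h2, hs.rd _ h3, hs.rd _ h4, hs.rd _ h5, hs.var _ h1]
  exact h

/-- The effect of uniting `u` and `v`. -/
structure United (N u v : ℕ) (ρ ρ' : ℕ → ℕ) (σ τ : Mem) : Prop where
  state : HKState N ρ' τ
  eq : ρ' u = ρ' v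
  coarser : ∀ p q, ρ p = ρ q → ρ' p = ρ' q
  le : σ.var vtop ≤ τ.var vtop
  old : ∀ j < σ.var vtop, τ.rd aA j = σ.rd aA j ∧ τ.rd aB j = σ.rd aB j
  new : ∀ j < τ.var vtop, σ.var vtop ≤ j → τ.rd aA j = u ∧ τ.rd aB j = v

/-- Two searches for roots dominate the time. Nothing is recorded for a pair that is already
identified; only a pair that really merges two classes will be processed later. -/
theorem wp_unite {N u v : ℕ} {ρ : ℕ → ℕ} {σ : Mem} (h : HKState N ρ σ)
    (hlen : ∀ a, N ≤ σ.len a) (hu : σ.var vu = u) (hv : σ.var vw = v) (hun : u < N) (hvn : v < N) :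
    wp I unite (fun τ t => (∃ ρ', United N u v ρ ρ' σ τ) ∧
      t ≤ 90 * (Nat.log 2 N + 1)) σ := by
  rw [unite, wp_seq]
  refine (wp_findRoot (u := u) h.uf (by simp [hu]) hun).mono ?_
  rintro σ1 t1 ⟨hr1, hs1, ht1⟩
  rw [wp_seq]
  have hP1 : σ1.rd aPar = σ.rd aPar := hs1.rd _
  have hR1 : σ1.rd aRk = σ.rd aRk := hs1.rd _
  refine (wp_findRoot (u := v) (N := N) (ρ := ρ) (by rw [hP1, hR1]; exact h.uf)
    (by simp [hs1.var vw, hv]) hvn).mono ?_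
  rintro σ2 t2 ⟨hr2, hs2, ht2⟩
  have hs : Frame [vr, vr'] [] σ σ2 := (hs1.trans (ys := [vr, vr']) (Frame.refl _ [] _)
    (by simp) (by simp)).trans ⟨fun x hx => hs2.var x (by simp at hx ⊢; tauto), fun a ha => hs2.rd a ha, hs2.len⟩
    (List.Subset.refl _) (by simp)
  have e1 : σ2.var vr = ρ u := by rw [hs2.var _, hr1]
  have eP : σ2.rd aPar = σ.rd aPar := hs.rd _
  have eR : σ2.rd aRk = σ.rd aRk := hs.rd _
  have eA : σ2.rd aA = σ.rd aA := hs.rd _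
  have eB : σ2.rd aB = σ.rd aB := hs.rd _
  have eu : σ2.var vu = u := by rw [hs.var _, hu]
  have ev : σ2.var vw = v := by rw [hs.var _, hv]
  have et : σ2.var vtop = σ.var vtop := hs.var _
  have hru := h.uf.root_lt u hun
  have hrv := h.uf.root_lt v hvn
  have l1 : ∀ r < N, ∀ a, r < σ2.len a := fun r hr a => by
    rw [hs.len]; exact hr.trans_le (hlen a)
  simp only [cost] at ht1 ht2
  by_cases heq : ρ u = ρ v
  · simp only [evals, wp_ite, e1, hr2, heq, if_true, one_ne_zero, if_false, wp_skip, cost]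
    refine ⟨⟨ρ, h.of_same hs, heq,
      fun _ _ h => h, et.ge, fun j _ => by rw [eA, eB]; exact ⟨rfl, rfl⟩, fun j h1 h2 => ?_⟩, ?_⟩
    · omega
    · omega
  -- There still is a root, so fewer than N pairs are recorded and the new pair fits into the
  -- arrays.
  have htop : σ.var vtop < N := by
    have h1 := h.count
    have : 0 < ((Finset.range N).filter (fun q => σ.rd aPar q = q)).card :=
      Finset.card_pos.2 ⟨ρ u, by simp [hru, h.uf.par_root u hun]⟩
    omega
  -- Common end of the three cases (smaller, equal or larger rank), which differ only in the
  -- contents of `aPar` and `aRk`.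
  have fin : ∀ (τ : Mem) ρ', τ.rd aA = update (σ.rd aA) (σ.var vtop) u →
      τ.rd aB = update (σ.rd aB) (σ.var vtop) v → τ.var vtop = σ.var vtop + 1 →
      HopcroftKarp N (τ.rd aPar) (τ.rd aRk) (update (σ.rd aA) (σ.var vtop) u)
        (update (σ.rd aB) (σ.var vtop) v) (σ.var vtop + 1) ρ' →
      ρ' u = ρ' v → (∀ p q, ρ p = ρ q → ρ' p = ρ' q) → United N u v ρ ρ' σ τ := by
    intro τ ρ' a1 a2 a3 a4 a5 a6
    refine ⟨?_, a5, a6, by omega, fun j hj => ?_, fun j h1 h2 => ?_⟩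
    · unfold HKState; rw [a1, a2, a3]; exact a4
    · simp [a1, a2, show j ≠ σ.var vtop by omega]
    · obtain rfl : j = σ.var vtop := by omega
      simp [a1, a2]
  by_cases hlt : σ.rd aRk (ρ u) < σ.rd aRk (ρ v)
  · simp [e1, hr2, heq, eP, eR, eA, eB, hlt, eu, ev, et, l1, hru, hrv, htop]
    refine ⟨⟨fun q => if ρ q = ρ u then ρ v else ρ q, fin _ _ ?_ ?_ ?_ ?_ ?_ ?_⟩, by omega⟩
    · simp [eA, eB, et, l1, htop]
    · simp [eA, eB, et, l1, htop]
    · simp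
    · simp only [rd_setVar, rd_wr, var_wr, len_wr, l1 _ hru, eP, eR]
      simp only [Fin.reduceEq, if_true, if_false]
      exact h.link hun hvn (Or.inl ⟨rfl, rfl⟩) heq hlt.le (fun _ _ => rfl) (by rw [if_neg hlt.ne])
    · simp
    · intro p q hpq; simp [hpq]
  · by_cases hre : σ.rd aRk (ρ u) = σ.rd aRk (ρ v)
    · simp [e1, hr2, heq, eP, eR, eA, eB, hre, eu, ev, et, l1, hru, hrv, htop]
      refine ⟨⟨fun q => if ρ q = ρ v then ρ u else ρ q, fin _ _ ?_ ?_ ?_ ?_ ?_ ?_⟩, by omega⟩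
      · simp [eA, eB, et, l1, htop]
      · simp [eA, eB, et, l1, htop]
      · simp
      · simp only [rd_setVar, rd_wr, var_wr, len_wr, l1 _ hru, l1 _ hrv, eP, eR]
        simp only [Fin.reduceEq, if_true, if_false]
        exact h.link hun hvn (Or.inr ⟨rfl, rfl⟩) (Ne.symm heq) hre.ge
          (fun q hq => by simp [hq]) (by simp [hre])
      · simp
      · intro p q hpq; simp [hpq]
    · simp [e1, hr2, heq, eP, eR, eA, eB, hlt, hre, eu, ev, et, l1, hru, hrv, htop]
      refine ⟨⟨fun q => if ρ q = ρ v then ρ u else ρ q, fin _ _ ?_ ?_ ?_ ?_ ?_ ?_⟩, by omega⟩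
      · simp [eA, eB, et, l1, htop]
      · simp [eA, eB, et, l1, htop]
      · simp
      · simp only [rd_setVar, rd_wr, var_wr, len_wr, l1 _ hrv, eP, eR]
        simp only [Fin.reduceEq, if_true, if_false]
        exact h.link hun hvn (Or.inr ⟨rfl, rfl⟩) (Ne.symm heq) (by omega)
          (fun q hq => rfl) (by rw [if_neg (Ne.symm hre)])
      · simp
      · intro p q hpq; simp [hpq]

end Program


/-! ### Closure under successors -/

/-- `E` is an equivalence relation that is compatible with the transitions on `0, …, N - 1` and
contains the pair `(s, s')`. -/
structure Congruence (N K : ℕ) (δ : ℕ → ℕ → ℕ) (s s' : ℕ) (E : ℕ → ℕ → Prop) : Prop where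
  equiv : Equivalence E
  base : E s s'
  step : ∀ p < N, ∀ q < N, ∀ x < K, E p q → E (δ p x) (δ q x)

section Program

variable {I : Input} {N K : ℕ} {δ : ℕ → ℕ → ℕ} {s s' : ℕ}

def hkInit : Prog :=
  .seq (.assign vtop (.const 0)) <|
  .for vq (.var vN) (.seq (.write aPar (.var vq) (.var vq)) (.write aRk (.var vq) (.const 0)))

theorem wp_hkInit {σ : Mem} (h : HasTable N K δ σ) :
    wp I hkInit (fun τ t => HKState N id τ ∧ τ.var vtop = 0 ∧ t ≤ 20 * N + 10) σ := by
  simp only [steps, hkInit]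
  refine (wp_for (H := N) (T := 6) (Inv := fun j τ => τ.var vq = j ∧ τ.var vN = N ∧
    τ.var vtop = 0 ∧ (∀ a, N ≤ τ.len a) ∧ ∀ q < j, τ.rd aPar q = q ∧ τ.rd aRk q = 0)
    ?_ ?_ ?_ ?_).mono ?_
  · simp [h.var_N, h.len]
  · rintro j σ ⟨_, h2, _⟩; simpa using h2
  · rintro j σ ⟨h1, _⟩; exact h1
  · rintro j σ hj ⟨h1, h2, h3, h4, h5⟩
    have l := fun a => hj.trans_le (h4 a)
    simp [h1, h2, h3, l, h4]
    intro q hq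
    by_cases hqj : q = j
    · simp [hqj]
    · simp [hqj, h5 q (by omega)]
  · rintro τ t ⟨⟨h1, h2, h3, h4, h5⟩, h6⟩
    refine ⟨⟨UnionFind.discrete N (fun q hq => (h5 q hq).1) (fun q hq => (h5 q hq).2), ?_, ?_, ?_,
      ?_⟩, h3, ?_⟩
    · rw [h3, Finset.filter_true_of_mem]
      · simp
      · intro q hq; exact (h5 q (by simpa using hq)).1
    · intro j hj; omega
    · intro j hj; omega
    · intro E hE _ p _ q _ hpq
      have : p = q := hpq
      exact this ▸ hE.refl p
    · simp at h6 ⊢; omega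

/-- Process the successors of the pair number `vh`. -/
def hkProcess : Prog :=
  .for vx (.var vK) <|
  .seq (.assign vu (.read aT (.add (.mul (.read aA (.var vh)) (.var vK)) (.var vx)))) <|
  .seq (.assign vw (.read aT (.add (.mul (.read aB (.var vh)) (.var vK)) (.var vx)))) unite

/-- The invariant of the closure under successors. -/
structure HKClosing (N K : ℕ) (δ : ℕ → ℕ → ℕ) (s s' h : ℕ) (ρ : ℕ → ℕ) (σ : Mem) :
    Prop where
  state : HKState N ρ σ
  var_h : σ.var vh = h
  le : h ≤ σ.var vtop
  base : ρ s = ρ s'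
  closed : ∀ j < h, ∀ x < K, ρ (δ (σ.rd aA j) x) = ρ (δ (σ.rd aB j) x)
  least : ∀ E, Congruence N K δ s s' E → ∀ j < σ.var vtop, E (σ.rd aA j) (σ.rd aB j)

theorem HKState.congr {ρ : ℕ → ℕ} {σ τ : Mem} (h : HKState N ρ σ)
    (h1 : τ.var vtop = σ.var vtop) (h2 : τ.rd aPar = σ.rd aPar) (h3 : τ.rd aRk = σ.rd aRk)
    (h4 : τ.rd aA = σ.rd aA) (h5 : τ.rd aB = σ.rd aB) : HKState N ρ τ := by
  unfold HKState
  rw [h1, h2, h3, h4, h5]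
  exact h

/-- The pairs recorded here are successors of a recorded pair by one letter, so they belong to every
congruence that contains (s, s'); this keeps `least`. Uniting them makes `ρ` only coarser, which
keeps `closed`. -/
theorem wp_hkProcess {σ : Mem} (hT : HasTable N K δ σ) {h : ℕ} {ρ : ℕ → ℕ}
    (hC : HKClosing N K δ s s' h ρ σ) (hlt : h < σ.var vtop) :
    wp I hkProcess (fun τ t => HasTable N K δ τ ∧ (∃ ρ', HKClosing N K δ s s' h ρ' τ ∧
      h < τ.var vtop ∧ ∀ x < K, ρ' (δ (τ.rd aA h) x) = ρ' (δ (τ.rd aB h) x)) ∧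
      t ≤ 122 * K * (Nat.log 2 N + 1) + 6) σ := by
  refine (wp_for (H := K) (T := 110 * (Nat.log 2 N + 1)) (Inv := fun j τ => τ.var vx = j ∧
    HasTable N K δ τ ∧ ∃ ρ', HKClosing N K δ s s' h ρ' τ ∧
      h < τ.var vtop ∧ ∀ x < j, ρ' (δ (τ.rd aA h) x) = ρ' (δ (τ.rd aB h) x))
    ?_ ?_ ?_ ?_).mono ?_
  · refine ⟨by simp, hT.of_same ((Frame.refl [vx] [] σ).setVar), ρ, ⟨hC.state.congr ?_ rfl rfl rfl rfl, ?_, ?_, hC.base, hC.closed, ?_⟩,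
      ?_, by simp⟩
    · simp
    · simp [hC.var_h]
    · simp [hC.le]
    · simpa using hC.least
    · simpa using hlt
  · rintro j σ ⟨_, h2, _⟩; simpa using h2.var_K
  · rintro j σ ⟨h1, _⟩; exact h1
  · clear hT hC hlt ρ σ
    rintro j σ hj ⟨hx, hT, ρ, hC, hlt, hj'⟩
    obtain ⟨pa, pb⟩ := hC.state.pair_lt h hlt
    have ta := hT.table _ pa j hj
    have tb := hT.table _ pb j hj
    simp only [evals, wp_seq, wp_assign, hx, hC.var_h, hT.var_K, ta, rd_setVar, var_setVar, Fin.reduceEq, if_false, tb]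
    set u := δ (σ.rd aA h) j with hu
    set v := δ (σ.rd aB h) j with hv
    set σ1 := (σ.setVar vu u).setVar vw v with hσ1
    have hs : Frame [vu, vw] [] σ σ1 :=
      (Frame.rfl.setVar).setVar
    refine (wp_unite (u := u) (v := v) (hC.state.of_same hs) (fun a => by rw [hs.len]; exact hT.len a) (by simp [hσ1])
      (by simp [hσ1]) (hT.lt _ pa j hj) (hT.lt _ pb j hj)).frame (by simp) ?_
    rintro σ2 t2 hs2 ⟨⟨ρ', hU⟩, ht2⟩
    have hT2 : HasTable N K δ σ2 := (hT.of_same hs).of_same hs2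
    have et : σ1.var vtop = σ.var vtop := hs.var _
    have eA : σ1.rd aA = σ.rd aA := hs.rd _
    have eB : σ1.rd aB = σ.rd aB := hs.rd _
    have htop := hU.le
    have hh := hC.le
    have old : ∀ j < σ.var vtop, σ2.rd aA j = σ.rd aA j ∧ σ2.rd aB j = σ.rd aB j := by
      have := hU.old; rwa [et, eA, eB] at this
    refine ⟨?_, ⟨by simp, ?_, ρ', ⟨?_, ?_, ?_, hU.coarser _ _ hC.base, ?_, ?_⟩, ?_, ?_⟩, ?_⟩
    · rw [hs2.var _, hs.var _, hx]
    · exact hT2.of_same ((Frame.refl [vx] [] _).setVar)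
    · exact hU.state.congr (by simp) rfl rfl rfl rfl
    · simp [hs2.var vh, hs.var vh, hC.var_h]
    · simp; omega
    · intro i hi x hx
      simp only [rd_setVar]
      rw [(old i (by omega)).1, (old i (by omega)).2]
      exact hU.coarser _ _ (hC.closed i hi x hx)
    · intro E hE i hi
      simp only [rd_setVar, var_setVar, Fin.reduceEq, if_false] at hi ⊢
      by_cases hi' : i < σ.var vtop
      · rw [(old i hi').1, (old i hi').2]; exact hC.least E hE i hi'
      · have := hU.new i hi (by omega)
        rw [this.1, this.2]
        exact hE.step _ pa _ pb _ hj (hC.least E hE h hlt)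
    · omega
    · intro x hx
      rw [(old h hlt).1, (old h hlt).2]
      by_cases hxj : x = j
      · subst hxj; exact hU.eq
      · exact hU.coarser _ _ (hj' x (by omega))
    · simp; omega
  · rintro τ t ⟨⟨h1, h2, h3⟩, ht⟩
    refine ⟨h2, h3, ht.trans ?_⟩
    simp
    nlinarith [Nat.zero_le (K * Nat.log 2 N), Nat.zero_le K]

def hkClosure : Prog :=
  .seq hkInit <| .seq (.assign vu (.var vS)) <| .seq (.assign vw (.var vS')) <|
  .seq unite <| .seq (.assign vh (.const 0)) <|
  .loop (.lt (.var vh) (.var vtop)) (.seq hkProcess (.assign vh (.add (.var vh) (.const 1))))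

/-- The relation given by `ρ` is the congruence generated by `(s, s')`. -/
structure GeneratedBy (N K : ℕ) (δ : ℕ → ℕ → ℕ) (s s' : ℕ) (ρ : ℕ → ℕ) : Prop where
  lt : ∀ q < N, ρ q < N
  root : ∀ q < N, ρ (ρ q) = ρ q
  base : ρ s = ρ s'
  step : ∀ p < N, ∀ q < N, ∀ x < K, ρ p = ρ q → ρ (δ p x) = ρ (δ q x)
  least : ∀ E, Congruence N K δ s s' E → ∀ p < N, ∀ q < N, ρ p = ρ q → E p q

/-- At most N - 1 unions succeed, and only recorded pairs are expanded. So there are at most N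
rounds of K unions, each of logarithmic cost. -/
theorem wp_hkClosure {σ : Mem} (hT : HasTable N K δ σ) (hs : σ.var vS = s)
    (hs' : σ.var vS' = s') (hsN : s < N) (hsN' : s' < N) :
    wp I hkClosure (fun τ t => HasTable N K δ τ ∧ (∃ ρ, HKState N ρ τ ∧
      GeneratedBy N K δ s s' ρ) ∧
      t ≤ 130 * N * (K + 1) * (Nat.log 2 N + 1) + 130 * (Nat.log 2 N + 1)) σ := by
  rw [hkClosure, wp_seq]
  refine (wp_hkInit hT).frame (by simp [hkInit]) ?_
  rintro σ1 t1 f1 ⟨h1, h2, h3⟩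
  have hT1 := hT.of_same f1 (by simp [hkInit]) (by simp [hkInit]) (by simp [hkInit])
  have es : σ1.var vS = s := by rw [f1.var _ (by simp [hkInit]), hs]
  have es' : σ1.var vS' = s' := by rw [f1.var _ (by simp [hkInit]), hs']
  simp only [evals, wp_seq, wp_assign, var_setVar, Fin.reduceEq, if_false, es, es', cost]
  set σ2 := (σ1.setVar vu s).setVar vw s' with hσ2
  have f2 : Frame [vu, vw] [] σ1 σ2 :=
      (Frame.rfl.setVar).setVar
  have hT2 := hT1.of_same f2
  refine (wp_unite (u := s) (v := s') (h1.of_same f2) hT2.len (by simp [hσ2]) (by simp [hσ2]) hsN hsN').frame (by simp) ?_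
  rintro σ3 t3 f3 ⟨⟨ρ, hU⟩, ht3⟩
  have hT3 := hT2.of_same f3
  have e0 : σ2.var vtop = 0 := by rw [f2.var _, h2]
  refine (wp_loop (Inv := fun τ => HasTable N K δ τ ∧ ∃ h ρ, HKClosing N K δ s s' h ρ τ)
    (Φ := fun τ => (N - τ.var vh) * (122 * K * (Nat.log 2 N + 1) + 14)) ?_ ?_).mono ?_
  · rintro σ ⟨hT, h, ρ, hC⟩ hlt
    simp [hC.var_h] at hlt
    rw [wp_seq]
    refine (wp_hkProcess hT hC hlt).mono ?_
    rintro τ t ⟨hT', ⟨ρ', hC', hlt', hx⟩, ht⟩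
    rw [wp_assign]
    simp only [evals, hC'.var_h, cost]
    refine ⟨⟨?_, h + 1, ρ', ?_, ?_, ?_, hC'.base, ?_, ?_⟩, ?_⟩
    · exact hT'.of_same ((Frame.refl [vh] [] _).setVar)
    · exact hC'.state.congr (by simp) rfl rfl rfl rfl
    · simp
    · simpa using hlt'
    · intro j hj x hxK
      simp only [rd_setVar]
      by_cases hjh : j = h
      · subst hjh; exact hx x hxK
      · exact hC'.closed j (by omega) x hxK
    · simpa using hC'.least
    · have hN : h < N := by
        have := hC.state.count
        omega
      obtain ⟨r, rfl⟩ : ∃ r, N = h + 1 + r := ⟨N - (h + 1), by omega⟩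
      simp only [var_setVar, if_true, hC.var_h]
      rw [show h + 1 + r - (h + 1) = r by omega, show h + 1 + r - h = r + 1 by omega, add_mul r 1]
      omega
  · refine ⟨hT3.of_same ((Frame.refl [vh] [] _).setVar), 0, ρ, hU.state.congr (by simp) rfl rfl rfl rfl, by simp, by simp, hU.eq, by simp,
      ?_⟩
    intro E hE j hj
    simp only [rd_setVar, var_setVar, Fin.reduceEq, if_false] at hj ⊢
    have := hU.new j hj (by omega)
    rw [this.1, this.2]
    exact hE.base
  · rintro σ4 t4 ⟨⟨hT4, h, ρ', hC⟩, hend, ht4⟩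
    simp [hC.var_h] at hend
    have hh : h = σ4.var vtop := le_antisymm hC.le hend
    refine ⟨hT4, ⟨ρ', hC.state, hC.state.uf.root_lt, fun q hq => hC.state.uf.root_root hq, hC.base,
      ?_, fun E hE => hC.state.gen E hE.equiv (hC.least E hE)⟩, ?_⟩
    -- Only recorded pairs were expanded. But having congruent successors is itself an equivalence
    -- relation that contains them, hence it contains all pairs identified by `ρ'`.
    · have := hC.state.gen (fun p q => ∀ x < K, ρ' (δ p x) = ρ' (δ q x))
        ⟨fun _ _ _ => rfl, fun h x hx => (h x hx).symm, fun h h' x hx => (h x hx).trans (h' x hx)⟩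
        (fun j hj => hC.closed j (by omega))
      intro p hp q hq x hx hpq
      exact this p hp q hq hpq x hx
    · simp at ht4
      have a1 : (N - σ4.var vh) * (122 * K * (Nat.log 2 N + 1) + 14) ≥ 0 := Nat.zero_le _
      have a2 : N * (122 * K * (Nat.log 2 N + 1) + 14) + 34 * N ≤
          130 * N * (K + 1) * (Nat.log 2 N + 1) := by
        have : 1 ≤ N := by omega
        nlinarith [Nat.zero_le (N * K * Nat.log 2 N), Nat.zero_le (N * K),
          Nat.zero_le (N * Nat.log 2 N)]
      have : 1 ≤ N := by omega
      omega

/-- Store the roots in an array. -/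
def hkFlatten : Prog :=
  .for vq (.var vN) (.seq (findRoot vr (.var vq)) (.write aCls (.var vq) (.var vr)))

theorem wp_hkFlatten {σ : Mem} {ρ : ℕ → ℕ} (hT : HasTable N K δ σ) (h : HKState N ρ σ) :
    wp I hkFlatten (fun τ t => (∀ q < N, τ.rd aCls q = ρ q) ∧
      t ≤ 40 * N * (Nat.log 2 N + 1) + 10) σ := by
  refine (wp_for (H := N) (T := 20 * (Nat.log 2 N + 1) + 5) (Inv := fun j τ => τ.var vq = j ∧
    HasTable N K δ τ ∧ HKState N ρ τ ∧ ∀ q < j, τ.rd aCls q = ρ q) ?_ ?_ ?_ ?_).mono ?_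
  · have f := (Frame.refl [vq] [] σ).setVar (x := vq) (v := 0)
    exact ⟨by simp, hT.of_same f, h.of_same f, by simp⟩
  · rintro j σ ⟨_, h2, _⟩; simpa using h2.var_N
  · rintro j σ ⟨h1, _⟩; exact h1
  · clear hT h σ
    rintro j σ hj ⟨hq, hT, h, hc⟩
    rw [wp_seq]
    refine (wp_findRoot (u := j) h.uf (by simp [hq]) hj).mono ?_
    rintro τ t ⟨hr, f, ht⟩
    simp only [wp_write, eval_var, hr, f.var vq, hq, cost]
    have f'' := ((f.trans (ys := [vr, vq]) (bs := [aCls]) .rfl).wr (a := aCls) (i := j)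
      (v := ρ j)).setVar
      (x := vq) (v := j + 1)
    refine ⟨by simp [f.var vq, hq], ⟨by simp, hT.of_same f'',
      h.of_same f'', ?_⟩, ?_⟩
    · intro q hqj
      simp only [rd_setVar, rd_wr, if_true, f.len, hj.trans_le (hT.len _), f.rd aCls]
      by_cases hqj' : q = j
      · simp [hqj']
      · simp [hqj', hc q (by omega)]
    · simp at ht; omega
  · rintro τ t ⟨⟨_, _, _, h⟩, ht⟩
    refine ⟨h, ht.trans ?_⟩
    simp
    nlinarith [Nat.zero_le (N * Nat.log 2 N)]

end Program


/-! ## Strongly connected components, by the path-based algorithm -/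

/-- `v` is reachable from `u` by edges `a → g a x`, `x < K`. -/
def Reach (K : ℕ) (g : ℕ → ℕ → ℕ) : ℕ → ℕ → Prop :=
  Relation.ReflTransGen fun a c => ∃ x < K, c = g a x

/-- Invariant of the path-based algorithm. `I v` is `0` for a new node, the position (from `1` on)
of `v` on the stack `S` for a node on the path, and a number `> N` of its component for a finished
node. `B` holds the positions where the components of the contracted path begin, `T` the nodes with
unexplored edges. -/
structure PathBased (N K : ℕ) (g : ℕ → ℕ → ℕ) (I S B T ptr : ℕ → ℕ) (s m t c root : ℕ) :
    Prop where
  idx : ∀ v < N, I v = 0 ∨ (1 ≤ I v ∧ I v ≤ s ∧ S (I v - 1) = v) ∨ (N < I v ∧ I v < c)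
  stk : ∀ j < s, S j < N ∧ I (S j) = j + 1
  bd : ∀ j < m, 1 ≤ B j ∧ B j ≤ s
  bd_lt : ∀ j < m, ∀ i < j, B i < B j
  bd_zero : 0 < s → 0 < m ∧ B 0 = 1
  tk : ∀ j < t, T j < N ∧ 1 ≤ I (T j) ∧ I (T j) ≤ s
  tk_lt : ∀ j < t, ∀ i < j, I (T i) < I (T j)
  bd_tk : ∀ j < m, ∃ i < t, I (T i) = B j
  done : ∀ v < N, 1 ≤ I v → I v ≤ s → ptr v < K → ∃ i < t, T i = v
  fwd : ∀ j < s, ∀ i ≤ j, Reach K g (S i) (S j)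
  bwd : ∀ j < s, ∀ i ≤ j, (∀ l < m, B l ≤ j + 1 → B l ≤ i + 1) → Reach K g (S j) (S i)
  expl : ∀ v < N, 1 ≤ I v → I v ≤ s → ∀ x < K, x < ptr v →
    I (g v x) ≠ 0 ∧ ∀ l < m, B l ≤ I v → B l ≤ I (g v x)
  fin_le : ∀ v < N, N < I v → ∀ x < K, N < I (g v x) ∧ I (g v x) ≤ I v
  fin_reach : ∀ u < N, ∀ v < N, N < I u → I u = I v → Reach K g u v
  comp : N < c ∧ c ≤ N + 1 + ((Finset.range N).filter (fun v => N < I v)).card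
  root_le : root ≤ N
  roots : ∀ v < root, I v ≠ 0
  ptr_new : ∀ v < N, I v = 0 → ptr v = 0
  ptr_le : ∀ v < N, ptr v ≤ K

namespace PathBased

variable {N K : ℕ} {g : ℕ → ℕ → ℕ} {I S B T ptr : ℕ → ℕ} {s m t c root : ℕ}

theorem s_le (h : PathBased N K g I S B T ptr s m t c root) : s ≤ N := by
  have := Finset.card_le_card_of_injOn (s := Finset.range s) (t := Finset.range N) S
    (fun j hj => by simpa using (h.stk j (by simpa using hj)).1)
    (fun i hi j hj hij => by
      have h1 := (h.stk i (by simpa using hi)).2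
      have h2 := (h.stk j (by simpa using hj)).2
      rw [hij] at h1; omega)
  simpa using this

theorem s_lt (h : PathBased N K g I S B T ptr s m t c root) {w : ℕ} (hw : w < N) (h0 : I w = 0) :
    s < N := by
  have := Finset.card_le_card_of_injOn (s := Finset.range s) (t := (Finset.range N).erase w) S
    (fun j hj => by
      have hj := h.stk j (by simpa using hj)
      simp only [Finset.coe_erase, Finset.coe_range, Set.mem_sdiff, Set.mem_Iio,
        Set.mem_singleton_iff]
      exact ⟨hj.1, fun e => by rw [e, h0] at hj; omega⟩)
    (fun i hi j hj hij => by
      have h1 := (h.stk i (by simpa using hi)).2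
      have h2 := (h.stk j (by simpa using hj)).2
      rw [hij] at h1; omega)
  rw [Finset.card_erase_of_mem (by simpa using hw)] at this
  simp at this
  omega

theorem m_le (h : PathBased N K g I S B T ptr s m t c root) : m ≤ s := by
  have := Finset.card_le_card_of_injOn (s := Finset.range m) (t := Finset.Icc 1 s) B
    (fun j hj => by simpa using h.bd j (by simpa using hj))
    (fun i hi j hj hij => by
      simp at hi hj
      rcases lt_trichotomy i j with hl | hl | hl
      · have := h.bd_lt j hj i hl; omega
      · exact hl
      · have := h.bd_lt i hi j hl; omega)
  simpa using this

theorem t_le (h : PathBased N K g I S B T ptr s m t c root) : t ≤ s := by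
  have := Finset.card_le_card_of_injOn (s := Finset.range t) (t := Finset.Icc 1 s) (fun j => I (T j))
    (fun j hj => by simpa using (h.tk j (by simpa using hj)).2)
    (fun i hi j hj hij => by
      simp at hi hj
      rcases lt_trichotomy i j with hl | hl | hl
      · have := h.tk_lt j hj i hl; dsimp only at hij; omega
      · exact hl
      · have := h.tk_lt i hi j hl; dsimp only at hij; omega)
  simpa using this

/-- The first node of each component of the path stays on `T` until the component is finished, and a
non-empty path has a first component. -/
theorem s_eq_zero (h : PathBased N K g I S B T ptr s m t c root) (ht : t = 0) : s = 0 := by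
  by_contra hs
  obtain ⟨i, hi, _⟩ := h.bd_tk 0 (h.bd_zero (by omega)).1
  omega

theorem bd_mono (h : PathBased N K g I S B T ptr s m t c root) {i j : ℕ} (hj : j < m) (hi : i ≤ j) :
    B i ≤ B j := by
  rcases hi.eq_or_lt with rfl | hl
  · exact le_rfl
  · exact (h.bd_lt j hj i hl).le

/-- The last node with unexplored edges belongs to the last component of the path. -/
theorem top_class (h : PathBased N K g I S B T ptr s m (t + 1) c root) :
    0 < m ∧ B (m - 1) ≤ I (T t) := by
  obtain ⟨h1, h2, h3⟩ := h.tk t (by omega)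
  have hm := (h.bd_zero (by omega)).1
  refine ⟨hm, ?_⟩
  obtain ⟨i, hi, he⟩ := h.bd_tk (m - 1) (by omega)
  rw [← he]
  rcases (show i ≤ t by omega).eq_or_lt with rfl | hl
  · exact le_rfl
  · exact (h.tk_lt t (by omega) i hl).le

theorem init (N K : ℕ) (g : ℕ → ℕ → ℕ) {I ptr : ℕ → ℕ} (S B T : ℕ → ℕ) (hI : ∀ v < N, I v = 0)
    (hp : ∀ v < N, ptr v = 0) : PathBased N K g I S B T ptr 0 0 0 (N + 1) 0 := by
  constructor <;> grind

theorem incRoot (h : PathBased N K g I S B T ptr s m t c root) (hr : root < N) (h0 : I root ≠ 0) :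
    PathBased N K g I S B T ptr s m t c (root + 1) :=
  { h with
    root_le := hr
    roots := by have := h.roots; grind }

theorem incPtr (h : PathBased N K g I S B T ptr s m t c root) {v : ℕ} (hv : v < N)
    (h1 : 1 ≤ I v) (hk : ptr v < K) (hw0 : I (g v (ptr v)) ≠ 0)
    (hw : ∀ l < m, B l ≤ I v → B l ≤ I (g v (ptr v))) :
    PathBased N K g I S B T (update ptr v (ptr v + 1)) s m t c root :=
  { h with
    done := by have := h.done; grind
    expl := by have := h.expl; grind
    ptr_new := by have := h.ptr_new; grind
    ptr_le := by have := h.ptr_le; grind }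

/-- The new node is a component of its own at the end of the path: the boundary `s + 1` separates it
from all earlier nodes, so `bwd` gains no new obligation, and `hr` supplies the new cases of `fwd`.
-/
theorem push (h : PathBased N K g I S B T ptr s m t c root) {w : ℕ} (hw : w < N) (h0 : I w = 0)
    (hr : ∀ i < s, Reach K g (S i) w) :
    PathBased N K g (update I w (s + 1)) (update S s w)
      (update B m (s + 1)) (update T t w) ptr (s + 1) (m + 1) (t + 1) c root := by
  have hsN := h.s_lt hw h0
  have hSw : ∀ j < s, S j ≠ w := fun j hj e => by
    have := (h.stk j hj).2; rw [e, h0] at this; omega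
  have hTw : ∀ j < t, T j ≠ w := fun j hj e => by
    have := (h.tk j hj).2; rw [e, h0] at this; omega
  have hI : ∀ u, u ≠ w → update I w (s + 1) u = I u := fun u hu => by simp [hu]
  have hne : ∀ u, I u ≠ 0 → u ≠ w := fun u hu e => hu (by rw [e, h0])
  have hIpos : ∀ u, I u ≠ 0 → update I w (s + 1) u ≠ 0 := fun u hu => by
    rwa [hI u (hne u hu)]
  refine ⟨?_, ?_, ?_, ?_, ?_, ?_, ?_, ?_, ?_, ?_, ?_, ?_, ?_, ?_, ?_, h.root_le, ?_, ?_, h.ptr_le⟩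
  · have := h.idx; grind
  · have := h.stk; grind
  · have := h.bd; grind
  · intro j hj i hi; have := h.bd i; have := h.bd_lt j; grind
  · have := h.bd_zero; have := h.bd 0; grind
  · have := h.tk; grind
  · intro j hj i hi; have := h.tk i; have := h.tk j; have := h.tk_lt j; grind
  · intro j hj; have := h.bd_tk j; by_cases he : j = m
    · exact ⟨t, by grind⟩
    · obtain ⟨i, hi, hb⟩ := this (by omega); exact ⟨i, by grind⟩
  · intro v hv; have := h.idx v hv; have := h.done v hv; by_cases he : v = w
    · exact fun _ _ _ => ⟨t, by grind⟩
    · intro h1 h2 h3; obtain ⟨i, hi, hT⟩ := this (by grind) (by grind) h3; exact ⟨i, by grind⟩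
  · intro j hj i hi
    by_cases he : j = s
    · subst he
      rcases hi.eq_or_lt with rfl | hl
      · exact Relation.ReflTransGen.refl
      · rw [update_of_ne (by omega)]
        simpa using hr i hl
    · rw [update_of_ne he, update_of_ne (by omega)]
      exact h.fwd j (by omega) i hi
  · intro j hj i hi hl
    by_cases he : j = s
    · subst he
      have := hl m (by omega)
      simp at this
      obtain rfl : i = j := by omega
      exact Relation.ReflTransGen.refl
    · rw [update_of_ne he, update_of_ne (by omega)]
      refine h.bwd j (by omega) i hi fun l hlm hb => ?_
      have := hl l (by omega)
      rw [update_of_ne (by omega)] at this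
      exact this hb
  · intro v hv h1 h2 x hx hp
    have := h.ptr_new v hv; have := h.idx v hv; have := h.expl v hv; grind
  · have := h.fin_le; grind
  · have := h.fin_reach; grind
  · have : (Finset.range N).filter (fun v => N < update I w (s + 1) v) =
        (Finset.range N).filter (fun v => N < I v) := by
      ext v
      by_cases he : v = w
      · subst he; simp [h0]; omega
      · simp [he]
    rw [this]; exact h.comp
  · have := h.roots; grind
  · have := h.ptr_new; grind

/-- Contract the last two components of the path. -/
theorem popB (h : PathBased N K g I S B T ptr s (m + 1) (t + 1) c root)
    (hk : ptr (T t) < K) (hw0 : I (g (T t) (ptr (T t))) ≠ 0)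
    (hw : I (g (T t) (ptr (T t))) < B m) (hg : g (T t) (ptr (T t)) < N) :
    PathBased N K g I S B T ptr s m (t + 1) c root := by
  set v := T t with hv
  set w := g v (ptr v) with hwdef
  obtain ⟨hvN, hv1, hvs⟩ := h.tk t (by omega)
  obtain ⟨_, htc⟩ := h.top_class
  simp only [Nat.add_sub_cancel] at htc
  rw [← hv] at hvN hv1 hvs htc
  obtain ⟨hB1, hBs⟩ := h.bd m (by omega)
  have hvS : S (I v - 1) = v := by
    rcases h.idx v hvN with h1 | ⟨_, _, h1⟩ | ⟨h1, _⟩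
    · omega
    · exact h1
    · have := h.s_le; omega
  have hwS : S (I w - 1) = w := by
    rcases h.idx w hg with h1 | ⟨_, _, h1⟩ | ⟨h1, _⟩
    · omega
    · exact h1
    · have := h.s_le; omega
  have hm : 0 < m := by
    have := h.bd_zero (by omega)
    by_contra h0
    obtain rfl : m = 0 := by omega
    omega
  exact { h with
    bd := fun j hj => h.bd j (by omega)
    bd_lt := fun j hj => h.bd_lt j (by omega)
    bd_zero := fun hs => ⟨hm, (h.bd_zero hs).2⟩
    bd_tk := fun j hj => h.bd_tk j (by omega)
    expl := fun u hu a b x hx d =>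
      ⟨(h.expl u hu a b x hx d).1, fun l hl => (h.expl u hu a b x hx d).2 l (by omega)⟩
    -- Forgetting the last boundary matters only if it lies between `i` and `j`. Then `S j` reaches
    -- `v` inside the last component, the edge leads to `w` before the boundary, and `w` reaches `S
    -- i` either forward along the path or backward inside the merged component.
    bwd := fun j hj i hi hl => by
      by_cases hsep : B m ≤ j + 1 → B m ≤ i + 1
      · refine h.bwd j hj i hi fun l hlm => ?_
        by_cases he : l = m
        · rw [he]; exact hsep
        · exact hl l (by omega)
      · push Not at hsep
        have r1 : Reach K g (S j) v := by
          rcases le_total j (I v - 1) with hle | hle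
          · have := h.fwd (I v - 1) (by omega) j hle
            rwa [hvS] at this
          · have := h.bwd j hj (I v - 1) hle fun l hlm _ => by
              have := h.bd_mono (show m < m + 1 by omega) (show l ≤ m by omega)
              omega
            rwa [hvS] at this
        have r2 : Reach K g v w := Relation.ReflTransGen.single ⟨_, hk, rfl⟩
        have r3 : Reach K g w (S i) := by
          rcases le_total (I w - 1) i with hle | hle
          · have := h.fwd i (by omega) (I w - 1) hle
            rwa [hwS] at this
          · have := h.bwd (I w - 1) (by omega) i hle fun l hlm hb => by
              by_cases he : l = m
              · subst he; omega
              · exact hl l (by omega) (by omega)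
            rwa [hwS] at this
        exact (r1.trans r2).trans r3 }

/-- The dropped node has no unexplored edge and does not begin its component, so no boundary loses
the node of `T` that represents it. -/
theorem popT (h : PathBased N K g I S B T ptr s m (t + 1) c root) (hk : K ≤ ptr (T t))
    (hb : B (m - 1) ≠ I (T t)) : PathBased N K g I S B T ptr s m t c root :=
  { h with
    tk := fun j hj => h.tk j (by omega)
    tk_lt := fun j hj => h.tk_lt j (by omega)
    bd_tk := fun j hj => by
      have := h.top_class; have := h.bd_mono (i := j) (j := m - 1); have := h.bd_tk j hj; grind
    done := by have := h.done; grind }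

/-- The last component of the path is complete. -/
theorem finish (h : PathBased N K g I S B T ptr s (m + 1) (t + 1) c root)
    (hg : ∀ q < N, ∀ x < K, g q x < N) (hk : K ≤ ptr (T t)) (hb : B m = I (T t)) {I' : ℕ → ℕ}
    (hI' : ∀ u < N, I' u = if B m ≤ I u ∧ I u ≤ s then c else I u) :
    PathBased N K g I' S B T ptr (B m - 1) m t (c + 1) root := by
  obtain ⟨hvN, hv1, hvs⟩ := h.tk t (by omega)
  obtain ⟨hB1, hBs⟩ := h.bd m (by omega)
  have hsN := h.s_le
  have hc := h.comp.1
  -- An unexplored edge of the last component would put its source on `T`; but the other entries of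
  -- `T` have positions below `I (T t)`, which is the beginning of that component.
  have hptr : ∀ u < N, B m ≤ I u → I u ≤ s → K ≤ ptr u := by
    intro u hu h1 h2; by_contra hlt
    obtain ⟨i, hi, he⟩ := h.done u hu (by omega) h2 (by omega)
    have := h.tk_lt t (by omega) i; grind
  have hTlow : ∀ j < t, I (T j) < B m := fun j hj => by
    rw [hb]; exact h.tk_lt t (by omega) j hj
  have hle : ∀ u < N, I u ≤ I' u := by grind
  refine ⟨?_, ?_, ?_, ?_, ?_, ?_, ?_, ?_, ?_, ?_, ?_, ?_, ?_, ?_, ?_, h.root_le, ?_, ?_, h.ptr_le⟩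
  · have := h.idx; grind
  · have := h.stk; grind
  · have := h.bd; have := h.bd_lt m; grind
  · exact fun j hj => h.bd_lt j (by omega)
  · have := h.bd_zero; grind
  · have := h.tk; grind
  · intro j hj i hi; have := h.tk i; have := h.tk j; have := h.tk_lt j; grind
  · intro j hj; have := h.bd_tk j; have := h.bd_lt m; have := h.tk; grind
  · intro v hv; have := h.done v hv; grind
  · exact fun j hj => h.fwd j (by omega)
  · intro j hj i hi hl; have := h.bwd j (by omega) i hi; grind
  · intro v hv h1 h2 x hx hp; have := h.expl v hv; have := hg v hv x hx; grind
  -- Edges out of the finished component lead into it, or to nodes finished earlier, whose number is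
  -- below `c`: all its edges are explored, and `expl` excludes targets on the path before the last
  -- boundary.
  · intro v hv h1 x hx; have := hg v hv x hx; have := h.idx _ this
    have := h.expl v hv; have := h.fin_le v hv; have := hptr v hv; grind
  · intro u hu v hv h1 h2
    have hval : ∀ u < N, N < I' u → (B m ≤ I u ∧ I u ≤ s ∧ I' u = c ∧ S (I u - 1) = u) ∨
        (N < I u ∧ I' u = I u ∧ I' u < c) := by
      intro u hu h1
      have := h.idx u hu; grind
    rcases hval u hu h1 with ⟨u1, u2, u3, u4⟩ | ⟨u1, u2, u3⟩
    · rcases hval v hv (by omega) with ⟨v1, v2, v3, v4⟩ | ⟨v1, v2, v3⟩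
      · rw [← u4, ← v4]
        rcases le_total (I u - 1) (I v - 1) with hle | hle
        · exact h.fwd _ (by omega) _ hle
        · refine h.bwd _ (by omega) _ hle fun l hl _ => ?_
          have := h.bd_mono (show m < m + 1 by omega) (show l ≤ m by omega)
          omega
      · omega
    · rcases hval v hv (by omega) with ⟨v1, v2, v3, v4⟩ | ⟨v1, v2, v3⟩
      · omega
      · exact h.fin_reach u hu v hv u1 (by omega)
  -- Each finished component has at least one node. So the next number `c` exceeds N + 1 by at most
  -- the number of finished nodes, and all numbers stay below 2N + 1.
  · refine ⟨by omega, ?_⟩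
    have hsub : (Finset.range N).filter (fun v => N < I v) ⊂
        (Finset.range N).filter (fun v => N < I' v) := by
      rw [Finset.ssubset_iff_of_subset]
      · refine ⟨T t, ?_, ?_⟩
        · simp only [Finset.mem_filter, Finset.mem_range]
          exact ⟨hvN, by grind⟩
        · simp only [Finset.mem_filter, Finset.mem_range, not_and]
          intro _; omega
      · intro v hv
        simp only [Finset.mem_filter, Finset.mem_range] at hv ⊢
        exact ⟨hv.1, hv.2.trans_le (hle v hv.1)⟩
    have := Finset.card_lt_card hsub
    have := h.comp.2
    omega
  · have := h.roots; have := h.root_le; grind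
  · have := h.ptr_new; grind

end PathBased


-- The program for strongly connected components

notation "vs" => (19 : Fin 40)
notation "vm" => (20 : Fin 40)
notation "vt" => (21 : Fin 40)
notation "vc" => (22 : Fin 40)
notation "vroot" => (23 : Fin 40)
notation "vv" => (24 : Fin 40)
notation "ve" => (25 : Fin 40)
notation "vb" => (26 : Fin 40)
notation "aI" => (7 : Fin 20)
notation "aS" => (8 : Fin 20)
notation "aBd" => (9 : Fin 20)
notation "aTs" => (10 : Fin 20)
notation "aPtr" => (11 : Fin 20)

/-- The memory holds a state of the path-based algorithm, together with the table and the map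
`cl` of the nodes to their representatives. -/
structure SCCState (N K : ℕ) (δ : ℕ → ℕ → ℕ) (cl : ℕ → ℕ) (σ : Mem) : Prop where
  table : HasTable N K δ σ
  cls : ∀ q < N, σ.rd aCls q = cl q
  cls_lt : ∀ q < N, cl q < N
  path : PathBased N K (fun q x => cl (δ q x)) (σ.rd aI) (σ.rd aS) (σ.rd aBd) (σ.rd aTs)
    (σ.rd aPtr) (σ.var vs) (σ.var vm) (σ.var vt) (σ.var vc) (σ.var vroot)

/-- The number of zeros of `f` below `N`. -/
def zeros (N : ℕ) (f : ℕ → ℕ) : ℕ := ((Finset.range N).filter (fun v => f v = 0)).card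

theorem zeros_update {N w a : ℕ} {f : ℕ → ℕ} (hw : w < N) (h0 : f w = 0) (ha : a ≠ 0) :
    zeros N (update f w a) + 1 = zeros N f := by
  have : (Finset.range N).filter (fun v => update f w a v = 0) =
      ((Finset.range N).filter (fun v => f v = 0)).erase w := by
    ext v
    by_cases he : v = w
    · simp [he, ha]
    · simp [he]
  have h1 : 0 < ((Finset.range N).filter (fun v => f v = 0)).card :=
    Finset.card_pos.2 ⟨w, by simp [hw, h0]⟩
  rw [zeros, zeros, this, Finset.card_erase_of_mem (by simp [hw, h0])]
  omega

/-- A potential that pays for the remaining steps of the path-based algorithm. -/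
def sccPotential (N K : ℕ) (σ : Mem) : ℕ :=
  (N - σ.var vroot) + ∑ v ∈ Finset.range N, (K - σ.rd aPtr v) +
    3 * zeros N (σ.rd aI) + σ.var vs + σ.var vm + σ.var vt

section Program

variable {I : Input} {N K : ℕ} {δ : ℕ → ℕ → ℕ} {cl : ℕ → ℕ}

def sccPush : Prog :=
  .seq (.write aS (.var vs) (.var vw)) <| .seq (.assign vs (.add (.var vs) (.const 1))) <|
  .seq (.write aI (.var vw) (.var vs)) <| .seq (.write aBd (.var vm) (.var vs)) <|
  .seq (.assign vm (.add (.var vm) (.const 1))) <| .seq (.write aTs (.var vt) (.var vw)) <|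
  .assign vt (.add (.var vt) (.const 1))

/-- A push leaves the potential unchanged: the loss of one new node, of weight 3, pays for the
growth of three stacks. The advance of a pointer or of the root after the push makes it decrease. -/
theorem wp_sccPush {σ : Mem} (h : SCCState N K δ cl σ) {w : ℕ} (hv : σ.var vw = w)
    (hw : w < N) (h0 : σ.rd aI w = 0)
    (hr : ∀ i < σ.var vs, Reach K (fun q x => cl (δ q x)) (σ.rd aS i) w) :
    wp I sccPush (fun τ t => SCCState N K δ cl τ ∧ sccPotential N K τ = sccPotential N K σ ∧
      τ.rd aI = update (σ.rd aI) w (σ.var vs + 1) ∧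
      τ.rd aBd = update (σ.rd aBd) (σ.var vm) (σ.var vs + 1) ∧
      τ.var vm = σ.var vm + 1 ∧ t ≤ 30) σ := by
  have hs := h.path.s_lt hw h0
  have hm := h.path.m_le
  have ht := h.path.t_le
  have l := h.table.len
  have l' : ∀ j < N, ∀ a, j < σ.len a := fun j hj a => hj.trans_le (l a)
  have fr : ∀ τ : Mem, Frame [vs, vm, vt] [aS, aI, aBd, aTs] σ τ →
      (τ.rd aI = update (σ.rd aI) w (σ.var vs + 1)) →
      (τ.rd aS = update (σ.rd aS) (σ.var vs) w) →
      (τ.rd aBd = update (σ.rd aBd) (σ.var vm) (σ.var vs + 1)) →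
      (τ.rd aTs = update (σ.rd aTs) (σ.var vt) w) →
      (τ.var vs = σ.var vs + 1) → (τ.var vm = σ.var vm + 1) → (τ.var vt = σ.var vt + 1) →
      SCCState N K δ cl τ ∧ sccPotential N K τ = sccPotential N K σ := by
    intro τ f e1 e2 e3 e4 e5 e6 e7
    have eP : τ.rd aPtr = σ.rd aPtr := f.rd _
    have eR : τ.var vroot = σ.var vroot := f.var _
    refine ⟨⟨h.table.of_same f, ?_, h.cls_lt, ?_⟩, ?_⟩
    · rw [f.rd _]; exact h.cls
    · rw [e1, e2, e3, e4, e5, e6, e7, eP, eR, f.var vc]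
      exact h.path.push hw h0 hr
    · have := zeros_update (a := σ.var vs + 1) hw h0 (by omega)
      unfold sccPotential
      rw [eP, eR, e1, e5, e6, e7]
      omega
  simp only [evals, sccPush, wp_seq, wp_write, wp_assign, var_setVar, var_wr, Fin.reduceEq, if_true, if_false, hv, cost]
  exact and_assoc.1 ⟨fr _ Frame.rfl.wr.setVar.wr.wr.setVar.wr.setVar (by simp [l', hw])
    (by simp [l', hs]) (by simp [l' _ (hm.trans_lt hs)]) (by simp [l' _ (ht.trans_lt hs)]) (by simp)
    (by simp) (by simp), by simp [l', hw], by simp [l' _ (hm.trans_lt hs)], by simp, by norm_num⟩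

def sccComplete : Prog :=
  .loop (.lt (.var vb) (.var vs))
    (.seq (.assign vs (.sub (.var vs) (.const 1)))
      (.write aI (.read aS (.var vs)) (.var vc)))

/-- The nodes from position `b + 1` on are popped one by one. The time is proportional to the
shrinking of the stack, which the potential pays for. -/
theorem wp_sccComplete {σ : Mem} {s b : ℕ} (hs : σ.var vs = s) (hb : σ.var vb = b)
    (hbs : b ≤ s) (hS : ∀ j < s, σ.rd aS j < N ∧ σ.rd aI (σ.rd aS j) = j + 1)
    (hI : ∀ u < N, 1 ≤ σ.rd aI u → σ.rd aI u ≤ s → σ.rd aS (σ.rd aI u - 1) = u)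
    (hl : N ≤ σ.len aI) :
    wp I sccComplete (fun τ t => Frame [vs] [aI] σ τ ∧ τ.var vs = b ∧
      (∀ u < N, τ.rd aI u =
        if b + 1 ≤ σ.rd aI u ∧ σ.rd aI u ≤ s then σ.var vc else σ.rd aI u) ∧
      t ≤ 13 * (s - b) + 4) σ := by
  refine (wp_loop (Inv := fun τ => Frame [vs] [aI] σ τ ∧ b ≤ τ.var vs ∧ τ.var vs ≤ s ∧
    ∀ u < N, τ.rd aI u =
        if τ.var vs + 1 ≤ σ.rd aI u ∧ σ.rd aI u ≤ s then σ.var vc else σ.rd aI u)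
    (Φ := fun τ => 13 * (τ.var vs - b)) ?_ ?_).mono ?_
  · rintro τ ⟨f, h1, h2, h3⟩ hlt
    have eb : τ.var vb = b := by rw [f.var _, hb]
    have eS : τ.rd aS = σ.rd aS := f.rd _
    have ec : τ.var vc = σ.var vc := f.var _
    simp [eb] at hlt
    obtain ⟨r, hr⟩ : ∃ r, τ.var vs = r + 1 := ⟨τ.var vs - 1, by omega⟩
    obtain ⟨hS1, hS2⟩ := hS r (by omega)
    simp only [evals, wp_seq, wp_assign, wp_write, hr, Nat.add_sub_cancel, var_setVar, rd_setVar, if_true, Fin.reduceEq, if_false, eS, ec, var_wr, cost]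
    refine ⟨⟨f.setVar.wr, by omega, by omega, ?_⟩, ?_⟩
    · intro u hu
      have hlen : σ.rd aS r < (τ.setVar vs r).len aI := by
        rw [len_setVar, f.len]; omega
      rw [rd_wr_self _ _ hlen]
      by_cases he : u = σ.rd aS r
      · subst he
        rw [update_self, if_pos]
        rw [hS2]; omega
      · rw [update_of_ne he, rd_setVar, h3 u hu]
        have : σ.rd aI u ≠ r + 1 := by
          intro e
          have := hI u hu (by omega) (by omega)
          rw [e] at this
          exact he (by simpa using this.symm)
        rw [hr]
        congr 1
        exact propext ⟨fun ⟨a, b⟩ => ⟨by omega, b⟩, fun ⟨a, b⟩ => ⟨by omega, b⟩⟩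
    · omega
  · refine ⟨Frame.refl _ _ _, by omega, by omega, ?_⟩
    intro u hu
    rw [if_neg (by omega)]
  · rintro τ t ⟨⟨f, h1, h2, h3⟩, hend, ht⟩
    have eb : τ.var vb = b := by rw [f.var _, hb]
    simp [eb] at hend
    have : τ.var vs = b := by omega
    rw [this] at h3 ht
    refine ⟨f, this, h3, ?_⟩
    simp [hs] at ht
    omega

def sccRootStep : Prog :=
  .seq (.ite (.eq (.read aI (.var vroot)) (.const 0))
    (.seq (.assign vw (.var vroot)) sccPush) .skip) <|
  .assign vroot (.add (.var vroot) (.const 1))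

/-- If the target lies before the last boundary, only that boundary is dropped and the pointer of
the node stays, so the same edge is read again until no boundary separates its ends. This replaces
an inner loop. -/
def sccEdgeStep : Prog :=
  .seq (.assign vw (.read aCls (.read aT (.add (.mul (.var vv) (.var vK)) (.var ve))))) <|
  .ite (.eq (.read aI (.var vw)) (.const 0))
    (.seq sccPush (.write aPtr (.var vv) (.add (.var ve) (.const 1)))) <|
  .ite (.lt (.read aI (.var vw)) (.read aBd (.sub (.var vm) (.const 1))))
    (.assign vm (.sub (.var vm) (.const 1)))
    (.write aPtr (.var vv) (.add (.var ve) (.const 1)))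

def sccPopStep : Prog :=
  .seq (.assign vt (.sub (.var vt) (.const 1))) <|
  .ite (.eq (.read aBd (.sub (.var vm) (.const 1))) (.read aI (.var vv)))
    (.seq (.assign vm (.sub (.var vm) (.const 1))) <|
      .seq (.assign vb (.sub (.read aI (.var vv)) (.const 1))) <|
      .seq sccComplete (.assign vc (.add (.var vc) (.const 1)))) .skip

def sccStep : Prog :=
  .ite (.eq (.var vt) (.const 0)) sccRootStep <|
  .seq (.assign vv (.read aTs (.sub (.var vt) (.const 1)))) <|
  .seq (.assign ve (.read aPtr (.var vv))) <|
  .ite (.lt (.var ve) (.var vK)) sccEdgeStep sccPopStep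

theorem SCCState.of_same {σ τ : Mem} (h : SCCState N K δ cl σ)
    (f : Frame [vw, vv, ve] [] σ τ) :
    SCCState N K δ cl τ ∧ sccPotential N K τ = sccPotential N K σ := by
  refine ⟨⟨h.table.of_same f, ?_, h.cls_lt, ?_⟩, ?_⟩
  · rw [f.rd _]; exact h.cls
  · rw [f.rd _, f.rd _, f.rd _, f.rd _, f.rd _, f.var _, f.var _, f.var _, f.var _, f.var _]
    exact h.path
  · unfold sccPotential
    rw [f.rd _, f.rd _, f.var _, f.var _, f.var _,
      f.var _]

theorem wp_sccRootStep {σ : Mem} (h : SCCState N K δ cl σ) (ht : σ.var vt = 0)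
    (hr : σ.var vroot < N) :
    wp I sccRootStep (fun τ t => SCCState N K δ cl τ ∧
      t + 100 * sccPotential N K τ ≤ 50 + 100 * (sccPotential N K σ - 1)
      ∧ 0 < sccPotential N K σ) σ := by
  have fin : ∀ τ : Mem, SCCState N K δ cl τ → τ.var vroot < N →
      τ.rd aI (τ.var vroot) ≠ 0 → SCCState N K δ cl (τ.setVar vroot (τ.var vroot + 1)) ∧
      sccPotential N K (τ.setVar vroot (τ.var vroot + 1)) + 1 = sccPotential N K τ := by
    intro τ h hr h0
    have f : Frame [vroot] [] τ (τ.setVar vroot (τ.var vroot + 1)) :=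
      Frame.rfl.setVar
    refine ⟨⟨h.table.of_same f, h.cls, h.cls_lt, ?_⟩, ?_⟩
    · simpa using h.path.incRoot hr h0
    · simp [sccPotential]; omega
  by_cases h0 : σ.rd aI (σ.var vroot) = 0
  · simp only [evals, steps, sccRootStep, wp_ite, h0]
    obtain ⟨h', e'⟩ := h.of_same
      (((Frame.refl [vw, vv, ve] [] σ).setVar (x := vw) (v := σ.var vroot)))
    have hs0 := h.path.s_eq_zero ht
    refine (wp_sccPush h' (w := σ.var vroot) (by simp) hr (by simpa using h0)
      (by simp [hs0])).frame (by simp [sccPush]) ?_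
    rintro σ1 t1 f ⟨h1, h2, h3, h4, h5, h6⟩
    have er : σ1.var vroot = σ.var vroot := by rw [f.var _ (by simp [sccPush])]; simp
    have := fin σ1 h1 (by omega) (by rw [h3, er]; simp)
    refine ⟨this.1, ?_, ?_⟩
    · simp; omega
    · omega
  · simp only [evals, steps, sccRootStep, wp_ite, h0]
    have := fin σ h hr h0
    refine ⟨this.1, ?_, ?_⟩
    · simp; omega
    · omega

theorem SCCState.incPtr {σ : Mem} (h : SCCState N K δ cl σ) {v : ℕ} (hv : v < N)
    (h1 : 1 ≤ σ.rd aI v) (hk : σ.rd aPtr v < K)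
    (hw0 : σ.rd aI (cl (δ v (σ.rd aPtr v))) ≠ 0)
    (hw : ∀ l < σ.var vm, σ.rd aBd l ≤ σ.rd aI v →
      σ.rd aBd l ≤ σ.rd aI (cl (δ v (σ.rd aPtr v)))) :
    SCCState N K δ cl (σ.wr aPtr v (σ.rd aPtr v + 1)) ∧
      sccPotential N K (σ.wr aPtr v (σ.rd aPtr v + 1)) + 1 = sccPotential N K σ := by
  have hl : v < σ.len aPtr := hv.trans_le (h.table.len _)
  have f : Frame [] [aPtr] σ (σ.wr aPtr v (σ.rd aPtr v + 1)) :=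
    Frame.rfl.wr
  refine ⟨⟨h.table.of_same f, ?_, h.cls_lt, ?_⟩, ?_⟩
  · simpa using h.cls
  · simpa [hl] using h.path.incPtr hv h1 hk hw0 hw
  · have : ∑ u ∈ Finset.range N, (K - update (σ.rd aPtr) v (σ.rd aPtr v + 1) u) + 1 =
        ∑ u ∈ Finset.range N, (K - σ.rd aPtr u) := by
      rw [← Finset.add_sum_erase _ _ (Finset.mem_range.2 hv),
        ← Finset.add_sum_erase (Finset.range N) (fun u => K - σ.rd aPtr u) (Finset.mem_range.2 hv)]
      have : ∑ u ∈ (Finset.range N).erase v,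
          (K - update (σ.rd aPtr) v (σ.rd aPtr v + 1) u) =
          ∑ u ∈ (Finset.range N).erase v, (K - σ.rd aPtr u) :=
        Finset.sum_congr rfl fun u hu => by
          rw [update_of_ne (Finset.ne_of_mem_erase hu)]
      rw [this]; simp; omega
    simp [sccPotential, hl]
    omega

theorem wp_sccEdgeStep {σ : Mem} (h : SCCState N K δ cl σ) {v t : ℕ}
    (ht : σ.var vt = t + 1) (hv : σ.var vv = v) (hvT : v = σ.rd aTs t)
    (he : σ.var ve = σ.rd aPtr v) (hk : σ.rd aPtr v < K) :
    wp I sccEdgeStep (fun τ t => SCCState N K δ cl τ ∧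
      t + 100 * sccPotential N K τ ≤ 60 + 100 * (sccPotential N K σ - 1)
      ∧ 0 < sccPotential N K σ) σ := by
  obtain ⟨hvN, hv1, hvs⟩ := h.path.tk t (by omega)
  have htop := (show PathBased N K _ _ _ _ _ _ _ _ (t + 1) _ _ by
    rw [← ht]; exact h.path).top_class
  rw [← hvT] at hvN hv1 hvs htop
  obtain ⟨hm, htc⟩ := htop
  have hvS : σ.rd aS (σ.rd aI v - 1) = v := by
    rcases h.path.idx v hvN with h1 | ⟨_, _, h1⟩ | ⟨h1, _⟩
    · omega
    · exact h1
    · have := h.path.s_le; omega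
  have hlt := h.table.lt v hvN _ hk
  have hw := h.cls_lt _ hlt
  simp only [evals, steps, sccEdgeStep, hv, he, h.table.var_K, h.table.table v hvN _ hk, h.cls _ hlt]
  set w := cl (δ v (σ.rd aPtr v)) with hwdef
  obtain ⟨h', e'⟩ := h.of_same
    (((Frame.refl [vw, vv, ve] [] σ).setVar (x := vw) (v := w)))
  have hin : v < σ.len aPtr := hvN.trans_le (h.table.len _)
  by_cases h0 : σ.rd aI w = 0
  · simp only [evals, wp_ite, rd_setVar, var_setVar, if_true, h0, one_ne_zero, if_false, wp_seq]
    refine (wp_sccPush h' (w := w) (by simp) hw (by simpa using h0) ?_).frame (by simp [sccPush]) ?_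
    · intro i hi
      simp only [rd_setVar, var_setVar, Fin.reduceEq, if_false] at hi ⊢
      have r1 : Reach K (fun q x => cl (δ q x)) (σ.rd aS i) v := by
        rcases le_total i (σ.rd aI v - 1) with hle | hle
        · have := h.path.fwd (σ.rd aI v - 1) (by omega) i hle
          rwa [hvS] at this
        · have := h.path.bwd i hi (σ.rd aI v - 1) hle fun l hlm _ => by
            have := h.path.bd_mono (show σ.var vm - 1 < σ.var vm by omega)
              (show l ≤ σ.var vm - 1 by omega)
            omega
          rwa [hvS] at this
      exact r1.tail ⟨_, hk, rfl⟩
    · rintro σ1 t1 f ⟨h1, h2, h3, h4, h5, h6⟩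
      have ev : σ1.var vv = v := by rw [f.var _ (by simp [sccPush])]; simp [hv]
      have ee : σ1.var ve = σ.rd aPtr v := by rw [f.var _ (by simp [sccPush])]; simp [he]
      have eP : σ1.rd aPtr = σ.rd aPtr := by rw [f.rd _ (by simp [sccPush])]; simp
      simp only [evals, steps, ev, ee]
      have hvw : v ≠ w := fun e => by rw [← e] at h0; omega
      simp only [rd_setVar, var_setVar, Fin.reduceEq, if_false] at h3 h4 h5
      have key := h1.incPtr hvN (by rw [h3, update_of_ne hvw]; omega)
        (by rw [eP]; exact hk) (by rw [eP, ← hwdef, h3]; simp) (by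
          rw [eP, ← hwdef, h3, h4, h5]
          intro l hl hb
          simp only [update_self, update_of_ne hvw] at hb ⊢
          by_cases hlm : l = σ.var vm
          · simp [hlm]
          · rw [update_of_ne hlm]
            have := h.path.bd l (by omega); omega)
      rw [eP] at key
      refine ⟨key.1, ?_, ?_⟩
      · have := key.2
        simp; omega
      · have := key.2; omega
  by_cases hB : σ.rd aI w < σ.rd aBd (σ.var vm - 1)
  · simp only [evals, wp_ite, rd_setVar, var_setVar, if_true, h0, one_ne_zero, if_false, Fin.reduceEq, hB, wp_assign]
    have hpath : PathBased N K (fun q x => cl (δ q x)) (σ.rd aI) (σ.rd aS) (σ.rd aBd) (σ.rd aTs)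
        (σ.rd aPtr) (σ.var vs) (σ.var vm - 1) (t + 1) (σ.var vc) (σ.var vroot) := by
      refine PathBased.popB ?_ (by rw [← hvT]; exact hk) (by rw [← hvT]; exact h0)
        (by rw [← hvT]; exact hB) (by rw [← hvT]; exact hw)
      have := h.path
      rw [ht] at this
      convert this using 1
      omega
    have f : Frame [vm] [] (σ.setVar vw w) ((σ.setVar vw w).setVar vm (σ.var vm - 1)) :=
      Frame.rfl.setVar
    refine ⟨⟨h'.table.of_same f, h.cls, h.cls_lt, ?_⟩, ?_⟩
    · simpa [ht] using hpath
    · simp [sccPotential]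
      omega
  · simp only [wp_ite, eval_eq, eval_read, eval_var, rd_setVar, var_setVar, if_true,
      h0, eval_const, if_false, eval_lt, eval_sub, Fin.reduceEq, hB,
      wp_write, eval_add, hv, he]
    have key := h'.incPtr hvN (by simpa using hv1) (by simpa using hk) (by simpa using h0) (by
      intro l hl _
      simp only [rd_setVar, var_setVar, Fin.reduceEq, if_false] at hl ⊢
      have := h.path.bd_mono (show σ.var vm - 1 < σ.var vm by omega)
              (show l ≤ σ.var vm - 1 by omega)
      rw [← hwdef]
      omega)
    simp only [rd_setVar] at key
    refine ⟨key.1, ?_, ?_⟩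
    · have := key.2
      simp; omega
    · have := key.2; omega

end Program


section Program

variable {I : Input} {N K : ℕ} {δ : ℕ → ℕ → ℕ} {cl : ℕ → ℕ}

theorem wp_sccPopStep {σ : Mem} (h : SCCState N K δ cl σ) {v t : ℕ}
    (ht : σ.var vt = t + 1) (hv : σ.var vv = v) (hvT : v = σ.rd aTs t) (hk : K ≤ σ.rd aPtr v) :
    wp I sccPopStep (fun τ t => SCCState N K δ cl τ ∧
      t + 100 * sccPotential N K τ ≤ 60 + 100 * (sccPotential N K σ - 1)
      ∧ 0 < sccPotential N K σ) σ := by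
  obtain ⟨hvN, hv1, hvs⟩ := h.path.tk t (by omega)
  have hpath : PathBased N K (fun q x => cl (δ q x)) (σ.rd aI) (σ.rd aS) (σ.rd aBd) (σ.rd aTs)
      (σ.rd aPtr) (σ.var vs) (σ.var vm) (t + 1) (σ.var vc) (σ.var vroot) := by
    rw [← ht]; exact h.path
  have htop := hpath.top_class
  rw [← hvT] at hvN hv1 hvs htop
  obtain ⟨hm, htc⟩ := htop
  by_cases hB : σ.rd aBd (σ.var vm - 1) = σ.rd aI v
  · simp only [evals, sccPopStep, wp_seq, wp_assign, wp_ite, ht, Nat.add_sub_cancel, rd_setVar, var_setVar, Fin.reduceEq, if_false, hv, hB, if_true, one_ne_zero]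
    obtain ⟨m, hm'⟩ : ∃ m, σ.var vm = m + 1 := ⟨σ.var vm - 1, by omega⟩
    rw [hm'] at hB hpath
    simp only [Nat.add_sub_cancel] at hB
    refine (wp_sccComplete (N := N) (s := σ.var vs) (b := σ.rd aI v - 1) (by simp) (by simp)
      (by omega) ?_ ?_ ?_).mono ?_
    · simpa using h.path.stk
    · intro u hu h1 h2
      rw [rd_setVar, rd_setVar, rd_setVar] at h1 h2 ⊢
      rcases h.path.idx u hu with h3 | ⟨_, _, h3⟩ | ⟨h3, _⟩
      · omega
      · exact h3
      · have := h.path.s_le; omega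
    · exact h.table.len _
    · rintro σ1 t1 ⟨f, h1, h2, h3⟩
      have f' : Frame [vt, vm, vb, vs] [aI] σ σ1 :=
        (Frame.refl [vt, vm, vb] [] σ).setVar.setVar.setVar.trans
          ⟨fun x hx => f.var x (by simp at hx ⊢; tauto), fun a ha => f.rd a ha, f.len⟩
      have f'' : Frame [vt, vm, vb, vs, vc] [aI] σ (σ1.setVar vc (σ1.var vc + 1)) :=
        (f'.trans .rfl).setVar
      have e1 : σ1.var vt = t := by rw [f.var _]; simp
      have e2 : σ1.var vm = m := by rw [f.var _]; simp [hm']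
      have e3 : σ1.var vc = σ.var vc := f'.var _
      have e4 : σ1.var vroot = σ.var vroot := f'.var _
      have e5 : σ1.rd aS = σ.rd aS := f'.rd _
      have e6 : σ1.rd aBd = σ.rd aBd := f'.rd _
      have e7 : σ1.rd aTs = σ.rd aTs := f'.rd _
      have e8 : σ1.rd aPtr = σ.rd aPtr := f'.rd _
      simp only [rd_setVar, var_setVar, Fin.reduceEq, if_false] at h2
      have hI : ∀ u < N, σ1.rd aI u =
          if σ.rd aBd m ≤ σ.rd aI u ∧ σ.rd aI u ≤ σ.var vs then σ.var vc else σ.rd aI u := by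
        intro u hu
        rw [h2 u hu, hB]
        congr 1
        exact propext ⟨fun ⟨a, b⟩ => ⟨by omega, b⟩, fun ⟨a, b⟩ => ⟨by omega, b⟩⟩
      have key := hpath.finish (fun q hq x hx => h.cls_lt _ (h.table.lt q hq x hx))
        (by rw [← hvT]; exact hk) (by rw [← hvT]; exact hB) hI
      refine ⟨⟨h.table.of_same f'', ?_, h.cls_lt, ?_⟩, ?_⟩
      · rw [rd_setVar, f'.rd _]; exact h.cls
      · simp only [evals, rd_setVar, var_setVar, Fin.reduceEq, if_false, if_true, h1, e1, e2, e3, e4, e5, e6, e7, e8]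
        rw [← hB]; exact key
      · have hz : zeros N (σ1.rd aI) ≤ zeros N (σ.rd aI) := by
          refine Finset.card_le_card fun u hu => ?_
          simp only [Finset.mem_filter, Finset.mem_range] at hu ⊢
          refine ⟨hu.1, ?_⟩
          have := hI u hu.1
          have hc := h.path.comp.1
          split_ifs at this <;> omega
        simp only [evals, sccPotential, rd_setVar, var_setVar, Fin.reduceEq, if_false, if_true, h1, e1, e2, e3, e4, e8, cost]
        omega
  · simp only [sccPopStep, wp_seq, wp_assign, wp_ite, eval_sub, eval_var, ht,
      Nat.add_sub_cancel, eval_const, eval_eq, eval_read, rd_setVar, var_setVar,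
      Fin.reduceEq, if_false, hv, hB, if_true, wp_skip]
    have f : Frame [vt] [] σ (σ.setVar vt t) := Frame.rfl.setVar
    refine ⟨⟨h.table.of_same f, h.cls, h.cls_lt, ?_⟩, ?_⟩
    · have := hpath.popT (by rw [← hvT]; exact hk) (by rw [← hvT]; exact hB)
      simpa using this
    · simp [sccPotential]
      omega

/-- Every step decreases the potential by at least one: it advances the root or a pointer, drops a
boundary, or pops a node. The factor 100 covers the bounded work of a step, including its share in
emptying the stack. -/
theorem wp_sccStep {σ : Mem} (h : SCCState N K δ cl σ)
    (hgo : 0 < σ.var vt + (N - σ.var vroot)) :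
    wp I sccStep (fun τ t => SCCState N K δ cl τ ∧
      t + 10 + 100 * sccPotential N K τ ≤ 100 * sccPotential N K σ) σ := by
  by_cases ht : σ.var vt = 0
  · simp only [evals, steps, sccStep, wp_ite, ht]
    refine (wp_sccRootStep h ht (by omega)).mono ?_
    rintro τ t ⟨h1, h2, h3⟩
    exact ⟨h1, by simp; omega⟩
  · obtain ⟨t, ht'⟩ : ∃ t, σ.var vt = t + 1 := ⟨σ.var vt - 1, by omega⟩
    simp only [evals, sccStep, wp_ite, ht, if_true, if_false, wp_seq, wp_assign, rd_setVar, var_setVar, Fin.reduceEq]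
    set v := σ.rd aTs (σ.var vt - 1) with hv
    have hv' : v = σ.rd aTs t := by rw [hv, ht']; rfl
    obtain ⟨h', e'⟩ := h.of_same (((Frame.refl [vw, vv, ve] [] σ).setVar (x := vv) (v := v)).setVar (x := ve) (v := σ.rd aPtr v))
    rw [h.table.var_K]
    by_cases hk : σ.rd aPtr v < K
    · simp only [hk, if_true, one_ne_zero, if_false]
      refine (wp_sccEdgeStep h' (v := v) (t := t) (by simp [ht']) (by simp) (by simpa using hv')
        (by simp) (by simpa using hk)).mono ?_
      rintro τ t ⟨h1, h2, h3⟩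
      exact ⟨h1, by simp; omega⟩
    · simp only [steps, hk]
      refine (wp_sccPopStep h' (v := v) (t := t) (by simp [ht']) (by simp) (by simpa using hv')
        (by simpa using hk)).mono ?_
      rintro τ t ⟨h1, h2, h3⟩
      exact ⟨h1, by simp; omega⟩

/-- Compute the strongly connected components of the quotient graph. -/
def sccAll : Prog :=
  .seq (.for vq (.var vN) (.seq (.write aI (.var vq) (.const 0)) (.write aPtr (.var vq) (.const 0)))) <|
  .seq (.assign vs (.const 0)) <| .seq (.assign vm (.const 0)) <| .seq (.assign vt (.const 0)) <|
  .seq (.assign vroot (.const 0)) <| .seq (.assign vc (.add (.var vN) (.const 1))) <|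
  .loop (.lt (.const 0) (.add (.var vt) (.sub (.var vN) (.var vroot)))) sccStep

/-- `I` numbers the strongly connected components of the graph with edges `v → g v x`, and edges do
not increase the number. -/
structure SCCNumbering (N K : ℕ) (g : ℕ → ℕ → ℕ) (I : ℕ → ℕ) : Prop where
  edge_le : ∀ v < N, ∀ x < K, I (g v x) ≤ I v
  reach : ∀ u < N, ∀ v < N, I u = I v → Reach K g u v
  lt : ∀ v < N, I v < 2 * N + 1

/-- When the loop ends, `T` is empty and the root has passed all nodes. Hence the path is empty,
every node is finished, and the clauses `fin_le` and `fin_reach` are the two halves of the result.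
-/
theorem wp_sccAll {σ : Mem} (hT : HasTable N K δ σ) (hc : ∀ q < N, σ.rd aCls q = cl q)
    (hlt : ∀ q < N, cl q < N) :
    wp I sccAll (fun τ t => SCCNumbering N K (fun q x => cl (δ q x)) (τ.rd aI) ∧
      t ≤ 100 * N * (K + 5) + 40) σ := by
  rw [sccAll, wp_seq]
  refine ((wp_for (H := N) (T := 6) (Inv := fun j τ => τ.var vq = j ∧
    Frame [vq] [aI, aPtr] σ τ ∧ ∀ q < j, τ.rd aI q = 0 ∧ τ.rd aPtr q = 0)
    ?_ ?_ ?_ ?_)).mono ?_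
  · exact ⟨by simp, Frame.rfl.setVar, by simp⟩
  · rintro j τ ⟨_, h2, _⟩; simp [h2.var vN, hT.var_N]
  · rintro j τ ⟨h1, _⟩; exact h1
  · rintro j τ hj ⟨h1, h2, h3⟩
    simp only [evals, wp_seq, wp_write, var_wr, h1, cost]
    have l : ∀ a, j < τ.len a := fun a => by rw [h2.len]; exact hj.trans_le (hT.len a)
    refine ⟨trivial, ⟨by simp, h2.wr.wr.setVar, ?_⟩, by norm_num⟩
    intro q hq
    by_cases hqj : q = j
    · simp [hqj, l]
    · simp [hqj, l, h3 q (by omega)]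
  rintro σ1 t1 ⟨⟨_, f1, h₁⟩, ht1⟩
  simp only [wp_seq, wp_assign, eval_var, eval_const, eval_add, var_setVar,
    Fin.reduceEq, if_false, f1.var vN, hT.var_N]
  set σ2 := ((((σ1.setVar vs 0).setVar vm 0).setVar vt 0).setVar vroot 0).setVar vc (N + 1) with hσ2
  have f2 : Frame [vs, vm, vt, vroot, vc] [] σ1 σ2 :=
    (((((Frame.rfl.setVar).setVar).setVar).setVar).setVar)
  have hT1 := hT.of_same f1
  have hT2 := hT1.of_same f2
  have hS2 : SCCState N K δ cl σ2 := by
    refine ⟨hT2, ?_, hlt, ?_⟩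
    · rw [f2.rd _, f1.rd _]; exact hc
    · have := PathBased.init N K (fun q x => cl (δ q x)) (σ1.rd aS) (σ1.rd aBd) (σ1.rd aTs)
        (fun v hv => (h₁ v hv).1) (fun v hv => (h₁ v hv).2)
      simpa [hσ2] using this
  refine (wp_loop (Inv := SCCState N K δ cl) (Φ := fun σ => 100 * sccPotential N K σ)
    ?_ hS2).mono ?_
  · intro σ h hgo
    have hgo' : 0 < σ.var vt + (N - σ.var vroot) := by
      rw [← h.table.var_N]
      simp at hgo
      omega
    refine (wp_sccStep h hgo').mono ?_
    rintro τ t ⟨h1, h2⟩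
    exact ⟨h1, by simp; omega⟩
  · rintro σ3 t3 ⟨h₃, hend, ht3⟩
    have hend' : σ3.var vt = 0 ∧ N ≤ σ3.var vroot := by
      simp [h₃.table.var_N] at hend
      omega
    have hs0 := h₃.path.s_eq_zero hend'.1
    have hbig : ∀ v < N, N < σ3.rd aI v := by
      intro v hv
      rcases h₃.path.idx v hv with h1 | ⟨h1, h2, _⟩ | ⟨h1, _⟩
      · exact absurd h1 (h₃.path.roots v (by omega))
      · omega
      · exact h1
    refine ⟨⟨fun v hv x hx => (h₃.path.fin_le v hv (hbig v hv) x hx).2,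
      fun u hu v hv he => h₃.path.fin_reach u hu v hv (hbig u hu) he, fun v hv => ?_⟩, ?_⟩
    · rcases h₃.path.idx v hv with h1 | ⟨h1, h2, _⟩ | ⟨_, h1⟩
      · exact absurd h1 (h₃.path.roots v (by omega))
      · omega
      · have := h₃.path.comp.2
        have := Finset.card_filter_le (Finset.range N) (fun v => N < σ3.rd aI v)
        simp only [Finset.card_range] at this
        omega
    -- Initially all stacks are empty; what counts are the N roots, the N K edges, and the new nodes
    -- with weight 3.
    · have hpot : sccPotential N K σ2 ≤ N + N * K + 3 * N := by
        have h1 : ∑ v ∈ Finset.range N, (K - σ2.rd aPtr v) ≤ N * K := by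
          refine (Finset.sum_le_card_nsmul _ _ K fun v _ => Nat.sub_le _ _).trans ?_
          simp
        have h2 : zeros N (σ2.rd aI) ≤ N := by
          have := Finset.card_filter_le (Finset.range N) (fun v => σ2.rd aI v = 0)
          simpa [zeros] using this
        have e1 : σ2.var vroot = 0 := by simp [hσ2]
        have e2 : σ2.var vs = 0 := by simp [hσ2]
        have e3 : σ2.var vm = 0 := by simp [hσ2]
        have e4 : σ2.var vt = 0 := by simp [hσ2]
        unfold sccPotential
        rw [e1, e2, e3, e4]
        omega
      simp at ht1 ht3 ⊢
      have : 100 * N * (K + 5) = 100 * (N + N * K + 3 * N) + 100 * N := by ring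
      omega

end Program


/-! ## Peeling off the nodes without incoming edges -/

notation "vo" => (27 : Fin 40)
notation "vp" => (28 : Fin 40)
notation "aDeg" => (12 : Fin 20)
notation "aOrd" => (13 : Fin 20)

open Classical in
/-- Number of edges in `U` that lead to `t`. -/
noncomputable def inDegree (N K : ℕ) (G : ℕ → ℕ → ℕ) (A : ℕ → ℕ → Prop) (U : Set (ℕ × ℕ)) (t : ℕ) :
    ℕ :=
  ((Finset.range N ×ˢ Finset.range K).filter
    (fun p => A p.1 p.2 ∧ G p.1 p.2 = t ∧ p ∈ U)).card

section InDegree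

variable {N K : ℕ} {G : ℕ → ℕ → ℕ} {A : ℕ → ℕ → Prop}

theorem inDegree_congr {U V : Set (ℕ × ℕ)} {t : ℕ}
    (h : ∀ q < N, ∀ x < K, A q x → ((q, x) ∈ U ↔ (q, x) ∈ V)) :
    inDegree N K G A U t = inDegree N K G A V t := by
  classical
  unfold inDegree
  congr 1
  refine Finset.filter_congr fun p hp => ?_
  simp only [Finset.mem_product, Finset.mem_range] at hp
  constructor
  · rintro ⟨h1, h2, h3⟩; exact ⟨h1, h2, (h _ hp.1 _ hp.2 h1).1 h3⟩
  · rintro ⟨h1, h2, h3⟩; exact ⟨h1, h2, (h _ hp.1 _ hp.2 h1).2 h3⟩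

theorem inDegree_insert {U V : Set (ℕ × ℕ)} {q x : ℕ} (hq : q < N) (hx : x < K) (hA : A q x)
    (hU : (q, x) ∉ U) (hV : ∀ q' < N, ∀ x' < K, A q' x' →
      ((q', x') ∈ V ↔ (q', x') = (q, x) ∨ (q', x') ∈ U)) :
    inDegree N K G A V = update (inDegree N K G A U) (G q x)
      (inDegree N K G A U (G q x) + 1) := by
  classical
  funext t
  by_cases ht : t = G q x
  · subst ht
    rw [update_self]
    unfold inDegree
    rw [← Finset.card_insert_of_notMem (a := (q, x))]
    · congr 1
      ext ⟨q', x'⟩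
      simp only [Finset.mem_filter, Finset.mem_product, Finset.mem_range, Finset.mem_insert]
      constructor
      · rintro ⟨⟨h1, h2⟩, h3, h4, h5⟩
        rcases (hV _ h1 _ h2 h3).1 h5 with h6 | h6
        · exact Or.inl h6
        · exact Or.inr ⟨⟨h1, h2⟩, h3, h4, h6⟩
      · rintro (h6 | ⟨⟨h1, h2⟩, h3, h4, h5⟩)
        · have h6' := h6
          simp only [Prod.mk.injEq] at h6
          obtain ⟨rfl, rfl⟩ := h6
          exact ⟨⟨hq, hx⟩, hA, rfl, (hV _ hq _ hx hA).2 (Or.inl rfl)⟩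
        · exact ⟨⟨h1, h2⟩, h3, h4, (hV _ h1 _ h2 h3).2 (Or.inr h5)⟩
    · simp [hU]
  · rw [update_of_ne ht]
    unfold inDegree
    congr 1
    refine Finset.filter_congr fun p hp => ?_
    simp only [Finset.mem_product, Finset.mem_range] at hp
    constructor
    · rintro ⟨h1, h2, h3⟩
      refine ⟨h1, h2, ((hV _ hp.1 _ hp.2 h1).1 h3).resolve_left fun e => ht ?_⟩
      rw [← h2, show p.1 = q from congrArg Prod.fst e, show p.2 = x from congrArg Prod.snd e]
    · rintro ⟨h1, h2, h3⟩
      exact ⟨h1, h2, (hV _ hp.1 _ hp.2 h1).2 (Or.inr h3)⟩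

theorem inDegree_eq_zero {U : Set (ℕ × ℕ)} {t : ℕ} :
    inDegree N K G A U t = 0 ↔ ∀ q < N, ∀ x < K, A q x → G q x = t → (q, x) ∉ U := by
  classical
  unfold inDegree
  rw [Finset.card_eq_zero, Finset.filter_eq_empty_iff]
  constructor
  · intro h q hq x hx h1 h2 h3
    exact h (Finset.mem_product.2 ⟨Finset.mem_range.2 hq, Finset.mem_range.2 hx⟩) ⟨h1, h2, h3⟩
  · rintro h ⟨q, x⟩ hp ⟨h1, h2, h3⟩
    simp only [Finset.mem_product, Finset.mem_range] at hp
    exact h q hp.1 x hp.2 h1 h2 h3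

end InDegree

/-- The edges that are not yet removed: `h` nodes of the list `ord` and `x` edges of the next one
are processed. -/
def unpeeled (ord : ℕ → ℕ) (h x : ℕ) : Set (ℕ × ℕ) :=
  {p | (∀ j < h, ord j ≠ p.1) ∧ ¬ (p.1 = ord h ∧ p.2 < x)}

/-- A list of `o` distinct numbers below `N` has `o ≤ N`. -/
theorem le_of_forall_ne {ord : ℕ → ℕ} {o N : ℕ} (hlt : ∀ j < o, ord j < N)
    (hne : ∀ j < o, ∀ i < j, ord i ≠ ord j) : o ≤ N := by
  have := Finset.card_le_card_of_injOn (s := Finset.range o) (t := Finset.range N) ord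
    (fun j hj => by simpa using hlt j (by simpa using hj))
    (fun i hi j hj hij => by
      simp only [Finset.coe_range, Set.mem_Iio] at hi hj
      rcases lt_trichotomy i j with hl | hl | hl
      · exact absurd hij (hne j hj i hl)
      · exact hl
      · exact absurd hij.symm (hne i hi j hl))
  simpa using this

/-- Invariant of the peeling algorithm. -/
structure Peeling (N K : ℕ) (G : ℕ → ℕ → ℕ) (A : ℕ → ℕ → Prop) (deg ord : ℕ → ℕ) (o h x : ℕ) :
    Prop where
  ord_lt : ∀ j < o, ord j < N
  ord_inj : ∀ j < o, ∀ i < j, ord i ≠ ord j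
  deg_eq : ∀ t < N, deg t = inDegree N K G A (unpeeled ord h x) t
  mem : ∀ t < N, deg t = 0 ↔ ∃ j < o, ord j = t
  pred : ∀ j < o, ∀ q < N, ∀ x < K, A q x → G q x = ord j → ∃ i < j, ord i = q

namespace Peeling

variable {N K : ℕ} {G : ℕ → ℕ → ℕ} {A : ℕ → ℕ → Prop} {deg ord : ℕ → ℕ} {o h x : ℕ}

theorem o_le (P : Peeling N K G A deg ord o h x) : o ≤ N := le_of_forall_ne P.ord_lt P.ord_inj

theorem skip (P : Peeling N K G A deg ord o h x) (hA : ¬ A (ord h) x) :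
    Peeling N K G A deg ord o h (x + 1) :=
  { P with
    deg_eq := fun t ht => by
      rw [P.deg_eq t ht]
      refine inDegree_congr fun q _ x' _ hqx => ?_
      simp only [unpeeled, Set.mem_ofPred_eq]
      refine and_congr_right fun _ => not_congr (and_congr_right fun e => ?_)
      have : x' ≠ x := fun e' => hA (by rw [← e, ← e']; exact hqx)
      omega }

/-- The edge is still counted in the degree of its target, so that degree is positive, the truncated
subtraction is exact, and the target is not yet listed. A degree that falls to zero means that all
predecessors are listed, so appending the target keeps `pred`. -/
theorem remove (P : Peeling N K G A deg ord o h x) (ho : h < o) (hx : x < K) (hA : A (ord h) x)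
    (hG : G (ord h) x < N) :
    deg (G (ord h) x) ≠ 0 ∧
    (deg (G (ord h) x) - 1 ≠ 0 →
      Peeling N K G A (update deg (G (ord h) x) (deg (G (ord h) x) - 1)) ord o h (x + 1)) ∧
    (deg (G (ord h) x) - 1 = 0 → o < N ∧
      Peeling N K G A (update deg (G (ord h) x) (deg (G (ord h) x) - 1))
        (update ord o (G (ord h) x)) (o + 1) h (x + 1)) := by
  set t := G (ord h) x with ht
  have hnot : (ord h, x) ∉ unpeeled ord h (x + 1) := by
    simp [unpeeled]
  have hins := inDegree_insert (U := unpeeled ord h (x + 1)) (V := unpeeled ord h x) (G := G)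
    (P.ord_lt h ho) hx hA hnot (fun q' _ x' _ _ => by
      simp only [unpeeled, Set.mem_ofPred_eq, Prod.mk.injEq]
      constructor
      · rintro ⟨h1, h2⟩
        by_cases he : q' = ord h ∧ x' = x
        · exact Or.inl he
        · refine Or.inr ⟨h1, fun ⟨h3, h4⟩ => ?_⟩
          rcases (show x' ≤ x by omega).eq_or_lt with h5 | h5
          · exact he ⟨h3, h5⟩
          · exact h2 ⟨h3, h5⟩
      · rintro (⟨rfl, rfl⟩ | ⟨h1, h2⟩)
        · exact ⟨fun j hj => P.ord_inj h ho j hj, by omega⟩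
        · exact ⟨h1, fun ⟨h3, h4⟩ => h2 ⟨h3, by omega⟩⟩)
  have hdeg : ∀ u < N, update deg t (deg t - 1) u =
      inDegree N K G A (unpeeled ord h (x + 1)) u := by
    intro u hu
    by_cases he : u = t
    · subst he
      rw [update_self, P.deg_eq _ hu, hins, ← ht, update_self]
      omega
    · rw [update_of_ne he, P.deg_eq _ hu, hins, update_of_ne he]
  have h0 : deg t ≠ 0 := by
    rw [P.deg_eq _ hG, hins, ← ht, update_self]
    omega
  have hnew : ∀ j < o, ord j ≠ t := fun j hj e => h0 ((P.mem t hG).2 ⟨j, hj, e⟩)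
  refine ⟨h0, fun h1 => ⟨P.ord_lt, P.ord_inj, hdeg, fun u hu => ?_, P.pred⟩, fun h1 => ?_⟩
  · have := P.mem u hu; grind
  · have hord : ∀ j, j ≤ h → update ord o t j = ord j := fun j hj => by
      rw [update_of_ne (by omega)]
    have hU : unpeeled (update ord o t) h (x + 1) = unpeeled ord h (x + 1) := by
      ext p
      simp only [unpeeled, Set.mem_ofPred_eq, hord h le_rfl]
      refine and_congr_left fun _ => ⟨fun h j hj => ?_, fun h j hj => ?_⟩
      · rw [← hord j hj.le]; exact h j hj
      · rw [hord j hj.le]; exact h j hj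
    have P' : Peeling N K G A (update deg t (deg t - 1)) (update ord o t) (o + 1)
        h (x + 1) := by
      refine ⟨?_, ?_, ?_, ?_, ?_⟩
      · have := P.ord_lt; grind
      · intro j hj i hi; have := P.ord_inj (j := j) (i := i); grind
      · intro u hu
        rw [hdeg u hu, hU]
      · intro u hu; have := P.mem u hu; by_cases he : u = t
        · exact ⟨fun _ => ⟨o, by grind⟩, by grind⟩
        · rw [update_of_ne he, this]
          exact ⟨fun ⟨j, hj, e⟩ => ⟨j, by grind⟩, fun ⟨j, hj, e⟩ => ⟨j, by grind⟩⟩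
      · intro j hj q hq y hy hqy e
        by_cases he : j = o
        · subst he
          rw [update_self] at e
          have h2 := hdeg t hG
          rw [update_self, h1] at h2
          have h3 := inDegree_eq_zero.1 h2.symm q hq y hy hqy e
          have h4 : (∃ i < h, ord i = q) ∨ q = ord h := by
            by_contra hc
            push Not at hc
            exact h3 ⟨hc.1, fun e => hc.2 e.1⟩
          rcases h4 with ⟨i, hi, h4⟩ | h4
          · exact ⟨i, by omega, by rw [hord i hi.le]; exact h4⟩
          · exact ⟨h, ho, by rw [hord h le_rfl]; exact h4.symm⟩
        · rw [update_of_ne he] at e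
          obtain ⟨i, hi, h4⟩ := P.pred j (by omega) q hq y hy hqy e
          exact ⟨i, hi, by rw [update_of_ne (by omega), h4]⟩
    exact ⟨P'.o_le, P'⟩

theorem next (P : Peeling N K G A deg ord o h K) : Peeling N K G A deg ord o (h + 1) 0 :=
  { P with
    deg_eq := fun t ht => by
      rw [P.deg_eq t ht]
      refine inDegree_congr fun q _ x hx _ => ?_
      simp only [unpeeled, Set.mem_ofPred_eq]
      constructor
      · rintro ⟨h1, h2⟩
        refine ⟨fun j hj e => ?_, by omega⟩
        rcases (show j ≤ h by omega).eq_or_lt with rfl | hl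
        · exact h2 ⟨e.symm, hx⟩
        · exact h1 j hl e
      · rintro ⟨h1, _⟩
        exact ⟨fun j hj => h1 j (by omega), fun ⟨h2, _⟩ => h1 h (by omega) h2.symm⟩ }

end Peeling

/-- The result of peeling: `ord` lists the removed nodes, every node after its predecessors; the
nodes that are left have `deg ≠ 0`, and a predecessor that is left. -/
structure Peeled (N K : ℕ) (G : ℕ → ℕ → ℕ) (A : ℕ → ℕ → Prop) (deg ord : ℕ → ℕ) (o : ℕ) :
    Prop where
  ord_lt : ∀ j < o, ord j < N
  ord_inj : ∀ j < o, ∀ i < j, ord i ≠ ord j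
  mem : ∀ t < N, deg t = 0 ↔ ∃ j < o, ord j = t
  pred : ∀ j < o, ∀ q < N, ∀ x < K, A q x → G q x = ord j → ∃ i < j, ord i = q
  live : ∀ t < N, deg t ≠ 0 → ∃ q < N, ∃ x < K, A q x ∧ G q x = t ∧ deg q ≠ 0
  le : o ≤ N

/-- Once all listed nodes are processed, the edges that remain are those whose source is not listed.
A node with positive degree is therefore the target of an edge from another node that is left. -/
theorem Peeling.peeled {N K : ℕ} {G : ℕ → ℕ → ℕ} {A : ℕ → ℕ → Prop} {deg ord : ℕ → ℕ} {o : ℕ}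
    (P : Peeling N K G A deg ord o o 0) : Peeled N K G A deg ord o where
  ord_lt := P.ord_lt
  ord_inj := P.ord_inj
  mem := P.mem
  pred := P.pred
  le := P.o_le
  live t ht h0 := by
    rw [P.deg_eq t ht] at h0
    have := mt inDegree_eq_zero.2 h0
    push Not at this
    obtain ⟨q, hq, x, hx, h1, h2, h3⟩ := this
    refine ⟨q, hq, x, hx, h1, h2, fun h4 => ?_⟩
    obtain ⟨j, hj, h5⟩ := (P.mem q hq).1 h4
    exact h3.1 j hj h5

/-! ### The peeling program -/

section Program

variable {I : Input} {N K : ℕ} {G : ℕ → ℕ → ℕ} {A : ℕ → ℕ → Prop}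

/-- The expressions `tgt` and `act` compute the target and the presence of the edge number `vx` of
the node `vq`, whatever the contents of the working memory of the peeling algorithm. -/
structure EdgeExprs (I : Input) (N K : ℕ) (G : ℕ → ℕ → ℕ) (A : ℕ → ℕ → Prop)
    (tgt act : Exp) (σ : Mem) : Prop where
  var_N : σ.var vN = N
  var_K : σ.var vK = K
  len_deg : N ≤ σ.len aDeg
  len_ord : N ≤ σ.len aOrd
  lt : ∀ q < N, ∀ x < K, A q x → G q x < N
  tgt : ∀ τ, Frame [vq, vx, vu, vo, vp] [aDeg, aOrd] σ τ → τ.var vq < N → τ.var vx < K →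
    tgt.eval I τ = G (τ.var vq) (τ.var vx)
  act : ∀ τ, Frame [vq, vx, vu, vo, vp] [aDeg, aOrd] σ τ → τ.var vq < N → τ.var vx < K →
    (act.eval I τ = 0 ↔ ¬ A (τ.var vq) (τ.var vx))

theorem EdgeExprs.of_same {tgt act : Exp} {σ τ : Mem}
    (h : EdgeExprs I N K G A tgt act σ)
    (f : Frame [vq, vx, vu, vo, vp] [aDeg, aOrd] σ τ) :
    EdgeExprs I N K G A tgt act τ where
  var_N := by rw [f.var _, h.var_N]
  var_K := by rw [f.var _, h.var_K]
  len_deg := by rw [f.len]; exact h.len_deg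
  len_ord := by rw [f.len]; exact h.len_ord
  lt := h.lt
  tgt υ f' := h.tgt υ (f.trans f')
  act υ f' := h.act υ (f.trans f')

/-- Add to the entries of `a` the numbers of the edges that lead to them. -/
def countEdges (hN hK : Exp) (a : Fin 20) (tgt act : Exp) : Prog :=
  .for vq hN <| .for vx hK <| .write a tgt (.add (.read a tgt) (.lt (.const 0) act))

/-- The count is added to whatever `a` holds. The same double loop thus computes degrees, marks
blocks, and collects the violations of a condition. -/
theorem wp_countEdges {hN hK tgt act : Exp} {a : Fin 20} {σ : Mem}
    (hN' : ∀ τ, Frame [vq, vx] [a] σ τ → hN.eval I τ = N)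
    (hK' : ∀ τ, Frame [vq, vx] [a] σ τ → hK.eval I τ = K)
    (ht : ∀ τ, Frame [vq, vx] [a] σ τ → τ.var vq < N → τ.var vx < K →
      tgt.eval I τ = G (τ.var vq) (τ.var vx))
    (ha : ∀ τ, Frame [vq, vx] [a] σ τ → τ.var vq < N → τ.var vx < K →
      (act.eval I τ = 0 ↔ ¬ A (τ.var vq) (τ.var vx)))
    (hl : ∀ q < N, ∀ x < K, A q x → G q x < σ.len a) :
    wp I (countEdges hN hK a tgt act) (fun τ t => Frame [vq, vx] [a] σ τ ∧
      (∀ t, τ.rd a t = σ.rd a t + inDegree N K G A Set.univ t) ∧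
      t ≤ N * (K * (2 * tgt.cost + act.cost + hK.cost + 20) + hK.cost + hN.cost + 12) + hN.cost + 5)
      σ := by
  refine (wp_for (H := N) (T := K * (2 * tgt.cost + act.cost + hK.cost + 20) + hK.cost + 5)
    (Inv := fun j τ => τ.var vq = j ∧ Frame [vq, vx] [a] σ τ ∧
      ∀ t, τ.rd a t = σ.rd a t + inDegree N K G A {p | p.1 < j} t)
    ⟨by simp, Frame.rfl.setVar, fun t => by
      rw [rd_setVar, left_eq_add, inDegree_eq_zero]; simp⟩
    (fun _ τ h => hN' τ h.2.1) (fun _ _ h => h.1) ?_).mono ?_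
  · rintro j τ hj ⟨h1, h2, h3⟩
    refine (wp_for (H := K) (T := 2 * tgt.cost + act.cost + 10) (Inv := fun i τ =>
      τ.var vx = i ∧ τ.var vq = j ∧ Frame [vq, vx] [a] σ τ ∧
      ∀ t, τ.rd a t = σ.rd a t + inDegree N K G A {p | p.1 < j ∨ p.1 = j ∧ p.2 < i} t)
      ⟨by simp, by simpa using h1, h2.setVar, fun t => by simpa using h3 t⟩
      (fun _ τ h => hK' τ h.2.2.1) (fun _ _ h => h.1) ?_).mono ?_
    · rintro i τ hi ⟨h1, h2, h3, h4⟩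
      have hact := ha τ h3 (by omega) (by omega)
      have htgt := ht τ h3 (by omega) (by omega)
      rw [h1, h2] at hact htgt
      simp only [wp_write, evals, htgt, var_wr, rd_setVar]
      refine ⟨h1, ⟨by simp, by simpa using h2, h3.wr.setVar, fun t => ?_⟩, by simp; omega⟩
      by_cases hA : A j i
      · rw [if_pos (Nat.pos_of_ne_zero fun e => hact.1 e hA), rd_wr_self _ _ (by rw [h3.len]; exact hl j hj i hi hA),
          inDegree_insert hj hi hA (U := {p | p.1 < j ∨ p.1 = j ∧ p.2 < i}) (by simp)
          fun q' _ x' _ _ => by simp only [Set.mem_ofPred_eq, Prod.mk.injEq]; omega]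
        by_cases he : t = G j i
        · rw [he, update_self, update_self, h4, add_assoc]
        · rw [update_of_ne he, update_of_ne he, h4]
      · rw [if_neg (by simp [hact.2 hA]), inDegree_congr (V := {p | p.1 < j ∨ p.1 = j ∧ p.2 < i})
          fun q _ x _ hqx => ?_, ← h4]
        · simp
        · have : ¬ (q = j ∧ x = i) := fun ⟨e, e'⟩ => hA (by rwa [← e, ← e'])
          simp only [Set.mem_ofPred_eq]
          omega
    · rintro σ1 t ⟨⟨_, h5, h6, h7⟩, ht⟩
      refine ⟨h5, ⟨by simp, h6.setVar, fun t => ?_⟩, ht.trans ?_⟩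
      · rw [rd_setVar, h7]
        congr 1
        refine inDegree_congr fun q _ x hx _ => ?_
        simp only [Set.mem_ofPred_eq]
        omega
      · have := Nat.mul_le_mul_left K (show 2 * tgt.cost + act.cost + 10 + hK.cost + 7 ≤
          2 * tgt.cost + act.cost + hK.cost + 20 by omega)
        omega
  · rintro τ t ⟨⟨_, h2, h3⟩, ht⟩
    refine ⟨h2, fun t => ?_, ht.trans_eq (by ring)⟩
    rw [h3]
    exact congrArg _ (inDegree_congr fun q hq x _ _ => by simp [hq])

def peelCount (tgt act : Exp) : Prog :=
  .seq (.for vq (.var vN) (.write aDeg (.var vq) (.const 0))) <|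
  countEdges (.var vN) (.var vK) aDeg tgt act

theorem wp_peelCount {tgt act : Exp} {σ : Mem}
    (h : EdgeExprs I N K G A tgt act σ) :
    wp I (peelCount tgt act) (fun τ t => Frame [vq, vx, vu, vo, vp] [aDeg, aOrd] σ τ ∧
      (∀ t < N, τ.rd aDeg t = inDegree N K G A Set.univ t) ∧
      t ≤ (2 * tgt.cost + act.cost + 50) * (N * (K + 1)) + 12) σ := by
  rw [peelCount, wp_seq]
  refine (wp_fill (H := N) (g := fun _ => 0) (fun τ f => by simp [f.var vN, h.var_N])
    (fun _ _ _ _ _ _ _ => rfl) h.len_deg).mono ?_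
  rintro σ1 t1 ⟨f1, h₁, _, ht1⟩
  have f := fun τ (f : Frame [vq, vx] [aDeg] σ1 τ) =>
    f1.trans (ys := [vq, vx, vu, vo, vp]) (bs := [aDeg, aOrd]) f.weaken
  refine (wp_countEdges (fun τ s => by simp [(f τ s).var vN, h.var_N])
    (fun τ s => by simp [(f τ s).var vK, h.var_K]) (fun τ s => h.tgt τ (f τ s))
    (fun τ s => h.act τ (f τ s)) fun q hq x hx hA => ?_).mono ?_
  · rw [f1.len]
    exact (h.lt q hq x hx hA).trans_le h.len_deg
  · rintro σ2 t2 ⟨f2, h₂, ht2⟩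
    refine ⟨f _ f2, fun t ht => by rw [h₂, h₁ t ht, zero_add], ?_⟩
    simp only [cost] at ht1 ht2
    have : (2 * tgt.cost + act.cost + 50) * (N * (K + 1)) =
      N * (K * (2 * tgt.cost + act.cost + 1 + 20) + 1 + 1 + 12) + N * 36 +
        (29 * (N * K) + (2 * tgt.cost + act.cost) * N) := by ring
    omega

def peelStart : Prog :=
  .seq (.assign vo (.const 0)) <|
  .for vq (.var vN) <| .ite (.eq (.read aDeg (.var vq)) (.const 0))
    (.seq (.write aOrd (.var vo) (.var vq)) (.assign vo (.add (.var vo) (.const 1)))) .skip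

theorem wp_peelStart {tgt act : Exp} {σ : Mem}
    (h : EdgeExprs I N K G A tgt act σ)
    (hdeg : ∀ t < N, σ.rd aDeg t = inDegree N K G A Set.univ t) :
    wp I peelStart (fun τ t => Frame [vq, vx, vu, vo, vp] [aDeg, aOrd] σ τ ∧
      Peeling N K G A (τ.rd aDeg) (τ.rd aOrd) (τ.var vo) 0 0 ∧ t ≤ 30 * N + 10) σ := by
  simp only [evals, steps, peelStart]
  refine (wp_for (H := N) (T := 20) (Inv := fun i τ => τ.var vq = i ∧
    Frame [vq, vx, vu, vo, vp] [aOrd] σ τ ∧ τ.var vo ≤ i ∧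
    (∀ j < τ.var vo, τ.rd aOrd j < i) ∧
    (∀ j < τ.var vo, ∀ i < j, τ.rd aOrd i ≠ τ.rd aOrd j) ∧
    ∀ t < i, σ.rd aDeg t = 0 ↔ ∃ j < τ.var vo, τ.rd aOrd j = t) ?_ ?_ ?_ ?_).mono ?_
  · exact ⟨by simp, (Frame.rfl.setVar).setVar, by simp,
      by simp, by simp, by simp⟩
  · rintro j τ ⟨_, h2, _⟩; simp [h2.var vN, h.var_N]
  · rintro j τ ⟨h1, _⟩; exact h1
  · rintro i τ hi ⟨h1, h2, h3, h4, h5, h6⟩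
    have eD : τ.rd aDeg = σ.rd aDeg := h2.rd _
    by_cases h0 : σ.rd aDeg i = 0
    · simp only [evals, wp_ite, h1, eD, h0, if_true, one_ne_zero, if_false, wp_seq, wp_write, wp_assign, var_wr, var_setVar, Fin.reduceEq, cost, rd_setVar]
      have l : τ.var vo < τ.len aOrd := by
        rw [h2.len]; have := h.len_ord; omega
      rw [rd_wr_self _ _ l]
      refine ⟨trivial, ⟨trivial, h2.wr.setVar.setVar,
        by omega, ?_, ?_, ?_⟩, by omega⟩
      · intro j hj
        by_cases he : j = τ.var vo
        · simp [he]
        · rw [update_of_ne he]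
          have := h4 j (by omega); omega
      · intro j hj k hk
        rw [update_of_ne (show k ≠ τ.var vo by omega)]
        by_cases he : j = τ.var vo
        · have := h4 k (by omega)
          simp [he]; omega
        · rw [update_of_ne he]; exact h5 j (by omega) k hk
      · intro t ht
        by_cases he : t = i
        · subst he
          exact ⟨fun _ => ⟨τ.var vo, by omega, by simp⟩, fun _ => h0⟩
        · rw [h6 t (by omega)]
          constructor
          · rintro ⟨j, hj, e⟩
            exact ⟨j, by omega, by rw [update_of_ne (by omega), e]⟩
          · rintro ⟨j, hj, e⟩
            by_cases hjo : j = τ.var vo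
            · rw [hjo, update_self] at e; exact absurd e.symm he
            · rw [update_of_ne hjo] at e
              exact ⟨j, by omega, e⟩
    · simp only [evals, wp_ite, h1, eD, h0, if_true, if_false, wp_skip, var_setVar, Fin.reduceEq, cost, rd_setVar]
      refine ⟨trivial, ⟨trivial, h2.setVar, by omega,
        fun j hj => (h4 j hj).trans (by omega), h5, ?_⟩, by omega⟩
      intro t ht
      by_cases he : t = i
      · subst he
        exact ⟨fun e => absurd e h0, fun ⟨j, hj, e⟩ => by have := h4 j hj; omega⟩
      · exact h6 t (by omega)
  · rintro τ t ⟨⟨h1, h2, h3, h4, h5, h6⟩, ht⟩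
    have eD : τ.rd aDeg = σ.rd aDeg := h2.rd _
    refine ⟨h2.trans Frame.rfl, ⟨h4, h5, ?_, by rwa [eD], ?_⟩, ?_⟩
    · intro t ht
      rw [eD, hdeg t ht]
      exact inDegree_congr fun q _ x _ _ => by simp [unpeeled]
    · intro j hj q hq x hx hA e
      have := (h6 _ (h4 j hj)).2 ⟨j, hj, rfl⟩
      rw [hdeg _ (h4 j hj), inDegree_eq_zero] at this
      exact absurd (Set.mem_univ _) (this q hq x hx hA e)
    · simp at ht ⊢; omega

/-- Peel off the nodes without incoming edges; `ord` lists them. -/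
def peel (tgt act : Exp) : Prog :=
  .seq (peelCount tgt act) <| .seq peelStart <| .seq (.assign vp (.const 0)) <|
  .loop (.lt (.var vp) (.var vo)) <|
  .seq (.assign vq (.read aOrd (.var vp))) <|
  .seq (.for vx (.var vK) <| .ite act
    (.seq (.assign vu tgt) <|
      .seq (.write aDeg (.var vu) (.sub (.read aDeg (.var vu)) (.const 1))) <|
      .ite (.eq (.read aDeg (.var vu)) (.const 0))
        (.seq (.write aOrd (.var vo) (.var vu)) (.assign vo (.add (.var vo) (.const 1)))) .skip)
    .skip) <|
  .assign vp (.add (.var vp) (.const 1))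

/-- Each listed node is scanned once, over its K edges; the potential counts the nodes that may
still have to be scanned, and the list never exceeds N entries. -/
theorem wp_peel {tgt act : Exp} {σ : Mem}
    (h : EdgeExprs I N K G A tgt act σ) :
    wp I (peel tgt act) (fun τ t => Frame [vq, vx, vu, vo, vp] [aDeg, aOrd] σ τ ∧
      Peeled N K G A (τ.rd aDeg) (τ.rd aOrd) (τ.var vo) ∧
      t ≤ 3 * (tgt.cost + act.cost + 50) * (N * (K + 1)) + 40) σ := by
  rw [peel, wp_seq]
  refine (wp_peelCount h).mono ?_
  rintro σ1 t1 ⟨f1, h₁, ht1⟩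
  rw [wp_seq]
  refine (wp_peelStart (h.of_same f1) h₁).mono ?_
  rintro σ2 t2 ⟨f2, h₂, ht2⟩
  simp only [evals, steps]
  have f2' := f1.trans f2
  refine (wp_loop (Inv := fun τ => Frame [vq, vx, vu, vo, vp] [aDeg, aOrd] σ τ ∧
      Peeling N K G A (τ.rd aDeg) (τ.rd aOrd) (τ.var vo) (τ.var vp) 0 ∧ τ.var vp ≤ τ.var vo)
    (Φ := fun τ => (N - τ.var vp) * (K * (tgt.cost + act.cost + 35) + 30)) ?_ ?_).mono ?_
  · rintro τ ⟨f, P, hle⟩ hgo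
    have hlt : τ.var vp < τ.var vo := by
      by_contra hc
      exact hgo (by simp [hc])
    have hq := P.ord_lt _ hlt
    simp only [evals, steps]
    refine (wp_for (H := K) (T := tgt.cost + act.cost + 27) (Inv := fun i υ =>
      υ.var vx = i ∧ υ.var vq = τ.rd aOrd (τ.var vp) ∧ υ.var vp = τ.var vp ∧
      Frame [vq, vx, vu, vo, vp] [aDeg, aOrd] σ υ ∧
      Peeling N K G A (υ.rd aDeg) (υ.rd aOrd) (υ.var vo) (τ.var vp) i ∧
      τ.var vp < υ.var vo ∧ υ.rd aOrd (τ.var vp) = τ.rd aOrd (τ.var vp)) ?_ ?_ ?_ ?_).mono ?_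
    · exact ⟨by simp, by simp, by simp, f.setVar.setVar, by simpa using P,
        by simpa using hlt, by simp⟩
    · rintro j υ ⟨_, _, _, h2, _⟩; simp [h2.var vK, h.var_K]
    · rintro j υ ⟨h1, _⟩; exact h1
    · rintro i υ hi ⟨h1, h2, h3, h4, h5, h6, h7⟩
      set q := τ.rd aOrd (τ.var vp) with hqdef
      have hact := h.act υ h4 (by omega) (by omega)
      rw [h1, h2] at hact
      rw [wp_ite]
      by_cases hA : A q i
      · rw [if_neg (by rw [hact]; exact not_not.2 hA)]
        have htgt := h.tgt υ h4 (by omega) (by omega)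
        rw [h1, h2] at htgt
        have hG := h.lt q hq i hi hA
        have key := h5.remove h6 hi (by rw [h7]; exact hA) (by rw [h7]; exact hG)
        rw [h7] at key
        obtain ⟨k0, k1, k2⟩ := key
        have l1 : G q i < (υ.setVar vu (G q i)).len aDeg := by
          rw [len_setVar, h4.len]; exact hG.trans_le h.len_deg
        simp only [evals, wp_seq, wp_assign, wp_write, wp_ite, htgt, var_setVar, if_true, rd_setVar, var_wr, Fin.reduceEq, if_false, cost, rd_wr_self _ _ l1, update_self]
        by_cases h0 : υ.rd aDeg (G q i) - 1 = 0
        · obtain ⟨ho, k2⟩ := k2 h0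
          have l2 : υ.var vo < (υ.setVar vu (G q i)).len aOrd := by
            rw [len_setVar, h4.len]; exact ho.trans_le h.len_ord
          simp only [h0, if_true, one_ne_zero, if_false, var_setVar, var_wr, Fin.reduceEq, h1,
            eval_add, eval_var, eval_const, rd_setVar]
          refine ⟨trivial, ⟨trivial, h2, h3, h4.setVar.wr.wr.setVar.setVar, ?_, by omega, ?_⟩, by omega⟩
          · have e1 : ((((υ.setVar vu (G q i)).wr aDeg (G q i) 0)).wr aOrd (υ.var vo)
                (G q i)).rd aDeg = update (υ.rd aDeg) (G q i) 0 := by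
              rw [rd_wr, if_neg (by simp), rd_wr_self _ _ l1, rd_setVar]
            rw [e1, rd_wr_self _ _ (by rw [len_wr]; exact l2)]
            rw [h0] at k2
            simpa using k2
          · rw [rd_wr_self _ _ (by rw [len_wr]; exact l2), update_of_ne (by omega)]
            simpa using h7
        · simp only [h0, if_false, if_true, wp_skip, var_wr, var_setVar, Fin.reduceEq, h1,
            rd_setVar]
          refine ⟨trivial, ⟨trivial, h2, h3, h4.setVar.wr.setVar, ?_, h6, ?_⟩, by omega⟩
          · rw [rd_wr_self _ _ l1]
            simpa using k1 h0
          · simpa using h7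
      · rw [if_pos (hact.2 hA)]
        simp only [wp_skip]
        exact ⟨h1, ⟨by simp, by simp [h2], by simp [h3], h4.setVar,
          h5.skip (by rw [h7]; exact hA), by simpa using h6, by simpa using h7⟩, by omega⟩
    · rintro υ t ⟨⟨h1, h2, h3, h4, h5, h6, h7⟩, ht⟩
      simp only [evals, rd_setVar, var_setVar, if_true, Fin.reduceEq, if_false, h3, cost]
      refine ⟨⟨h4.setVar, h5.next, h6⟩, ?_⟩
      have hN := P.o_le
      obtain ⟨r, hr⟩ : ∃ r, N = τ.var vp + 1 + r := ⟨N - (τ.var vp + 1), by omega⟩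
      have r1 : N - (τ.var vp + 1) = r := by omega
      have r2 : N - τ.var vp = r + 1 := by omega
      rw [r1, r2, add_mul r 1]
      simp only [cost] at ht
      have : tgt.cost + act.cost + 27 + 1 + 7 = tgt.cost + act.cost + 35 := by ring
      rw [this] at ht
      omega
  · exact ⟨f2'.setVar, by simpa using h₂, by simp⟩
  · rintro σ3 t3 ⟨⟨f3, P, hle⟩, hend, ht3⟩
    have hend' : ¬ σ3.var vp < σ3.var vo := fun hc => by simp [hc] at hend
    have : σ3.var vp = σ3.var vo := by omega
    rw [this] at P
    refine ⟨f3, P.peeled, ?_⟩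
    simp only [var_setVar, if_true, Nat.sub_zero, cost] at ht3
    have e1 : 3 * (tgt.cost + act.cost + 50) * (N * (K + 1)) =
      (2 * tgt.cost + act.cost + 50) * (N * (K + 1)) + N * (K * (tgt.cost + act.cost + 35) + 30) +
        (act.cost * N * K + (tgt.cost + 2 * act.cost) * N + 65 * N * K + 70 * N) := by ring
    simp only [cost]
    have : 30 * N ≤ 70 * N := by omega
    omega

end Program


/-! ## Equivalence of the states of a weak automaton -/

/-! ### Runs of transition functions on infinite words -/

section Runs

variable {Q A : Type*}

/-- The run of the transition function `δ` on the `ω`-word `w`. -/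
def omegaRun (δ : Q → A → Q) (q : Q) (w : ℕ → A) : ℕ → Q
  | 0 => q
  | i + 1 => δ (omegaRun δ q w i) (w i)

/-- The run on `w` visits `F` infinitely often. -/
def OmegaAcc (δ : Q → A → Q) (F : Q → Prop) (q : Q) (w : ℕ → A) : Prop :=
  ∃ᶠ i in Filter.atTop, F (omegaRun δ q w i)

theorem omegaRun_add (δ : Q → A → Q) (q : Q) (w : ℕ → A) (i j : ℕ) :
    omegaRun δ q w (i + j) = omegaRun δ (omegaRun δ q w i) (fun k => w (i + k)) j := by
  induction j with
  | zero => rfl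
  | succ j ih => rw [← add_assoc, omegaRun, ih]; rfl

theorem omegaAcc_tail (δ : Q → A → Q) (F : Q → Prop) (q : Q) (w : ℕ → A) (i : ℕ) :
    OmegaAcc δ F q w ↔ OmegaAcc δ F (omegaRun δ q w i) (fun k => w (i + k)) := by
  unfold OmegaAcc
  simp only [Filter.frequently_atTop, ← omegaRun_add]
  constructor
  · intro h a
    obtain ⟨b, hb, hF⟩ := h (i + a)
    exact ⟨b - i, by omega, by rwa [Nat.add_sub_cancel' (by omega)]⟩
  · intro h a
    obtain ⟨b, hb, hF⟩ := h a
    exact ⟨i + b, by omega, hF⟩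

theorem omegaRun_congr {δ : Q → A → Q} {q : Q} {w w' : ℕ → A} {n : ℕ} (h : ∀ i < n, w i = w' i) :
    omegaRun δ q w n = omegaRun δ q w' n := by
  induction n with
  | zero => rfl
  | succ n ih => rw [omegaRun, omegaRun, ih fun i hi => h i (by omega), h n (by omega)]

end Runs

/-! ### Reachability and periodic words -/

section Words

variable {K : ℕ} {δ : ℕ → ℕ → ℕ}

theorem reach_iff_word {p q : ℕ} :
    Reach K δ p q ↔ ∃ u : List ℕ, (∀ x ∈ u, x < K) ∧ u.foldl δ p = q := by
  constructor
  · intro h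
    induction h with
    | refl => exact ⟨[], by simp, rfl⟩
    | tail _ h ih =>
      obtain ⟨u, hu, rfl⟩ := ih
      obtain ⟨x, hx, rfl⟩ := h
      refine ⟨u ++ [x], ?_, by simp⟩
      intro y hy
      rcases List.mem_append.1 hy with h | h
      · exact hu y h
      · simp at h; rw [h]; exact hx
  · rintro ⟨u, hu, rfl⟩
    induction u generalizing p with
    | nil => exact Relation.ReflTransGen.refl
    | cons x u ih =>
      exact Relation.ReflTransGen.head ⟨x, hu x (by simp), rfl⟩
        (ih fun y hy => hu y (List.mem_cons_of_mem _ hy))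

/-- The periodic word `u u u …`. -/
def periodicWord (u : List ℕ) : ℕ → ℕ := fun i => u.getD (i % u.length) 0

theorem omegaRun_list (u : List ℕ) (w : ℕ → ℕ) (h : ∀ i < u.length, w i = u.getD i 0) (q : ℕ) :
    omegaRun δ q w u.length = u.foldl δ q := by
  induction u using List.reverseRecOn with
  | nil => rfl
  | append_singleton u x ih =>
    rw [List.length_append, List.length_singleton, omegaRun, ih, List.foldl_append]
    · have := h u.length (by simp)
      simp at this
      simp [this]
    · intro i hi
      rw [h i (by simp; omega)]
      simp [List.getElem?_append, hi]

theorem omegaRun_periodic (u : List ℕ) (q m : ℕ) :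
    omegaRun δ q (periodicWord u) (m * u.length) = (fun q => u.foldl δ q)^[m] q := by
  induction m generalizing q with
  | zero => simp [omegaRun]
  | succ m ih =>
    rw [iterate_succ_apply, ← ih, add_mul, one_mul, add_comm, omegaRun_add]
    congr 1
    · exact omegaRun_list u _ (fun i hi => by simp [periodicWord, Nat.mod_eq_of_lt hi]) q
    · funext k
      simp [periodicWord]

theorem periodicWord_lt {u : List ℕ} (hu : u ≠ []) (h : ∀ x ∈ u, x < K) (i : ℕ) :
    periodicWord u i < K := by
  have : i % u.length < u.length := Nat.mod_lt _ (List.length_pos_iff.2 hu)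
  unfold periodicWord
  rw [List.getD_eq_getElem _ _ this]
  exact h _ (List.getElem_mem _)

theorem reach_omegaRun {q : ℕ} {w : ℕ → ℕ} (hw : ∀ i, w i < K) {i j : ℕ} (hij : i ≤ j) :
    Reach K δ (omegaRun δ q w i) (omegaRun δ q w j) := by
  obtain ⟨k, rfl⟩ := Nat.exists_eq_add_of_le hij
  induction k with
  | zero => exact Relation.ReflTransGen.refl
  | succ k ih => exact (ih (by omega)).tail ⟨_, hw _, rfl⟩

end Words

/-- Two iterates of a self-map of `{0, …, N - 1}` coincide. -/
theorem exists_iterate_eq {N : ℕ} {f : ℕ → ℕ} (hf : ∀ q < N, f q < N) {p : ℕ} (hp : p < N) :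
    ∃ i j, i < j ∧ j ≤ N ∧ f^[i] p = f^[j] p := by
  have hmem : ∀ i, f^[i] p < N := fun i => by
    induction i with
    | zero => exact hp
    | succ i ih => rw [iterate_succ_apply']; exact hf _ ih
  obtain ⟨i, hi, j, hj, hne, he⟩ := Finset.exists_ne_map_eq_of_card_lt_of_maps_to
    (s := Finset.range (N + 1)) (t := Finset.range N) (f := fun i => f^[i] p) (by simp)
    (fun i _ => by simpa using hmem i)
  simp only [Finset.mem_range] at hi hj
  rcases lt_or_gt_of_ne hne with h | h
  · exact ⟨i, j, h, by omega, he⟩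
  · exact ⟨j, i, h, by omega, he.symm⟩

/-- A property that holds infinitely often along a sequence in a finite set holds infinitely often
at the same point. -/
theorem exists_frequently_eq {N : ℕ} {r : ℕ → ℕ} {P : ℕ → Prop} (hr : ∀ i, r i < N)
    (h : ∃ᶠ i in Filter.atTop, P (r i)) : ∃ p < N, P p ∧ ∃ᶠ i in Filter.atTop, r i = p := by
  by_contra hcon
  push Not at hcon
  refine h ?_
  have : ∀ᶠ i in Filter.atTop, ∀ p ∈ Finset.range N, P p → r i ≠ p := by
    rw [Filter.eventually_all_finset]
    intro p hp
    by_cases hP : P p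
    · filter_upwards [hcon p (by simpa using hp) hP] with i hi _
      exact hi
    · exact Filter.Eventually.of_forall fun i h => absurd h hP
  filter_upwards [this] with i hi hP
  exact hi (r i) (by simpa using hr i) hP rfl

/-- A weak automaton on the states `0, …, N - 1` with the letters `0, …, K - 1`. -/
structure WeakTable (N K : ℕ) (δ : ℕ → ℕ → ℕ) (F : ℕ → Prop) : Prop where
  lt : ∀ q < N, ∀ x < K, δ q x < N
  weak : ∀ p < N, ∀ q < N, Reach K δ p q → Reach K δ q p → (F p ↔ F q)

/-- Two states accept the same words over the letters `0, …, K - 1`. -/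
def SameLanguage (K : ℕ) (δ : ℕ → ℕ → ℕ) (F : ℕ → Prop) (p q : ℕ) : Prop :=
  ∀ w : ℕ → ℕ, (∀ i, w i < K) → (OmegaAcc δ F p w ↔ OmegaAcc δ F q w)

/-! ### The criterion by components and cycles -/

section Criterion

variable {N K : ℕ} {δ : ℕ → ℕ → ℕ} {F : ℕ → Prop}

theorem WeakTable.run_lt (h : WeakTable N K δ F) {q : ℕ} (hq : q < N) {w : ℕ → ℕ}
    (hw : ∀ i, w i < K) (i : ℕ) : omegaRun δ q w i < N := by
  induction i with
  | zero => exact hq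
  | succ i ih => exact h.lt _ ih _ (hw i)

theorem WeakTable.foldl_lt (h : WeakTable N K δ F) {q : ℕ} (hq : q < N) {u : List ℕ}
    (hu : ∀ x ∈ u, x < K) : u.foldl δ q < N := by
  induction u generalizing q with
  | nil => exact hq
  | cons x u ih =>
    exact ih (h.lt _ hq _ (hu x (by simp))) fun y hy => hu y (List.mem_cons_of_mem _ hy)

/-- If the run returns to its first state infinitely often, this state decides the acceptance. -/
theorem WeakTable.acc_iff (h : WeakTable N K δ F) {q : ℕ} (hq : q < N) {w : ℕ → ℕ}
    (hw : ∀ i, w i < K) (hret : ∃ᶠ i in Filter.atTop, omegaRun δ q w i = q) :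
    OmegaAcc δ F q w ↔ F q := by
  constructor
  · intro hacc
    obtain ⟨i, _, hi⟩ := Filter.frequently_atTop.1 hacc 0
    obtain ⟨j, hj, hj'⟩ := Filter.frequently_atTop.1 hret i
    have r1 := reach_omegaRun (δ := δ) (q := q) hw (Nat.zero_le i)
    have r2 := reach_omegaRun (δ := δ) (q := q) hw hj
    rw [hj'] at r2
    exact (h.weak _ (h.run_lt hq hw i) q hq r2 r1).1 hi
  · intro hF
    exact hret.mono fun i hi => by rw [hi]; exact hF

/-- Language equivalence is a congruence. -/
theorem sameLanguage_congruence {s s' : ℕ} (h : SameLanguage K δ F s s') :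
    Congruence N K δ s s' (SameLanguage K δ F) where
  equiv := ⟨fun _ _ _ => Iff.rfl, fun h w hw => (h w hw).symm,
    fun h h' w hw => (h w hw).trans (h' w hw)⟩
  base := h
  step p _ q _ x hx hpq w hw := by
    have := hpq (fun i => if i = 0 then x else w (i - 1)) (fun i => by
      split_ifs
      · exact hx
      · exact hw _)
    rw [omegaAcc_tail δ F p _ 1, omegaAcc_tail δ F q _ 1] at this
    have e : (fun k => (fun i => if i = 0 then x else w (i - 1)) (1 + k)) = w := by
      funext k
      simp [show 1 + k ≠ 0 by omega, show 1 + k - 1 = k by omega]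
    rw [e] at this
    exact this

/-- If `p` is equivalent to `a`, and `a` lies on a cycle labelled `u`, then reading `u` repeatedly
from `p` leads to a state with the acceptance of `a`. -/
theorem WeakTable.exists_iterate_acc (h : WeakTable N K δ F) {a p : ℕ} {u : List ℕ} (ha : a < N)
    (hp : p < N) (hu : ∀ x ∈ u, x < K) (hne : u ≠ []) (hloop : u.foldl δ a = a)
    (heq : ∀ i, SameLanguage K δ F ((fun q => u.foldl δ q)^[i] p) a) :
    ∃ i ≤ N, (F ((fun q => u.foldl δ q)^[i] p) ↔ F a) := by
  set f := fun q => u.foldl δ q with hf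
  have hfN : ∀ q < N, f q < N := fun q hq => h.foldl_lt hq hu
  obtain ⟨i, j, hij, hj, he⟩ := exists_iterate_eq hfN hp
  refine ⟨i, by omega, ?_⟩
  have hw := periodicWord_lt hne hu
  have hlen : 0 < u.length := List.length_pos_iff.2 hne
  have hiN : f^[i] p < N := by
    clear he heq hij
    induction i with
    | zero => exact hp
    | succ i ih => rw [iterate_succ_apply']; exact hfN _ ih
  have ret : ∀ e k, 0 < k → f^[k] e = e →
      ∃ᶠ i in Filter.atTop, omegaRun δ e (periodicWord u) i = e := by
    intro e k hk hke
    rw [Filter.frequently_atTop]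
    intro m
    refine ⟨(k * m) * u.length, ?_, ?_⟩
    · calc m = 1 * m * 1 := by ring
        _ ≤ k * m * u.length := by gcongr <;> omega
    · rw [omegaRun_periodic, iterate_mul]
      exact iterate_fixed hke m
  -- On the word u u u … the run from `a` returns to `a`, and the run from the i-th iterate returns
  -- to it since iterates i and j coincide. Both acceptances are thus decided by the states
  -- themselves, and they agree because the languages do.
  have h1 := h.acc_iff ha hw (ret a 1 one_pos hloop)
  have h2 := h.acc_iff hiN hw (ret _ (j - i) (by omega) (by
    rw [← iterate_add_apply, Nat.sub_add_cancel hij.le, he]))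
  rw [← h1, ← h2]
  exact heq i _ hw

variable {s s' : ℕ} {ρ I deg ord : ℕ → ℕ} {o : ℕ}

theorem GeneratedBy.foldl (hg : GeneratedBy N K δ s s' ρ) (h : WeakTable N K δ F) {q : ℕ}
    (hq : q < N) {u : List ℕ} (hu : ∀ x ∈ u, x < K) :
    ρ (u.foldl δ q) = u.foldl (fun q x => ρ (δ q x)) (ρ q) := by
  induction u generalizing q with
  | nil => rfl
  | cons x u ih =>
    have hx := hu x (by simp)
    rw [List.foldl_cons, List.foldl_cons,
      ih (h.lt _ hq _ hx) fun y hy => hu y (List.mem_cons_of_mem _ hy)]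
    congr 1
    exact hg.step _ hq _ (hg.lt q hq) x hx (hg.root q hq).symm

theorem reach_iterate {u : List ℕ} (hu : ∀ x ∈ u, x < K) (p i : ℕ) :
    Reach K δ p ((fun q => u.foldl δ q)^[i] p) := by
  induction i with
  | zero => exact Relation.ReflTransGen.refl
  | succ i ih =>
    rw [iterate_succ_apply']
    exact ih.trans (reach_iff_word.2 ⟨u, hu, rfl⟩)

theorem reach_iterate_le {u : List ℕ} (hu : ∀ x ∈ u, x < K) (p : ℕ) {i j : ℕ} (hij : i ≤ j) :
    Reach K δ ((fun q => u.foldl δ q)^[i] p) ((fun q => u.foldl δ q)^[j] p) := by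
  obtain ⟨k, rfl⟩ := Nat.exists_eq_add_of_le hij
  rw [add_comm, iterate_add_apply]
  exact reach_iterate hu _ k

/-- If `s` and `s'` are equivalent, then states on cycles over the same component of the quotient
have the same acceptance. -/
theorem WeakTable.acc_eq_of_cycles (h : WeakTable N K δ F) (hg : GeneratedBy N K δ s s' ρ)
    (hs : SameLanguage K δ F s s') {a c : ℕ} {u v y z : List ℕ} (ha : a < N) (hc : c < N)
    (hu : ∀ x ∈ u, x < K) (hv : ∀ x ∈ v, x < K) (hy : ∀ x ∈ y, x < K) (hz : ∀ x ∈ z, x < K)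
    (hu0 : u ≠ []) (hv0 : v ≠ []) (hua : u.foldl δ a = a) (hvc : v.foldl δ c = c)
    (hyac : ρ (y.foldl δ a) = ρ c) (hzca : ρ (z.foldl δ c) = ρ a) : F a ↔ F c := by
  have hE : ∀ p < N, ∀ q < N, ρ p = ρ q → SameLanguage K δ F p q :=
    hg.least _ (sameLanguage_congruence hs)
  have hcong : ∀ w : List ℕ, (∀ x ∈ w, x < K) → ∀ p < N, ∀ q < N, ρ p = ρ q →
      ρ (w.foldl δ p) = ρ (w.foldl δ q) := fun w hw p hp q hq e => by
    rw [hg.foldl h hp hw, hg.foldl h hq hw, e]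
  have iter : ∀ (w : List ℕ), (∀ x ∈ w, x < K) → ∀ e < N, w.foldl δ e = e → ∀ p < N, ρ p = ρ e →
      ∀ i, (fun q => w.foldl δ q)^[i] p < N ∧ ρ ((fun q => w.foldl δ q)^[i] p) = ρ e := by
    intro w hw e he hwe p hp hpe i
    induction i with
    | zero => exact ⟨hp, hpe⟩
    | succ i ih =>
      rw [iterate_succ_apply']
      refine ⟨h.foldl_lt ih.1 hw, ?_⟩
      have := hcong w hw _ ih.1 _ he ih.2
      rw [hwe] at this
      exact this
  set f := fun q => u.foldl δ q with hf
  set g := fun q => v.foldl δ q with hgdef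
  -- Reads u^N y v^N z. From a state congruent to `a` this leads back to the class of `a`; N
  -- repetitions suffice to pass through a state with the acceptance of `a` while reading u, and
  -- through one with the acceptance of `c` while reading v.
  let H : ℕ → ℕ := fun p => z.foldl δ (g^[N] (y.foldl δ (f^[N] p)))
  have step : ∀ p < N, ρ p = ρ a → (H p < N ∧ ρ (H p) = ρ a) ∧
      ∃ e₁ < N, ∃ e₂ < N, Reach K δ p e₁ ∧ Reach K δ e₁ (H p) ∧ Reach K δ p e₂ ∧
        Reach K δ e₂ (H p) ∧ (F e₁ ↔ F a) ∧ (F e₂ ↔ F c) := by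
    intro p hp hpa
    have i1 := iter u hu a ha hua p hp hpa
    have j1 : y.foldl δ (f^[N] p) < N := h.foldl_lt (i1 N).1 hy
    have j2 : ρ (y.foldl δ (f^[N] p)) = ρ c := by
      rw [hcong y hy _ (i1 N).1 _ ha (i1 N).2, hyac]
    have i2 := iter v hv c hc hvc _ j1 j2
    have hz' : H p < N ∧ ρ (H p) = ρ a :=
      ⟨h.foldl_lt (i2 N).1 hz, by
        change ρ (z.foldl δ _) = _
        rw [hcong z hz _ (i2 N).1 _ hc (i2 N).2, hzca]⟩
    obtain ⟨i, hi, hFi⟩ := h.exists_iterate_acc ha hp hu hu0 hua fun i =>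
      hE _ (i1 i).1 _ ha (i1 i).2
    obtain ⟨j, hj, hFj⟩ := h.exists_iterate_acc hc j1 hv hv0 hvc fun i =>
      hE _ (i2 i).1 _ hc (i2 i).2
    have r1 : Reach K δ (f^[N] p) (y.foldl δ (f^[N] p)) := reach_iff_word.2 ⟨y, hy, rfl⟩
    have r2 : Reach K δ (g^[N] (y.foldl δ (f^[N] p))) (H p) := reach_iff_word.2 ⟨z, hz, rfl⟩
    refine ⟨hz', _, (i1 i).1, _, (i2 j).1, reach_iterate hu p i, ?_, ?_, ?_, hFi, hFj⟩
    · exact ((reach_iterate_le hu p hi).trans r1).trans ((reach_iterate hv _ N).trans r2)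
    · exact ((reach_iterate hu p N).trans r1).trans (reach_iterate hv _ j)
    · exact (reach_iterate_le hv _ hj).trans r2
  have hH : ∀ k, H^[k] a < N ∧ ρ (H^[k] a) = ρ a := by
    intro k
    induction k with
    | zero => exact ⟨ha, rfl⟩
    | succ k ih => rw [iterate_succ_apply']; exact (step _ ih.1 ih.2).1
  have hreach : ∀ k l, k ≤ l → Reach K δ (H^[k] a) (H^[l] a) := by
    intro k l hkl
    induction l, hkl using Nat.le_induction with
    | base => exact Relation.ReflTransGen.refl
    | succ l _ ih =>
      obtain ⟨_, e₁, _, _, _, r1, r2, _⟩ := step _ (hH l).1 (hH l).2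
      rw [iterate_succ_apply']
      exact ih.trans (r1.trans r2)
  -- The iterates of `H` repeat, which closes a cycle through states of both acceptances; weakness
  -- makes these equal.
  obtain ⟨k, l, hkl, hek⟩ : ∃ k l, k < l ∧ H^[k] a = H^[l] a := by
    obtain ⟨i, hi, j, hj, hne, he⟩ := Finset.exists_ne_map_eq_of_card_lt_of_maps_to
      (s := Finset.range (N + 1)) (t := Finset.range N) (f := fun i => H^[i] a) (by simp)
      (fun i _ => by simpa using (hH i).1)
    rcases lt_or_gt_of_ne hne with h | h
    · exact ⟨i, j, h, he⟩
    · exact ⟨j, i, h, he.symm⟩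
  obtain ⟨_, e₁, h1, e₂, h2, r1, r2, r3, r4, hF1, hF2⟩ := step _ (hH k).1 (hH k).2
  have back : Reach K δ (H (H^[k] a)) (H^[k] a) := by
    have := hreach (k + 1) l hkl
    rw [iterate_succ_apply', ← hek] at this
    exact this
  rw [← hF1, ← hF2]
  exact h.weak _ h1 _ h2 ((r2.trans back).trans r3) ((r4.trans back).trans r1)

/-- The edges of the automaton inside a block: a component of the quotient, and an acceptance. -/
def BlockEdge (δ : ℕ → ℕ → ℕ) (F : ℕ → Prop) (ρ I : ℕ → ℕ) (q x : ℕ) : Prop :=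
  I (ρ q) = I (ρ (δ q x)) ∧ (F q ↔ F (δ q x))

/-- A surviving node has a surviving predecessor in its block. Walking backwards among finitely many
nodes, some node repeats; it lies on a cycle, and the walk has not left the block. -/
theorem Peeled.exists_cycle (P : Peeled N K δ (BlockEdge δ F ρ I) deg ord o) {p : ℕ} (hp : p < N)
    (hd : deg p ≠ 0) :
    ∃ r < N, I (ρ r) = I (ρ p) ∧ (F r ↔ F p) ∧
      ∃ u : List ℕ, u ≠ [] ∧ (∀ x ∈ u, x < K) ∧ u.foldl δ r = r := by
  have hpre : ∀ t, ∃ q, t < N → deg t ≠ 0 →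
      (q < N ∧ deg q ≠ 0 ∧ ∃ x < K, BlockEdge δ F ρ I q x ∧ δ q x = t) := by
    intro t
    by_cases h : t < N ∧ deg t ≠ 0
    · obtain ⟨q, hq, x, hx, h1, h2, h3⟩ := P.live t h.1 h.2
      exact ⟨q, fun _ _ => ⟨hq, h3, x, hx, h1, h2⟩⟩
    · exact ⟨0, fun h1 h2 => absurd ⟨h1, h2⟩ h⟩
  choose pre hpre using hpre
  have hmem : ∀ i, pre^[i] p < N ∧ deg (pre^[i] p) ≠ 0 := by
    intro i
    induction i with
    | zero => exact ⟨hp, hd⟩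
    | succ i ih =>
      rw [iterate_succ_apply']
      have := hpre _ ih.1 ih.2
      exact ⟨this.1, this.2.1⟩
  have hblk : ∀ i, I (ρ (pre^[i] p)) = I (ρ p) ∧ (F (pre^[i] p) ↔ F p) := by
    intro i
    induction i with
    | zero => exact ⟨rfl, Iff.rfl⟩
    | succ i ih =>
      rw [iterate_succ_apply']
      obtain ⟨_, _, x, _, ⟨h1, h2⟩, h3⟩ := hpre _ (hmem i).1 (hmem i).2
      rw [h3] at h1 h2
      exact ⟨h1.trans ih.1, h2.trans ih.2⟩
  have hword : ∀ k i, ∃ u : List ℕ, u.length = k ∧ (∀ x ∈ u, x < K) ∧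
      u.foldl δ (pre^[i + k] p) = pre^[i] p := by
    intro k
    induction k with
    | zero => intro i; exact ⟨[], rfl, by simp, rfl⟩
    | succ k ih =>
      intro i
      obtain ⟨u, h1, h2, h3⟩ := ih i
      obtain ⟨_, _, x, hx, _, h4⟩ := hpre _ (hmem (i + k)).1 (hmem (i + k)).2
      refine ⟨x :: u, by simp [h1], ?_, ?_⟩
      · intro y hy
        rcases List.mem_cons.1 hy with rfl | h
        · exact hx
        · exact h2 y h
      · rw [← add_assoc, iterate_succ_apply', List.foldl_cons, h4, h3]
  obtain ⟨i, hi, j, hj, hne, he⟩ := Finset.exists_ne_map_eq_of_card_lt_of_maps_to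
    (s := Finset.range (N + 1)) (t := Finset.range N) (f := fun i => pre^[i] p) (by simp)
    (fun i _ => by simpa using (hmem i).1)
  have fin : ∀ i j, i < j → pre^[i] p = pre^[j] p → ∃ u : List ℕ, u ≠ [] ∧ (∀ x ∈ u, x < K) ∧
      u.foldl δ (pre^[i] p) = pre^[i] p := by
    intro i j hij he
    obtain ⟨u, h1, h2, h3⟩ := hword (j - i) i
    rw [Nat.add_sub_cancel' hij.le, ← he] at h3
    exact ⟨u, fun e => by subst e; simp at h1; omega, h2, h3⟩
  rcases lt_or_gt_of_ne hne with h | h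
  · exact ⟨_, (hmem i).1, (hblk i).1, (hblk i).2, fin i j h he⟩
  · exact ⟨_, (hmem j).1, (hblk j).1, (hblk j).2, fin j i h he.symm⟩

/-- States that a run visits infinitely often are not peeled. -/
theorem Peeled.live_of_return (P : Peeled N K δ (BlockEdge δ F ρ I) deg ord o)
    (h : WeakTable N K δ F) {q : ℕ} (hq : q < N) {w : ℕ → ℕ} (hw : ∀ i, w i < K) {i0 : ℕ}
    (hconst : ∀ i, i0 ≤ i → I (ρ (omegaRun δ q w i)) = I (ρ (omegaRun δ q w i0))) {p : ℕ}
    (hp : ∃ᶠ i in Filter.atTop, omegaRun δ q w i = p) :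
    deg p ≠ 0 ∧ I (ρ p) = I (ρ (omegaRun δ q w i0)) := by
  obtain ⟨i, hi, hip⟩ := Filter.frequently_atTop.1 hp i0
  obtain ⟨j, hj, hjp⟩ := Filter.frequently_atTop.1 hp (i + 1)
  -- Between two visits of `p` all states lie on a common cycle, so by weakness they share one
  -- acceptance and all edges of this piece of the run are block edges.
  have hF : ∀ k, i ≤ k → k ≤ j → (F (omegaRun δ q w k) ↔ F p) := by
    intro k hk hkj
    have r1 := reach_omegaRun (δ := δ) (q := q) hw hk
    have r2 := reach_omegaRun (δ := δ) (q := q) hw hkj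
    rw [hip] at r1
    rw [hjp] at r2
    exact h.weak _ (h.run_lt hq hw k) _ (by rw [← hip]; exact h.run_lt hq hw i) r2 r1
  refine ⟨fun h0 => ?_, by rw [← hip]; exact hconst i hi⟩
  -- Infinite descent: if one state of the cycle were peeled, its predecessor on the cycle would
  -- occur earlier in the list, and so on around the cycle forever.
  have hcyc : ∀ l, l < o → ∀ k, i < k → k ≤ j → ord l = omegaRun δ q w k → False := by
    intro l
    induction l using Nat.strong_induction_on with
    | _ l ih =>
      intro hl k hk hkj hol
      obtain ⟨k, rfl⟩ : ∃ k', k = k' + 1 := ⟨k - 1, by omega⟩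
      obtain ⟨l', hl', hol'⟩ := P.pred l hl _ (h.run_lt hq hw k) (w k) (hw k)
        ⟨(hconst k (by omega)).trans (hconst (k + 1) (by omega)).symm,
          (hF k (by omega) (by omega)).trans (hF (k + 1) (by omega) hkj).symm⟩ hol.symm
      by_cases hki : k = i
      · refine ih l' hl' (by omega) j (by omega) le_rfl ?_
        rw [hol', hki, hip, hjp]
      · exact ih l' hl' (by omega) k (by omega) (by omega) hol'
  obtain ⟨l, hl, hol⟩ := (P.mem p (by rw [← hip]; exact h.run_lt hq hw i)).1 h0
  exact hcyc l hl j (by omega) le_rfl (by rw [hol, hjp])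

/-- The criterion for the equivalence of `s` and `s'`. -/
theorem WeakTable.sameLanguage_iff (h : WeakTable N K δ F) (hs : s < N) (hs' : s' < N)
    (hg : GeneratedBy N K δ s s' ρ) (hI : SCCNumbering N K (fun q x => ρ (δ q x)) I)
    (P : Peeled N K δ (BlockEdge δ F ρ I) deg ord o) :
    SameLanguage K δ F s s' ↔
      ∀ p < N, ∀ q < N, deg p ≠ 0 → deg q ≠ 0 → I (ρ p) = I (ρ q) → F p → F q := by
  constructor
  · intro hL p hp q hq hdp hdq hpq hFp
    obtain ⟨a, ha, ha1, ha2, u, hu0, hu, hua⟩ := P.exists_cycle hp hdp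
    obtain ⟨c, hc, hc1, hc2, v, hv0, hv, hvc⟩ := P.exists_cycle hq hdq
    have hac : I (ρ a) = I (ρ c) := by rw [ha1, hc1, hpq]
    obtain ⟨y, hy, hyac⟩ := reach_iff_word.1 (hI.reach _ (hg.lt a ha) _ (hg.lt c hc) hac)
    obtain ⟨z, hz, hzca⟩ := reach_iff_word.1 (hI.reach _ (hg.lt c hc) _ (hg.lt a ha) hac.symm)
    rw [← hg.foldl h ha hy] at hyac
    rw [← hg.foldl h hc hz] at hzca
    have := h.acc_eq_of_cycles hg hL ha hc hu hv hy hz hu0 hv0 hua hvc hyac hzca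
    exact hc2.1 (this.1 (ha2.2 hFp))
  · intro hcrit w hw
    have hρ : ∀ i, ρ (omegaRun δ s w i) = ρ (omegaRun δ s' w i) := by
      intro i
      induction i with
      | zero => exact hg.base
      | succ i ih => exact hg.step _ (h.run_lt hs hw i) _ (h.run_lt hs' hw i) _ (hw i) ih
    -- Component numbers do not increase along edges of the quotient, so from some moment on the run
    -- stays in one component.
    have hdec : ∀ i, I (ρ (omegaRun δ s w (i + 1))) ≤ I (ρ (omegaRun δ s w i)) := by
      intro i
      have hi := h.run_lt hs hw i
      have e := hI.edge_le _ (hg.lt _ hi) (w i) (hw i)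
      have e' := hg.step _ (hg.lt _ hi) _ hi (w i) (hw i) (hg.root _ hi)
      rw [e'] at e
      exact e
    have hanti : Antitone fun i => I (ρ (omegaRun δ s w i)) := antitone_nat_of_succ_le hdec
    obtain ⟨i0, hi0⟩ : ∃ i0, ∀ i, i0 ≤ i →
        I (ρ (omegaRun δ s w i)) = I (ρ (omegaRun δ s w i0)) := by
      obtain ⟨i0, hi0⟩ := WellFounded.has_min (measure fun i => I (ρ (omegaRun δ s w i))).wf
        Set.univ ⟨0, trivial⟩
      refine ⟨i0, fun i hi => le_antisymm (hanti hi) ?_⟩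
      by_contra hlt
      exact hi0.2 i trivial (not_le.1 hlt)
    -- The two runs are congruent at every moment, so states that they visit infinitely often
    -- survive in the same component; an accepting one of the first run makes the recurrent one of
    -- the second run accepting.
    have key : ∀ a c, a < N → c < N → (∀ i, ρ (omegaRun δ a w i) = ρ (omegaRun δ s w i)) →
        (∀ i, ρ (omegaRun δ c w i) = ρ (omegaRun δ s w i)) → OmegaAcc δ F a w →
        OmegaAcc δ F c w := by
      intro a c ha hc hra hrc hacc
      obtain ⟨p, hp, hFp, hpf⟩ := exists_frequently_eq (h.run_lt ha hw) hacc
      obtain ⟨q, hq, _, hqf⟩ := exists_frequently_eq (P := fun _ => True) (h.run_lt hc hw)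
        (Filter.Eventually.frequently (Filter.Eventually.of_forall fun _ => trivial))
      obtain ⟨d1, e1⟩ := P.live_of_return h ha hw (i0 := i0)
        (fun i hi => by rw [hra, hra]; exact hi0 i hi) hpf
      obtain ⟨d2, e2⟩ := P.live_of_return h hc hw (i0 := i0)
        (fun i hi => by rw [hrc, hrc]; exact hi0 i hi) hqf
      have := hcrit p hp q hq d1 d2 (by rw [e1, e2, hra, hrc]) hFp
      exact hqf.mono fun i hi => by rw [hi]; exact this
    exact ⟨key s s' hs hs' (fun _ => rfl) fun i => (hρ i).symm,
      key s' s hs' hs (fun i => (hρ i).symm) fun _ => rfl⟩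

end Criterion


/-! ## Deciding the equivalence of two states of a weak automaton -/

notation "vres" => (29 : Fin 40)
notation "aSeen" => (14 : Fin 20)

section Program

variable {I : Input} {N K : ℕ} {δ : ℕ → ℕ → ℕ} {s s' : ℕ}

/-- The block of the value of `e`. -/
def blockOf (e : Exp) : Exp :=
  .add (.mul (.const 2) (.read aI (.read aCls e))) (.read aF e)

def tableTarget : Exp := .read aT (.add (.mul (.var vq) (.var vK)) (.var vx))

/-- Mark the blocks of the nodes that were not peeled off, and look for a component with two
marked blocks. -/
def compareBlocks : Prog :=
  .seq (.for vq (.add (.mul (.const 4) (.var vN)) (.const 2)) (.write aSeen (.var vq) (.const 0))) <|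
  .seq (countEdges (.var vN) (.const 1) aSeen (blockOf (.var vq)) (.read aDeg (.var vq))) <|
  .seq (.write aOrd (.const 0) (.const 0)) <|
  .seq (countEdges (.var vN) (.const 1) aOrd (.const 0)
    (.mul (.read aSeen (.mul (.const 2) (.read aI (.read aCls (.var vq)))))
      (.read aSeen (.add (.mul (.const 2) (.read aI (.read aCls (.var vq)))) (.const 1))))) <|
  .assign vres (.eq (.read aOrd (.const 0)) (.const 0))

-- Block numbers are twice the component number plus the acceptance bit; components are numbered
-- below 2N + 1, whence the length 4N + 2 of `aSeen`. A component is bad iff both of its blocks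
-- contain survivors. The list of peeled nodes is no longer needed, so position 0 of `aOrd` serves
-- as the counter of bad components.
open Classical in
theorem wp_compareBlocks {ρ : ℕ → ℕ} {σ : Mem} (hN : σ.var vN = N) (h0 : 0 < σ.len aOrd)
    (hl : 4 * N + 2 ≤ σ.len aSeen) (hF : ∀ q < N, σ.rd aF q ≤ 1)
    (hC : ∀ q < N, σ.rd aCls q = ρ q) (hI : ∀ q < N, σ.rd aI (ρ q) < 2 * N + 1) :
    wp I compareBlocks (fun τ t => τ.var vres = (if ∀ p < N, ∀ q < N,
      σ.rd aDeg p ≠ 0 → σ.rd aDeg q ≠ 0 → σ.rd aI (ρ p) = σ.rd aI (ρ q) →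
      σ.rd aF p = 1 → σ.rd aF q = 1 then 1 else 0) ∧ t ≤ 250 * N + 90) σ := by
  rw [compareBlocks, wp_seq]
  refine (wp_fill (H := 4 * N + 2) (g := fun _ => 0) (fun τ f => by simp [f.var vN, hN])
    (fun _ _ _ _ _ _ _ => rfl) hl).mono ?_
  rintro σ1 t1 ⟨f1, h1, _, ht1⟩
  rw [wp_seq]
  refine (wp_countEdges (N := N) (K := 1)
    (G := fun q _ => 2 * σ.rd aI (ρ q) + σ.rd aF q) (A := fun q _ => σ.rd aDeg q ≠ 0)
    (fun τ f => by simp [f.var vN, f1.var vN, hN]) (fun _ _ => rfl) (fun τ f hq _ => by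
      simp [blockOf, hC _ hq, f.rd aI, f1.rd aI, f.rd aCls, f1.rd aCls, f.rd aF, f1.rd aF])
    (fun τ f _ _ => by simp [f.rd aDeg, f1.rd aDeg]) fun q hq _ _ _ => ?_).mono ?_
  · have := hI q hq
    have := hF q hq
    rw [f1.len]
    omega
  rintro σ2 t2 ⟨f2, h2, ht2⟩
  simp only [wp_seq, wp_write, evals]
  have f : ∀ τ, Frame [vq, vx] [aOrd] (σ2.wr aOrd 0 0) τ →
      Frame [vq, vx] [aSeen, aOrd] σ τ := fun τ f =>
    (((f1.trans f2).weaken (ys := [vq, vx]) (bs := [aSeen, aOrd])).wr (a := aOrd) (i := 0)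
      (v := 0)).trans (f.weaken (by simp))
  refine (wp_countEdges (N := N) (K := 1) (G := fun _ _ => 0) (A := fun q _ =>
    σ2.rd aSeen (2 * σ.rd aI (ρ q)) * σ2.rd aSeen (2 * σ.rd aI (ρ q) + 1) ≠ 0)
    (fun τ s => by simp [(f τ s).var vN, hN]) (fun _ _ => rfl) (fun _ _ _ _ => rfl)
    (fun τ s hq _ => ?_) fun q hq _ _ _ => by simpa [f1.len, f2.len] using h0).mono ?_
  · simp [hC _ hq, (f τ s).rd aI, (f τ s).rd aCls, s.rd aSeen, or_iff_not_imp_left]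
  rintro σ3 t3 ⟨f3, h3, ht3⟩
  have hS : ∀ r < 4 * N + 2, σ2.rd aSeen r ≠ 0 ↔
      ∃ q < N, σ.rd aDeg q ≠ 0 ∧ 2 * σ.rd aI (ρ q) + σ.rd aF q = r := fun r hr => by
    rw [h2, h1 r hr, zero_add, ne_eq, inDegree_eq_zero]
    simp
  rw [wp_assign]
  refine ⟨?_, ?_⟩
  · simp only [evals, steps, h3]
    rw [rd_wr_self _ _ (by rwa [f2.len, f1.len]), update_self, zero_add]
    refine if_congr (inDegree_eq_zero.trans ⟨fun h p hp q hq d1 d2 e e1 => ?_, fun h r hr _ _ hne _ _ => ?_⟩) rfl rfl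
    · by_contra e2
      have := hI q hq
      have := hF q hq
      exact h q hq 0 one_pos (mul_ne_zero ((hS _ (by omega)).2 ⟨q, hq, d2, by omega⟩)
        ((hS _ (by omega)).2 ⟨p, hp, d1, by omega⟩)) rfl (Set.mem_univ _)
    · obtain ⟨a1, a2⟩ := mul_ne_zero_iff.1 hne
      have := hI r hr
      obtain ⟨q, hq, d2, e2⟩ := (hS _ (by omega)).1 a1
      obtain ⟨p, hp, d1, e1⟩ := (hS _ (by omega)).1 a2
      have := hF p hp
      have := hF q hq
      have := h p hp q hq d1 d2 (by omega) (by omega)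
      omega
  · simp only [cost, blockOf] at ht1 ht2 ht3 ⊢
    omega

/-- Decide whether the states `vS` and `vS'` of the weak automaton in memory are equivalent. -/
def solve : Prog :=
  .seq hkClosure <| .seq hkFlatten <| .seq sccAll <|
  .seq (peel tableTarget (.eq (blockOf (.var vq)) (blockOf tableTarget))) compareBlocks

/-- The variables and arrays that `solve` uses. -/
theorem Frame.of_solve {σ τ : Mem} (h : Frame solve.mv solve.ma σ τ) :
    Frame [vq, vx, vu, vw, vr, vr', vtop, vh, vs, vm, vt, vc, vroot, vv, ve, vb, vo, vp, vres]
      [aPar, aRk, aA, aB, aCls, aI, aS, aBd, aTs, aPtr, aDeg, aOrd, aSeen] σ τ := by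
  refine h.weaken ?_ ?_ <;>
  · simp only [solve, hkClosure, hkInit, hkProcess, hkFlatten, sccAll, sccStep, sccRootStep,
      sccEdgeStep, sccPopStep, sccComplete, sccPush, peel, peelCount, countEdges, peelStart, compareBlocks,
      findRoot, unite, Cmd.mv, Cmd.ma, Cmd.mv_for, Cmd.ma_for]
    decide

theorem createFree_solve : solve.createFree := by
  simp [solve, hkClosure, hkInit, hkProcess, hkFlatten, sccAll, sccStep, sccRootStep, sccEdgeStep,
    sccPopStep, sccComplete, sccPush, peel, peelCount, countEdges, peelStart, compareBlocks]

theorem wp_solve {σ : Mem} (hT : HasTable N K δ σ) (hF : ∀ q < N, σ.rd aF q ≤ 1)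
    (hW : WeakTable N K δ (fun q => σ.rd aF q = 1)) (hl : 4 * N + 2 ≤ σ.len aSeen)
    (hs : σ.var vS = s) (hs' : σ.var vS' = s') (hsN : s < N) (hsN' : s' < N) :
    wp I solve (fun τ t =>
      (SameLanguage K δ (fun q => σ.rd aF q = 1) s s' → τ.var vres = 1) ∧
      (¬ SameLanguage K δ (fun q => σ.rd aF q = 1) s s' → τ.var vres = 0) ∧
      t ≤ 2000 * (N * (K + 1) * (Nat.log 2 N + 1)) + 2000 * (Nat.log 2 N + 1)) σ := by
  obtain ⟨c1, c2, c3, c4, c5⟩ := createFree_solve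
  rw [solve, wp_seq]
  refine (wp_hkClosure hT hs hs' hsN hsN').frame c1 ?_
  rintro σ1 t1 f1 ⟨hT1, ⟨ρ, hk, hg⟩, ht1⟩
  rw [wp_seq]
  refine (wp_hkFlatten hT1 hk).frame c2 ?_
  rintro σ2 t2 f2 ⟨hc, ht2⟩
  have hT2 := hT1.of_same f2 (by simp [hkFlatten]) (by simp [hkFlatten]) (by simp [hkFlatten])
  rw [wp_seq]
  refine (wp_sccAll hT2 hc hg.lt).frame c3 ?_
  rintro σ3 t3 f3 ⟨hI, ht3⟩
  have hT3 := hT2.of_same f3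
    (by simp [sccAll, sccStep, sccRootStep, sccEdgeStep, sccPopStep, sccComplete, sccPush])
    (by simp [sccAll, sccStep, sccRootStep, sccEdgeStep, sccPopStep, sccComplete, sccPush])
    (by simp [sccAll, sccStep, sccRootStep, sccEdgeStep, sccPopStep, sccComplete, sccPush])
  have hC3 : ∀ q < N, σ3.rd aCls q = ρ q := by
    rw [f3.rd _ (by simp [sccAll, sccStep, sccRootStep, sccEdgeStep, sccPopStep, sccComplete,
      sccPush])]
    exact hc
  have hF3 : σ3.rd aF = σ.rd aF := by
    rw [f3.rd _ (by simp [sccAll, sccStep, sccRootStep, sccEdgeStep, sccPopStep, sccComplete,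
      sccPush]), f2.rd _ (by simp [hkFlatten]), f1.rd _ (by simp [hkClosure, hkInit, hkProcess])]
  have hl3 : 4 * N + 2 ≤ σ3.len aSeen := by rw [f3.len, f2.len, f1.len]; exact hl
  set A := BlockEdge δ (fun q => σ.rd aF q = 1) ρ (σ3.rd aI) with hA
  have hEE : EdgeExprs I N K δ A tableTarget (.eq (blockOf (.var vq)) (blockOf tableTarget)) σ3 := by
    refine ⟨hT3.var_N, hT3.var_K, hT3.len _, hT3.len _, fun q hq x hx _ => hT3.lt q hq x hx, ?_, ?_⟩
    · intro τ f hq hx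
      simp only [evals, tableTarget, f.rd aT, f.var vK, hT3.var_K]
      exact hT3.table _ hq _ hx
    · intro τ f hq hx
      have hlt := hT3.lt _ hq _ hx
      simp only [evals, blockOf, tableTarget, f.rd aT, f.rd aI, f.rd aCls, f.rd aF, f.var vK, hT3.var_K, hT3.table _ hq _ hx, hC3 _ hq, hC3 _ hlt, hF3, hA, BlockEdge]
      have e1 := hF _ hq
      have e2 := hF _ hlt
      simp only [ite_eq_right_iff, one_ne_zero, imp_false]
      refine not_congr ⟨fun e => ⟨by omega, by omega⟩, fun ⟨e, e'⟩ => by omega⟩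
  rw [wp_seq]
  refine (wp_peel hEE).mono ?_
  rintro σ4 t4 ⟨f4, P, ht4⟩
  have hI4 : σ4.rd aI = σ3.rd aI := f4.rd _
  have hC4 : ∀ q < N, σ4.rd aCls q = ρ q := by rw [f4.rd _]; exact hC3
  have hF4 : σ4.rd aF = σ.rd aF := by rw [f4.rd _]; exact hF3
  refine (wp_compareBlocks (N := N) (by rw [f4.var _]; exact hT3.var_N)
    (by rw [f4.len]; have := hT3.len aOrd; omega) (by rw [f4.len]; exact hl3) (by rw [hF4]; exact hF)
    hC4 (fun q hq => by rw [hI4]; exact hI.lt _ (hg.lt q hq))).mono ?_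
  rintro σ5 t5 ⟨h5, ht5⟩
  rw [hI4, hF4] at h5
  have hiff := hW.sameLanguage_iff hsN hsN' hg hI P
  refine ⟨fun h => by rw [h5, if_pos (hiff.1 h)], fun h => by rw [h5, if_neg (mt hiff.2 h)], ?_⟩
  simp only [tableTarget, blockOf, cost] at ht4
  set L := Nat.log 2 N
  have b1 : 130 * N * (K + 1) * (L + 1) = 130 * (N * (K + 1) * (L + 1)) := by ring
  have b2 : 40 * N * (L + 1) ≤ 40 * (N * (K + 1) * (L + 1)) := by
    have : N * 1 * (L + 1) ≤ N * (K + 1) * (L + 1) := by gcongr; omega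
    nlinarith
  have b3 : N * (K + 1) ≤ N * (K + 1) * (L + 1) := Nat.le_mul_of_pos_right _ (by omega)
  have b4 : 100 * N * (K + 5) = 100 * (N * (K + 1)) + 400 * N := by ring
  have b5 : N ≤ N * (K + 1) := Nat.le_mul_of_pos_right _ (by omega)
  rw [b1] at ht1
  rw [b4] at ht3
  omega

end Program


/-! ## Saturation of a language of encodings -/

/-! ### Distinct expansions of one real number -/

section OfDigits

variable {b : ℕ}

theorem Real.ofDigits_cons (f : ℕ → Fin b) (n : ℕ) :
    (b : ℝ) * Real.ofDigits (fun i => f (i + n)) = f n + Real.ofDigits (fun i => f (i + (n + 1))) := by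
  have hb : (b : ℝ) ≠ 0 := by
    have := Fin.pos (f 0)
    positivity
  rw [Real.ofDigits_eq_sum_add_ofDigits _ 1]
  simp only [Finset.sum_range_one, Real.ofDigitsTerm, zero_add, pow_one]
  rw [mul_add, mul_comm ((f n : ℕ) : ℝ), mul_inv_cancel_left₀ hb, mul_inv_cancel_left₀ hb]
  congr 2
  funext i
  ring_nf

/-- Two sequences of digits that agree up to a position where the digit of the second one is
larger by one, and that continue with digits `b - 1` and with digits `0`. -/
structure CarryAt (p : ℕ) (f g : ℕ → Fin b) : Prop where
  before : ∀ j < p, f j = g j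
  at_pos : (f p).val + 1 = (g p).val
  max : ∀ j, p < j → (f j).val = b - 1
  zero : ∀ j, p < j → (g j).val = 0

theorem Real.ofDigits_tail_eq {f g : ℕ → Fin b} (h : Real.ofDigits f = Real.ofDigits g) {p : ℕ}
    (hp : ∀ j < p, f j = g j) :
    Real.ofDigits (fun i => f (i + p)) = Real.ofDigits (fun i => g (i + p)) := by
  induction p with
  | zero => simpa using h
  | succ p ih =>
    have := ih fun j hj => hp j (by omega)
    have e1 := Real.ofDigits_cons f p
    have e2 := Real.ofDigits_cons g p
    rw [this, hp p (by omega)] at e1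
    linarith

theorem Real.ofDigits_eq_of_tail {f g : ℕ → Fin b} {p : ℕ} (hp : ∀ j < p, f j = g j)
    (h : Real.ofDigits (fun i => f (i + p)) = Real.ofDigits (fun i => g (i + p))) :
    Real.ofDigits f = Real.ofDigits g := by
  induction p with
  | zero => simpa using h
  | succ p ih =>
    refine ih (fun j hj => hp j (by omega)) ?_
    have hb : (b : ℝ) ≠ 0 := by
      have := Fin.pos (f 0)
      positivity
    have e1 := Real.ofDigits_cons f p
    have e2 := Real.ofDigits_cons g p
    rw [h, hp p (by omega)] at e1
    exact mul_left_cancel₀ hb (e1.trans e2.symm)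

/-- No expansion exceeds 1, and b = f n + (rest) with f n ≤ b - 1 forces equality in both places;
the rest is again 1. -/
theorem Real.digits_eq_of_ofDigits_eq_one {f : ℕ → Fin b} {n : ℕ}
    (h : Real.ofDigits (fun i => f (i + n)) = 1) : ∀ j, n ≤ j → (f j).val = b - 1 := by
  have key : ∀ j, n ≤ j → Real.ofDigits (fun i => f (i + j)) = 1 → (f j).val = b - 1 ∧
      Real.ofDigits (fun i => f (i + (j + 1))) = 1 := by
    intro j _ h
    have e := Real.ofDigits_cons f j
    rw [h] at e
    have h1 := Real.ofDigits_le_one (fun i => f (i + (j + 1)))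
    have h2 : (f j).val ≤ b - 1 := by omega
    have h3 : 0 < b := Fin.pos (f 0)
    have h4 : ((f j).val : ℝ) ≤ (b : ℝ) - 1 := by
      have : ((f j).val : ℝ) ≤ ((b - 1 : ℕ) : ℝ) := by exact_mod_cast h2
      rwa [Nat.cast_sub h3, Nat.cast_one] at this
    have h5 : Real.ofDigits (fun i => f (i + (j + 1))) = 1 := by linarith
    refine ⟨?_, h5⟩
    have : ((f j).val : ℝ) = ((b - 1 : ℕ) : ℝ) := by
      rw [Nat.cast_sub h3, Nat.cast_one]; linarith
    exact_mod_cast this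
  have all : ∀ j, n ≤ j → Real.ofDigits (fun i => f (i + j)) = 1 := by
    intro j hj
    induction j, hj using Nat.le_induction with
    | base => exact h
    | succ j hj ih => exact (key j hj ih).2
  exact fun j hj => (key j hj (all j hj)).1

theorem Real.digits_eq_of_ofDigits_eq_zero {f : ℕ → Fin b} {n : ℕ}
    (h : Real.ofDigits (fun i => f (i + n)) = 0) : ∀ j, n ≤ j → (f j).val = 0 := by
  have key : ∀ j, n ≤ j → Real.ofDigits (fun i => f (i + j)) = 0 → (f j).val = 0 ∧
      Real.ofDigits (fun i => f (i + (j + 1))) = 0 := by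
    intro j _ h
    have e := Real.ofDigits_cons f j
    rw [h, mul_zero] at e
    have h1 := Real.ofDigits_nonneg (fun i => f (i + (j + 1)))
    have h2 : (0 : ℝ) ≤ (f j).val := by positivity
    have : ((f j).val : ℝ) = 0 := by linarith
    exact ⟨by exact_mod_cast this, by linarith⟩
  have all : ∀ j, n ≤ j → Real.ofDigits (fun i => f (i + j)) = 0 := by
    intro j hj
    induction j, hj using Nat.le_induction with
    | base => exact h
    | succ j hj ih => exact (key j hj ih).2
  exact fun j hj => (key j hj (all j hj)).1

theorem CarryAt.ofDigits_eq (hb : 2 ≤ b) {f g : ℕ → Fin b} {p : ℕ} (h : CarryAt p f g) :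
    Real.ofDigits f = Real.ofDigits g := by
  refine Real.ofDigits_eq_of_tail h.before ?_
  have e1 := Real.ofDigits_cons f p
  have e2 := Real.ofDigits_cons g p
  have f1 : Real.ofDigits (fun i => f (i + (p + 1))) = 1 := by
    rw [← Real.ofDigits_const_last_eq_one' (show 1 < b by omega)]
    congr 1
    funext i
    exact Fin.ext (h.max _ (by omega))
  have g1 : Real.ofDigits (fun i => g (i + (p + 1))) = 0 := by
    have gz : ∀ i, (g (i + (p + 1))).val = 0 := fun i => h.zero _ (by omega)
    simp [Real.ofDigits, Real.ofDigitsTerm, gz]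
  have hg : ((g p).val : ℝ) = (f p).val + 1 := by rw [← h.at_pos]; push_cast; ring
  rw [f1] at e1
  rw [g1, add_zero, hg] at e2
  exact mul_left_cancel₀ (show (b : ℝ) ≠ 0 by positivity) (e1.trans e2.symm)

/-- At the first difference the digits differ by at least 1, whereas the two tails lie between 0 and
1. So the digits differ by exactly 1, and the tails have the values 1 and 0. -/
theorem Real.exists_carryAt {f g : ℕ → Fin b} (h : Real.ofDigits f = Real.ofDigits g) (hne : f ≠ g) :
    ∃ p, CarryAt p f g ∨ CarryAt p g f := by
  classical
  have hex : ∃ p, f p ≠ g p := ne_iff.1 hne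
  have hp := Nat.find_spec hex
  have hlt : ∀ j < Nat.find hex, f j = g j := fun j hj => not_not.1 (Nat.find_min hex hj)
  set p := Nat.find hex
  have main : ∀ f g : ℕ → Fin b, Real.ofDigits f = Real.ofDigits g → (∀ j < p, f j = g j) →
      (f p).val < (g p).val → CarryAt p f g := by
    intro f g h hlt hp
    have e0 := Real.ofDigits_tail_eq h hlt
    have e1 := Real.ofDigits_cons f p
    have e2 := Real.ofDigits_cons g p
    rw [e0, e2] at e1
    have f1 := Real.ofDigits_le_one (fun i => f (i + (p + 1)))
    have g1 := Real.ofDigits_nonneg (fun i => g (i + (p + 1)))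
    have hle : ((f p).val : ℝ) + 1 ≤ (g p).val := by exact_mod_cast hp
    have hf : Real.ofDigits (fun i => f (i + (p + 1))) = 1 := by linarith
    have hg : Real.ofDigits (fun i => g (i + (p + 1))) = 0 := by linarith
    refine ⟨hlt, ?_, Real.digits_eq_of_ofDigits_eq_one hf, Real.digits_eq_of_ofDigits_eq_zero hg⟩
    have : ((f p).val : ℝ) + 1 = (g p).val := by linarith
    exact_mod_cast this
  rcases lt_or_gt_of_ne (fun e => hp (Fin.ext e)) with h1 | h1
  · exact ⟨p, Or.inl (main f g h hlt h1)⟩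
  · exact ⟨p, Or.inr (main g f h.symm (fun j hj => (hlt j hj).symm) h1)⟩

/-- The number written by a finite word followed by an infinite one. -/
theorem natValue_add_ofDigits (e : ℕ → Fin b) (m : ℕ) :
    (natValue ((List.range m).map e) : ℝ) + Real.ofDigits (fun k => e (k + m)) =
      (b : ℝ) ^ m * Real.ofDigits e := by
  induction m with
  | zero => simp [natValue]
  | succ m ih =>
    have e1 := Real.ofDigits_cons e m
    have e2 : natValue ((List.range (m + 1)).map e) = (e m).val + b * natValue ((List.range m).map e) := by
      simp [natValue, List.range_succ, Nat.ofDigits_cons]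
    rw [e2, pow_succ, mul_comm _ (b : ℝ), mul_assoc, ← ih]
    push_cast
    linarith

end OfDigits

/-! ### Encodings as digit sequences with one dot -/

section Encodings

variable {b d : ℕ}

/-- The word with the sign `e 0`, `m` digits before the dot, and the digits `e 1, e 2, …`. -/
def wordOf (m : ℕ) (e : ℕ → Fin d → Fin b) : ℕ → Letter b d := fun j =>
  if j ≤ m then some (e j) else if j = m + 1 then none else some (e (j - 1))

/-- The position of the `k`-th digit. -/
def digitPos (m k : ℕ) : ℕ := if k ≤ m then k else k + 1

theorem wordOf_digitPos (m : ℕ) (e : ℕ → Fin d → Fin b) (k : ℕ) :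
    wordOf m e (digitPos m k) = some (e k) := by
  unfold wordOf digitPos
  by_cases h : k ≤ m
  · simp [h]
  · simp [h, show ¬ k + 1 ≤ m by omega, show k ≠ m by omega]

theorem wordOf_dot (m : ℕ) (e : ℕ → Fin d → Fin b) : wordOf m e (m + 1) = none := by
  simp [wordOf]

theorem wordOf_eq_none {m : ℕ} {e : ℕ → Fin d → Fin b} {j : ℕ} :
    wordOf m e j = none ↔ j = m + 1 := by
  unfold wordOf
  split_ifs with h1 h2
  · simp; omega
  · simp [h2]
  · simp [h2]

theorem exists_digitPos {m j : ℕ} (h : j ≠ m + 1) : ∃ k, digitPos m k = j := by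
  unfold digitPos
  by_cases hj : j ≤ m
  · exact ⟨j, by simp [hj]⟩
  · exact ⟨j - 1, by rw [if_neg (by omega)]; omega⟩

theorem digitPos_lt {m k l : ℕ} : digitPos m k < digitPos m l ↔ k < l := by
  unfold digitPos; split_ifs <;> omega

theorem digitPos_eq_zero {m k : ℕ} : digitPos m k = 0 ↔ k = 0 := by
  unfold digitPos
  by_cases h : k ≤ m
  · rw [if_pos h]
  · rw [if_neg h]; omega

theorem exists_wordOf {w : ℕ → Letter b d} {m : ℕ} (h : ∀ j, w j = none ↔ j = m + 1) :
    ∃ e, w = wordOf m e := by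
  have hs : ∀ k, ∃ x, w (digitPos m k) = some x := fun k => by
    rw [← Option.ne_none_iff_exists']
    rw [ne_eq, h]
    unfold digitPos; split_ifs <;> omega
  choose e he using hs
  refine ⟨e, funext fun j => ?_⟩
  by_cases hj : j = m + 1
  · rw [hj, wordOf_dot, h]
  · obtain ⟨k, rfl⟩ := exists_digitPos hj
    rw [he, wordOf_digitPos]

/-- The digits of the component `i`, with the sign replaced by the digit `0` or `1`. -/
def signedDigits (hb : 2 ≤ b) (e : ℕ → Fin d → Fin b) (i : Fin d) : ℕ → Fin b := fun k =>
  if k = 0 then (if (e 0 i).val = 0 then ⟨1, by omega⟩ else ⟨0, by omega⟩) else e k i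

/-- Adding b^m to the value turns the sign into an ordinary leading digit: sign 0 contributes b^m
and sign b-1 contributes 0. The exceptional step from the sign b-1 to the sign 0 becomes the
ordinary carry from the digit 0 to the digit 1. -/
theorem encodes_iff (hb : 2 ≤ b) {w : ℕ → Letter b d} {r : Fin d → ℝ} :
    Encodes w r ↔ ∃ m e, (∀ i, IsSignDigit (e 0 i)) ∧ w = wordOf m e ∧
      ∀ i, r i = (b : ℝ) ^ m * (b * Real.ofDigits (signedDigits hb e i) - 1) := by
  have value : ∀ (m : ℕ) (e : ℕ → Fin d → Fin b) (i : Fin d),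
      complementValue (e 0 i) (((List.range m).map fun k => e (k + 1)).map fun x => x i)
        (fun j => e (j + (m + 1)) i) =
      (b : ℝ) ^ m * (b * Real.ofDigits (signedDigits hb e i) - 1) := by
    intro m e i
    have e1 := Real.ofDigits_cons (signedDigits hb e i) 0
    have e2 := natValue_add_ofDigits (fun k => e (k + 1) i) m
    have e3 : (fun i_1 => signedDigits hb e i (i_1 + (0 + 1))) = fun k => e (k + 1) i := by
      funext k; simp [signedDigits]
    rw [e3] at e1
    simp only [add_zero] at e1
    have e4 : ((List.range m).map fun k => e (k + 1)).map (fun x => x i) =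
      (List.range m).map fun k => e (k + 1) i := by simp
    have e5 : (fun j => e (j + (m + 1)) i) = fun k => e (k + m + 1) i := by
      funext k; rw [add_assoc]
    rw [complementValue, e4, e5, add_assoc, e2, e1]
    simp only [signedDigits, if_true, List.length_map, List.length_range]
    split_ifs
    · simp
    · simp; ring
  constructor
  · rintro ⟨a, v, u, ha, rfl, hr⟩
    let e : ℕ → Fin d → Fin b := fun k => if k = 0 then a else
      if h : k - 1 < v.length then v[k - 1] else u (k - 1 - v.length)
    refine ⟨v.length, e, ha, ?_, fun i => ?_⟩
    · funext j
      simp only [concatWord, wordOf, e]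
      rcases Nat.lt_trichotomy j (v.length + 1) with h | h | h
      · rcases j with _ | j
        · simp
        · simp only [show j + 1 ≤ v.length by omega, if_true]
          have hj : j < v.length := by omega
          simp [hj, List.getElem_append, Nat.lt_succ_of_lt hj]
          intro h'
          omega
      · subst h
        simp
      · obtain ⟨k, rfl⟩ := Nat.exists_eq_add_of_lt h
        rw [if_neg (by omega), if_neg (by omega), dif_neg (by simp; omega), if_neg (by omega),
          dif_neg (by omega)]
        congr 2
        simp
    · rw [← value, hr i]
      congr 1
      · congr 1
        refine List.ext_getElem (by simp) fun k h1 h2 => ?_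
        have h1' : k < v.length := by simpa using h1
        simp [e, h1']
      · funext j
        simp [e, show ¬ j + v.length < v.length by omega]
  · rintro ⟨m, e, hs, rfl, hr⟩
    refine ⟨e 0, (List.range m).map fun k => e (k + 1), fun j => e (j + (m + 1)), hs, ?_,
      fun i => by rw [hr i, value]⟩
    funext j
    simp only [concatWord, wordOf]
    rcases Nat.lt_trichotomy j (m + 1) with h | h | h
    · rcases j with _ | j
      · simp
      · have : j < m := by omega
        simp [this, show j + 1 ≤ m by omega, List.getElem_append]
        intro h'
        omega
    · subst h
      simp
    · obtain ⟨k, rfl⟩ := Nat.exists_eq_add_of_lt h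
      rw [if_neg (by omega), if_neg (by omega), dif_neg (by simp; omega)]
      congr 2
      simp; omega

end Encodings


/-! ### Saturation by carries in one component and repeated signs -/

section Saturation

variable {b d : ℕ}

/-- The word has the form `a v ⋆ u`. -/
def IsEncoding (w : ℕ → Letter b d) : Prop :=
  ∃ m e, (∀ i, IsSignDigit (e 0 i)) ∧ w = wordOf m e

/-- The two letters are vectors of digits that agree, except in the component `i`, where the
digits are related by `R`. -/
def DifferAt (i : Fin d) (R : ℕ → ℕ → Prop) (l l' : Letter b d) : Prop :=
  ∃ x y, l = some x ∧ l' = some y ∧ (∀ i', i' ≠ i → x i' = y i') ∧ R (x i) (y i)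

/-- The two words agree before the position `p` and in all components but `i`. In the component
`i` the digit at the position `p` is larger by one in the second word (or it is the sign and
changes from `b - 1` to `0`), and the digits after it are `b - 1` in the first word, and `0` in the
second one. -/
structure Carry (i : Fin d) (p : ℕ) (u v : ℕ → Letter b d) : Prop where
  before : ∀ j < p, u j = v j
  at_pos : DifferAt i (fun x y => if p = 0 then x = b - 1 ∧ y = 0 else x + 1 = y) (u p) (v p)
  after : ∀ j, p < j → (u j = none ∧ v j = none) ∨
    DifferAt i (fun x y => x = b - 1 ∧ y = 0) (u j) (v j)

theorem Carry.none_iff {i : Fin d} {p : ℕ} {u v : ℕ → Letter b d} (h : Carry i p u v) (j : ℕ) :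
    u j = none ↔ v j = none := by
  rcases Nat.lt_trichotomy j p with hj | rfl | hj
  · rw [h.before j hj]
  · obtain ⟨x, y, h1, h2, _⟩ := h.at_pos
    simp [h1, h2]
  · rcases h.after j hj with ⟨h1, h2⟩ | ⟨x, y, h1, h2, _⟩ <;> simp [h1, h2]

theorem differAt_some {i : Fin d} {R : ℕ → ℕ → Prop} {x y : Fin d → Fin b} :
    DifferAt i R (some x) (some y) ↔ (∀ i', i' ≠ i → x i' = y i') ∧ R (x i) (y i) := by
  constructor
  · rintro ⟨x', y', h1, h2, h⟩
    obtain rfl := Option.some_inj.1 h1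
    obtain rfl := Option.some_inj.1 h2
    exact h
  · exact fun h => ⟨x, y, rfl, rfl, h⟩

theorem Carry.of_wordOf {i : Fin d} {m k : ℕ} {e e' : ℕ → Fin d → Fin b}
    (h : Carry i (digitPos m k) (wordOf m e) (wordOf m e')) :
    (∀ l < k, e l = e' l) ∧ (∀ l i', i' ≠ i → e l i' = e' l i') ∧
    (if k = 0 then (e k i).val = b - 1 ∧ (e' k i).val = 0 else (e k i).val + 1 = (e' k i).val) ∧
    ∀ l, k < l → (e l i).val = b - 1 ∧ (e' l i).val = 0 := by
  have h1 : ∀ l < k, e l = e' l := fun l hl => by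
    have := h.before _ (digitPos_lt.2 hl)
    rwa [wordOf_digitPos, wordOf_digitPos, Option.some_inj] at this
  have h2 := h.at_pos
  rw [wordOf_digitPos, wordOf_digitPos, differAt_some] at h2
  simp only [digitPos_eq_zero] at h2
  have h3 : ∀ l, k < l → (∀ i', i' ≠ i → e l i' = e' l i') ∧ (e l i).val = b - 1 ∧
      (e' l i).val = 0 := fun l hl => by
    have := h.after _ (digitPos_lt.2 hl)
    rw [wordOf_digitPos, wordOf_digitPos, differAt_some] at this
    simpa using this
  refine ⟨h1, fun l i' hi' => ?_, h2.2, fun l hl => (h3 l hl).2⟩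
  rcases Nat.lt_trichotomy l k with hl | rfl | hl
  · rw [h1 l hl]
  · exact h2.1 i' hi'
  · exact (h3 l hl).1 i' hi'

theorem signedDigits_zero (hb : 2 ≤ b) (e : ℕ → Fin d → Fin b) (i : Fin d) :
    (signedDigits hb e i 0).val = if (e 0 i).val = 0 then 1 else 0 := by
  simp only [signedDigits, if_true]
  split_ifs <;> rfl

theorem signedDigits_of_ne (hb : 2 ≤ b) (e : ℕ → Fin d → Fin b) (i : Fin d) {k : ℕ} (hk : k ≠ 0) :
    signedDigits hb e i k = e k i := by simp [signedDigits, hk]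

theorem Carry.carryAt (hb : 2 ≤ b) {i : Fin d} {m k : ℕ} {e e' : ℕ → Fin d → Fin b}
    (h : Carry i (digitPos m k) (wordOf m e) (wordOf m e')) :
    CarryAt k (signedDigits hb e i) (signedDigits hb e' i) := by
  obtain ⟨h1, h2, h3, h4⟩ := h.of_wordOf
  refine ⟨fun l hl => ?_, ?_, fun l hl => ?_, fun l hl => ?_⟩
  · by_cases h0 : l = 0
    · subst h0; simp [signedDigits, h1 0 hl]
    · rw [signedDigits_of_ne _ _ _ h0, signedDigits_of_ne _ _ _ h0, h1 l hl]
  · by_cases h0 : k = 0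
    · subst h0
      rw [if_pos rfl] at h3
      rw [signedDigits_zero, signedDigits_zero, if_neg (by omega), if_pos h3.2]
    · rw [if_neg h0] at h3
      rw [signedDigits_of_ne _ _ _ h0, signedDigits_of_ne _ _ _ h0, h3]
  · rw [signedDigits_of_ne _ _ _ (by omega)]; exact (h4 l hl).1
  · rw [signedDigits_of_ne _ _ _ (by omega)]; exact (h4 l hl).2

theorem signedDigits_injective (hb : 2 ≤ b) {e e' : ℕ → Fin d → Fin b} {i : Fin d}
    (hs : IsSignDigit (e 0 i)) (hs' : IsSignDigit (e' 0 i)) {k : ℕ}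
    (h : signedDigits hb e i k = signedDigits hb e' i k) : e k i = e' k i := by
  by_cases h0 : k = 0
  · subst h0
    have h := congrArg Fin.val h
    rw [signedDigits_zero, signedDigits_zero] at h
    apply Fin.ext
    unfold IsSignDigit at hs hs'
    split_ifs at h <;> omega
  · rwa [signedDigits_of_ne _ _ _ h0, signedDigits_of_ne _ _ _ h0] at h

theorem CarryAt.carry (hb : 2 ≤ b) {i : Fin d} {m k : ℕ} {e e' : ℕ → Fin d → Fin b}
    (hs : IsSignDigit (e 0 i)) (hs' : IsSignDigit (e' 0 i))
    (h : CarryAt k (signedDigits hb e i) (signedDigits hb e' i))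
    (hne : ∀ l i', i' ≠ i → e l i' = e' l i') :
    Carry i (digitPos m k) (wordOf m e) (wordOf m e') := by
  have hbefore : ∀ l < k, e l = e' l := fun l hl => by
    funext i'
    by_cases hi : i' = i
    · subst hi; exact signedDigits_injective hb hs hs' (h.before l hl)
    · exact hne l i' hi
  refine ⟨fun j hj => ?_, ?_, fun j hj => ?_⟩
  · by_cases hjm : j = m + 1
    · rw [hjm, wordOf_dot, wordOf_dot]
    · obtain ⟨l, rfl⟩ := exists_digitPos hjm
      rw [wordOf_digitPos, wordOf_digitPos, hbefore l (digitPos_lt.1 hj)]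
  · rw [wordOf_digitPos, wordOf_digitPos, differAt_some]
    simp only [digitPos_eq_zero]
    refine ⟨hne k, ?_⟩
    have := h.at_pos
    by_cases h0 : k = 0
    · subst h0
      rw [signedDigits_zero, signedDigits_zero] at this
      unfold IsSignDigit at hs hs'
      simp only [if_true]
      split_ifs at this <;> omega
    · rw [signedDigits_of_ne _ _ _ h0, signedDigits_of_ne _ _ _ h0] at this
      rwa [if_neg h0]
  · by_cases hjm : j = m + 1
    · rw [hjm, wordOf_dot, wordOf_dot]; exact Or.inl ⟨rfl, rfl⟩
    · obtain ⟨l, rfl⟩ := exists_digitPos hjm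
      have hl := digitPos_lt.1 hj
      rw [wordOf_digitPos, wordOf_digitPos, differAt_some]
      have h1 := h.max l hl
      have h2 := h.zero l hl
      rw [signedDigits_of_ne _ _ _ (by omega)] at h1 h2
      exact Or.inr ⟨hne l, h1, h2⟩

theorem wordOf_pred (m : ℕ) (e : ℕ → Fin d → Fin b) :
    (fun j => wordOf m e (j - 1)) = wordOf (m + 1) (fun k => e (k - 1)) := by
  funext j
  unfold wordOf
  rcases Nat.lt_trichotomy j (m + 2) with h | h | h
  · rw [if_pos (by omega), if_pos (by omega)]
  · rw [if_neg (by omega), if_pos (by omega), if_neg (by omega), if_pos (by omega)]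
  · rw [if_neg (by omega), if_neg (by omega), if_neg (by omega), if_neg (by omega)]

/-- A repeated sign 0 adds a leading zero. For the sign b-1 the identity is -b^(m+1) + (b-1) b^m =
-b^m. -/
theorem value_pred (hb : 2 ≤ b) (m : ℕ) (e : ℕ → Fin d → Fin b) (i : Fin d)
    (hs : IsSignDigit (e 0 i)) :
    (b : ℝ) ^ (m + 1) * (b * Real.ofDigits (signedDigits hb (fun k => e (k - 1)) i) - 1) =
      (b : ℝ) ^ m * (b * Real.ofDigits (signedDigits hb e i) - 1) := by
  have e1 := Real.ofDigits_cons (signedDigits hb e i) 0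
  have e2 := Real.ofDigits_cons (signedDigits hb (fun k => e (k - 1)) i) 0
  have e3 := Real.ofDigits_cons (signedDigits hb (fun k => e (k - 1)) i) 1
  simp only [add_zero, zero_add] at e1 e2 e3
  have e4 : (fun j => signedDigits hb (fun k => e (k - 1)) i (j + (1 + 1))) =
      fun j => signedDigits hb e i (j + 1) := by
    funext j
    rw [signedDigits_of_ne _ _ _ (by omega), signedDigits_of_ne _ _ _ (by omega)]
    rfl
  have e5 : (signedDigits hb (fun k => e (k - 1)) i 0) = signedDigits hb e i 0 := by
    simp [signedDigits]
  have e6 : signedDigits hb (fun k => e (k - 1)) i 1 = e 0 i := by simp [signedDigits]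
  have e7 : (b : ℝ) * ((signedDigits hb e i 0).val : ℝ) + ((e 0 i).val : ℝ) - b =
      (signedDigits hb e i 0).val - 1 := by
    rw [signedDigits_zero]
    rcases hs with h | h
    · simp [h]
    · rw [if_neg (by omega), h, Nat.cast_sub (by omega)]
      simp
  rw [e4, e6] at e3
  rw [e2, e1, e5, pow_succ]
  calc _ = (b : ℝ) ^ m * (b * ((signedDigits hb e i 0).val : ℝ) +
        b * (Real.ofDigits fun j => signedDigits hb (fun k => e (k - 1)) i (j + 1)) - b) := by ring
    _ = _ := by rw [e3]; congr 1; linarith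

/-- The condition of saturation, for changes of one component and of the number of sign digits. -/
structure LocallySaturated (L : Set (ℕ → Letter b d)) : Prop where
  encoding : ∀ w ∈ L, IsEncoding w
  sign : ∀ w : ℕ → Letter b d, (∃ x, w 0 = some x ∧ ∀ i, IsSignDigit (x i)) →
    (w ∈ L ↔ (fun j => w (j - 1)) ∈ L)
  carry : ∀ i p u v, Carry i p u v → (u ∈ L ↔ v ∈ L)

/-- It suffices that one of the words is an encoding: the dots are at the same places, and at
position 0 a carry exchanges two sign digits. -/
theorem Carry.encodes (hb : 2 ≤ b) {i : Fin d} {p : ℕ} {u v : ℕ → Letter b d} (h : Carry i p u v)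
    (hu : IsEncoding u ∨ IsEncoding v) : ∃ r, Encodes u r ∧ Encodes v r := by
  have hform : ∃ m e e', u = wordOf m e ∧ v = wordOf m e' ∧
      ((∀ i, IsSignDigit (e 0 i)) ∨ ∀ i, IsSignDigit (e' 0 i)) := by
    rcases hu with ⟨m, e, hs, rfl⟩ | ⟨m, e, hs, rfl⟩
    · obtain ⟨e', he'⟩ := exists_wordOf (w := v) (m := m) fun j => by
        rw [← h.none_iff, wordOf_eq_none]
      exact ⟨m, e, e', rfl, he', Or.inl hs⟩
    · obtain ⟨e', he'⟩ := exists_wordOf (w := u) (m := m) fun j => by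
        rw [h.none_iff, wordOf_eq_none]
      exact ⟨m, e', e, he', rfl, Or.inr hs⟩
  obtain ⟨m, e, e', rfl, rfl, hs⟩ := hform
  have hp : p ≠ m + 1 := by
    rintro rfl
    obtain ⟨x, y, hx, _⟩ := h.at_pos
    rw [wordOf_dot] at hx
    simp at hx
  obtain ⟨k, rfl⟩ := exists_digitPos hp
  obtain ⟨h1, h2, h3, h4⟩ := h.of_wordOf
  have hsign : (∀ i, IsSignDigit (e 0 i)) ∧ ∀ i, IsSignDigit (e' 0 i) := by
    have : ∀ i, IsSignDigit (e 0 i) ↔ IsSignDigit (e' 0 i) := by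
      intro i'
      by_cases hi : i' = i
      · subst hi
        by_cases h0 : k = 0
        · subst h0
          rw [if_pos rfl] at h3
          exact ⟨fun _ => Or.inl h3.2, fun _ => Or.inr h3.1⟩
        · rw [h1 0 (by omega)]
      · rw [h2 0 i' hi]
    rcases hs with hs | hs
    · exact ⟨hs, fun i => (this i).1 (hs i)⟩
    · exact ⟨fun i => (this i).2 (hs i), hs⟩
  refine ⟨fun i => (b : ℝ) ^ m * (b * Real.ofDigits (signedDigits hb e i) - 1),
    (encodes_iff hb).2 ⟨m, e, hsign.1, rfl, fun _ => rfl⟩,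
    (encodes_iff hb).2 ⟨m, e', hsign.2, rfl, fun i' => ?_⟩⟩
  by_cases hi : i' = i
  · subst hi
    rw [(h.carryAt hb).ofDigits_eq hb]
  · congr 4
    funext l
    simp only [signedDigits, h2 _ i' hi]

theorem SaturatedLanguage.locallySaturated (hb : 2 ≤ b) {L : Set (ℕ → Letter b d)}
    (h : SaturatedLanguage L) : LocallySaturated L := by
  have h1 : ∀ w ∈ L, IsEncoding w := fun w hw => by
    obtain ⟨r, hr⟩ := h.1 w hw
    obtain ⟨m, e, hs, he, _⟩ := (encodes_iff hb).1 hr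
    exact ⟨m, e, hs, he⟩
  refine ⟨h1, ?_, ?_⟩
  · rintro w ⟨x, hx, hxs⟩
    have key : ∀ m e, (∀ i, IsSignDigit (e 0 i)) → w = wordOf m e →
        (w ∈ L ↔ (fun j => w (j - 1)) ∈ L) := by
      rintro m e hs rfl
      have r1 := (encodes_iff hb).2 ⟨m, e, hs, rfl, fun _ => rfl⟩
      have r2 : Encodes (fun j => wordOf m e (j - 1)) _ := (encodes_iff hb).2
        ⟨m + 1, fun k => e (k - 1), hs, wordOf_pred m e, fun i => (value_pred hb m e i (hs i)).symm⟩
      exact ⟨h.2 _ _ _ r1 r2, h.2 _ _ _ r2 r1⟩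
    by_cases hw : w ∈ L
    · obtain ⟨m, e, hs, he⟩ := h1 w hw
      exact key m e hs he
    -- Here only the longer word is known to be an encoding. Its second letter is `w 0`, a vector of
    -- digits, so the dot does not come right after the sign and deleting the first letter leaves an
    -- encoding.
    · refine ⟨fun hw' => absurd hw' hw, fun hw' => ?_⟩
      obtain ⟨m, e, hs, he⟩ := h1 _ hw'
      have hm : ∀ j, w j = wordOf m e (j + 1) := fun j => by
        rw [← he]; rfl
      rcases m with _ | m
      · have := hm 0
        rw [hx, wordOf_dot] at this
        simp at this
      · have hw2 : w = wordOf m (fun k => e (k + 1)) := by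
          funext j
          rw [hm]
          unfold wordOf
          rcases Nat.lt_trichotomy j (m + 1) with h | h | h
          · rw [if_pos (by omega), if_pos (by omega)]
          · rw [if_neg (by omega), if_pos (by omega), if_neg (by omega), if_pos (by omega)]
          · rw [if_neg (by omega), if_neg (by omega), if_neg (by omega), if_neg (by omega)]
            change some (e (j + 1 - 1)) = some (e (j - 1 + 1))
            rw [show j + 1 - 1 = j - 1 + 1 by omega]
        refine (key m _ (fun i => ?_) hw2).2 hw'
        have : some x = some (e 1) := by rw [← hx, hm]; simp [wordOf]
        rw [zero_add, ← Option.some_inj.1 this]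
        exact hxs i
  · intro i p u v hc
    constructor
    · intro hu
      obtain ⟨r, hr, hr'⟩ := hc.encodes hb (Or.inl (h1 u hu))
      exact h.2 r _ _ hr hr' hu
    · intro hv
      obtain ⟨r, hr, hr'⟩ := hc.encodes hb (Or.inr (h1 v hv))
      exact h.2 r _ _ hr' hr hv

/-- Two expansions of one number are equal or differ by one carry, in one of the two directions. -/
theorem LocallySaturated.of_differ_one (hb : 2 ≤ b) {L : Set (ℕ → Letter b d)}
    (h : LocallySaturated L) (m : ℕ) {e e' : ℕ → Fin d → Fin b} (i : Fin d)
    (hs : IsSignDigit (e 0 i)) (hs' : IsSignDigit (e' 0 i))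
    (hne : ∀ l i', i' ≠ i → e l i' = e' l i')
    (hv : Real.ofDigits (signedDigits hb e i) = Real.ofDigits (signedDigits hb e' i)) :
    wordOf m e ∈ L ↔ wordOf m e' ∈ L := by
  by_cases heq : signedDigits hb e i = signedDigits hb e' i
  · have : e = e' := by
      funext l i'
      by_cases hi : i' = i
      · subst hi; exact signedDigits_injective hb hs hs' (congrFun heq l)
      · exact hne l i' hi
    rw [this]
  · obtain ⟨p, hp | hp⟩ := Real.exists_carryAt hv heq
    · exact h.carry i _ _ _ (hp.carry hb hs hs' hne)
    · exact (h.carry i _ _ _ (hp.carry hb hs' hs fun l i' hi => (hne l i' hi).symm)).symm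

/-- The components in which the words may differ are changed one at a time; the intermediate words
are encodings of the same vector. -/
theorem LocallySaturated.of_same_length (hb : 2 ≤ b) {L : Set (ℕ → Letter b d)}
    (h : LocallySaturated L) (m : ℕ) (S : Finset (Fin d)) :
    ∀ e e' : ℕ → Fin d → Fin b, (∀ i, IsSignDigit (e 0 i)) → (∀ i, IsSignDigit (e' 0 i)) →
    (∀ l i, i ∉ S → e l i = e' l i) →
    (∀ i, Real.ofDigits (signedDigits hb e i) = Real.ofDigits (signedDigits hb e' i)) →
    (wordOf m e ∈ L ↔ wordOf m e' ∈ L) := by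
  induction S using Finset.induction_on with
  | empty =>
    intro e e' _ _ hne _
    have : e = e' := by funext l i; exact hne l i (by simp)
    rw [this]
  | insert i S _ ih =>
    intro e e' hs hs' hne hv
    let e₁ : ℕ → Fin d → Fin b := fun l => update (e l) i (e' l i)
    have h1 : ∀ l, e₁ l i = e' l i := fun l => by simp [e₁]
    have h2 : ∀ l i', i' ≠ i → e₁ l i' = e l i' := fun l i' hi => by simp [e₁, hi]
    have hd1 : signedDigits hb e₁ i = signedDigits hb e' i := by
      funext k; simp only [signedDigits, h1]
    have hd2 : ∀ i', i' ≠ i → signedDigits hb e₁ i' = signedDigits hb e i' := fun i' hi => by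
      funext k; simp only [signedDigits, h2 _ i' hi]
    have hs1 : ∀ i', IsSignDigit (e₁ 0 i') := fun i' => by
      by_cases hi : i' = i
      · rw [hi, h1]; exact hs' i
      · rw [h2 _ _ hi]; exact hs i'
    refine (h.of_differ_one hb m i (hs i) (hs1 i) (fun l i' hi => (h2 l i' hi).symm)
      (by rw [hd1, hv])).trans (ih e₁ e' hs1 hs' (fun l i' hi => ?_) fun i' => ?_)
    · by_cases hi' : i' = i
      · rw [hi', h1]
      · rw [h2 _ _ hi']; exact hne l i' (by simp [hi, hi'])
    · by_cases hi' : i' = i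
      · rw [hi', hd1]
      · rw [hd2 _ hi', hv]

/-- Repeat the sign to increase the number of digits before the dot. -/
theorem LocallySaturated.exists_longer (hb : 2 ≤ b) {L : Set (ℕ → Letter b d)}
    (h : LocallySaturated L) {m : ℕ} {e : ℕ → Fin d → Fin b} (hs : ∀ i, IsSignDigit (e 0 i)) (n : ℕ) :
    ∃ e' : ℕ → Fin d → Fin b, (∀ i, IsSignDigit (e' 0 i)) ∧
      (wordOf m e ∈ L ↔ wordOf (m + n) e' ∈ L) ∧
      ∀ i, (b : ℝ) ^ (m + n) * (b * Real.ofDigits (signedDigits hb e' i) - 1) =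
        (b : ℝ) ^ m * (b * Real.ofDigits (signedDigits hb e i) - 1) := by
  induction n with
  | zero => exact ⟨e, hs, Iff.rfl, fun _ => rfl⟩
  | succ n ih =>
    obtain ⟨e', hs', hL, hv⟩ := ih
    refine ⟨fun k => e' (k - 1), hs', hL.trans ?_, fun i => ?_⟩
    · rw [← add_assoc, ← wordOf_pred]
      exact h.sign _ ⟨e' 0, by simp [wordOf], hs'⟩
    · rw [← add_assoc, value_pred hb _ _ _ (hs' i), hv]

/-- For two encodings with m and m' digits before the dot, the signs are repeated m' and m times.
Both then have m + m' digits, and equal values give equal expansions in each component. -/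
theorem saturatedLanguage_iff (hb : 2 ≤ b) {L : Set (ℕ → Letter b d)} :
    SaturatedLanguage L ↔ LocallySaturated L := by
  refine ⟨fun h => h.locallySaturated hb, fun h => ⟨fun w hw => ?_, fun r w w' hw hw' hL => ?_⟩⟩
  · obtain ⟨m, e, hs, rfl⟩ := h.encoding w hw
    exact ⟨_, (encodes_iff hb).2 ⟨m, e, hs, rfl, fun _ => rfl⟩⟩
  · obtain ⟨m, e, hs, rfl, hr⟩ := (encodes_iff hb).1 hw
    obtain ⟨m', e', hs', rfl, hr'⟩ := (encodes_iff hb).1 hw'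
    obtain ⟨f, hf, hfL, hfv⟩ := h.exists_longer hb hs m'
    obtain ⟨f', hf', hfL', hfv'⟩ := h.exists_longer hb hs' m
    rw [add_comm m' m] at hfL' hfv'
    rw [hfL', ← h.of_same_length hb (m + m') Finset.univ f f' hf hf' (by simp) fun i => ?_, ← hfL]
    · exact hL
    · have hb0 : (b : ℝ) ≠ 0 := by positivity
      have e1 := (hfv i).trans ((hr i).symm.trans ((hr' i).trans (hfv' i).symm))
      have e2 := mul_left_cancel₀ (pow_ne_zero _ hb0) e1
      exact mul_left_cancel₀ hb0 (by linarith)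

end Saturation


/-! ## Automata that compare the acceptance of related words -/

/-! ### Automata composed of layers -/

section Layers

variable {n : ℕ} {δ t : ℕ → ℕ → ℕ} {F F' : ℕ → Prop}

theorem omegaRun_shift {c q j : ℕ} {W W' : ℕ → ℕ} (ht : ∀ q x, t q x < n)
    (h : ∀ i < j, ∀ q < n, δ (c + q) (W i) = c + t q (W' i)) (hq : q < n) :
    omegaRun δ (c + q) W j = c + omegaRun t q W' j ∧ omegaRun t q W' j < n := by
  induction j with
  | zero => exact ⟨rfl, hq⟩
  | succ j ih =>
    obtain ⟨h1, h2⟩ := ih fun i hi => h i (by omega)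
    exact ⟨by rw [omegaRun, h1, h j (by omega) _ h2]; rfl, ht _ _⟩

theorem omegaAcc_of_forall {A B Q R : Type*} {δ : Q → A → Q} {δ' : R → B → R} {F : Q → Prop}
    {F' : R → Prop} {q : Q} {q' : R} {w : ℕ → A} {w' : ℕ → B}
    (h : ∀ i, F (omegaRun δ q w i) ↔ F' (omegaRun δ' q' w' i)) :
    OmegaAcc δ F q w ↔ OmegaAcc δ' F' q' w' := by
  unfold OmegaAcc
  simp only [h]

theorem omegaAcc_shift {c q : ℕ} {W W' : ℕ → ℕ} (ht : ∀ q x, t q x < n)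
    (h : ∀ i, ∀ q < n, δ (c + q) (W i) = c + t q (W' i)) (hF : ∀ q < n, F' (c + q) ↔ F q)
    (hq : q < n) : OmegaAcc δ F' (c + q) W ↔ OmegaAcc t F q W' :=
  omegaAcc_of_forall fun i => by
    obtain ⟨h1, h2⟩ := omegaRun_shift (j := i) ht (fun i _ => h i) hq
    rw [h1, hF _ h2]

theorem not_omegaAcc_of_forall {A Q : Type*} {δ : Q → A → Q} {F : Q → Prop} {q : Q} {w : ℕ → A}
    (k : ℕ) (h : ∀ i, k ≤ i → ¬ F (omegaRun δ q w i)) : ¬ OmegaAcc δ F q w := by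
  intro ha
  obtain ⟨i, hi, hF⟩ := Filter.frequently_atTop.1 ha k
  exact h i hi hF

theorem not_omegaAcc_of_sink {A Q : Type*} {δ : Q → A → Q} {F : Q → Prop} {q s : Q} {w : ℕ → A}
    (hs : ∀ x, δ s x = s) (hF : ¬ F s) {k : ℕ} (hk : omegaRun δ q w k = s) :
    ¬ OmegaAcc δ F q w := by
  refine not_omegaAcc_of_forall k fun i hi => ?_
  have : omegaRun δ q w i = s := by
    induction i, hi using Nat.le_induction with
    | base => exact hk
    | succ i _ ih => rw [omegaRun, ih, hs]
  rwa [this]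

/-- An automaton made of layers, of which the accepting ones project to a weak automaton. -/
theorem WeakTable.of_layers {N K K' : ℕ} (hW : WeakTable n K' t F) (lay π : ℕ → ℕ)
    (good : ℕ → Prop) (lt : ∀ q < N, ∀ x < K, δ q x < N)
    (hF : ∀ q < N, F' q ↔ good (lay q) ∧ F (π q))
    (hlay : ∀ q < N, ∀ x < K, lay q ≤ lay (δ q x)) (hπ : ∀ q < N, good (lay q) → π q < n)
    (hstep : ∀ q < N, ∀ x < K, good (lay q) → lay (δ q x) = lay q →
      ∃ y < K', t (π q) y = π (δ q x)) : WeakTable N K δ F' := by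
  have mono : ∀ p q, p < N → Reach K δ p q → q < N ∧ lay p ≤ lay q := by
    intro p q hp h
    induction h with
    | refl => exact ⟨hp, le_rfl⟩
    | tail _ h ih =>
      obtain ⟨x, hx, rfl⟩ := h
      exact ⟨lt _ ih.1 _ hx, ih.2.trans (hlay _ ih.1 _ hx)⟩
  have proj : ∀ p q, p < N → good (lay p) → Reach K δ p q → lay q = lay p →
      Reach K' t (π p) (π q) := by
    intro p q hp hg h
    induction h with
    | refl => intro _; exact Relation.ReflTransGen.refl
    | @tail r _ h h' ih =>
      intro he
      obtain ⟨x, hx, rfl⟩ := h'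
      have h1 := mono p r hp h
      have h2 := hlay r h1.1 x hx
      have h3 : lay r = lay p := by omega
      obtain ⟨y, hy, e⟩ := hstep r h1.1 x hx (h3 ▸ hg) (by omega)
      exact (ih h3).tail ⟨y, hy, e.symm⟩
  refine ⟨lt, fun p hp q hq h1 h2 => ?_⟩
  -- Layers never decrease along transitions, so a cycle stays in one layer; in an accepting layer
  -- it projects to a cycle of the given weak automaton.
  have he : lay p = lay q := le_antisymm (mono p q hp h1).2 (mono q p hq h2).2
  rw [hF p hp, hF q hq, he]
  refine and_congr_right fun hg => ?_
  have hg' : good (lay p) := he ▸ hg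
  exact hW.weak _ (hπ p hp hg') _ (hπ q hq hg) (proj p q hp hg' h1 he.symm)
    (proj q p hq hg h2 he)

end Layers

/-! ### The automaton that tests carries in one component -/

section CarryTable

variable (n D b pw : ℕ) (t : ℕ → ℕ → ℕ) (s0 : ℕ)

/-- The digit of the letter `x` in the component with the weight `pw`. -/
def digitOf (x : ℕ) : ℕ := x / pw % b

/-- The letter `x` with the digit `b - 1`. -/
def maxLetter (x : ℕ) : ℕ := if x < D then x + (b - 1 - digitOf b pw x) * pw else x

/-- The letter `x` with the digit `0`. -/
def zeroLetter (x : ℕ) : ℕ := if x < D then x - digitOf b pw x * pw else x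

/-- The letter of a flagged letter: `y ≤ D` is the letter `y` without a flag, and `D + 1 + x` is
the letter `x` with a flag. -/
def unflag (y : ℕ) : ℕ := if y < D + 1 then y else y - (D + 1)

/-- An automaton with two initial states `4 n` and `4 n + 1`. The flag marks the position of
a carry; from the first initial state the automaton reads the first word of the carry, and from
the second one the second word. -/
def carryTable (q y : ℕ) : ℕ :=
  if q < n then
    if y < D + 1 then t q y else
    if unflag D y < D then
      if digitOf b pw (unflag D y) + 1 < b then 2 * n + t q (unflag D y) else 4 * n + 2
    else 4 * n + 2
  else if q < 2 * n then
    if y < D + 1 then n + t (q - n) y else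
    if unflag D y < D then
      if digitOf b pw (unflag D y) + 1 < b then 3 * n + t (q - n) (unflag D y + pw) else 4 * n + 2
    else 4 * n + 2
  else if q < 3 * n then 2 * n + t (q - 2 * n) (maxLetter D b pw (unflag D y))
  else if q < 4 * n then 3 * n + t (q - 3 * n) (zeroLetter D b pw (unflag D y))
  else if q = 4 * n then
    if y < D + 1 then t s0 y else
    if unflag D y < D then
      if digitOf b pw (unflag D y) + 1 = b then 2 * n + t s0 (unflag D y) else 4 * n + 2
    else 4 * n + 2
  else if q = 4 * n + 1 then
    if y < D + 1 then n + t s0 y else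
    if unflag D y < D then
      if digitOf b pw (unflag D y) + 1 = b then 3 * n + t s0 (zeroLetter D b pw (unflag D y))
      else 4 * n + 2
    else 4 * n + 2
  else 4 * n + 2

/-- The accepting states of `carryTable`. -/
def carryAcc (F : ℕ → Prop) (q : ℕ) : Prop :=
  (2 * n ≤ q ∧ q < 3 * n ∧ F (q - 2 * n)) ∨ (3 * n ≤ q ∧ q < 4 * n ∧ F (q - 3 * n))

/-- A carry with the weight `pw` is possible at the position `p` with the letter `x`. -/
def CanCarry (p x : ℕ) : Prop :=
  x < D ∧ if p = 0 then digitOf b pw x + 1 = b else digitOf b pw x + 1 < b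

/-- The first word of a carry at the position `p`. -/
def carryMax (p : ℕ) (X : ℕ → ℕ) (j : ℕ) : ℕ := if j ≤ p then X j else maxLetter D b pw (X j)

/-- The second word of a carry at the position `p`. -/
def carryZero (p : ℕ) (X : ℕ → ℕ) (j : ℕ) : ℕ :=
  if j < p then X j else if j = p then (if p = 0 then zeroLetter D b pw (X j) else X j + pw)
  else zeroLetter D b pw (X j)

variable {n D b pw t s0} {F : ℕ → Prop}

theorem carryTable_max {q y : ℕ} (hq : q < n) : carryTable n D b pw t s0 (2 * n + q) y =
    2 * n + t q (maxLetter D b pw (unflag D y)) := by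
  unfold carryTable
  rw [if_neg (by omega), if_neg (by omega), if_pos (by omega), Nat.add_sub_cancel_left]

theorem carryTable_zero {q y : ℕ} (hq : q < n) : carryTable n D b pw t s0 (3 * n + q) y =
    3 * n + t q (zeroLetter D b pw (unflag D y)) := by
  unfold carryTable
  rw [if_neg (by omega), if_neg (by omega), if_neg (by omega), if_pos (by omega),
    Nat.add_sub_cancel_left]

theorem carryTable_sink {y : ℕ} : carryTable n D b pw t s0 (4 * n + 2) y = 4 * n + 2 := by
  unfold carryTable
  rw [if_neg (by omega), if_neg (by omega), if_neg (by omega), if_neg (by omega),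
    if_neg (by omega), if_neg (by omega)]

theorem carryTable_first {y : ℕ} : carryTable n D b pw t s0 (4 * n) y =
    if y < D + 1 then t s0 y else
    if unflag D y < D then
      if digitOf b pw (unflag D y) + 1 = b then 2 * n + t s0 (unflag D y) else 4 * n + 2
    else 4 * n + 2 := by
  unfold carryTable
  rw [if_neg (by omega), if_neg (by omega), if_neg (by omega), if_neg (by omega), if_pos rfl]

theorem carryTable_second {y : ℕ} : carryTable n D b pw t s0 (4 * n + 1) y =
    if y < D + 1 then n + t s0 y else
    if unflag D y < D then
      if digitOf b pw (unflag D y) + 1 = b then 3 * n + t s0 (zeroLetter D b pw (unflag D y))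
      else 4 * n + 2
    else 4 * n + 2 := by
  unfold carryTable
  rw [if_neg (by omega), if_neg (by omega), if_neg (by omega), if_neg (by omega),
    if_neg (by omega), if_pos rfl]

theorem carryTable_preFirst {q y : ℕ} (hq : q < n) : carryTable n D b pw t s0 q y =
    if y < D + 1 then t q y else
    if unflag D y < D then
      if digitOf b pw (unflag D y) + 1 < b then 2 * n + t q (unflag D y) else 4 * n + 2
    else 4 * n + 2 := by
  unfold carryTable
  rw [if_pos hq]

theorem carryTable_preSecond {q y : ℕ} (hq : q < n) : carryTable n D b pw t s0 (n + q) y =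
    if y < D + 1 then n + t q y else
    if unflag D y < D then
      if digitOf b pw (unflag D y) + 1 < b then 3 * n + t q (unflag D y + pw) else 4 * n + 2
    else 4 * n + 2 := by
  unfold carryTable
  rw [if_neg (by omega), if_pos (by omega), Nat.add_sub_cancel_left]

theorem unflag_lt {y : ℕ} (hy : y < 2 * (D + 1)) : unflag D y < D + 1 := by
  unfold unflag; split_ifs <;> omega

/-- The order of the layers of the checking automata. -/
def layerRank (n : ℕ) (r0 r1 r2 r3 : ℕ) (q : ℕ) : ℕ :=
  if q < n then r0 else if q < 2 * n then r1 else if q < 3 * n then r2 else if q < 4 * n then r3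
  else if q < 4 * n + 2 then 0 else 9

section LayerRank

variable {r0 r1 r2 r3 r : ℕ}

theorem layerRank_zero (h : r < n) : layerRank n r0 r1 r2 r3 r = r0 := by
  unfold layerRank; rw [if_pos h]

theorem layerRank_one (h : r < n) : layerRank n r0 r1 r2 r3 (n + r) = r1 := by
  unfold layerRank; rw [if_neg (by omega), if_pos (by omega)]

theorem layerRank_two (h : r < n) : layerRank n r0 r1 r2 r3 (2 * n + r) = r2 := by
  unfold layerRank; rw [if_neg (by omega), if_neg (by omega), if_pos (by omega)]

theorem layerRank_three (h : r < n) : layerRank n r0 r1 r2 r3 (3 * n + r) = r3 := by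
  unfold layerRank
  rw [if_neg (by omega), if_neg (by omega), if_neg (by omega), if_pos (by omega)]

theorem layerRank_first : layerRank n r0 r1 r2 r3 (4 * n) = 0 := by
  unfold layerRank
  rw [if_neg (by omega), if_neg (by omega), if_neg (by omega), if_neg (by omega),
    if_pos (by omega)]

theorem layerRank_second : layerRank n r0 r1 r2 r3 (4 * n + 1) = 0 := by
  unfold layerRank
  rw [if_neg (by omega), if_neg (by omega), if_neg (by omega), if_neg (by omega),
    if_pos (by omega)]

theorem layerRank_sink : layerRank n r0 r1 r2 r3 (4 * n + 2) = 9 := by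
  unfold layerRank
  rw [if_neg (by omega), if_neg (by omega), if_neg (by omega), if_neg (by omega),
    if_neg (by omega)]

end LayerRank

theorem layer_cases {q : ℕ} (hq : q < 4 * n + 3) : (q < n) ∨ (∃ r < n, q = n + r) ∨
    (∃ r < n, q = 2 * n + r) ∨ (∃ r < n, q = 3 * n + r) ∨ q = 4 * n ∨ q = 4 * n + 1 ∨
    q = 4 * n + 2 := by
  by_cases h1 : q < n
  · exact Or.inl h1
  by_cases h2 : q < 2 * n
  · exact Or.inr (Or.inl ⟨q - n, by omega, by omega⟩)
  by_cases h3 : q < 3 * n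
  · exact Or.inr (Or.inr (Or.inl ⟨q - 2 * n, by omega, by omega⟩))
  by_cases h4 : q < 4 * n
  · exact Or.inr (Or.inr (Or.inr (Or.inl ⟨q - 3 * n, by omega, by omega⟩)))
  · omega

theorem zeroLetter_lt {x : ℕ} (hx : x < D + 1) : zeroLetter D b pw x < D + 1 := by
  unfold zeroLetter; split_ifs <;> omega

theorem carryAcc_max {q : ℕ} (hq : q < n) : carryAcc n F (2 * n + q) ↔ F q := by
  unfold carryAcc
  rw [Nat.add_sub_cancel_left]
  constructor
  · rintro (h | h)
    · exact h.2.2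
    · omega
  · exact fun h => Or.inl ⟨by omega, by omega, h⟩

theorem carryAcc_zero {q : ℕ} (hq : q < n) : carryAcc n F (3 * n + q) ↔ F q := by
  unfold carryAcc
  rw [Nat.add_sub_cancel_left]
  constructor
  · rintro (h | h)
    · omega
    · exact h.2.2
  · exact fun h => Or.inr ⟨by omega, by omega, h⟩

theorem carryTable_lt (ht : ∀ q x, t q x < n) {q : ℕ} (hq : q < 4 * n + 3) (y : ℕ) :
    carryTable n D b pw t s0 q y < 4 * n + 3 := by
  rcases layer_cases hq with h' | ⟨r, hr, rfl⟩ | ⟨r, hr, rfl⟩ | ⟨r, hr, rfl⟩ | rfl | rfl | rfl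
  · rw [carryTable_preFirst h']
    have := ht q y; have := ht q (unflag D y)
    split_ifs <;> omega
  · rw [carryTable_preSecond hr]
    have := ht r y; have := ht r (unflag D y + pw)
    split_ifs <;> omega
  · rw [carryTable_max hr]
    have := ht r (maxLetter D b pw (unflag D y))
    omega
  · rw [carryTable_zero hr]
    have := ht r (zeroLetter D b pw (unflag D y))
    omega
  · rw [carryTable_first]
    have := ht s0 y; have := ht s0 (unflag D y)
    split_ifs <;> omega
  · rw [carryTable_second]
    have := ht s0 y; have := ht s0 (zeroLetter D b pw (unflag D y))
    split_ifs <;> omega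
  · rw [carryTable_sink]; omega

theorem carryTable_rank (ht : ∀ q x, t q x < n) {q : ℕ} (hq : q < 4 * n + 3) (y : ℕ) :
    layerRank n 1 1 2 3 q ≤ layerRank n 1 1 2 3 (carryTable n D b pw t s0 q y) := by
  rcases layer_cases hq with h' | ⟨r, hr, rfl⟩ | ⟨r, hr, rfl⟩ | ⟨r, hr, rfl⟩ | rfl | rfl | rfl
  · rw [carryTable_preFirst h', layerRank_zero h']
    split_ifs
    · rw [layerRank_zero (ht _ _)]
    · rw [layerRank_two (ht _ _)]; omega
    all_goals rw [layerRank_sink]; omega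
  · rw [carryTable_preSecond hr, layerRank_one hr]
    split_ifs
    · rw [layerRank_one (ht _ _)]
    · rw [layerRank_three (ht _ _)]; omega
    all_goals rw [layerRank_sink]; omega
  · rw [carryTable_max hr, layerRank_two hr, layerRank_two (ht _ _)]
  · rw [carryTable_zero hr, layerRank_three hr, layerRank_three (ht _ _)]
  · rw [layerRank_first]; omega
  · rw [layerRank_second]; omega
  · rw [carryTable_sink]

/-- The layers beginning at 0 and n simulate the input before the flag, for the first and the second
word, and are rejecting. Those beginning at 2n and 3n simulate it after the flag, with digits
replaced by b-1 and by 0, and inherit its acceptance. -/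
theorem carryTable_weak (hW : WeakTable n (D + 1) t F) (ht : ∀ q x, t q x < n)
    (hmax : ∀ x < D + 1, maxLetter D b pw x < D + 1) :
    WeakTable (4 * n + 3) (2 * (D + 1)) (carryTable n D b pw t s0) (carryAcc n F) := by
  refine hW.of_layers (layerRank n 1 1 2 3)
    (fun q => if q < 3 * n then q - 2 * n else q - 3 * n) (fun l => l = 2 ∨ l = 3)
    (fun q hq y _ => carryTable_lt ht hq y) ?_ (fun q hq y _ => carryTable_rank ht hq y) ?_ ?_
  · intro q hq
    rcases layer_cases hq with h' | ⟨r, hr, rfl⟩ | ⟨r, hr, rfl⟩ | ⟨r, hr, rfl⟩ | rfl | rfl | rfl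
    · rw [layerRank_zero h']; unfold carryAcc; omega
    · rw [layerRank_one hr]; unfold carryAcc; omega
    · rw [layerRank_two hr, carryAcc_max hr, if_pos (by omega), Nat.add_sub_cancel_left]; simp
    · rw [layerRank_three hr, carryAcc_zero hr, if_neg (by omega), Nat.add_sub_cancel_left]; simp
    · rw [layerRank_first]; unfold carryAcc; omega
    · rw [layerRank_second]; unfold carryAcc; omega
    · rw [layerRank_sink]; unfold carryAcc; omega
  · intro q hq h
    rcases layer_cases hq with h' | ⟨r, hr, rfl⟩ | ⟨r, hr, rfl⟩ | ⟨r, hr, rfl⟩ | rfl | rfl | rfl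
    · rw [layerRank_zero h'] at h; omega
    · rw [layerRank_one hr] at h; omega
    · rw [if_pos (by omega)]; omega
    · rw [if_neg (by omega)]; omega
    · rw [layerRank_first] at h; omega
    · rw [layerRank_second] at h; omega
    · rw [layerRank_sink] at h; omega
  · intro q hq y hy h _
    have hy' := unflag_lt hy
    rcases layer_cases hq with h' | ⟨r, hr, rfl⟩ | ⟨r, hr, rfl⟩ | ⟨r, hr, rfl⟩ | rfl | rfl | rfl
    · rw [layerRank_zero h'] at h; omega
    · rw [layerRank_one hr] at h; omega
    · refine ⟨_, hmax _ hy', ?_⟩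
      have := ht r (maxLetter D b pw (unflag D y))
      rw [carryTable_max hr, if_pos (by omega), if_pos (by omega), Nat.add_sub_cancel_left,
        Nat.add_sub_cancel_left]
    · refine ⟨zeroLetter D b pw (unflag D y), zeroLetter_lt hy', ?_⟩
      have := ht r (zeroLetter D b pw (unflag D y))
      rw [carryTable_zero hr, if_neg (by omega), if_neg (by omega), Nat.add_sub_cancel_left,
        Nat.add_sub_cancel_left]
    · rw [layerRank_first] at h; omega
    · rw [layerRank_second] at h; omega
    · rw [layerRank_sink] at h; omega

/-- The run before the flag. -/
theorem carryTable_run {c s p : ℕ} {W : ℕ → ℕ} (ht : ∀ q x, t q x < n)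
    (hs : ∀ y < D + 1, carryTable n D b pw t s0 s y = c + t s0 y)
    (hc : ∀ q < n, ∀ y < D + 1, carryTable n D b pw t s0 (c + q) y = c + t q y)
    (hp : ∀ j < p, W j < D + 1) (hp0 : p ≠ 0) :
    omegaRun (carryTable n D b pw t s0) s W p = c + omegaRun t s0 W p ∧ omegaRun t s0 W p < n := by
  obtain ⟨p, rfl⟩ := Nat.exists_eq_succ_of_ne_zero hp0
  rw [Nat.succ_eq_add_one, add_comm, omegaRun_add, omegaRun_add]
  have : omegaRun (carryTable n D b pw t s0) s W 1 = c + omegaRun t s0 W 1 := hs _ (hp 0 (by omega))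
  rw [this]
  exact omegaRun_shift ht (fun i hi q hq => hc q hq _ (hp _ (by omega))) (ht _ _)

/-- Only the first flag has a meaning; afterwards `unflag` ignores flags. At position 0 the run is
still in the initial state 4n, which tests for a sign b-1 instead of a digit that can be increased.
-/
theorem carryTable_first_iff {p : ℕ} {W : ℕ → ℕ} (ht : ∀ q x, t q x < n)
    (hp : ∀ j < p, W j < D + 1) (hp' : ¬ W p < D + 1) :
    OmegaAcc (carryTable n D b pw t s0) (carryAcc n F) (4 * n) W ↔
      CanCarry D b pw p (unflag D (W p)) ∧
        OmegaAcc t F s0 (carryMax D b pw p fun j => unflag D (W j)) := by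
  set δ := carryTable n D b pw t s0 with hδ
  set U := carryMax D b pw p fun j => unflag D (W j) with hU
  have hUW : ∀ j < p, W j = U j := fun j hj => by
    simp only [hU, carryMax, if_pos hj.le, unflag, if_pos (hp j hj)]
  have hUp : U p = unflag D (W p) := by simp [hU, carryMax]
  have hstep : omegaRun δ (4 * n) W (p + 1) =
      if unflag D (W p) < D then
        if (if p = 0 then digitOf b pw (unflag D (W p)) + 1 = b
          else digitOf b pw (unflag D (W p)) + 1 < b) then 2 * n + omegaRun t s0 U (p + 1)
        else 4 * n + 2
      else 4 * n + 2 := by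
    by_cases h0 : p = 0
    · subst h0
      simp only [omegaRun, zero_add, hδ, if_true]
      rw [carryTable_first, if_neg hp', hUp]
    · obtain ⟨h1, h2⟩ := carryTable_run (c := 0) (s := 4 * n) (b := b) (pw := pw) (s0 := s0) ht
        (fun y hy => by rw [carryTable_first, if_pos hy, zero_add])
        (fun q hq y hy => by rw [zero_add, zero_add, carryTable_preFirst hq, if_pos hy]) hp h0
      rw [omegaRun, hδ, h1, zero_add, carryTable_preFirst h2, if_neg hp']
      simp only [if_neg h0, omegaRun, hUp, omegaRun_congr hUW]
  by_cases hC : CanCarry D b pw p (unflag D (W p))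
  · rw [if_pos hC.1, if_pos hC.2] at hstep
    rw [omegaAcc_tail δ _ _ _ (p + 1), omegaAcc_tail t _ _ _ (p + 1), hstep]
    simp only [hC, true_and]
    refine omegaAcc_shift ht (fun i q hq => ?_) (fun q hq => carryAcc_max hq) (ht _ _)
    rw [hδ, carryTable_max hq]
    simp only [hU, carryMax, if_neg (show ¬ p + 1 + i ≤ p by omega)]
  · have : omegaRun δ (4 * n) W (p + 1) = 4 * n + 2 := by
      rw [hstep]
      unfold CanCarry at hC
      by_cases h1 : unflag D (W p) < D
      · rw [if_pos h1, if_neg fun h2 => hC ⟨h1, h2⟩]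
      · rw [if_neg h1]
    simp only [hC, false_and, iff_false]
    exact not_omegaAcc_of_sink (fun _ => carryTable_sink) (by unfold carryAcc; omega) this

theorem carryTable_second_iff {p : ℕ} {W : ℕ → ℕ} (ht : ∀ q x, t q x < n)
    (hp : ∀ j < p, W j < D + 1) (hp' : ¬ W p < D + 1) :
    OmegaAcc (carryTable n D b pw t s0) (carryAcc n F) (4 * n + 1) W ↔
      CanCarry D b pw p (unflag D (W p)) ∧
        OmegaAcc t F s0 (carryZero D b pw p fun j => unflag D (W j)) := by
  set δ := carryTable n D b pw t s0 with hδ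
  set U := carryZero D b pw p fun j => unflag D (W j) with hU
  have hUW : ∀ j < p, W j = U j := fun j hj => by
    simp only [hU, carryZero, if_pos hj, unflag, if_pos (hp j hj)]
  have hUp : U p = if p = 0 then zeroLetter D b pw (unflag D (W p)) else unflag D (W p) + pw := by
    simp [hU, carryZero]
  have hstep : omegaRun δ (4 * n + 1) W (p + 1) =
      if unflag D (W p) < D then
        if (if p = 0 then digitOf b pw (unflag D (W p)) + 1 = b
          else digitOf b pw (unflag D (W p)) + 1 < b) then 3 * n + omegaRun t s0 U (p + 1)
        else 4 * n + 2
      else 4 * n + 2 := by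
    by_cases h0 : p = 0
    · subst h0
      simp only [omegaRun, zero_add, hδ, if_true]
      rw [carryTable_second, if_neg hp', hUp, if_pos rfl]
    · obtain ⟨h1, h2⟩ := carryTable_run (c := n) (s := 4 * n + 1) (b := b) (pw := pw) (s0 := s0) ht
        (fun y hy => by rw [carryTable_second, if_pos hy])
        (fun q hq y hy => by rw [carryTable_preSecond hq, if_pos hy]) hp h0
      rw [omegaRun, hδ, h1, carryTable_preSecond h2, if_neg hp']
      simp only [if_neg h0, omegaRun, hUp, omegaRun_congr hUW]
  by_cases hC : CanCarry D b pw p (unflag D (W p))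
  · rw [if_pos hC.1, if_pos hC.2] at hstep
    rw [omegaAcc_tail δ _ _ _ (p + 1), omegaAcc_tail t _ _ _ (p + 1), hstep]
    simp only [hC, true_and]
    refine omegaAcc_shift ht (fun i q hq => ?_) (fun q hq => carryAcc_zero hq) (ht _ _)
    rw [hδ, carryTable_zero hq]
    simp only [hU, carryZero, if_neg (show ¬ p + 1 + i < p by omega),
      if_neg (show ¬ p + 1 + i = p by omega)]
  · have : omegaRun δ (4 * n + 1) W (p + 1) = 4 * n + 2 := by
      rw [hstep]
      unfold CanCarry at hC
      by_cases h1 : unflag D (W p) < D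
      · rw [if_pos h1, if_neg fun h2 => hC ⟨h1, h2⟩]
      · rw [if_neg h1]
    simp only [hC, false_and, iff_false]
    exact not_omegaAcc_of_sink (fun _ => carryTable_sink) (by unfold carryAcc; omega) this

/-- Without a flag the run never leaves the rejecting layers, so such words cannot distinguish the
two initial states. -/
theorem carryTable_not_acc {c s : ℕ} {W : ℕ → ℕ} (ht : ∀ q x, t q x < n)
    (hs : ∀ y < D + 1, carryTable n D b pw t s0 s y = c + t s0 y)
    (hc : ∀ q < n, ∀ y < D + 1, carryTable n D b pw t s0 (c + q) y = c + t q y)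
    (hcn : c ≤ n) (hW : ∀ j, W j < D + 1) :
    ¬ OmegaAcc (carryTable n D b pw t s0) (carryAcc n F) s W := by
  refine not_omegaAcc_of_forall 1 fun i hi => ?_
  obtain ⟨h1, h2⟩ := carryTable_run ht hs hc (fun j _ => hW j) (show i ≠ 0 by omega)
  rw [h1]
  unfold carryAcc
  omega

/-- The two initial states are equivalent iff the two words of each carry are both accepted, or
both rejected. -/
theorem carryTable_sameLanguage (ht : ∀ q x, t q x < n) :
    SameLanguage (2 * (D + 1)) (carryTable n D b pw t s0) (carryAcc n F) (4 * n) (4 * n + 1) ↔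
      ∀ X : ℕ → ℕ, (∀ j, X j < D + 1) → ∀ p, CanCarry D b pw p (X p) →
        (OmegaAcc t F s0 (carryMax D b pw p X) ↔ OmegaAcc t F s0 (carryZero D b pw p X)) := by
  constructor
  · intro h X hX p hp
    have h1 : ∀ j < p, (fun j => if j = p then D + 1 + X j else X j) j < D + 1 := fun j hj => by
      simp only [if_neg hj.ne]; exact hX j
    have h2 : ¬ (fun j => if j = p then D + 1 + X j else X j) p < D + 1 := by simp; omega
    have h3 : (fun j => unflag D ((fun j => if j = p then D + 1 + X j else X j) j)) = X := by
      funext j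
      have := hX j
      by_cases hj : j = p
      · simp only [if_pos hj, unflag]; rw [if_neg (by omega)]; omega
      · simp only [if_neg hj, unflag, if_pos this]
    have := h (fun j => if j = p then D + 1 + X j else X j) fun j => by
      have := hX j
      by_cases hj : j = p
      · simp only [if_pos hj]; omega
      · simp only [if_neg hj]; omega
    rw [carryTable_first_iff ht h1 h2, carryTable_second_iff ht h1 h2, h3] at this
    have h4 : unflag D ((fun j => if j = p then D + 1 + X j else X j) p) = X p := congrFun h3 p
    rw [h4] at this
    simpa [hp] using this
  · intro h W hW
    -- The first flagged position is the position of the carry. If the letter there admits no carry,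
    -- both runs fall into the sink.
    by_cases hex : ∃ p, ¬ W p < D + 1
    · classical
      have hp := Nat.find_spec hex
      have hlt : ∀ j < Nat.find hex, W j < D + 1 := fun j hj => not_not.1 (Nat.find_min hex hj)
      rw [carryTable_first_iff ht hlt hp, carryTable_second_iff ht hlt hp]
      exact and_congr_right fun hC => h _ (fun j => unflag_lt (hW j)) _ hC
    · push Not at hex
      refine iff_of_false ?_ ?_
      · exact carryTable_not_acc (c := 0) ht
          (fun y hy => by rw [carryTable_first, if_pos hy, zero_add])
          (fun q hq y hy => by rw [zero_add, zero_add, carryTable_preFirst hq, if_pos hy])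
          (by omega) hex
      · exact carryTable_not_acc (c := n) ht
          (fun y hy => by rw [carryTable_second, if_pos hy])
          (fun q hq y hy => by rw [carryTable_preSecond hq, if_pos hy]) le_rfl hex

end CarryTable


/-! ### The automaton that tests encodings and the repetition of the sign -/

section SignTable

variable (n D : ℕ) (t : ℕ → ℕ → ℕ) (s0 : ℕ) (sgn : ℕ → ℕ)

/-- An automaton with two initial states `4 n` and `4 n + 1`, that compares the acceptance of a
word with its being an encoding, and, if the first letter has a flag, with the acceptance of the
word with a repeated sign. -/
def signTable (q y : ℕ) : ℕ :=
  if q < n then t q (unflag D y)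
  else if q < 2 * n then
    if unflag D y < D then n + t (q - n) (unflag D y) else 2 * n + t (q - n) (unflag D y)
  else if q < 3 * n then
    if unflag D y < D then 2 * n + t (q - 2 * n) (unflag D y) else 4 * n + 2
  else if q = 4 * n then
    if y < D + 1 then t s0 y
    else if sgn (unflag D y) = 1 then t (t s0 (unflag D y)) (unflag D y) else 4 * n + 2
  else if q = 4 * n + 1 then
    if sgn (unflag D y) = 1 then n + t s0 (unflag D y) else 4 * n + 2
  else 4 * n + 2

/-- The accepting states of `signTable`. -/
def signAcc (F : ℕ → Prop) (q : ℕ) : Prop :=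
  (q < n ∧ F q) ∨ (2 * n ≤ q ∧ q < 3 * n ∧ F (q - 2 * n))

variable {n D t s0 sgn} {F : ℕ → Prop}

theorem signTable_zero {q y : ℕ} (hq : q < n) :
    signTable n D t s0 sgn q y = t q (unflag D y) := by
  unfold signTable; rw [if_pos hq]

theorem signTable_one {q y : ℕ} (hq : q < n) : signTable n D t s0 sgn (n + q) y =
    if unflag D y < D then n + t q (unflag D y) else 2 * n + t q (unflag D y) := by
  unfold signTable; rw [if_neg (by omega), if_pos (by omega), Nat.add_sub_cancel_left]

theorem signTable_two {q y : ℕ} (hq : q < n) : signTable n D t s0 sgn (2 * n + q) y =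
    if unflag D y < D then 2 * n + t q (unflag D y) else 4 * n + 2 := by
  unfold signTable
  rw [if_neg (by omega), if_neg (by omega), if_pos (by omega), Nat.add_sub_cancel_left]

theorem signTable_three {q y : ℕ} (hq : q < n) :
    signTable n D t s0 sgn (3 * n + q) y = 4 * n + 2 := by
  unfold signTable
  rw [if_neg (by omega), if_neg (by omega), if_neg (by omega), if_neg (by omega),
    if_neg (by omega)]

theorem signTable_first {y : ℕ} : signTable n D t s0 sgn (4 * n) y =
    if y < D + 1 then t s0 y
    else if sgn (unflag D y) = 1 then t (t s0 (unflag D y)) (unflag D y) else 4 * n + 2 := by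
  unfold signTable
  rw [if_neg (by omega), if_neg (by omega), if_neg (by omega), if_pos rfl]

theorem signTable_second {y : ℕ} : signTable n D t s0 sgn (4 * n + 1) y =
    if sgn (unflag D y) = 1 then n + t s0 (unflag D y) else 4 * n + 2 := by
  unfold signTable
  rw [if_neg (by omega), if_neg (by omega), if_neg (by omega), if_neg (by omega), if_pos rfl]

theorem signTable_sink {y : ℕ} : signTable n D t s0 sgn (4 * n + 2) y = 4 * n + 2 := by
  unfold signTable
  rw [if_neg (by omega), if_neg (by omega), if_neg (by omega), if_neg (by omega),
    if_neg (by omega)]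

theorem signAcc_zero {q : ℕ} (hq : q < n) : signAcc n F q ↔ F q := by
  unfold signAcc
  constructor
  · rintro (h | h)
    · exact h.2
    · omega
  · exact fun h => Or.inl ⟨hq, h⟩

theorem signAcc_two {q : ℕ} (hq : q < n) : signAcc n F (2 * n + q) ↔ F q := by
  unfold signAcc
  rw [Nat.add_sub_cancel_left]
  constructor
  · rintro (h | h)
    · omega
    · exact h.2.2
  · exact fun h => Or.inr ⟨by omega, by omega, h⟩

theorem not_signAcc_sink : ¬ signAcc n F (4 * n + 2) := by unfold signAcc; omega

theorem signTable_lt (ht : ∀ q x, t q x < n) {q : ℕ} (hq : q < 4 * n + 3) (y : ℕ) :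
    signTable n D t s0 sgn q y < 4 * n + 3 := by
  rcases layer_cases hq with h' | ⟨r, hr, rfl⟩ | ⟨r, hr, rfl⟩ | ⟨r, hr, rfl⟩ | rfl | rfl | rfl
  · rw [signTable_zero h']; have := ht q (unflag D y); omega
  · rw [signTable_one hr]; have := ht r (unflag D y); split_ifs <;> omega
  · rw [signTable_two hr]; have := ht r (unflag D y); split_ifs <;> omega
  · rw [signTable_three hr]; omega
  · rw [signTable_first]
    have := ht s0 y; have := ht (t s0 (unflag D y)) (unflag D y)
    split_ifs <;> omega
  · rw [signTable_second]; have := ht s0 (unflag D y); split_ifs <;> omega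
  · rw [signTable_sink]; omega

theorem signTable_rank (ht : ∀ q x, t q x < n) {q : ℕ} (hq : q < 4 * n + 3) (y : ℕ) :
    layerRank n 2 1 3 4 q ≤ layerRank n 2 1 3 4 (signTable n D t s0 sgn q y) := by
  rcases layer_cases hq with h' | ⟨r, hr, rfl⟩ | ⟨r, hr, rfl⟩ | ⟨r, hr, rfl⟩ | rfl | rfl | rfl
  · rw [signTable_zero h', layerRank_zero h', layerRank_zero (ht _ _)]
  · rw [signTable_one hr, layerRank_one hr]
    split_ifs
    · rw [layerRank_one (ht _ _)]
    · rw [layerRank_two (ht _ _)]; omega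
  · rw [signTable_two hr, layerRank_two hr]
    split_ifs
    · rw [layerRank_two (ht _ _)]
    · rw [layerRank_sink]; omega
  · rw [signTable_three hr, layerRank_three hr, layerRank_sink]; omega
  · rw [layerRank_first]; omega
  · rw [layerRank_second]; omega
  · rw [signTable_sink]

/-- The layer at 0 simulates the input; the layer at n waits for the dot and is rejecting; the layer
at 2n simulates the input after the dot and forbids another one. The layer at 3n is unused and only
keeps the numbering of states common to both kinds of automata. -/
theorem signTable_weak (hW : WeakTable n (D + 1) t F) (ht : ∀ q x, t q x < n) :
    WeakTable (4 * n + 3) (2 * (D + 1)) (signTable n D t s0 sgn) (signAcc n F) := by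
  refine hW.of_layers (layerRank n 2 1 3 4)
    (fun q => if q < n then q else q - 2 * n) (fun l => l = 2 ∨ l = 3)
    (fun q hq y _ => signTable_lt ht hq y) ?_ (fun q hq y _ => signTable_rank ht hq y) ?_ ?_
  · intro q hq
    rcases layer_cases hq with h' | ⟨r, hr, rfl⟩ | ⟨r, hr, rfl⟩ | ⟨r, hr, rfl⟩ | rfl | rfl | rfl
    · rw [layerRank_zero h', signAcc_zero h', if_pos h']; simp
    · rw [layerRank_one hr]; unfold signAcc; omega
    · rw [layerRank_two hr, signAcc_two hr, if_neg (by omega), Nat.add_sub_cancel_left]; simp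
    · rw [layerRank_three hr]; unfold signAcc; omega
    · rw [layerRank_first]; unfold signAcc; omega
    · rw [layerRank_second]; unfold signAcc; omega
    · rw [layerRank_sink]; unfold signAcc; omega
  · intro q hq h
    rcases layer_cases hq with h' | ⟨r, hr, rfl⟩ | ⟨r, hr, rfl⟩ | ⟨r, hr, rfl⟩ | rfl | rfl | rfl
    · rw [if_pos h']; exact h'
    · rw [layerRank_one hr] at h; omega
    · rw [if_neg (by omega)]; omega
    · rw [layerRank_three hr] at h; omega
    · rw [layerRank_first] at h; omega
    · rw [layerRank_second] at h; omega
    · rw [layerRank_sink] at h; omega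
  · intro q hq y hy h he
    have hy' := unflag_lt hy
    rcases layer_cases hq with h' | ⟨r, hr, rfl⟩ | ⟨r, hr, rfl⟩ | ⟨r, hr, rfl⟩ | rfl | rfl | rfl
    · exact ⟨_, hy', by rw [signTable_zero h', if_pos h', if_pos (ht _ _)]⟩
    · rw [layerRank_one hr] at h; omega
    · refine ⟨unflag D y, hy', ?_⟩
      rw [signTable_two hr, layerRank_two hr] at he
      rw [signTable_two hr, if_neg (show ¬ 2 * n + r < n by omega), Nat.add_sub_cancel_left]
      split_ifs at he ⊢ with h1 h2
      · omega
      · rw [Nat.add_sub_cancel_left]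
      · rw [layerRank_sink] at he; omega
      · rw [layerRank_sink] at he; omega
    · rw [layerRank_three hr] at h; omega
    · rw [layerRank_first] at h; omega
    · rw [layerRank_second] at h; omega
    · rw [layerRank_sink] at h; omega

theorem signTable_acc_zero (ht : ∀ q x, t q x < n) {q : ℕ} (hq : q < n) (W : ℕ → ℕ) :
    OmegaAcc (signTable n D t s0 sgn) (signAcc n F) q W ↔
      OmegaAcc t F q (fun j => unflag D (W j)) := by
  have := omegaAcc_shift (c := 0) (δ := signTable n D t s0 sgn) (F' := signAcc n F) (F := F)
    (W := W) (W' := fun j => unflag D (W j)) ht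
    (fun i q hq => by rw [zero_add, zero_add, signTable_zero hq])
    (fun q hq => by rw [zero_add, signAcc_zero hq]) hq
  rwa [zero_add] at this

theorem signTable_acc_two (ht : ∀ q x, t q x < n) {q : ℕ} (hq : q < n) {W : ℕ → ℕ} :
    OmegaAcc (signTable n D t s0 sgn) (signAcc n F) (2 * n + q) W ↔
      OmegaAcc t F q (fun j => unflag D (W j)) ∧ ∀ j, unflag D (W j) < D := by
  by_cases h : ∀ j, unflag D (W j) < D
  · rw [omegaAcc_shift (W' := fun j => unflag D (W j)) (F := F) ht
      (fun i q hq => by rw [signTable_two hq, if_pos (h i)]) (fun q hq => signAcc_two hq) hq]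
    simp [h]
  · simp only [h, and_false, iff_false]
    push Not at h
    classical
    have hp := Nat.find_spec h
    have hlt : ∀ j < Nat.find h, unflag D (W j) < D := fun j hj => not_le.1 (Nat.find_min h hj)
    set p := Nat.find h
    obtain ⟨h1, h2⟩ := omegaRun_shift (δ := signTable n D t s0 sgn) (c := 2 * n)
      (W' := fun j => unflag D (W j)) ht
      (fun i hi q hq => by rw [signTable_two hq, if_pos (hlt i hi)]) hq
    refine not_omegaAcc_of_sink (fun _ => signTable_sink) not_signAcc_sink (k := p + 1) ?_
    rw [omegaRun, h1, signTable_two h2, if_neg (by omega)]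

/-- Without a dot the run stays in a rejecting layer; the first dot moves it to the layer at 2n,
from which a second dot leads to the sink. So exactly one dot is required. -/
theorem signTable_acc_one (ht : ∀ q x, t q x < n) {q : ℕ} (hq : q < n) {W : ℕ → ℕ} :
    OmegaAcc (signTable n D t s0 sgn) (signAcc n F) (n + q) W ↔
      OmegaAcc t F q (fun j => unflag D (W j)) ∧ ∃ p, ∀ j, unflag D (W j) < D ↔ j ≠ p := by
  by_cases h : ∀ j, unflag D (W j) < D
  · refine iff_of_false ?_ ?_
    · refine not_omegaAcc_of_forall 0 fun i _ => ?_
      obtain ⟨h1, h2⟩ := omegaRun_shift (δ := signTable n D t s0 sgn) (c := n) (j := i)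
        (W' := fun j => unflag D (W j)) ht
        (fun i hi q hq => by rw [signTable_one hq, if_pos (h i)]) hq
      rw [h1]
      unfold signAcc; omega
    · rintro ⟨_, p, hp⟩
      exact (hp p).1 (h p) rfl
  · push Not at h
    classical
    have hp := Nat.find_spec h
    have hlt : ∀ j < Nat.find h, unflag D (W j) < D := fun j hj => not_le.1 (Nat.find_min h hj)
    set p := Nat.find h
    obtain ⟨h1, h2⟩ := omegaRun_shift (δ := signTable n D t s0 sgn) (c := n) (j := p)
      (W' := fun j => unflag D (W j)) ht
      (fun i hi q hq => by rw [signTable_one hq, if_pos (hlt i hi)]) hq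
    have h3 : omegaRun (signTable n D t s0 sgn) (n + q) W (p + 1) =
        2 * n + omegaRun t q (fun j => unflag D (W j)) (p + 1) := by
      rw [omegaRun, h1, signTable_one h2, if_neg (by omega)]; rfl
    rw [omegaAcc_tail _ _ _ _ (p + 1), h3,
      signTable_acc_two (q := omegaRun t q (fun j => unflag D (W j)) (p + 1)) ht (ht _ _),
      omegaAcc_tail t F q _ (p + 1)]
    refine and_congr_right fun _ => ⟨fun h => ⟨p, fun j => ?_⟩, ?_⟩
    · rcases Nat.lt_trichotomy j p with hj | rfl | hj
      · simp only [hlt j hj, hj.ne, ne_eq, not_false_eq_true]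
      · simp only [ne_eq, not_true_eq_false, iff_false]; omega
      · have := h (j - (p + 1))
        rw [Nat.add_sub_cancel' (by omega)] at this
        simp only [this, hj.ne', ne_eq, not_false_eq_true]
    · rintro ⟨p', hp'⟩ j
      have : p = p' := by
        by_contra hne
        have := (hp' p).2 hne
        omega
      rw [hp']; omega

/-- A flag on the first letter makes the automaton read that letter twice, so the comparison with
the other initial state expresses invariance under repetition of the sign. -/
theorem signTable_acc_first (ht : ∀ q x, t q x < n) {W : ℕ → ℕ} :
    OmegaAcc (signTable n D t s0 sgn) (signAcc n F) (4 * n) W ↔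
      if W 0 < D + 1 then OmegaAcc t F s0 (fun j => unflag D (W j))
      else sgn (unflag D (W 0)) = 1 ∧ OmegaAcc t F s0 (fun j => unflag D (W (j - 1))) := by
  rw [omegaAcc_tail _ _ _ _ 1]
  have h1 : omegaRun (signTable n D t s0 sgn) (4 * n) W 1 =
    signTable n D t s0 sgn (4 * n) (W 0) := rfl
  rw [h1, signTable_first]
  split_ifs with h h'
  · rw [signTable_acc_zero ht (ht _ _), omegaAcc_tail t F s0 _ 1]
    simp only [omegaRun, unflag, if_pos h]
  · rw [signTable_acc_zero ht (ht _ _), omegaAcc_tail t F s0 _ 2]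
    simp only [h', true_and, omegaRun]
    have : (fun k => unflag D (W (2 + k - 1))) = fun j => unflag D (W (1 + j)) := by
      funext k; rw [show 2 + k - 1 = 1 + k by omega]
    rw [this]
  · simp only [h', false_and, iff_false]
    exact not_omegaAcc_of_sink (fun _ => signTable_sink) not_signAcc_sink (k := 0) rfl

theorem signTable_acc_second (ht : ∀ q x, t q x < n) (hsgn : ∀ x, sgn x = 1 → x < D) {W : ℕ → ℕ} :
    OmegaAcc (signTable n D t s0 sgn) (signAcc n F) (4 * n + 1) W ↔
      sgn (unflag D (W 0)) = 1 ∧ OmegaAcc t F s0 (fun j => unflag D (W j)) ∧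
        ∃ p, ∀ j, unflag D (W j) < D ↔ j ≠ p := by
  rw [omegaAcc_tail _ _ _ _ 1]
  have h1 : omegaRun (signTable n D t s0 sgn) (4 * n + 1) W 1 =
    signTable n D t s0 sgn (4 * n + 1) (W 0) := rfl
  rw [h1, signTable_second]
  split_ifs with h
  · rw [signTable_acc_one ht (ht _ _), omegaAcc_tail t F s0 _ 1]
    simp only [h, true_and, omegaRun]
    refine and_congr_right fun _ => ⟨?_, ?_⟩
    · rintro ⟨p, hp⟩
      refine ⟨1 + p, fun j => ?_⟩
      rcases j with _ | j
      · simp only [hsgn _ h, true_iff]; omega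
      · rw [add_comm j 1, hp]; omega
    · rintro ⟨p, hp⟩
      have : p ≠ 0 := by
        rintro rfl
        exact (hp 0).1 (hsgn _ h) rfl
      exact ⟨p - 1, fun j => by rw [hp]; omega⟩
  · simp only [h, false_and, iff_false]
    exact not_omegaAcc_of_sink (fun _ => signTable_sink) not_signAcc_sink (k := 0) rfl

/-- The two initial states are equivalent iff only encodings are accepted, and the repetition of
the sign does not change the acceptance. -/
theorem signTable_sameLanguage (ht : ∀ q x, t q x < n) (hsgn : ∀ x, sgn x = 1 → x < D) :
    SameLanguage (2 * (D + 1)) (signTable n D t s0 sgn) (signAcc n F) (4 * n) (4 * n + 1) ↔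
      (∀ X : ℕ → ℕ, (∀ j, X j < D + 1) → OmegaAcc t F s0 X →
        sgn (X 0) = 1 ∧ ∃ p, ∀ j, X j < D ↔ j ≠ p) ∧
      ∀ X : ℕ → ℕ, (∀ j, X j < D + 1) → sgn (X 0) = 1 →
        (OmegaAcc t F s0 X ↔ OmegaAcc t F s0 (fun j => X (j - 1))) := by
  have un : ∀ x < D + 1, unflag D x = x := fun x hx => if_pos hx
  constructor
  · intro h
    have h1 : ∀ X : ℕ → ℕ, (∀ j, X j < D + 1) → OmegaAcc t F s0 X →
        sgn (X 0) = 1 ∧ ∃ p, ∀ j, X j < D ↔ j ≠ p := by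
      intro X hX hacc
      have := h X fun j => by have := hX j; omega
      rw [signTable_acc_first ht, signTable_acc_second ht hsgn, if_pos (hX 0)] at this
      simp only [un _ (hX _)] at this
      exact ⟨(this.1 hacc).1, (this.1 hacc).2.2⟩
    refine ⟨h1, fun X hX hs => ?_⟩
    -- The test word for the sign condition carries a flag on its first letter and nowhere else.
    have e : ∀ j, unflag D (if j = 0 then D + 1 + X 0 else X j) = X j := fun j => by
      by_cases hj : j = 0
      · rw [if_pos hj, hj]; unfold unflag; rw [if_neg (by omega)]; omega
      · rw [if_neg hj, un _ (hX j)]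
    have := h (fun j => if j = 0 then D + 1 + X 0 else X j) fun j => by
      have := hX j; have := hX 0
      split_ifs <;> omega
    rw [signTable_acc_first ht, signTable_acc_second ht hsgn, if_neg (by simp; omega)] at this
    have e0 : unflag D (if True then D + 1 + X 0 else X 0) = X 0 := by simpa using e 0
    simp only [e, e0, hs, true_and] at this
    rw [this]
    exact ⟨fun ha => ⟨ha, (h1 X hX ha).2⟩, fun ha => ha.1⟩
  · rintro ⟨h1, h2⟩ W hW
    have hX : ∀ j, unflag D (W j) < D + 1 := fun j => unflag_lt (hW j)
    rw [signTable_acc_first ht, signTable_acc_second ht hsgn]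
    split_ifs with h
    · exact ⟨fun ha => ⟨(h1 _ hX ha).1, ha, (h1 _ hX ha).2⟩, fun ha => ha.2.1⟩
    · refine and_congr_right fun hs => ?_
      rw [← h2 _ hX hs]
      exact ⟨fun ha => ⟨ha, (h1 _ hX ha).2⟩, fun ha => ha.1⟩

end SignTable

/-! ## The input automaton -/

section Input

variable {n b d : ℕ}

/-- The number of a letter. -/
def letterCode (l : Letter b d) : ℕ := l.elim (b ^ d) fun a => (finFunctionFinEquiv a).val

theorem letterCode_some_lt (a : Fin d → Fin b) : letterCode (some a) < b ^ d :=
  (finFunctionFinEquiv a).isLt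

theorem letterCode_lt (l : Letter b d) : letterCode l < b ^ d + 1 := by
  rcases l with _ | a
  · simp [letterCode]
  · exact (letterCode_some_lt a).trans (by omega)

theorem letterCode_lt_iff {l : Letter b d} : letterCode l < b ^ d ↔ l ≠ none := by
  rcases l with _ | a
  · simp [letterCode]
  · simp [letterCode_some_lt a]

theorem exists_letterCode {x : ℕ} (hx : x < b ^ d + 1) : ∃ l : Letter b d, letterCode l = x := by
  by_cases h : x < b ^ d
  · exact ⟨some (finFunctionFinEquiv.symm ⟨x, h⟩), by
      rw [letterCode, Option.elim_some, Equiv.apply_symm_apply]⟩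
  · exact ⟨none, by simp [letterCode]; omega⟩

theorem DBA.toInput_trans (M : DBA (Fin n) (Letter b d)) (q : Fin n) (l : Letter b d) :
    M.toInput.trans q (letterCode l) = (M.trans q l).val := by
  rcases l with _ | a
  · simp [toInput, letterCode]
  · have := letterCode_some_lt a
    simp only [letterCode, Option.elim_some] at this ⊢
    simp only [toInput, q.isLt, dif_pos, this]
    rw [Fin.eta, Fin.eta, Equiv.symm_apply_apply]

/-- Outside its domain the function takes the default value 0, which is a state since an initial
state exists. So no range conditions are needed when the simulated transition function is iterated.
-/
theorem DBA.toInput_trans_lt (M : DBA (Fin n) (Letter b d)) (q x : ℕ) :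
    M.toInput.trans q x < n := by
  have : 0 < n := M.init.pos
  simp only [toInput]
  split_ifs <;> simp [this]

theorem DBA.toInput_acc (M : DBA (Fin n) (Letter b d)) (q : Fin n) :
    M.toInput.acc q = 1 ↔ q ∈ M.acc := by
  simp [toInput]

theorem DBA.toInput_acc_le (M : DBA (Fin n) (Letter b d)) (q : ℕ) : M.toInput.acc q ≤ 1 := by
  simp only [toInput]
  split_ifs <;> simp

theorem DBA.omegaRun_toInput (M : DBA (Fin n) (Letter b d)) (q : Fin n) (w : ℕ → Letter b d)
    (i : ℕ) : omegaRun M.toInput.trans q (fun j => letterCode (w j)) i = (M.run q w i).val := by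
  induction i with
  | zero => rfl
  | succ i ih => rw [omegaRun, ih, M.toInput_trans]; rfl

/-- Visiting the accepting set infinitely often is the same as visiting one accepting state
infinitely often, because there are finitely many states. -/
theorem DBA.acceptsFrom_iff (M : DBA (Fin n) (Letter b d)) (q : Fin n) (w : ℕ → Letter b d) :
    M.AcceptsFrom q w ↔ OmegaAcc M.toInput.trans (fun q => M.toInput.acc q = 1) q
      (fun j => letterCode (w j)) := by
  unfold OmegaAcc
  simp only [M.omegaRun_toInput]
  constructor
  · rintro ⟨p, hp, hf⟩
    exact hf.mono fun i hi => by rw [hi, M.toInput_acc]; exact hp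
  · intro h
    obtain ⟨p, hp, hP, hf⟩ := exists_frequently_eq (N := n)
      (P := fun q => M.toInput.acc q = 1) (r := fun i => (M.run q w i).val) (fun i => Fin.isLt _) h
    exact ⟨⟨p, hp⟩, (M.toInput_acc ⟨p, hp⟩).1 hP, hf.mono fun i hi => Fin.ext hi⟩

theorem DBA.reach_toInput (M : DBA (Fin n) (Letter b d)) {p : Fin n} {q : ℕ}
    (h : Reach (b ^ d + 1) M.toInput.trans p q) :
    ∃ q' : Fin n, q = q' ∧ (q' = p ∨ M.Accessible p q') := by
  induction h with
  | refl => exact ⟨p, rfl, Or.inl rfl⟩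
  | tail _ h ih =>
    obtain ⟨q', rfl, hq'⟩ := ih
    obtain ⟨x, hx, rfl⟩ := h
    obtain ⟨l, rfl⟩ := exists_letterCode hx
    refine ⟨M.trans q' l, M.toInput_trans q' l, Or.inr ?_⟩
    rcases hq' with rfl | ⟨u, hu, he⟩
    · exact ⟨[l], by simp, rfl⟩
    · exact ⟨u ++ [l], by simp, by simp [he]⟩

theorem DBA.Weak.weakTable {M : DBA (Fin n) (Letter b d)} (h : M.Weak) :
    WeakTable n (b ^ d + 1) M.toInput.trans (fun q => M.toInput.acc q = 1) := by
  refine ⟨fun q _ x _ => M.toInput_trans_lt q x, fun p hp q hq h1 h2 => ?_⟩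
  obtain ⟨q', hq', h1'⟩ := M.reach_toInput (p := ⟨p, hp⟩) h1
  obtain ⟨p', hp', h2'⟩ := M.reach_toInput (p := ⟨q, hq⟩) h2
  have e1 : q' = ⟨q, hq⟩ := Fin.ext hq'.symm
  have e2 : p' = ⟨p, hp⟩ := Fin.ext hp'.symm
  subst e1 e2
  have a1 := M.toInput_acc ⟨p, hp⟩
  have a2 := M.toInput_acc ⟨q, hq⟩
  simp only at a1 a2
  rw [a1, a2]
  rcases h1' with e | h1'
  · rw [e]
  · rcases h2' with e | h2'
    · rw [e]
    · exact h _ _ h1' h2'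

theorem digitOf_letterCode (a : Fin d → Fin b) (i : Fin d) :
    digitOf b (b ^ (i : ℕ)) (letterCode (some a)) = a i := by
  have h := finFunctionFinEquiv_symm_apply_val (finFunctionFinEquiv a) i
  rw [Equiv.symm_apply_apply] at h
  exact h.symm

/-- Stated additively, so that the truncated subtractions in the maximal and the zero letter can be
resolved by linear arithmetic. -/
theorem letterCode_update (a : Fin d → Fin b) (i : Fin d) (v : Fin b) :
    letterCode (some (update a i v)) + (a i).val * b ^ (i : ℕ) =
      letterCode (some a) + v.val * b ^ (i : ℕ) := by
  simp only [letterCode, Option.elim_some, finFunctionFinEquiv_apply]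
  rw [← Finset.add_sum_erase _ _ (Finset.mem_univ i),
    ← Finset.add_sum_erase Finset.univ (fun j => (a j).val * b ^ (j : ℕ)) (Finset.mem_univ i)]
  have : ∑ x ∈ Finset.univ.erase i, (update a i v x).val * b ^ (x : ℕ) =
      ∑ x ∈ Finset.univ.erase i, (a x).val * b ^ (x : ℕ) :=
    Finset.sum_congr rfl fun x hx => by rw [update_of_ne (Finset.ne_of_mem_erase hx)]
  rw [this, update_self]
  ring

theorem maxLetter_some (hb : 2 ≤ b) (a : Fin d → Fin b) (i : Fin d) :
    maxLetter (b ^ d) b (b ^ (i : ℕ)) (letterCode (some a)) =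
      letterCode (some (update a i ⟨b - 1, by omega⟩)) := by
  have h := letterCode_update a i ⟨b - 1, by omega⟩
  rw [maxLetter, if_pos (letterCode_some_lt a), digitOf_letterCode, Nat.sub_mul]
  have : (a i).val * b ^ (i : ℕ) ≤ (b - 1) * b ^ (i : ℕ) :=
    Nat.mul_le_mul_right _ (by omega)
  simp only at h
  omega

theorem zeroLetter_some (hb : 2 ≤ b) (a : Fin d → Fin b) (i : Fin d) :
    zeroLetter (b ^ d) b (b ^ (i : ℕ)) (letterCode (some a)) =
      letterCode (some (update a i ⟨0, by omega⟩)) := by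
  have h := letterCode_update a i ⟨0, by omega⟩
  rw [zeroLetter, if_pos (letterCode_some_lt a), digitOf_letterCode]
  simp only [zero_mul, add_zero] at h
  omega

theorem maxLetter_none {pw : ℕ} :
    maxLetter (b ^ d) b pw (letterCode (none : Letter b d)) = letterCode (none : Letter b d) := by
  simp [maxLetter, letterCode]

theorem zeroLetter_none {pw : ℕ} :
    zeroLetter (b ^ d) b pw (letterCode (none : Letter b d)) = letterCode (none : Letter b d) := by
  simp [zeroLetter, letterCode]

theorem maxLetter_lt (hb : 2 ≤ b) (i : Fin d) {x : ℕ} (hx : x < b ^ d + 1) :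
    maxLetter (b ^ d) b (b ^ (i : ℕ)) x < b ^ d + 1 := by
  obtain ⟨l, rfl⟩ := exists_letterCode hx
  rcases l with _ | a
  · rw [maxLetter_none]; exact letterCode_lt _
  · rw [maxLetter_some hb]; exact letterCode_lt _

theorem exists_letterWord {X : ℕ → ℕ} (hX : ∀ j, X j < b ^ d + 1) :
    ∃ w : ℕ → Letter b d, X = fun j => letterCode (w j) := by
  choose w hw using fun j => exists_letterCode (hX j)
  exact ⟨w, funext fun j => (hw j).symm⟩

end Input


/-! ### From words over vectors of digits to the checking automata -/

section Criterion

variable {n b d : ℕ}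

theorem carry_max_eq (hb : 2 ≤ b) {i : Fin d} {p : ℕ} {u v : ℕ → Letter b d} (h : Carry i p u v) :
    (carryMax (b ^ d) b (b ^ (i : ℕ)) p fun j => letterCode (u j)) = fun j => letterCode (u j) := by
  funext j
  simp only [carryMax]
  split_ifs with hj
  · rfl
  · rcases h.after j (by omega) with ⟨h1, _⟩ | ⟨x, y, h1, _, _, h2⟩
    · rw [h1, maxLetter_none]
    · rw [h1, maxLetter_some hb]
      congr 2
      rw [update_eq_self_iff]
      exact Fin.ext h2.1.symm

theorem update_eq_of_forall_ne {i : Fin d} {x y : Fin d → Fin b} (h : ∀ i', i' ≠ i → x i' = y i')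
    {c : Fin b} (hc : c.val = (y i).val) : update x i c = y := by
  funext i'
  by_cases hi : i' = i
  · subst hi; simp [Fin.ext hc]
  · simp [hi, h i' hi]

theorem carry_zero_eq (hb : 2 ≤ b) {i : Fin d} {p : ℕ} {u v : ℕ → Letter b d} (h : Carry i p u v) :
    (carryZero (b ^ d) b (b ^ (i : ℕ)) p fun j => letterCode (u j)) = fun j => letterCode (v j) := by
  funext j
  simp only [carryZero]
  split_ifs with hj hj' h0
  · rw [h.before j hj]
  · subst hj'
    obtain ⟨x, y, h1, h2, h3, h4⟩ := h.at_pos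
    rw [if_pos h0] at h4
    rw [h1, h2, zeroLetter_some hb, update_eq_of_forall_ne h3 h4.2.symm]
  · subst hj'
    obtain ⟨x, y, h1, h2, h3, h4⟩ := h.at_pos
    rw [if_neg h0] at h4
    have := letterCode_update x i (y i)
    rw [update_eq_of_forall_ne h3 rfl, ← h4] at this
    rw [h1, h2]
    linarith
  · rcases h.after j (by omega) with ⟨h1, h2⟩ | ⟨x, y, h1, h2, h3, h4⟩
    · rw [h1, h2, zeroLetter_none]
    · rw [h1, h2, zeroLetter_some hb, update_eq_of_forall_ne h3 h4.2.symm]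

theorem Carry.canCarry {i : Fin d} (hb : 2 ≤ b) {p : ℕ} {u v : ℕ → Letter b d} (h : Carry i p u v) :
    CanCarry (b ^ d) b (b ^ (i : ℕ)) p (letterCode (u p)) := by
  obtain ⟨x, y, h1, h2, h3, h4⟩ := h.at_pos
  rw [h1]
  refine ⟨letterCode_some_lt x, ?_⟩
  rw [digitOf_letterCode]
  by_cases h0 : p = 0
  · rw [if_pos h0] at h4 ⊢; omega
  · rw [if_neg h0] at h4 ⊢; have := (y i).isLt; omega

/-- The letters after `p` are overwritten in the component `i` by b-1 and by 0. What the word has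
there originally is irrelevant, so an arbitrary word with a suitable letter at `p` determines a
carry. -/
theorem exists_carry (hb : 2 ≤ b) {i : Fin d} {p : ℕ} {w : ℕ → Letter b d}
    (hp : CanCarry (b ^ d) b (b ^ (i : ℕ)) p (letterCode (w p))) :
    ∃ u v : ℕ → Letter b d, Carry i p u v ∧
      (carryMax (b ^ d) b (b ^ (i : ℕ)) p fun j => letterCode (w j)) =
        (fun j => letterCode (u j)) ∧
      (carryZero (b ^ d) b (b ^ (i : ℕ)) p fun j => letterCode (w j)) =
        fun j => letterCode (v j) := by
  obtain ⟨x, hx⟩ : ∃ x, w p = some x := Option.ne_none_iff_exists'.1 (letterCode_lt_iff.1 hp.1)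
  have hp' := hp.2
  rw [hx, digitOf_letterCode] at hp'
  have hy : ∃ c : Fin b, (if p = 0 then c.val = 0 else (x i).val + 1 = c.val) := by
    by_cases h0 : p = 0
    · exact ⟨⟨0, by omega⟩, by rw [if_pos h0]⟩
    · rw [if_neg h0] at hp'
      exact ⟨⟨(x i).val + 1, hp'⟩, by rw [if_neg h0]⟩
  obtain ⟨c, hc⟩ := hy
  let u : ℕ → Letter b d := fun j => if j ≤ p then w j else
    (w j).map fun a => update a i ⟨b - 1, by omega⟩
  let v : ℕ → Letter b d := fun j => if j < p then w j else if j = p then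
    some (update x i c) else (w j).map fun a => update a i ⟨0, by omega⟩
  have hc' : Carry i p u v := by
    refine ⟨fun j hj => ?_, ⟨x, update x i c, ?_, ?_, ?_, ?_⟩, fun j hj => ?_⟩
    · simp only [u, v, if_pos hj, if_pos hj.le]
    · simp only [u, if_pos le_rfl, hx]
    · simp only [v, lt_irrefl, if_false, if_true]
    · intro i' hi; simp [hi]
    · rw [update_self]
      by_cases h0 : p = 0
      · rw [if_pos h0] at hp' hc ⊢; omega
      · rw [if_neg h0] at hp' hc ⊢; exact hc
    · simp only [u, v, if_neg (show ¬ j ≤ p by omega), if_neg (show ¬ j < p by omega),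
        if_neg (show ¬ j = p by omega)]
      rcases w j with _ | a
      · exact Or.inl ⟨rfl, rfl⟩
      · exact Or.inr ⟨_, _, rfl, rfl, fun i' hi => by simp [hi], by simp⟩
  refine ⟨u, v, hc', ?_, ?_⟩
  · funext j
    simp only [carryMax]
    by_cases hj : j ≤ p
    · simp only [u, if_pos hj]
    · simp only [u, if_neg hj]
      rcases w j with _ | a
      · exact maxLetter_none
      · exact maxLetter_some hb a i
  · rw [← carry_zero_eq hb hc']
    funext j
    simp only [carryZero]
    rcases Nat.lt_trichotomy j p with hj | rfl | hj
    · simp only [u, if_pos hj, if_pos hj.le]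
    · simp only [u, lt_irrefl, if_true, if_false, le_refl]
    · simp only [u, if_neg (show ¬ j ≤ p by omega), if_neg (show ¬ j < p by omega),
        if_neg (show ¬ j = p by omega)]
      rcases w j with _ | a
      · rfl
      · rw [Option.map_some, zeroLetter_some hb, zeroLetter_some hb, update_idem]

variable (M : DBA (Fin n) (Letter b d))

theorem DBA.carry_iff (hb : 2 ≤ b) (i : Fin d) :
    (∀ p u v, Carry i p u v → (u ∈ {w | M.Accepts w} ↔ v ∈ {w | M.Accepts w})) ↔
    ∀ X : ℕ → ℕ, (∀ j, X j < b ^ d + 1) → ∀ p, CanCarry (b ^ d) b (b ^ (i : ℕ)) p (X p) →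
      (OmegaAcc M.toInput.trans (fun q => M.toInput.acc q = 1) M.init
        (carryMax (b ^ d) b (b ^ (i : ℕ)) p X) ↔
       OmegaAcc M.toInput.trans (fun q => M.toInput.acc q = 1) M.init
        (carryZero (b ^ d) b (b ^ (i : ℕ)) p X)) := by
  constructor
  · intro h X hX p hp
    obtain ⟨w, rfl⟩ := exists_letterWord hX
    obtain ⟨u, v, hc, e1, e2⟩ := exists_carry hb hp
    rw [e1, e2, ← M.acceptsFrom_iff, ← M.acceptsFrom_iff]
    exact h p u v hc
  · intro h p u v hc
    have := h (fun j => letterCode (u j)) (fun j => letterCode_lt _) p (hc.canCarry hb)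
    rw [carry_max_eq hb hc, carry_zero_eq hb hc, ← M.acceptsFrom_iff, ← M.acceptsFrom_iff] at this
    exact this

theorem isEncoding_iff {w : ℕ → Letter b d} : IsEncoding w ↔
    (∃ x, w 0 = some x ∧ ∀ i, IsSignDigit (x i)) ∧ ∃ p, ∀ j, w j ≠ none ↔ j ≠ p := by
  constructor
  · rintro ⟨m, e, hs, rfl⟩
    exact ⟨⟨e 0, by simp [wordOf], hs⟩, m + 1, fun j => not_congr wordOf_eq_none⟩
  · rintro ⟨⟨x, hx, hs⟩, p, hp⟩
    have hp0 : p ≠ 0 := by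
      rintro rfl
      exact (hp 0).1 (by simp [hx]) rfl
    obtain ⟨m, rfl⟩ := Nat.exists_eq_succ_of_ne_zero hp0
    obtain ⟨e, rfl⟩ := exists_wordOf fun j => not_iff_not.1 (hp j)
    refine ⟨m, e, ?_, rfl⟩
    have : some (e 0) = some x := by rw [← hx]; simp [wordOf]
    rw [Option.some_inj.1 this]
    exact hs

theorem DBA.sign_iff {sgn : ℕ → ℕ} (hsgn : ∀ x, sgn x = 1 → x < b ^ d)
    (hsgn' : ∀ a : Fin d → Fin b, sgn (letterCode (some a)) = 1 ↔ ∀ i, IsSignDigit (a i)) :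
    ((∀ w ∈ {w | M.Accepts w}, IsEncoding w) ∧
      ∀ w : ℕ → Letter b d, (∃ x, w 0 = some x ∧ ∀ i, IsSignDigit (x i)) →
        (w ∈ {w | M.Accepts w} ↔ (fun j => w (j - 1)) ∈ {w | M.Accepts w})) ↔
    (∀ X : ℕ → ℕ, (∀ j, X j < b ^ d + 1) →
      OmegaAcc M.toInput.trans (fun q => M.toInput.acc q = 1) M.init X →
        sgn (X 0) = 1 ∧ ∃ p, ∀ j, X j < b ^ d ↔ j ≠ p) ∧
      ∀ X : ℕ → ℕ, (∀ j, X j < b ^ d + 1) → sgn (X 0) = 1 →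
        (OmegaAcc M.toInput.trans (fun q => M.toInput.acc q = 1) M.init X ↔
         OmegaAcc M.toInput.trans (fun q => M.toInput.acc q = 1) M.init (fun j => X (j - 1))) := by
  have hs : ∀ l : Letter b d, (∃ x, l = some x ∧ ∀ i, IsSignDigit (x i)) ↔
      sgn (letterCode l) = 1 := by
    intro l
    rcases l with _ | a
    · simp only [reduceCtorEq, false_and, exists_false, false_iff]
      intro h
      exact letterCode_lt_iff.1 (hsgn _ h) rfl
    · rw [hsgn' a]
      constructor
      · rintro ⟨x, hx, h⟩
        rwa [Option.some_inj.1 hx]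
      · exact fun h => ⟨a, rfl, h⟩
  have he : ∀ w : ℕ → Letter b d, IsEncoding w ↔ sgn (letterCode (w 0)) = 1 ∧
      ∃ p, ∀ j, letterCode (w j) < b ^ d ↔ j ≠ p := fun w => by
    simp only [isEncoding_iff, hs, letterCode_lt_iff]
  constructor
  · rintro ⟨h1, h2⟩
    refine ⟨fun X hX hacc => ?_, fun X hX hX0 => ?_⟩
    · obtain ⟨w, rfl⟩ := exists_letterWord hX
      exact (he w).1 (h1 w ((M.acceptsFrom_iff _ _).2 hacc))
    · obtain ⟨w, rfl⟩ := exists_letterWord hX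
      have := h2 w ((hs _).2 hX0)
      exact ((M.acceptsFrom_iff _ _).symm.trans this).trans (M.acceptsFrom_iff _ _)
  · rintro ⟨h1, h2⟩
    refine ⟨fun w hw => ?_, fun w hw => ?_⟩
    · exact (he w).2 (h1 _ (fun j => letterCode_lt _) ((M.acceptsFrom_iff _ _).1 hw))
    · exact ((M.acceptsFrom_iff _ _).trans
        (h2 _ (fun j => letterCode_lt _) ((hs _).1 hw))).trans (M.acceptsFrom_iff _ _).symm

/-- The local conditions split into d tests for the carries and one for encodings and signs. The
function `sgn` is arbitrary beyond its value 1 on vectors of sign digits, so that the array computed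
by the program can be used. -/
theorem DBA.isRVA_iff (hb : 2 ≤ b) {sgn : ℕ → ℕ} (hsgn : ∀ x, sgn x = 1 → x < b ^ d)
    (hsgn' : ∀ a : Fin d → Fin b, sgn (letterCode (some a)) = 1 ↔ ∀ i, IsSignDigit (a i)) :
    M.IsRVA ↔
      (∀ i < d, SameLanguage (2 * (b ^ d + 1))
        (carryTable n (b ^ d) b (b ^ i) M.toInput.trans M.init)
        (carryAcc n fun q => M.toInput.acc q = 1) (4 * n) (4 * n + 1)) ∧
      SameLanguage (2 * (b ^ d + 1)) (signTable n (b ^ d) M.toInput.trans M.init sgn)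
        (signAcc n fun q => M.toInput.acc q = 1) (4 * n) (4 * n + 1) := by
  have ht := M.toInput_trans_lt
  unfold DBA.IsRVA
  rw [saturatedLanguage_iff hb, signTable_sameLanguage ht hsgn, ← M.sign_iff hsgn hsgn']
  have hc : (∀ i < d, SameLanguage (2 * (b ^ d + 1))
        (carryTable n (b ^ d) b (b ^ i) M.toInput.trans M.init)
        (carryAcc n fun q => M.toInput.acc q = 1) (4 * n) (4 * n + 1)) ↔
      ∀ i p u v, Carry i p u v → (u ∈ {w | M.Accepts w} ↔ v ∈ {w | M.Accepts w}) := by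
    constructor
    · intro h i
      rw [M.carry_iff hb]
      exact (carryTable_sameLanguage ht).1 (h i i.isLt)
    · intro h i hi
      rw [carryTable_sameLanguage ht]
      exact (M.carry_iff hb ⟨i, hi⟩).1 (h ⟨i, hi⟩)
  rw [hc]
  exact ⟨fun h => ⟨h.carry, h.encoding, h.sign⟩, fun h => ⟨h.2.1, h.2.2, h.1⟩⟩

end Criterion


/-! ## The decision program for the general case -/

section Tools

variable {k m : ℕ} {I : Input}

/-- The value of `f` if `e < e'`, and the value of `g` otherwise. -/
def Expr.iflt (e e' f g : Expr k m) : Expr k m :=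
  .add (.mul (.lt e e') f) (.mul (.sub (.const 1) (.lt e e')) g)

/-- The value of `f` if `e = e'`, and the value of `g` otherwise. -/
def Expr.ifeq (e e' f g : Expr k m) : Expr k m :=
  .add (.mul (.eq e e') f) (.mul (.sub (.const 1) (.eq e e')) g)

@[simp] theorem Expr.eval_iflt (e e' f g : Expr k m) (σ : Memory k m) : (iflt e e' f g).eval I σ =
    if e.eval I σ < e'.eval I σ then f.eval I σ else g.eval I σ := by
  simp only [evals, iflt]
  split_ifs <;> simp

@[simp] theorem Expr.eval_ifeq (e e' f g : Expr k m) (σ : Memory k m) : (ifeq e e' f g).eval I σ =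
    if e.eval I σ = e'.eval I σ then f.eval I σ else g.eval I σ := by
  simp only [evals, ifeq]
  split_ifs <;> simp

/-- Create all arrays of a list, with the same size. -/
def createAll (e : Expr k m) : List (Fin m) → Cmd k m
  | [] => .skip
  | a :: l => .seq (.create a e) (createAll e l)

/-- The size expression depends on the variables only, so it has the same value at each creation,
and no array is ever longer than `S` in between. -/
theorem exec_createAll {e : Expr k m} {S : ℕ} {v : Fin k → ℕ}
    (he : ∀ σ : Memory k m, σ.var = v → e.eval I σ = S) (l : List (Fin m)) :
    ∀ σ : Memory k m, σ.var = v → (∀ a, σ.len a ≤ S) → (∀ a i, σ.rd a i = 0) →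
    ∃ τ s, Exec I (createAll e l) σ τ (l.length * (e.cost + 1) + 1) s ∧ s ≤ k + m * S ∧
      τ.var = σ.var ∧ (∀ a, τ.len a ≤ S) ∧ (∀ a ∈ l, τ.len a = S) ∧
      (∀ a, σ.len a = S → τ.len a = S) ∧ ∀ a i, τ.rd a i = 0 := by
  have hsize : ∀ σ : Memory k m, (∀ a, σ.len a ≤ S) → σ.size ≤ k + m * S := fun σ h => by
    rw [size_eq]
    have := Finset.sum_le_card_nsmul Finset.univ (fun a => σ.len a) S fun a _ => h a
    simp at this
    omega
  induction l with
  | nil =>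
    intro σ _ h1 h2
    exact ⟨σ, _, by simpa [createAll] using Exec.skip σ, hsize σ h1, rfl, h1, by simp,
      fun _ h => h, h2⟩
  | cons a l ih =>
    intro σ hσ h1 h2
    have hl : ∀ c, (σ.mk0 a S).len c ≤ S := fun c => by
      rw [len_mk0]; split_ifs <;> simp [h1]
    obtain ⟨τ, s, hx, hs, hv, hle, hin, hkeep, h0⟩ := ih (σ.mk0 a S) hσ hl fun c i => by
      by_cases hc : c = a
      · subst hc; simp [rd, mk0, setArr, List.getD_replicate, List.getElem?_replicate]
        split_ifs <;> simp
      · have := h2 c i; simpa [rd, mk0, setArr, hc] using this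
    have hcr := Exec.create (I := I) σ a e
    rw [he σ hσ] at hcr
    refine ⟨τ, _, ?_, max_le (max_le (hsize σ h1) (hsize _ hl)) hs, hv, hle, ?_, ?_, h0⟩
    · have := Exec.seq hcr hx
      rw [List.length_cons, show (l.length + 1) * (e.cost + 1) + 1 =
        e.cost + 1 + (l.length * (e.cost + 1) + 1) by ring]
      exact this
    · intro c hc
      rcases List.mem_cons.1 hc with rfl | hc
      · exact hkeep _ (by simp)
      · exact hin c hc
    · intro c hc
      exact hkeep _ (by rw [len_mk0]; split_ifs <;> simp [hc])

/-- The part `pre` computes the size while no array exists; then all arrays are created with the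
same size; the body creates none. The space is therefore k + 1 + m S, whatever the body does. -/
theorem decidesWithin_of_wp {e : Expr (k + 1) m} {S T0 T : ℕ} {pre body : Cmd (k + 1) m} {p : Prop}
    {R : (Fin (k + 1) → ℕ) → Prop} (hc0 : pre.createFree) (hc : body.createFree)
    (h₀ : wp I pre (fun σ t => R σ.var ∧ t ≤ T0) (Memory.initial (k + 1) m))
    (he : ∀ σ : Memory (k + 1) m, R σ.var → e.eval I σ = S)
    (h : ∀ σ : Memory (k + 1) m, R σ.var → (∀ a, σ.len a = S) → (∀ a i, σ.rd a i = 0) →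
      wp I body (fun τ t => (p → τ.var 0 = 1) ∧ (¬ p → τ.var 0 = 0) ∧ t ≤ T) σ)
    {T' S' : ℝ} (hT : ((T0 + (m * (e.cost + 1) + 1 + T) : ℕ) : ℝ) ≤ T')
    (hS : ((k + 1 + m * S : ℕ) : ℝ) ≤ S') (hm : pre.ma = []) :
    DecidesWithin (.seq pre (.seq (createAll e (List.finRange m)) body)) I p T' S' := by
  obtain ⟨σ0, t0, s0, hx0, hR, ht0⟩ := h₀
  have ha : ∀ a, σ0.arr a = [] := fun a => hx0.arr_eq a (by simp [hm])
  obtain ⟨σ, s, hx, hs, hv, hle, hin, _, h0⟩ := exec_createAll (I := I) (v := σ0.var)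
    (fun σ hσ => he σ (by rw [hσ]; exact hR)) (List.finRange m)
    σ0 rfl (fun a => by simp [len, ha]) (fun a i => by simp [rd, ha])
  obtain ⟨τ, t', s', hx', h1, h2, ht⟩ := h σ (by rw [hv]; exact hR)
    (fun a => hin a (by simp)) h0
  have hs' := (hx'.len_eq hc).2
  have hs0 := (hx0.len_eq hc0).2
  have hsz : σ.size = k + 1 + m * S := by
    rw [size_eq]; simp [hin]
  have hsz0 : (Memory.initial (k + 1) m).size = k + 1 := by
    rw [size_eq]; simp [initial, len]
  refine ⟨τ, _, _, .seq hx0 (.seq hx hx'), h1, h2, le_trans ?_ hT, le_trans ?_ hS⟩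
  · rw [List.length_finRange]
    exact_mod_cast Nat.add_le_add ht0 (Nat.add_le_add_left ht _)
  · rw [hs', hsz, hs0, hsz0]
    exact_mod_cast max_le (by omega) (max_le hs le_rfl)

end Tools

notation "vAns" => (0 : Fin 40)
notation "vCmp" => (1 : Fin 40)
notation "vD" => (2 : Fin 40)
notation "vPw" => (3 : Fin 40)
notation "vLet" => (4 : Fin 40)
notation "aDig" => (15 : Fin 20)
notation "aSgn" => (16 : Fin 20)

/-! ### Filling the tables and running one test -/

section Program

variable {I : Input} {N K D : ℕ}

/-- Fill the table with the values of an expression. -/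
def fillTable (e : Exp) : Prog :=
  .for vq (.var vN) <| .for vx (.var vK) <|
    .seq (.assign vLet (.iflt (.var vx) (.add (.var vD) (.const 1)) (.var vx)
      (.sub (.var vx) (.add (.var vD) (.const 1)))))
    (.write aT (.add (.mul (.var vq) (.var vK)) (.var vx)) e)

theorem wp_fillTable {e : Exp} {δ : ℕ → ℕ → ℕ} {σ : Mem} (hN : σ.var vN = N)
    (hK : σ.var vK = K) (hD : σ.var vD = D) (hl : N * K ≤ σ.len aT)
    (he : ∀ q < N, ∀ x < K, ∀ τ, Frame [vq, vx, vLet] [aT] σ τ → τ.var vq = q →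
      τ.var vLet = unflag D x → τ.var vx = x → e.eval I τ = δ q x) :
    wp I (fillTable e) (fun τ t => Frame [vq, vx, vLet] [aT] σ τ ∧
      (∀ q < N, ∀ x < K, τ.rd aT (q * K + x) = δ q x) ∧
      t ≤ N * (K * (e.cost + 50) + 20) + 10) σ := by
  -- The table is filled in row-major order. An entry among those filled so far is either an earlier
  -- one or exactly the current pair.
  have lin : ∀ q x q' x', x < K → x' < K → q * K + x < q' * K + x' + 1 →
      q * K + x < q' * K + x' ∨ q = q' ∧ x = x' := by
    intro q x q' x' hx hx' h
    by_cases hq : q = q'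
    · subst hq; omega
    · left
      by_contra hcon
      have heq : q * K + x = q' * K + x' := by omega
      have e1 : (q * K + x) / K = q := by
        rw [mul_comm, Nat.mul_add_div (by omega), Nat.div_eq_of_lt hx, add_zero]
      have e2 : (q' * K + x') / K = q' := by
        rw [mul_comm, Nat.mul_add_div (by omega), Nat.div_eq_of_lt hx', add_zero]
      exact hq (by rw [← e1, heq, e2])
  let Inv : ℕ → Mem → Prop := fun L τ => Frame [vq, vx, vLet] [aT] σ τ ∧
    ∀ q x, x < K → q * K + x < L → τ.rd aT (q * K + x) = δ q x
  refine (wp_for (H := N) (T := K * (e.cost + 50) + 8) (Inv := fun j τ => τ.var vq = j ∧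
    Inv (j * K) τ) ⟨by simp, Frame.rfl.setVar, fun q x _ h => by omega⟩
    (fun j τ h => by simp [h.2.1.var vN, hN]) (fun j τ h => h.1) ?_).mono ?_
  · rintro q τ hq ⟨h1, h2, h3⟩
    refine (wp_for (H := K) (T := e.cost + 40) (Inv := fun j τ => τ.var vx = j ∧ τ.var vq = q ∧
      Inv (q * K + j) τ) ⟨by simp, by simpa using h1, h2.setVar, h3⟩
      (fun j τ h => by simp [h.2.2.1.var vK, hK]) (fun j τ h => h.1) ?_).mono ?_
    · rintro x σ1 hx ⟨g1, g2, g3, g4⟩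
      have hu : ((iflt (.var vx) (.add (.var vD) (.const 1)) (.var vx)
          (.sub (.var vx) (.add (.var vD) (.const 1))) : Exp)).eval I σ1 = unflag D x := by
        simp [g1, g3.var vD, hD, unflag]
      have f := g3.setVar (x := vLet) (v := unflag D x)
      have hidx : q * K + x < σ1.len aT := by
        rw [g3.len]
        have : q * K + K ≤ N * K := by rw [← Nat.succ_mul]; exact Nat.mul_le_mul_right _ hq
        omega
      rw [wp_seq, wp_assign, hu, wp_write, he q hq x hx _ f (by simp [g2]) (by simp) (by simp [g1])]
      simp only [evals, var_setVar, g1, g2, g3.var vK, hK]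
      refine ⟨by simp [g1], ⟨by simp, by simp [g2], f.wr.setVar,
        fun q' x' hx' hlt => ?_⟩, by simp [iflt]; omega⟩
      rw [rd_setVar]
      simp only [Fin.reduceEq, if_false, g1, g2]
      rw [rd_wr_self (σ1.setVar vLet (unflag D x)) _ (by simpa using hidx)]
      rcases lin _ _ _ _ hx' hx (by omega) with h | ⟨rfl, rfl⟩
      · rw [update_of_ne (by omega)]; exact g4 q' x' hx' h
      · rw [update_self]
    · rintro σ1 t ⟨⟨g1, g2, g3, g4⟩, ht⟩
      refine ⟨g2, ⟨by simp, g3.setVar, ?_⟩, by simp at ht; linarith⟩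
      rw [Nat.succ_mul]; exact g4
  · rintro τ t ⟨⟨h1, h2, h3⟩, ht⟩
    refine ⟨h2, fun q hq x hx => h3 q x hx ?_, by simp at ht; linarith⟩
    have : q * K + K ≤ N * K := by rw [← Nat.succ_mul]; exact Nat.mul_le_mul_right _ hq
    omega

end Program


section Program

variable {I : Input} {N K D : ℕ}

/-- Fill the table and the accepting states, and compare the languages of the states `4 n` and
`4 n + 1`. -/
def runCheck (e f : Exp) : Prog :=
  .seq (fillTable e) <| .seq (.for vq (.var vN) (.write aF (.var vq) f)) <|
  .seq (.assign vS (.mul (.const 4) .states)) <|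
  .seq (.assign vS' (.add (.mul (.const 4) .states) (.const 1))) <|
  .seq solve (.ite (.var vres) .skip (.assign vAns (.const 0)))

/-- Runs never leave the states below N, so values of the acceptance predicate beyond them do not
matter. -/
theorem SameLanguage.congr {δ : ℕ → ℕ → ℕ} {F F' : ℕ → Prop} (hW : WeakTable N K δ F')
    (hF : ∀ q < N, F q ↔ F' q) {p q : ℕ} (hp : p < N) (hq : q < N) :
    SameLanguage K δ F p q ↔ SameLanguage K δ F' p q := by
  refine forall_congr' fun w => forall_congr' fun hw => ?_
  rw [omegaAcc_of_forall (F := F) (F' := F') (q' := p) fun i => hF _ (hW.run_lt hp hw i),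
    omegaAcc_of_forall (F := F) (F' := F') (q' := q) fun i => hF _ (hW.run_lt hq hw i)]

-- The answer is only ever reset to 0, so consecutive tests accumulate their conjunction in `vAns`.
open Classical in
theorem wp_runCheck {e f : Exp} {δ : ℕ → ℕ → ℕ} {F : ℕ → Prop} {n : ℕ} {σ : Mem}
    (hn : I.states = n) (hN : σ.var vN = 4 * n + 3)
    (hK : σ.var vK = K) (hD : σ.var vD = D) (hl : ∀ a, (4 * n + 3) * K ≤ σ.len a) (hK6 : 6 ≤ K)
    (he : ∀ q < 4 * n + 3, ∀ x < K, ∀ τ, Frame [vq, vx, vLet] [aT] σ τ → τ.var vq = q →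
      τ.var vLet = unflag D x → τ.var vx = x → e.eval I τ = δ q x)
    (hf : ∀ q < 4 * n + 3, ∀ τ : Mem, τ.var vq = q → f.eval I τ = if F q then 1 else 0)
    (hW : WeakTable (4 * n + 3) K δ F) :
    wp I (runCheck e f) (fun τ t => Frame
      [vAns, vLet, vq, vx, vS, vS', vu, vw, vr, vr', vtop, vh, vs, vm, vt, vc, vroot, vv, ve, vb, vo,
        vp, vres]
      [aT, aF, aPar, aRk, aA, aB, aCls, aI, aS, aBd, aTs, aPtr, aDeg, aOrd, aSeen] σ τ ∧
      τ.var vAns = (if SameLanguage K δ F (4 * n) (4 * n + 1) then σ.var vAns else 0) ∧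
      t ≤ (e.cost + f.cost + 5000) * ((4 * n + 3) * (K + 1) * (Nat.log 2 (4 * n + 3) + 1))) σ := by
  set N := 4 * n + 3 with hNdef
  have hNK : N * 6 ≤ N * K := Nat.mul_le_mul_left _ hK6
  rw [runCheck, wp_seq]
  refine (wp_fillTable hN hK hD (hl _) he).mono ?_
  rintro σ1 t1 ⟨f1, h₁, ht1⟩
  rw [wp_seq]
  refine (wp_fill (H := N) (g := fun q => if F q then 1 else 0)
    (fun τ h => by simp [h.var vN, f1.var vN, hN])
    (fun q hq τ _ h _ _ => hf q hq τ h) (by rw [f1.len]; have := hl aF; omega)).mono ?_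
  rintro σ2 t2 ⟨f2, h₂, _, ht2⟩
  simp only [steps]
  set σ3 := (σ2.setVar vS (Expr.eval I σ2 (.mul (.const 4) .states))) with hσ3
  set σ4 := σ3.setVar vS' (Expr.eval I σ3 (.add (.mul (.const 4) .states) (.const 1))) with hσ4
  have f4 : Frame [vq, vx, vLet, vS, vS'] [aT, aF] σ σ4 :=
    (((f1.weaken (ys := [vq, vx, vLet, vS, vS']) (bs := [aT, aF])).trans
      (f2.weaken (ys := [vq, vx, vLet, vS, vS']) (bs := [aT, aF]))).setVar).setVar
  have hFr : σ4.rd aF = σ2.rd aF := rfl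
  have hF4 : ∀ q < N, (σ4.rd aF q = 1 ↔ F q) := fun q hq => by
    rw [hFr, h₂ q hq]; split_ifs with h <;> simp [h]
  have hW4 : WeakTable N K δ (fun q => σ4.rd aF q = 1) :=
    ⟨hW.lt, fun p hp q hq a b => by rw [hF4 p hp, hF4 q hq]; exact hW.weak p hp q hq a b⟩
  refine (wp_solve (N := N) (K := K) (δ := δ) (s := 4 * n) (s' := 4 * n + 1)
    ⟨by rw [f4.var _, hN], by rw [f4.var _, hK], ?_, hW.lt,
      fun a => by rw [f4.len]; have := hl a; omega⟩
    (fun q hq => by rw [hFr, h₂ q hq]; split_ifs <;> simp) hW4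
    (by rw [f4.len]; have := hl aSeen; omega)
    (by simp [hσ4, hσ3, hn]) (by simp [hσ4, hσ3, hn]) (by omega) (by omega)).frame
    createFree_solve ?_
  · have : σ4.rd aT = σ1.rd aT := f2.rd _
    rw [this]; exact h₁
  rintro σ5 t5 f5 ⟨h1, h0, ht5⟩
  rw [SameLanguage.congr hW hF4 (by omega) (by omega)] at h1 h0
  have f5' := (f4.weaken (ys := [vAns, vLet, vq, vx, vS, vS', vu, vw, vr, vr', vtop, vh, vs, vm, vt,
        vc, vroot, vv, ve, vb, vo, vp, vres])
      (bs := [aT, aF, aPar, aRk, aA, aB, aCls, aI, aS, aBd, aTs, aPtr, aDeg, aOrd, aSeen])).trans (f5.of_solve.weaken (ys := [vAns, vLet, vq, vx, vS, vS', vu, vw,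
        vr, vr', vtop, vh, vs, vm, vt, vc, vroot, vv, ve, vb, vo, vp, vres])
      (bs := [aT, aF, aPar, aRk, aA, aB, aCls, aI, aS, aBd, aTs, aPtr, aDeg, aOrd, aSeen]))
  have hA : σ5.var vAns = σ.var vAns := by
    rw [f5.of_solve.var _, f4.var _]
  set L := Nat.log 2 N
  set P := N * (K + 1) * (L + 1) with hP
  have b1 : N * (K + 1) ≤ P := Nat.le_mul_of_pos_right _ (by omega)
  have b2 : L + 1 ≤ P := Nat.le_mul_of_pos_left _ (by positivity)
  have b3 : N * (K * (e.cost + 50) + 20) ≤ (e.cost + 50) * P := by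
    calc N * (K * (e.cost + 50) + 20) ≤ N * ((K + 1) * (e.cost + 50)) := by gcongr; nlinarith
      _ = (e.cost + 50) * (N * (K + 1)) := by ring
      _ ≤ _ := by gcongr
  have b4 : N * (f.cost + 1 + 9) ≤ (f.cost + 10) * P := by
    have : N ≤ P := le_trans (Nat.le_mul_of_pos_right _ (by omega)) b1
    calc _ ≤ P * (f.cost + 1 + 9) := by gcongr
      _ = _ := by ring
  have b5 : (e.cost + f.cost + 5000) * P =
    (e.cost + 50) * P + (f.cost + 10) * P + 4940 * P := by ring
  have b6 : 1 ≤ P := by omega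
  simp only [cost] at ht2
  rw [wp_ite, eval_var]
  by_cases hS : SameLanguage K δ F (4 * n) (4 * n + 1)
  · rw [if_neg (by rw [h1 hS]; exact one_ne_zero), wp_skip, if_pos hS]
    exact ⟨f5', hA, by simp only [cost]; omega⟩
  · rw [if_pos (h0 hS), wp_assign, if_neg hS]
    exact ⟨f5'.setVar, by simp, by simp only [cost]; omega⟩

/-- `c * states`. -/
def timesStates (c : ℕ) : Exp := .mul (.const c) .states

def sinkExpr : Exp := .add (timesStates 4) (.const 2)
def stepExpr (c : ℕ) (x : Exp) : Exp :=
  .add (timesStates c) (.trans (.sub (.var vq) (timesStates c)) x)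
def readDigit : Exp := .read aDig (.var vLet)
def maxLetterExpr : Exp := .iflt (.var vLet) (.var vD)
  (.add (.var vLet) (.mul (.sub (.sub .base (.const 1)) readDigit) (.var vPw))) (.var vLet)
def zeroLetterExpr : Exp := .iflt (.var vLet) (.var vD)
  (.sub (.var vLet) (.mul readDigit (.var vPw))) (.var vLet)

/-- The value of `f` if there is no flag, the value of `g` if there is a flag, the letter is less
than `vD` and its digit is related to the base by `r`, and the sink otherwise. -/
def flagCase (r : Exp → Exp → Exp → Exp → Exp)
    (f g : Exp) : Exp :=
  .iflt (.var vx) (.add (.var vD) (.const 1)) f <| .iflt (.var vLet) (.var vD)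
    (r (.add readDigit (.const 1)) .base g sinkExpr) sinkExpr

def carryExpr : Exp :=
  .iflt (.var vq) .states (flagCase .iflt (.trans (.var vq) (.var vx))
    (.add (timesStates 2) (.trans (.var vq) (.var vLet)))) <|
  .iflt (.var vq) (timesStates 2) (flagCase .iflt
    (.add .states (.trans (.sub (.var vq) .states) (.var vx)))
    (.add (timesStates 3) (.trans (.sub (.var vq) .states) (.add (.var vLet) (.var vPw))))) <|
  .iflt (.var vq) (timesStates 3) (stepExpr 2 maxLetterExpr) <|
  .iflt (.var vq) (timesStates 4) (stepExpr 3 zeroLetterExpr) <|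
  .ifeq (.var vq) (timesStates 4) (flagCase .ifeq (.trans .init (.var vx))
    (.add (timesStates 2) (.trans .init (.var vLet)))) <|
  .ifeq (.var vq) (.add (timesStates 4) (.const 1)) (flagCase .ifeq
    (.add .states (.trans .init (.var vx)))
    (.add (timesStates 3) (.trans .init zeroLetterExpr))) sinkExpr

def carryAccExpr : Exp :=
  .iflt (.var vq) (timesStates 2) (.const 0) <|
  .iflt (.var vq) (timesStates 3) (.acc (.sub (.var vq) (timesStates 2))) <|
  .iflt (.var vq) (timesStates 4) (.acc (.sub (.var vq) (timesStates 3))) (.const 0)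

def signExpr : Exp :=
  .iflt (.var vq) .states (.trans (.var vq) (.var vLet)) <|
  .iflt (.var vq) (timesStates 2) (.iflt (.var vLet) (.var vD)
    (.add .states (.trans (.sub (.var vq) .states) (.var vLet)))
    (.add (timesStates 2) (.trans (.sub (.var vq) .states) (.var vLet)))) <|
  .iflt (.var vq) (timesStates 3) (.iflt (.var vLet) (.var vD)
    (stepExpr 2 (.var vLet)) sinkExpr) <|
  .ifeq (.var vq) (timesStates 4) (.iflt (.var vx) (.add (.var vD) (.const 1))
    (.trans .init (.var vx)) <| .ifeq (.read aSgn (.var vLet)) (.const 1)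
    (.trans (.trans .init (.var vLet)) (.var vLet)) sinkExpr) <|
  .ifeq (.var vq) (.add (timesStates 4) (.const 1)) (.ifeq (.read aSgn (.var vLet)) (.const 1)
    (.add .states (.trans .init (.var vLet))) sinkExpr) sinkExpr

def signAccExpr : Exp :=
  .iflt (.var vq) .states (.acc (.var vq)) <| .iflt (.var vq) (timesStates 2) (.const 0) <|
  .iflt (.var vq) (timesStates 3) (.acc (.sub (.var vq) (timesStates 2))) (.const 0)

theorem eval_carryExpr {σ : Mem} {b pw q x n : ℕ} (hn : I.states = n) (hb : I.base = b)
    (hpw : σ.var vPw = pw) (hD : σ.var vD = D) (hq : σ.var vq = q) (hx : σ.var vx = x)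
    (hl : σ.var vLet = unflag D x) (hdig : ∀ y < D, σ.rd aDig y = digitOf b pw y) :
    carryExpr.eval I σ = carryTable n D b pw I.trans I.init q x := by
  subst hn hb
  by_cases h : unflag D x < D
  · simp [carryExpr, carryTable, flagCase, maxLetterExpr, zeroLetterExpr, readDigit, stepExpr,
      timesStates, sinkExpr, hpw, hD, hq, hx, hl, hdig _ h, h, maxLetter, zeroLetter]
  · simp [carryExpr, carryTable, flagCase, maxLetterExpr, zeroLetterExpr, readDigit, stepExpr,
      timesStates, sinkExpr, hpw, hD, hq, hx, hl, h, maxLetter, zeroLetter]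

theorem eval_signExpr {σ : Mem} {q x n : ℕ} (hn : I.states = n) (hD : σ.var vD = D)
    (hq : σ.var vq = q) (hx : σ.var vx = x) (hl : σ.var vLet = unflag D x) :
    signExpr.eval I σ = signTable n D I.trans I.init (σ.rd aSgn) q x := by
  subst hn
  simp [signExpr, signTable, stepExpr, timesStates, sinkExpr, hD, hq, hx, hl]

open Classical in
theorem eval_carryAccExpr {σ : Mem} {q n : ℕ} (hn : I.states = n) (hq : σ.var vq = q)
    (hacc : ∀ q, I.acc q ≤ 1) :
    carryAccExpr.eval I σ = if carryAcc n (fun q => I.acc q = 1) q then 1 else 0 := by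
  subst hn
  have h1 := hacc (q - 2 * I.states)
  have h2 := hacc (q - 3 * I.states)
  simp only [evals, carryAccExpr, eval_iflt, timesStates, hq]
  by_cases h : carryAcc I.states (fun q => I.acc q = 1) q
  · rw [if_pos h]
    unfold carryAcc at h
    split_ifs <;> omega
  · rw [if_neg h]
    unfold carryAcc at h
    split_ifs <;> omega

open Classical in
theorem eval_signAccExpr {σ : Mem} {q n : ℕ} (hn : I.states = n) (hq : σ.var vq = q)
    (hacc : ∀ q, I.acc q ≤ 1) :
    signAccExpr.eval I σ = if signAcc n (fun q => I.acc q = 1) q then 1 else 0 := by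
  subst hn
  have h1 := hacc (q - 2 * I.states)
  have h2 := hacc q
  simp only [evals, signAccExpr, eval_iflt, timesStates, hq]
  by_cases h : signAcc I.states (fun q => I.acc q = 1) q
  · rw [if_pos h]
    unfold signAcc at h
    split_ifs <;> omega
  · rw [if_neg h]
    unfold signAcc at h
    split_ifs <;> omega

/-- Programs have no division. The digit of x is instead obtained from that of x - pw by counting
cyclically, so all digits of one weight are found in one pass. -/
theorem digitOf_rec {b pw x : ℕ} (hpw : 0 < pw) (hb : 2 ≤ b) : digitOf b pw x =
    if x < pw then 0 else if digitOf b pw (x - pw) + 1 < b then digitOf b pw (x - pw) + 1 else 0 := by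
  unfold digitOf
  by_cases h : x < pw
  · simp [h, Nat.div_eq_of_lt h]
  · rw [if_neg h, Nat.div_eq_sub_div hpw (by omega), Nat.add_mod, Nat.mod_eq_of_lt (show 1 < b by omega)]
    have := Nat.mod_lt ((x - pw) / pw) (show 0 < b by omega)
    split_ifs with h'
    · exact Nat.mod_eq_of_lt h'
    · rw [show (x - pw) / pw % b + 1 = b by omega, Nat.mod_self]

def digitExpr : Exp :=
  .iflt (.var vx) (.var vPw) (.const 0) <|
  .iflt (.add (.read aDig (.sub (.var vx) (.var vPw))) (.const 1)) .base
    (.add (.read aDig (.sub (.var vx) (.var vPw))) (.const 1)) (.const 0)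

/-- Keeps the old mark only if the current digit is 0 or b-1. After all components are treated, the
mark 1 singles out the vectors of sign digits, without a separate loop over d for each letter. -/
def signDigitExpr : Exp :=
  .ifeq (.read aDig (.var vx)) (.const 0) (.read aSgn (.var vx)) <|
  .ifeq (.add (.read aDig (.var vx)) (.const 1)) .base (.read aSgn (.var vx)) (.const 0)

/-- Compare the carries in the component `vCmp`. -/
def checkComponent : Prog :=
  .seq (.for vx (.var vD) (.write aDig (.var vx) digitExpr)) <|
  .seq (.for vx (.var vD) (.write aSgn (.var vx) signDigitExpr)) <|
  .seq (runCheck carryExpr carryAccExpr) (.assign vPw (.mul (.var vPw) .base))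

/-- Compute the number of vectors of digits. -/
def countLetters : Prog :=
  .seq (.assign vD (.const 1)) (.for vCmp .dim (.assign vD (.mul (.var vD) .base)))

/-- Decide whether a weak automaton is a Real Vector Automaton. -/
def decideRVA : Prog :=
  .seq (.assign vAns (.const 1)) <| .seq (.assign vPw (.const 1)) <|
  .seq (.assign vN (.add (timesStates 4) (.const 3))) <|
  .seq (.assign vK (.mul (.const 2) (.add (.var vD) (.const 1)))) <|
  .seq (.for vx (.var vD) (.write aSgn (.var vx) (.const 1))) <|
  .seq (.for vCmp .dim checkComponent) (runCheck signExpr signAccExpr)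

end Program


/-! ### The whole program for Real Vector Automata -/

section Program

variable {I : Input} {D : ℕ}

theorem createFree_runCheck (e f : Exp) : (runCheck e f).createFree := by
  simp [runCheck, fillTable, createFree_solve]

theorem createFree_decideRVA : decideRVA.createFree := by
  simp [decideRVA, checkComponent, createFree_runCheck]

/-- The memory during the main loop of `decideRVA`; `A i` is the answer for the component `i`. -/
structure LoopState (n b D S : ℕ) (A : ℕ → Prop) (j : ℕ) (σ : Mem) : Prop where
  var_N : σ.var vN = 4 * n + 3
  var_K : σ.var vK = 2 * (D + 1)
  var_D : σ.var vD = D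
  var_Pw : σ.var vPw = b ^ j
  len : ∀ a, σ.len a = S
  sgn : ∀ x, σ.rd aSgn x ≤ 1 ∧ (σ.rd aSgn x = 1 ↔ x < D ∧ ∀ i < j,
    digitOf b (b ^ i) x = 0 ∨ digitOf b (b ^ i) x + 1 = b)
  ans : (σ.var vAns = 1 ↔ ∀ i < j, A i) ∧ σ.var vAns ≤ 1

variable {n b d : ℕ}

-- One round treats one weight b^j: it computes the digits, refines the marks of sign vectors, runs
-- the test for carries, and multiplies the weight by b. The first two tasks cost only O(D) and are
-- absorbed in the bound of the test.
open Classical in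
theorem wp_checkComponent {S j : ℕ} {A : ℕ → Prop} {σ : Mem} (hn : I.states = n)
    (hb : I.base = b) (hb2 : 2 ≤ b) (hD2 : 2 ≤ D)
    (hacc : ∀ q, I.acc q ≤ 1)
    (hW : WeakTable (4 * n + 3) (2 * (D + 1)) (carryTable n D b (b ^ j) I.trans I.init)
      (carryAcc n fun q => I.acc q = 1))
    (hA : A j ↔ SameLanguage (2 * (D + 1)) (carryTable n D b (b ^ j) I.trans I.init)
      (carryAcc n fun q => I.acc q = 1) (4 * n) (4 * n + 1))
    (hS : S = (4 * n + 3) * (2 * (D + 1))) (h : LoopState n b D S A j σ) :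
    wp I checkComponent (fun τ t => τ.var vCmp = σ.var vCmp ∧ LoopState n b D S A (j + 1) τ ∧
      t ≤ (carryExpr.cost + carryAccExpr.cost + 6000) *
        ((4 * n + 3) * (2 * (D + 1) + 1) * (Nat.log 2 (4 * n + 3) + 1))) σ := by
  have hSD : D ≤ S := by rw [hS]; nlinarith
  rw [checkComponent, wp_seq]
  refine (wp_fill (H := D) (g := digitOf b (b ^ j))
    (fun τ f => by simp [f.var vD, h.var_D]) (fun x hx τ f hvx h1 _ => ?_)
    (by rw [h.len]; exact hSD)).mono ?_
  · rw [digitOf_rec (by positivity) hb2]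
    simp only [evals, digitExpr, eval_iflt, hvx, f.var vPw, h.var_Pw, hb]
    by_cases hlt : x < b ^ j
    · simp [hlt]
    · have : 0 < b ^ j := by positivity
      rw [h1 (x - b ^ j) (by omega)]
  rintro σ1 t1 ⟨f1, h₁, _, ht1⟩
  rw [wp_seq]
  have hs1 : σ1.rd aSgn = σ.rd aSgn := f1.rd _
  refine (wp_fill (H := D) (g := fun x => if digitOf b (b ^ j) x = 0 ∨ digitOf b (b ^ j) x + 1 = b
    then σ.rd aSgn x else 0)
    (fun τ f => by simp [f.var vD, f1.var vD, h.var_D])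
    (fun x hx τ f hvx _ h2 => ?_) (by rw [f1.len, h.len]; exact hSD)).mono ?_
  · simp only [evals, signDigitExpr, eval_ifeq, hvx, f.rd aDig, h₁ x hx, h2 x le_rfl, hs1, hb]
    split_ifs <;> first | rfl | tauto
  rintro σ2 t2 ⟨f2, h₂, h2', ht2⟩
  have f₁₂ : Frame [vx] [aDig, aSgn] σ σ2 :=
    (f1.weaken (ys := [vx]) (bs := [aDig, aSgn])).trans
      (f2.weaken (ys := [vx]) (bs := [aDig, aSgn]))
  have hd2 : σ2.rd aDig = σ1.rd aDig := f2.rd _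
  rw [wp_seq]
  refine (wp_runCheck (D := D) hn (by rw [f₁₂.var _, h.var_N])
    (by rw [f₁₂.var _, h.var_K]) (by rw [f₁₂.var _, h.var_D])
    (fun a => by rw [f₁₂.len, h.len, hS]) (by omega)
    (fun q _ x _ τ f g1 g2 g3 => eval_carryExpr hn hb
      (by rw [f.var _, f₁₂.var _, h.var_Pw])
      (by rw [f.var _, f₁₂.var _, h.var_D]) g1 g3 g2
      (fun y hy => by rw [f.rd _, hd2, h₁ y hy]))
    (fun q _ τ g => eval_carryAccExpr hn g hacc) hW).mono ?_
  rintro σ3 t3 ⟨f3, hans, ht3⟩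
  rw [wp_assign]
  have hA2 : σ2.var vAns = σ.var vAns := f₁₂.var _
  rw [hA2, if_congr hA.symm rfl rfl] at hans
  refine ⟨by simp [f3.var vCmp, f₁₂.var vCmp], ⟨?_, ?_, ?_, ?_, ?_, ?_, ?_⟩, ?_⟩
  · simp [f3.var vN, f₁₂.var vN, h.var_N]
  · simp [f3.var vK, f₁₂.var vK, h.var_K]
  · simp [f3.var vD, f₁₂.var vD, h.var_D]
  · simp [f3.var vPw, f₁₂.var vPw, h.var_Pw, hb, pow_succ]
  · intro a; rw [len_setVar, f3.len, f₁₂.len, h.len]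
  · intro x
    rw [rd_setVar, f3.rd aSgn]
    obtain ⟨g1, g2⟩ := h.sgn x
    have hall : ∀ Q : ℕ → Prop, (∀ i < j + 1, Q i) ↔ (∀ i < j, Q i) ∧ Q j := fun Q => by
      simp only [Nat.lt_succ_iff_lt_or_eq, or_imp, forall_and, forall_eq]
    rw [hall]
    by_cases hx : x < D
    · rw [h₂ x hx]
      split_ifs with hc
      · exact ⟨g1, g2.trans (by tauto)⟩
      · exact ⟨by omega, iff_of_false not_false (by tauto)⟩
    · rw [h2' x (by omega), hs1]
      exact ⟨g1, g2.trans (by tauto)⟩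
  · have hall : (∀ i < j + 1, A i) ↔ (∀ i < j, A i) ∧ A j := by
      simp only [Nat.lt_succ_iff_lt_or_eq, or_imp, forall_and, forall_eq]
    rw [hall, var_setVar, if_neg (by decide), hans]
    split_ifs with hc
    · exact ⟨h.ans.1.trans (by tauto), h.ans.2⟩
    · exact ⟨iff_of_false not_false (by tauto), by omega⟩
  · simp only [cost]
    set L := Nat.log 2 (4 * n + 3)
    set P := (4 * n + 3) * (2 * (D + 1) + 1) * (L + 1) with hP
    have b1 : D ≤ P := by
      calc D ≤ 1 * (2 * (D + 1) + 1) * 1 := by omega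
        _ ≤ P := by rw [hP]; gcongr <;> omega
    have b2 : (carryExpr.cost + carryAccExpr.cost + 6000) * P =
      (carryExpr.cost + carryAccExpr.cost + 5000) * P + 1000 * P := by ring
    simp [digitExpr, signDigitExpr, iflt, ifeq] at ht1 ht2
    omega

theorem wp_countLetters (σ : Mem) : wp I countLetters (fun τ t =>
    τ.var vD = I.base ^ I.dim ∧ t ≤ 20 * I.dim + 10) σ := by
  rw [countLetters, wp_seq, wp_assign]
  refine (wp_for (H := I.dim) (T := 4) (Inv := fun j τ => τ.var vCmp = j ∧
    τ.var vD = I.base ^ j) ⟨by simp, by simp⟩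
    (fun j τ _ => rfl) (fun j τ h => h.1) ?_).mono ?_
  · rintro j τ hj ⟨h1, h3⟩
    rw [wp_assign]
    exact ⟨by simp [h1], ⟨by simp, by simp [h3, pow_succ]⟩, by simp⟩
  · rintro σ1 t1 ⟨⟨_, h⟩, ht1⟩
    exact ⟨h, by simp at ht1 ⊢; omega⟩

open Classical in
theorem wp_decideRVA (hb : 2 ≤ b) (M : DBA (Fin n) (Letter b d)) (hd : 1 ≤ d) (hM : M.Weak)
    {σ : Mem} (hl : ∀ a, σ.len a = (4 * n + 3) * (2 * (b ^ d + 1)))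
    (h0 : ∀ a i, σ.rd a i = 0) (hvD : σ.var vD = b ^ d) :
    wp M.toInput decideRVA (fun τ t => (M.IsRVA → τ.var vAns = 1) ∧ (¬ M.IsRVA → τ.var vAns = 0) ∧
      t ≤ (carryExpr.cost + carryAccExpr.cost + signExpr.cost + signAccExpr.cost + 20000) *
        (d * ((4 * n + 3) * (2 * (b ^ d + 1) + 1) * (Nat.log 2 (4 * n + 3) + 1)))) σ := by
  set I := M.toInput with hI
  set D := b ^ d with hD
  set S := (4 * n + 3) * (2 * (D + 1)) with hS
  have hn : I.states = n := rfl
  have hbase : I.base = b := rfl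
  have ht := M.toInput_trans_lt
  have hD2 : 2 ≤ D := le_trans hb (Nat.le_self_pow (by omega) b)
  let A : ℕ → Prop := fun i => SameLanguage (2 * (D + 1)) (carryTable n D b (b ^ i) I.trans I.init)
    (carryAcc n fun q => I.acc q = 1) (4 * n) (4 * n + 1)
  simp only [steps, decideRVA]
  set σ2 := ((((σ.setVar vAns _).setVar vPw _).setVar vN _).setVar vK _) with hσ2
  have f2 : Frame [vAns, vPw, vN, vK] [] σ σ2 :=
    (((Frame.rfl.setVar).setVar).setVar).setVar
  have e₂ : σ2.var vD = D ∧ σ2.var vN = 4 * n + 3 ∧ σ2.var vK = 2 * (D + 1) ∧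
      σ2.var vPw = 1 ∧ σ2.var vAns = 1 := by
    simp [hσ2, hvD, timesStates, hn, hD]
  clear_value σ2
  obtain ⟨e1, e2, e3, e4, e5⟩ := e₂
  refine (wp_fill (H := D) (g := fun _ => 1) (fun τ f => by simp [f.var vD, e1])
    (fun _ _ _ _ _ _ _ => rfl) (by rw [f2.len, hl]; nlinarith)).mono ?_
  rintro σ3 t3 ⟨f3, h₃, h3', ht3⟩
  have hW : WeakTable n (D + 1) I.trans (fun q => I.acc q = 1) := hM.weakTable
  have hL : LoopState n b D S A 0 (σ3.setVar vCmp 0) := by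
    refine ⟨?_, ?_, ?_, ?_, fun a => ?_, fun x => ?_, ?_⟩
    · simp [f3.var vN, e2]
    · simp [f3.var vK, e3]
    · simp [f3.var vD, e1]
    · simp [f3.var vPw, e4]
    · rw [len_setVar, f3.len, f2.len, hl]
    · rw [rd_setVar]
      by_cases hx : x < D
      · simp [h₃ x hx, hx]
      -- Beyond the D vectors of digits the array keeps its initial zeros, so the dot never counts
      -- as a sign.
      · rw [h3' x (by omega), f2.rd _, h0]; simp [hx]
    · simp [f3.var vAns, e5]
  refine (wp_for (H := d) (T := (carryExpr.cost + carryAccExpr.cost + 6000) *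
        ((4 * n + 3) * (2 * (D + 1) + 1) * (Nat.log 2 (4 * n + 3) + 1)))
    (Inv := fun j τ => τ.var vCmp = j ∧ LoopState n b D S A j τ) ⟨by simp, hL⟩
    (fun j τ _ => rfl) (fun j τ h => h.1) ?_).mono ?_
  · rintro j τ hj ⟨h1, h2⟩
    refine (wp_checkComponent hn hbase hb hD2 M.toInput_acc_le
      (carryTable_weak hW ht fun x hx => maxLetter_lt hb ⟨j, hj⟩ hx) Iff.rfl hS h2).mono ?_
    rintro υ t ⟨g1, g2, g3⟩
    exact ⟨by rw [g1, h1], ⟨by simp, ⟨by simpa using g2.var_N, by simpa using g2.var_K,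
      by simpa using g2.var_D, by simpa using g2.var_Pw, g2.len, g2.sgn, by simpa using g2.ans⟩⟩, g3⟩
  rintro σ4 t4 ⟨⟨_, h₄⟩, ht4⟩
  refine (wp_runCheck (D := D) hn h₄.var_N h₄.var_K h₄.var_D (fun a => (h₄.len a).ge) (by omega)
    (fun q _ x _ τ f g1 g2 g3 => by
      rw [eval_signExpr hn (by rw [f.var _, h₄.var_D]) g1 g3 g2, f.rd _])
    (fun q _ τ g => eval_signAccExpr hn g M.toInput_acc_le)
    (signTable_weak (sgn := σ4.rd aSgn) hW ht)).mono ?_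
  rintro σ5 t5 ⟨_, hans, ht5⟩
  have hiff := M.isRVA_iff hb (sgn := σ4.rd aSgn) (fun x hx => ((h₄.sgn x).2.1 hx).1) fun a => by
    rw [(h₄.sgn _).2]
    constructor
    · intro h i
      have := h.2 i i.isLt
      rw [digitOf_letterCode] at this
      unfold IsSignDigit; omega
    · refine fun h => ⟨letterCode_some_lt a, fun i hi => ?_⟩
      have := h ⟨i, hi⟩
      have e := digitOf_letterCode a ⟨i, hi⟩
      simp only at e
      rw [e]
      unfold IsSignDigit at this; omega
  have hans' : σ5.var vAns = 1 ↔ M.IsRVA := by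
    rw [hiff, hans]
    split_ifs with hs
    · rw [h₄.ans.1]; exact ⟨fun h => ⟨h, hs⟩, fun h => h.1⟩
    · exact iff_of_false not_false fun h => hs h.2
  have hle : σ5.var vAns ≤ 1 := by
    rw [hans]; split_ifs
    · exact h₄.ans.2
    · omega
  refine ⟨hans'.2, fun h => ?_, ?_⟩
  · have := mt hans'.1 h; omega
  · set L := Nat.log 2 (4 * n + 3)
    set P := (4 * n + 3) * (2 * (D + 1) + 1) * (L + 1) with hP
    have b1 : D + 1 ≤ P := by
      calc D + 1 ≤ 1 * (2 * (D + 1) + 1) * 1 := by omega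
        _ ≤ P := by rw [hP]; gcongr <;> omega
    have b2 : P ≤ d * P := Nat.le_mul_of_pos_left _ (by omega)
    have b3 : d ≤ d * P := Nat.le_mul_of_pos_right _ (by omega)
    have e1 : d * ((carryExpr.cost + carryAccExpr.cost + 6000) * P + 1 + 7) =
      (carryExpr.cost + carryAccExpr.cost + 6000) * (d * P) + 8 * d := by ring
    have e2 : (signExpr.cost + signAccExpr.cost + 5000) * P ≤
      (signExpr.cost + signAccExpr.cost + 5000) * (d * P) := by gcongr
    have e3 : (carryExpr.cost + carryAccExpr.cost + signExpr.cost + signAccExpr.cost + 20000) *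
      (d * P) = (carryExpr.cost + carryAccExpr.cost + 6000) * (d * P) +
      (signExpr.cost + signAccExpr.cost + 5000) * (d * P) + 9000 * (d * P) := by ring
    simp only [cost, timesStates] at ht3 ht4 ⊢
    rw [e3]
    rw [e1] at ht4
    generalize carryExpr.cost = c1, carryAccExpr.cost = c2, signExpr.cost = c3, signAccExpr.cost = c4 at *
    omega

/-- 4n + 3 ≤ (n + 1)^3 for n ≥ 1, and log 2 ≤ log (n + 1) absorbs the summand 1. -/
theorem log_bound {n : ℕ} (hn : 1 ≤ n) :
    ((Nat.log 2 (4 * n + 3) : ℕ) : ℝ) + 1 ≤ 8 * Real.log (n + 1) := by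
  have h1 : (2 : ℝ) ^ Nat.log 2 (4 * n + 3) ≤ ((n : ℝ) + 1) ^ 3 := by
    have h2 : 2 ^ Nat.log 2 (4 * n + 3) ≤ (n + 1) ^ 3 :=
      (Nat.pow_log_le_self 2 (by omega)).trans (by nlinarith [Nat.mul_le_mul hn hn])
    exact_mod_cast h2
  have h3 := Real.log_le_log (by positivity) h1
  rw [Real.log_pow, Real.log_pow] at h3
  have h4 : Real.log 2 ≤ Real.log (n + 1) :=
    Real.log_le_log (by norm_num) (by have : (1 : ℝ) ≤ n := by exact_mod_cast hn
                                      linarith)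
  have h5 := Real.log_two_gt_d9
  push_cast at h3
  have h6 : (0 : ℝ) ≤ Nat.log 2 (4 * n + 3) := by positivity
  nlinarith

/-- All 20 arrays get the size (4n + 3) · 2(b^d + 1) of the transition table, which is O(n b^d). The
d + 1 tests reuse them. -/
theorem exists_decidesRVA : ∃ (k m : ℕ) (P : Cmd (k + 1) m) (C : ℝ),
    ∀ (b d n : ℕ), 2 ≤ b → 1 ≤ d → ∀ M : DBA (Fin n) (Letter b d), M.Weak →
      DecidesWithin P M.toInput M.IsRVA
        (C * (n * Real.log (n + 1) * d * (b : ℝ) ^ d)) (C * (n * (b : ℝ) ^ d)) := by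
  obtain ⟨c, hc⟩ : ∃ c : ℕ, carryExpr.cost + carryAccExpr.cost + signExpr.cost +
    signAccExpr.cost + 20000 = c := ⟨_, rfl⟩
  refine ⟨39, 20, .seq countLetters (.seq (createAll (.mul (.add (timesStates 4) (.const 3))
    (.mul (.const 2) (.add (.var vD) (.const 1)))) (List.finRange 20)) decideRVA),
    1000 * (c + 1000), fun b d n hb hd M hM => ?_⟩
  have hD : 2 ≤ b ^ d := le_trans hb (Nat.le_self_pow (by omega) b)
  have hn : 1 ≤ n := M.init.pos
  have hnR : (1 : ℝ) ≤ n := by exact_mod_cast hn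
  have hDR : (2 : ℝ) ≤ (b : ℝ) ^ d := by exact_mod_cast hD
  have hdR : (1 : ℝ) ≤ d := by exact_mod_cast hd
  have hlog := log_bound hn
  have hlog1 : 1 ≤ 8 * Real.log (n + 1) := by
    have : (0 : ℝ) ≤ Nat.log 2 (4 * n + 3) := by positivity
    linarith
  refine decidesWithin_of_wp (k := 39) (T0 := 20 * d + 10) (S := (4 * n + 3) * (2 * (b ^ d + 1)))
    (R := fun v => v vD = b ^ d) (by simp [countLetters]) createFree_decideRVA (wp_countLetters _)
    (fun σ h => by simp [timesStates, h, DBA.toInput]) (fun σ h1 h2 h3 => wp_decideRVA hb M hd hM h2 h3 h1)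
    ?_ ?_ (by simp [countLetters])
  · rw [hc]
    simp only [timesStates, cost]
    push_cast
    have e1 : (4 * (n : ℝ) + 3) ≤ 7 * n := by linarith
    have e2 : 2 * ((b : ℝ) ^ d + 1) + 1 ≤ 4 * (b : ℝ) ^ d := by linarith
    have e3 : (d : ℝ) * ((4 * n + 3) * (2 * ((b : ℝ) ^ d + 1) + 1) * (Nat.log 2 (4 * n + 3) + 1)) ≤
        d * ((7 * n) * (4 * (b : ℝ) ^ d) * (8 * Real.log (n + 1))) := by
      gcongr
    set X := (n : ℝ) * Real.log (n + 1) * d * (b : ℝ) ^ d with hX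
    have e4 : (d : ℝ) * ((7 * n) * (4 * (b : ℝ) ^ d) * (8 * Real.log (n + 1))) = 224 * X := by
      rw [hX]; ring
    have e5 : (d : ℝ) ≤ 8 * X := by
      calc (d : ℝ) = 1 * 1 * d * 1 := by ring
        _ ≤ n * (8 * Real.log (n + 1)) * d * (b : ℝ) ^ d := by gcongr; linarith
        _ = _ := by rw [hX]; ring
    have hc0 : (0 : ℝ) ≤ c := by positivity
    have e6 := mul_le_mul_of_nonneg_left (e3.trans e4.le) hc0
    have hX0 : 0 ≤ X := by linarith
    nlinarith [mul_nonneg hc0 hX0]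
  · push_cast
    have hc0 : (0 : ℝ) ≤ c := by positivity
    have e1 : (1 : ℝ) ≤ n * (b : ℝ) ^ d := by nlinarith
    have e2 : (4 * (n : ℝ) + 3) * (2 * ((b : ℝ) ^ d + 1)) ≤ (7 * n) * (4 * (b : ℝ) ^ d) := by
      exact mul_le_mul (by linarith) (by linarith) (by positivity) (by positivity)
    nlinarith [mul_nonneg hc0 (show (0 : ℝ) ≤ n * (b : ℝ) ^ d by linarith)]

end Program


/-! ## A criterion for minimal automata in one dimension -/

/-- The first `p` letters of `X`, followed by `Y`. -/
def splice (X : ℕ → ℕ) (p : ℕ) (Y : ℕ → ℕ) (j : ℕ) : ℕ := if j < p then X j else Y (j - p)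

/-- The word `c … c ⋆ c c c …` with the separator `b` at the position `l`. -/
def dotWord (b c l j : ℕ) : ℕ := if j = l then b else c

/-! ### Spliced words and words with one dot -/

section Words

variable {t : ℕ → ℕ → ℕ} {F : ℕ → Prop} {b : ℕ}

theorem omegaRun_splice (q : ℕ) (X Y : ℕ → ℕ) {i p : ℕ} (h : i ≤ p) :
    omegaRun t q (splice X p Y) i = omegaRun t q X i :=
  omegaRun_congr fun j hj => if_pos (by omega)

theorem omegaAcc_splice (q : ℕ) (X : ℕ → ℕ) (p : ℕ) (Y : ℕ → ℕ) :
    OmegaAcc t F q (splice X p Y) ↔ OmegaAcc t F (omegaRun t q X p) Y := by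
  rw [omegaAcc_tail t F q _ p, omegaRun_splice q X Y le_rfl]
  simp [splice]

theorem omegaAcc_cons (q x : ℕ) (Y : ℕ → ℕ) :
    OmegaAcc t F q (splice (fun _ => x) 1 Y) ↔ OmegaAcc t F (t q x) Y :=
  omegaAcc_splice q _ 1 Y

theorem splice_lt {X Y : ℕ → ℕ} {K : ℕ} (hX : ∀ j, X j < K) (hY : ∀ j, Y j < K) (p j : ℕ) :
    splice X p Y j < K := by
  unfold splice; split_ifs
  exacts [hX _, hY _]

theorem dotWord_lt {c : ℕ} (hc : c < b) (l j : ℕ) : dotWord b c l j < b + 1 := by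
  unfold dotWord; split_ifs <;> omega

theorem omegaAcc_dotWord_zero (q c : ℕ) :
    OmegaAcc t F q (dotWord b c 0) ↔ OmegaAcc t F (t q b) (fun _ => c) := by
  rw [omegaAcc_tail t F q _ 1]
  have : (fun k => dotWord b c 0 (1 + k)) = fun _ => c := by funext k; simp [dotWord]
  rw [this]; rfl

theorem omegaAcc_dotWord_succ (q c l : ℕ) :
    OmegaAcc t F q (dotWord b c (l + 1)) ↔ OmegaAcc t F (t q c) (dotWord b c l) := by
  rw [omegaAcc_tail t F q _ 1]
  have : (fun k => dotWord b c (l + 1) (1 + k)) = dotWord b c l := by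
    funext k; simp [dotWord, show 1 + k = l + 1 ↔ k = l by omega]
  rw [this]; simp [omegaRun, dotWord]

end Words

/-! ### The local criterion and its equivalence with saturation -/

section Criterion

variable (n b : ℕ) (t : ℕ → ℕ → ℕ) (F : ℕ → Prop) (s0 : ℕ)

/-- A rejecting state without outgoing transitions to other states. -/
def IsSink (q : ℕ) : Prop := ¬ F q ∧ ∀ x < b + 1, t q x = q

/-- A graph on the states before the dot, the states after the dot (shifted by `n`), and a root
`2 n` in the role of the initial state. -/
def dotGraph (v x : ℕ) : ℕ :=
  if v < n then if x < b then t v x else n + t v b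
  else if v < 2 * n then if x < b then n + t (v - n) x else v
  else if x < b then t s0 x else v

/-- The successor by the digit `0` for the node `q < n`, by the digit `b - 1` for `n + q`. -/
def extremeStep (v : ℕ) : ℕ := if v < n then t v 0 else n + t (v - n) (b - 1)

/-- The successor by the dot, in both halves of the nodes. -/
def dotStep (v : ℕ) : ℕ := if v < n then t v b else n + t (v - n) b

/-- Acceptance of `0 0 0 …` from the node `q < n`, of `(b-1) (b-1) (b-1) …` from `n + q`. -/
def NodeAcc (v : ℕ) : Prop :=
  if v < n then OmegaAcc t F v (fun _ => 0) else OmegaAcc t F (v - n) (fun _ => b - 1)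

/-- The same words `c … c ⋆ c c c …` are accepted from the two nodes. -/
def SameLabel (u v : ℕ) : Prop := ∀ l,
  NodeAcc n b t F (dotStep n b t ((extremeStep n b t)^[l] u)) ↔
    NodeAcc n b t F (dotStep n b t ((extremeStep n b t)^[l] v))

/-- The conditions that the program checks. -/
structure LocalCriterion : Prop where
  first : ∀ x < b + 1, x ≠ 0 → x ≠ b - 1 → IsSink b t F (t s0 x)
  twice : ∀ x, x = 0 ∨ x = b - 1 → t (t s0 x) x = t s0 x
  start : SameLabel n b t F (n + t s0 (b - 1)) (t s0 0)
  digits : ∀ q < n, Reach (b + 1) (dotGraph n b t s0) (2 * n) q → ∀ w : ℕ → ℕ, (∀ j, w j < b) →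
    ¬ OmegaAcc t F q w
  int_carry : ∀ q < n, Reach (b + 1) (dotGraph n b t s0) (2 * n) q → ∀ x, x + 1 < b →
    SameLabel n b t F (n + t q x) (t q (x + 1))
  dot : ∀ q < n, Reach (b + 1) (dotGraph n b t s0) (2 * n) (n + q) → IsSink b t F (t q b)
  frac_carry : ∀ q < n, Reach (b + 1) (dotGraph n b t s0) (2 * n) (n + q) → ∀ x, x + 1 < b →
    (NodeAcc n b t F (n + t q x) ↔ NodeAcc n b t F (t q (x + 1)))

variable {n b t F s0}

theorem IsSink.not_acc {q : ℕ} (h : IsSink b t F q) {w : ℕ → ℕ} (hw : ∀ j, w j < b + 1) :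
    ¬ OmegaAcc t F q w := by
  have : ∀ i, omegaRun t q w i = q := fun i => by
    induction i with
    | zero => rfl
    | succ i ih => rw [omegaRun, ih, h.2 _ (hw i)]
  exact not_omegaAcc_of_forall 0 fun i _ => by rw [this]; exact h.1

variable (hmin : ∀ p < n, ∀ q < n, SameLanguage (b + 1) t F p q → p = q) (ht : ∀ q x, t q x < n)

-- All states that reject every word have the same language, hence by minimality they are one state.
-- It contains its own successors, and if it were accepting, it would accept.
include hmin ht in
theorem isSink_of_forall {q : ℕ} (hq : q < n)
    (h : ∀ w : ℕ → ℕ, (∀ j, w j < b + 1) → ¬ OmegaAcc t F q w) : IsSink b t F q := by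
  have hx : ∀ x < b + 1, t q x = q := fun x hx => hmin _ (ht _ _) _ hq fun w hw =>
    iff_of_false (fun ha => h _ (splice_lt (fun _ => hx) hw 1) ((omegaAcc_cons q x w).2 ha)) (h w hw)
  refine ⟨fun hF => h (fun _ => 0) (fun _ => by omega) ?_, hx⟩
  have : ∀ i, omegaRun t q (fun _ => 0) i = q := fun i => by
    induction i with
    | zero => rfl
    | succ i ih => rw [omegaRun, ih, hx _ (by omega)]
  exact Filter.Frequently.of_forall fun i => by rw [this]; exact hF

-- Reading c^l ⋆ c c c … follows the extreme successor l times, then the dot, and then asks for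
-- acceptance of the constant word. The half of the node set records whether c is 0 or b-1, and both
-- steps stay in their half.
include ht in
theorem nodeAcc_iterate {c q : ℕ} (hc : c = 0 ∨ c = b - 1) (hq : q < n) (l : ℕ) :
    NodeAcc n b t F (dotStep n b t ((extremeStep n b t)^[l] (if c = 0 then q else n + q))) ↔
      OmegaAcc t F q (dotWord b c l) := by
  induction l generalizing q with
  | zero =>
    rw [omegaAcc_dotWord_zero]
    by_cases h0 : c = 0
    · simp [h0, dotStep, NodeAcc, hq, ht]
    · simp [h0, dotStep, NodeAcc, ← hc.resolve_left h0]
  | succ l ih =>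
    rw [omegaAcc_dotWord_succ, ← ih (ht _ _), iterate_succ_apply]
    by_cases h0 : c = 0
    · simp [h0, extremeStep, hq]
    · simp [h0, extremeStep, ← hc.resolve_left h0]

include ht in
theorem sameLabel_iff (hb : 2 ≤ b) {p q : ℕ} (hp : p < n) (hq : q < n) :
    SameLabel n b t F (n + p) q ↔
      ∀ l, OmegaAcc t F p (dotWord b (b - 1) l) ↔ OmegaAcc t F q (dotWord b 0 l) := by
  refine forall_congr' fun l => ?_
  rw [← nodeAcc_iterate ht (Or.inl rfl) hq, ← nodeAcc_iterate ht (Or.inr rfl) hp,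
    if_neg (by omega), if_pos rfl]

theorem frac_carry_iff {p q : ℕ} (hq : q < n) :
    (NodeAcc n b t F (n + p) ↔ NodeAcc n b t F q) ↔
      (OmegaAcc t F p (fun _ => b - 1) ↔ OmegaAcc t F q (fun _ => 0)) := by
  simp [NodeAcc, hq]

/-- The words with exactly one dot, at the position `r`. -/
def DotAt (b r : ℕ) (X : ℕ → ℕ) : Prop := ∀ j, X j < b ↔ j ≠ r

/-- The root is kept apart from the node of `s0`, since only states reached after at least one
letter are to be tested. The dot as a first letter contributes nothing and is turned into a loop. -/
theorem dotGraph_root {x : ℕ} : dotGraph n b t s0 (2 * n) x = if x < b then t s0 x else 2 * n := by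
  simp [dotGraph, show ¬ 2 * n < n ∨ n = 0 by omega, show ¬ 2 * n < n by omega]

theorem reach_root {x : ℕ} (hx : x < b) :
    Reach (b + 1) (dotGraph n b t s0) (2 * n) (t s0 x) :=
  Relation.ReflTransGen.single ⟨x, by omega, by simp [dotGraph_root, hx]⟩

include ht in
theorem reach_int {X : ℕ → ℕ} {p : ℕ} (hX : ∀ j < p, X j < b) (hp : 1 ≤ p) :
    Reach (b + 1) (dotGraph n b t s0) (2 * n) (omegaRun t s0 X p) := by
  induction p, hp using Nat.le_induction with
  | base => exact reach_root (hX 0 (by omega))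
  | succ p hp ih =>
    refine (ih fun j hj => hX j (by omega)).tail ⟨X p, by have := hX p (by omega); omega, ?_⟩
    have : omegaRun t s0 X p < n := by
      obtain ⟨k, rfl⟩ := Nat.exists_eq_add_of_le' hp; exact ht _ _
    simp [dotGraph, this, hX p, omegaRun]

include ht in
theorem reach_frac {X : ℕ → ℕ} {r p : ℕ} (hX : ∀ j < p, X j < b ↔ j ≠ r)
    (hX' : ∀ j, X j < b + 1) (hr : 1 ≤ r) (hp : r < p) :
    Reach (b + 1) (dotGraph n b t s0) (2 * n) (n + omegaRun t s0 X p) := by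
  induction p, hp using Nat.le_induction with
  | base =>
    refine (reach_int ht (p := r) (fun j hj => (hX j (by omega)).2 (by omega)) hr).tail
      ⟨b, by omega, ?_⟩
    have : omegaRun t s0 X r < n := by
      obtain ⟨k, rfl⟩ := Nat.exists_eq_add_of_le' hr; exact ht _ _
    have e : X r = b := by have := hX r (by omega); have := hX' r; omega
    simp [dotGraph, this, omegaRun, e]
  | succ p hp ih =>
    have hb := (hX p (by omega)).2 (by omega)
    refine (ih fun j hj => hX j (by omega)).tail ⟨X p, by omega, ?_⟩
    have : omegaRun t s0 X p < n := by
      obtain ⟨k, rfl⟩ : ∃ k, p = k + 1 := ⟨p - 1, by omega⟩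
      exact ht _ _
    simp [dotGraph, show n + omegaRun t s0 X p < 2 * n by omega, hb, omegaRun]

-- Nodes of the first half are states after a non-empty word of digits, nodes of the second half
-- those after a word with exactly one dot, which is not its first letter. The witnesses are
-- infinite words, so that they can be continued by splicing.
include ht in
theorem exists_word_of_reach (hb : 2 ≤ b) {v : ℕ}
    (h : Reach (b + 1) (dotGraph n b t s0) (2 * n) v) :
    v = 2 * n ∨ (v < n ∧ ∃ X p, 1 ≤ p ∧ (∀ j, X j < b) ∧ v = omegaRun t s0 X p) ∨
      ∃ X r p, 1 ≤ r ∧ r < p ∧ DotAt b r X ∧ (∀ j, X j < b + 1) ∧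
        v = n + omegaRun t s0 X p ∧ omegaRun t s0 X p < n := by
  have key : ∀ (X Y : ℕ → ℕ) p, omegaRun t s0 (splice X p Y) (p + 1) = t (omegaRun t s0 X p) (Y 0) :=
    fun X Y p => by rw [omegaRun, omegaRun_splice _ _ _ le_rfl]; simp [splice]
  induction h with
  | refl => exact Or.inl rfl
  | tail _ h ih =>
    obtain ⟨x, hx, rfl⟩ := h
    rcases ih with rfl | ⟨hv, X, p, hp, hX, rfl⟩ | ⟨X, r, p, hr, hrp, hd, hX, rfl, hv⟩
    · by_cases h : x < b
      · exact Or.inr (Or.inl ⟨by simp [dotGraph_root, h, ht],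
          fun _ => x, 1, le_rfl, fun _ => h, by simp [dotGraph_root, h, omegaRun]⟩)
      · exact Or.inl (by simp [dotGraph_root, h])
    · by_cases h : x < b
      · exact Or.inr (Or.inl ⟨by simp [dotGraph, h, hv, ht], splice X p fun _ => x, p + 1, by omega,
          splice_lt hX (fun _ => h) p, by simp [dotGraph, h, hv, key]⟩)
      · refine Or.inr (Or.inr ⟨splice X p (dotWord b 0 0), p, p + 1, hp, by omega, fun j => ?_,
          splice_lt (fun j => (hX j).trans (by omega)) (dotWord_lt (by omega) 0) p, ?_, ?_⟩)
        · unfold splice dotWord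
          split_ifs with h1 h2
          · exact iff_of_true (hX j) (by omega)
          · exact iff_of_false (by omega) (by omega)
          · exact iff_of_true (by omega) (by omega)
        · simp [dotGraph, h, hv, key, dotWord]
        · rw [key]; exact ht _ _
    · by_cases h : x < b
      · refine Or.inr (Or.inr ⟨splice X p fun _ => x, r, p + 1, hr, by omega, fun j => ?_,
          splice_lt hX (fun _ => by omega) p, ?_, ?_⟩)
        · unfold splice
          split_ifs with h1
          · exact hd j
          · exact iff_of_true h (by omega)
        · simp [dotGraph, h, show n + omegaRun t s0 X p < 2 * n by omega, key]
        · rw [key]; exact ht _ _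
      · exact Or.inr (Or.inr ⟨X, r, p, hr, hrp, hd, hX,
          by simp [dotGraph, h, show n + omegaRun t s0 X p < 2 * n by omega], hv⟩)

/-- The conditions of saturation for words of letter numbers. -/
structure WordCriterion (b : ℕ) (t : ℕ → ℕ → ℕ) (F : ℕ → Prop) (s0 : ℕ) : Prop where
  encoding : ∀ X : ℕ → ℕ, (∀ j, X j < b + 1) → OmegaAcc t F s0 X →
    (X 0 = 0 ∨ X 0 = b - 1) ∧ ∃ p, DotAt b p X
  sign : ∀ X : ℕ → ℕ, (∀ j, X j < b + 1) → X 0 = 0 ∨ X 0 = b - 1 →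
    (OmegaAcc t F s0 X ↔ OmegaAcc t F s0 (fun j => X (j - 1)))
  carry : ∀ X : ℕ → ℕ, (∀ j, X j < b + 1) → ∀ p, CanCarry b b 1 p (X p) →
    (OmegaAcc t F s0 (carryMax b b 1 p X) ↔ OmegaAcc t F s0 (carryZero b b 1 p X))

theorem maxLetter_one {x : ℕ} (hx : x < b + 1) : maxLetter b b 1 x = if x < b then b - 1 else b := by
  unfold maxLetter digitOf
  split_ifs with h
  · rw [Nat.div_one, Nat.mod_eq_of_lt h]; omega
  · omega

theorem zeroLetter_one {x : ℕ} (hx : x < b + 1) : zeroLetter b b 1 x = if x < b then 0 else b := by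
  unfold zeroLetter digitOf
  split_ifs with h
  · rw [Nat.div_one, Nat.mod_eq_of_lt h]; omega
  · omega

theorem canCarry_one {p x : ℕ} : CanCarry b b 1 p x ↔ x < b ∧ if p = 0 then x + 1 = b else x + 1 < b := by
  refine and_congr_right fun h => ?_
  rw [digitOf, Nat.div_one, Nat.mod_eq_of_lt h]

/-- The acceptance of the two words of a carry, from the state before the carry. -/
theorem omegaAcc_carry {X : ℕ → ℕ} (hX : ∀ j, X j < b + 1) {p : ℕ} :
    (OmegaAcc t F s0 (carryMax b b 1 p X) ↔ OmegaAcc t F (t (omegaRun t s0 X p) (X p))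
      (fun k => if X (p + 1 + k) < b then b - 1 else b)) ∧
    (OmegaAcc t F s0 (carryZero b b 1 p X) ↔ OmegaAcc t F (t (omegaRun t s0 X p)
      (if p = 0 then zeroLetter b b 1 (X p) else X p + 1))
      (fun k => if X (p + 1 + k) < b then 0 else b)) := by
  constructor
  · rw [omegaAcc_tail t F s0 _ (p + 1), omegaRun]
    have e1 : omegaRun t s0 (carryMax b b 1 p X) p = omegaRun t s0 X p :=
      omegaRun_congr fun i hi => by simp [carryMax, hi.le]
    have e2 : (fun k => carryMax b b 1 p X (p + 1 + k)) =
        fun k => if X (p + 1 + k) < b then b - 1 else b := by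
      funext k; rw [carryMax, if_neg (by omega), maxLetter_one (hX _)]
    rw [e1, e2, show carryMax b b 1 p X p = X p by simp [carryMax]]
  · rw [omegaAcc_tail t F s0 _ (p + 1), omegaRun]
    have e1 : omegaRun t s0 (carryZero b b 1 p X) p = omegaRun t s0 X p :=
      omegaRun_congr fun i hi => by simp [carryZero, hi]
    have e2 : (fun k => carryZero b b 1 p X (p + 1 + k)) =
        fun k => if X (p + 1 + k) < b then 0 else b := by
      funext k
      rw [carryZero, if_neg (by omega), if_neg (by omega), zeroLetter_one (hX _)]
    rw [e1, e2, show carryZero b b 1 p X p = if p = 0 then zeroLetter b b 1 (X p) else X p + 1 by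
      simp [carryZero]]

/-- Here dimension one enters: after a carry every digit is forced to be `c`, so only the distance
to the dot is left free, and none at all once the dot has passed. -/
theorem DotAt.carry_tail {r p c : ℕ} {X : ℕ → ℕ} (hd : DotAt b r X) (hp : X p < b) :
    (fun k => if X (p + 1 + k) < b then c else b) =
      if p < r then dotWord b c (r - p - 1) else fun _ => c := by
  have hne : p ≠ r := (hd p).1 hp
  split_ifs with h
  · funext k
    simp only [dotWord, hd (p + 1 + k)]
    by_cases hk : p + 1 + k = r
    · rw [if_neg (by omega), if_pos (by omega)]
    · rw [if_pos hk, if_neg (by omega)]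
  · funext k
    rw [if_pos ((hd _).2 (by omega))]

variable (hs : s0 < n)

-- Each way of violating the conditions on words leads to a reachable state at which a local
-- condition fails. Minimality plays no part in this direction.
include hs ht in
theorem WordCriterion.of_local (hb : 2 ≤ b) (h : LocalCriterion n b t F s0) :
    WordCriterion b t F s0 := by
  have hrun : ∀ X p, omegaRun t s0 X p < n := fun X p => by
    cases p
    exacts [hs, ht _ _]
  have henc : ∀ X : ℕ → ℕ, (∀ j, X j < b + 1) → OmegaAcc t F s0 X →
      (X 0 = 0 ∨ X 0 = b - 1) ∧ ∃ p, DotAt b p X := by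
    intro X hX hacc
    -- Any other first letter, including the dot, leads to a sink.
    have h0 : X 0 = 0 ∨ X 0 = b - 1 := by
      by_contra hc
      push Not at hc
      exact (h.first _ (hX 0) hc.1 hc.2).not_acc (fun j => hX (1 + j))
        ((omegaAcc_tail t F s0 X 1).1 hacc)
    refine ⟨h0, ?_⟩
    by_cases hdot : ∃ r, ¬ X r < b
    · classical
      set r := Nat.find hdot with hr
      have hr1 : ¬ X r < b := Nat.find_spec hdot
      have hr0 : 1 ≤ r := by
        by_contra hc
        rw [show r = 0 by omega] at hr1; omega
      have hlt : ∀ j < r, X j < b := fun j hj => not_not.1 (Nat.find_min hdot hj)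
      refine ⟨r, ?_⟩
      by_contra hc
      have hdot' : ∃ p, r < p ∧ ¬ X p < b := by
        by_contra hc'
        push Not at hc'
        refine hc fun j => ?_
        rcases lt_trichotomy j r with hj | hj | hj
        · exact iff_of_true (hlt j hj) hj.ne
        · exact iff_of_false (hj ▸ hr1) (by omega)
        · exact iff_of_true (hc' j hj) hj.ne'
      -- At the second dot the state before it is reachable in the second half, where the dot leads
      -- to a sink.
      set p := Nat.find hdot' with hp
      obtain ⟨hp1, hp2⟩ : r < p ∧ ¬ X p < b := Nat.find_spec hdot'
      have hreach := reach_frac ht (s0 := s0) (p := p) (r := r) (fun j hj => by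
        rcases lt_trichotomy j r with hj' | hj' | hj'
        · exact iff_of_true (hlt j hj') hj'.ne
        · exact iff_of_false (hj' ▸ hr1) (by omega)
        · have := Nat.find_min hdot' hj
          exact iff_of_true (by tauto) hj'.ne') hX hr0 hp1
      have e : X p = b := by have := hX p; omega
      refine (h.dot _ (hrun X p) hreach).not_acc (fun j => hX (p + 1 + j)) ?_
      have := (omegaAcc_tail t F s0 X (p + 1)).1 hacc
      rwa [omegaRun, e] at this
    -- A word without a dot consists of digits only and is rejected from the state after its first
    -- letter.
    · push Not at hdot
      exact absurd ((omegaAcc_tail t F s0 X 1).1 hacc)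
        (h.digits _ (hrun X 1) (reach_int ht (fun j _ => hdot j) le_rfl) _ fun j => hdot _)
  refine ⟨henc, fun X hX h0 => ?_, fun X hX p hp => ?_⟩
  · rw [omegaAcc_tail t F s0 X 1, omegaAcc_tail t F s0 _ 2]
    have e : (fun k => X (2 + k - 1)) = fun k => X (1 + k) := by
      funext k; rw [show 2 + k - 1 = 1 + k by omega]
    have := h.twice _ h0
    simp only [omegaRun, Nat.sub_zero, show (0 + 1 - 1) = 0 from rfl, e, this]
  · obtain ⟨h1, h2⟩ := omegaAcc_carry (t := t) (F := F) (s0 := s0) hX (p := p)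
    obtain ⟨hpb, hp'⟩ := canCarry_one.1 hp
    by_cases hd : ∃ r, DotAt b r X
    · obtain ⟨r, hd⟩ := hd
      rw [h1, h2, hd.carry_tail hpb, hd.carry_tail hpb]
      have hne : p ≠ r := (hd p).1 hpb
      by_cases hp0 : p = 0
      · subst hp0
        rw [if_pos rfl, zeroLetter_one (hX _), if_pos hpb, if_pos (by omega), if_pos (by omega)]
        rw [if_pos rfl] at hp'
        rw [show X 0 = b - 1 by omega]
        exact (sameLabel_iff ht hb (ht _ _) (ht _ _)).1 h.start _
      · rw [if_neg hp0]
        rw [if_neg hp0] at hp'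
        by_cases hpr : p < r
        · rw [if_pos hpr, if_pos hpr]
          exact (sameLabel_iff ht hb (ht _ _) (ht _ _)).1 (h.int_carry _ (hrun X p)
            (reach_int ht (fun j hj => (hd j).2 (by omega)) (by omega)) _ hp') _
        · rw [if_neg hpr, if_neg hpr]
          -- If the dot is the first letter, both words have already been caught in a sink and are
          -- rejected.
          by_cases hr0 : r = 0
          · have hsink := h.first (X 0) (hX 0) (by have := hd 0; omega) (by have := hd 0; omega)
            have : ∀ m, 1 ≤ m → omegaRun t s0 X m = t s0 (X 0) := fun m hm => by
              induction m, hm using Nat.le_induction with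
              | base => rfl
              | succ m _ ih => rw [omegaRun, ih, hsink.2 _ (hX _)]
            rw [this p (by omega), hsink.2 _ (hX _), hsink.2 _ (by omega)]
            exact iff_of_false (hsink.not_acc fun _ => by omega) (hsink.not_acc fun _ => by omega)
          · exact (frac_carry_iff (ht _ _)).1 (h.frac_carry _ (hrun X p)
              (reach_frac ht (fun j _ => hd j) hX (by omega) (by omega)) _ hp')
    -- Both words of the carry have their dots exactly where `X` has them. If `X` does not have
    -- exactly one, neither word is an encoding and both are rejected.
    · have hml : ∀ x, x < b + 1 → (maxLetter b b 1 x < b ↔ x < b) ∧ maxLetter b b 1 x < b + 1 :=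
        fun x hx => by rw [maxLetter_one hx]; split_ifs <;> omega
      have hzl : ∀ x, x < b + 1 → (zeroLetter b b 1 x < b ↔ x < b) ∧ zeroLetter b b 1 x < b + 1 :=
        fun x hx => by rw [zeroLetter_one hx]; split_ifs <;> omega
      have e1 : ∀ j, (carryMax b b 1 p X j < b ↔ X j < b) ∧ carryMax b b 1 p X j < b + 1 := fun j => by
        unfold carryMax; split_ifs
        · exact ⟨Iff.rfl, hX j⟩
        · exact hml _ (hX j)
      have e2 : ∀ j, (carryZero b b 1 p X j < b ↔ X j < b) ∧ carryZero b b 1 p X j < b + 1 := fun j => by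
        unfold carryZero; split_ifs with g1 g2 g3
        · exact ⟨Iff.rfl, hX j⟩
        · exact hzl _ (hX j)
        · rw [if_neg g3] at hp'; subst g2; omega
        · exact hzl _ (hX j)
      refine iff_of_false (fun ha => hd ?_) fun ha => hd ?_
      · obtain ⟨_, r, hr⟩ := henc _ (fun j => (e1 j).2) ha
        exact ⟨r, fun j => (e1 j).1.symm.trans (hr j)⟩
      · obtain ⟨_, r, hr⟩ := henc _ (fun j => (e2 j).2) ha
        exact ⟨r, fun j => (e2 j).1.symm.trans (hr j)⟩

-- Every local condition at a reachable state is witnessed by words that pass through it. Equality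
-- of languages is then turned into equality of states by minimality, in the conditions on sinks and
-- on the repetition of signs.
include ht hmin in
theorem WordCriterion.local (hb : 2 ≤ b) (h : WordCriterion b t F s0) :
    LocalCriterion n b t F s0 := by
  have hc : ∀ X : ℕ → ℕ, (∀ j, X j < b + 1) → ∀ p x, (if p = 0 then x + 1 = b else x + 1 < b) → ∀ l,
      (OmegaAcc t F (t (omegaRun t s0 X p) x) (dotWord b (b - 1) l) ↔
        OmegaAcc t F (t (omegaRun t s0 X p) (if p = 0 then 0 else x + 1)) (dotWord b 0 l)) ∧
      (OmegaAcc t F (t (omegaRun t s0 X p) x) (fun _ => b - 1) ↔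
        OmegaAcc t F (t (omegaRun t s0 X p) (if p = 0 then 0 else x + 1)) (fun _ => 0)) := by
    intro X hX p x hx l
    have hxb : x < b := by split_ifs at hx <;> omega
    -- The carry is applied to the word that follows `X` up to p, then reads `x`, then `Z`; of `Z`
    -- only the positions of the dots matter.
    have key : ∀ Z : ℕ → ℕ, (∀ j, Z j < b + 1) →
        (OmegaAcc t F (t (omegaRun t s0 X p) x) (fun k => if Z k < b then b - 1 else b) ↔
        OmegaAcc t F (t (omegaRun t s0 X p) (if p = 0 then 0 else x + 1))
          (fun k => if Z k < b then 0 else b)) := fun Z hZ => by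
      have hWv := splice_lt hX (splice_lt (fun _ => show x < b + 1 by omega) hZ 1) p
      set W := splice X p (splice (fun _ => x) 1 Z) with hW
      have e1 : W p = x := by simp [hW, splice]
      have e2 : ∀ k, W (p + 1 + k) = Z k := fun k => by
        simp [hW, splice, show ¬ p + 1 + k < p by omega, show ¬ p + 1 + k - p < 1 by omega,
          show p + 1 + k - p - 1 = k by omega]
      obtain ⟨h1, h2⟩ := omegaAcc_carry (t := t) (F := F) (s0 := s0) hWv (p := p)
      have := h.carry W hWv p (canCarry_one.2 ⟨by omega, by rw [e1]; exact hx⟩)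
      rw [h1, h2, e1, show omegaRun t s0 W p = _ from omegaRun_splice _ _ _ le_rfl, zeroLetter_one (by omega), if_pos hxb] at this
      simpa only [e2] using this
    constructor
    · have := key (dotWord b 0 l) (dotWord_lt (by omega) l)
      have e : ∀ c, (fun k => if dotWord b 0 l k < b then c else b) = dotWord b c l := fun c => by
        funext k; unfold dotWord; split_ifs <;> first | rfl | omega
      rwa [e, e] at this
    · simpa [show 0 < b by omega] using key (fun _ => 0) fun _ => by omega
  have hcons : ∀ x < b + 1, ∀ w : ℕ → ℕ, (∀ j, w j < b + 1) → ∀ j, splice (fun _ => x) 1 w j < b + 1 :=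
    fun x hx w hw => splice_lt (fun _ => hx) hw 1
  have hword : ∀ q, q < n → Reach (b + 1) (dotGraph n b t s0) (2 * n) q →
      ∃ X p, 1 ≤ p ∧ (∀ j, X j < b) ∧ q = omegaRun t s0 X p := fun q hq hr => by
    rcases exists_word_of_reach ht hb hr with e | ⟨_, e⟩ | ⟨_, _, _, _, _, _, _, e, _⟩
    · omega
    · exact e
    · omega
  have hword' : ∀ q, q < n → Reach (b + 1) (dotGraph n b t s0) (2 * n) (n + q) →
      ∃ X r p, 1 ≤ r ∧ r < p ∧ DotAt b r X ∧ (∀ j, X j < b + 1) ∧ q = omegaRun t s0 X p :=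
    fun q hq hr => by
    rcases exists_word_of_reach ht hb hr with e | ⟨_, _⟩ | ⟨X, r, p, h1, h2, h3, h4, e, _⟩
    · omega
    · omega
    · exact ⟨X, r, p, h1, h2, h3, h4, by omega⟩
  refine ⟨fun x hx h0 h1 => ?_, fun x hx => ?_, ?_, fun q hq hr w hw hacc => ?_,
    fun q hq hr x hx => ?_, fun q hq hr => ?_, fun q hq hr x hx => ?_⟩
  · refine isSink_of_forall hmin ht (ht _ _) fun w hw ha => ?_
    have := (h.encoding _ (hcons x hx w hw) ((omegaAcc_cons s0 x w).2 ha)).1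
    simp [splice] at this
    omega
  · have hxb : x < b + 1 := by omega
    refine (hmin _ (ht _ _) _ (ht _ _) fun w hw => ?_).symm
    have := h.sign _ (hcons x hxb w hw) (by simpa [splice] using hx)
    rw [omegaAcc_cons, omegaAcc_tail t F s0 _ 2] at this
    have e : (fun k => splice (fun _ => x) 1 w (2 + k - 1)) = w := by
      funext k; simp [splice, show ¬ 2 + k - 1 < 1 by omega, show 2 + k - 1 - 1 = k by omega]
    rw [e] at this
    simpa [omegaRun, splice] using this
  · rw [sameLabel_iff ht hb (ht _ _) (ht _ _)]
    intro l
    simpa [omegaRun] using (hc (fun _ => 0) (fun _ => by omega) 0 (b - 1) (by simp; omega) l).1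
  · obtain ⟨X, p, hp, hX, rfl⟩ := hword q hq hr
    obtain ⟨_, r, hr⟩ := h.encoding _ (splice_lt (K := b + 1) (fun j => (hX j).trans (by omega))
      (fun j => (hw j).trans (by omega)) p) ((omegaAcc_splice s0 X p w).2 hacc)
    exact (hr r).1 (splice_lt hX hw p r) rfl
  · obtain ⟨X, p, hp, hX, rfl⟩ := hword q hq hr
    rw [sameLabel_iff ht hb (ht _ _) (ht _ _)]
    intro l
    have h0 : p ≠ 0 := by omega
    have := (hc X (fun j => (hX j).trans (by omega)) p x (by rw [if_neg h0]; exact hx) l).1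
    rwa [if_neg h0] at this
  · obtain ⟨X, r, p, hr0, hrp, hd, hX, rfl⟩ := hword' q hq hr
    refine isSink_of_forall hmin ht (ht _ _) fun w hw ha => ?_
    obtain ⟨_, r', hr'⟩ := h.encoding _ (splice_lt hX (hcons b (by omega) w hw) p)
      ((omegaAcc_splice s0 X p _).2 ((omegaAcc_cons _ b w).2 ha))
    have g1 := hr' r
    have g2 := hr' p
    have g3 := hd r
    simp [splice, hrp] at g1 g2
    omega
  · obtain ⟨X, r, p, hr0, hrp, hd, hX, rfl⟩ := hword' q hq hr
    rw [frac_carry_iff (ht _ _)]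
    have h0 : p ≠ 0 := by omega
    have := (hc X hX p x (by rw [if_neg h0]; exact hx) 0).2
    rwa [if_neg h0] at this

end Criterion


/-! ## Labels of the nodes of a functional graph -/

notation "vA" => (30 : Fin 40)
notation "vB" => (31 : Fin 40)
notation "aW" => (17 : Fin 20)
notation "aNum" => (18 : Fin 20)
notation "aDen" => (19 : Fin 20)

section Codes

variable {N : ℕ} {f o : ℕ → ℕ}

/-- The number with the digits `o v, o (f v), …, o (f^[k - 1] v)` in base `3`. -/
def horner (f o : ℕ → ℕ) (v : ℕ) : ℕ → ℕ
  | 0 => 0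
  | k + 1 => 3 * horner f o v k + o (f^[k] v)

theorem horner_succ' (v k : ℕ) : horner f o v (k + 1) = o v * 3 ^ k + horner f o (f v) k := by
  induction k with
  | zero => simp [horner]
  | succ k ih => rw [horner, ih, horner, iterate_succ_apply]; ring

/-- The digits of a cycle, read from `v` on. -/
noncomputable def cycleNum (f o : ℕ → ℕ) (v : ℕ) : ℕ := horner f o v (minimalPeriod f v)

noncomputable def cycleDen (f : ℕ → ℕ) (v : ℕ) : ℕ := 3 ^ minimalPeriod f v - 1

/-- A purely periodic expansion in base 3 with period c is its block of digits divided by 3^c - 1.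
Multiplication by 3 splits off the first digit and rotates the block. -/
theorem cycleNum_rotate {v : ℕ} (hv : v ∈ periodicPts f) :
    3 * cycleNum f o v = o v * cycleDen f v + cycleNum f o (f v) := by
  have h1 := horner_succ' (f := f) (o := o) v (minimalPeriod f v)
  rw [horner, iterate_minimalPeriod] at h1
  rw [cycleNum, cycleDen, cycleNum, minimalPeriod_apply hv, Nat.mul_sub, mul_one]
  have : o v ≤ o v * 3 ^ minimalPeriod f v := Nat.le_mul_of_pos_right _ (by positivity)
  omega

theorem cycleDen_apply {v : ℕ} (hv : v ∈ periodicPts f) : cycleDen f (f v) = cycleDen f v := by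
  rw [cycleDen, minimalPeriod_apply hv, cycleDen]

theorem cycleDen_pos {v : ℕ} (hv : v ∈ periodicPts f) : 0 < cycleDen f v := by
  have := Nat.pow_le_pow_right (show 0 < 3 by omega) (minimalPeriod_pos_of_mem_periodicPts hv)
  unfold cycleDen; omega

/-- The quotient of `num v` and `den v` has the digits `o v, o (f v), …` in base `3`. -/
def IsCode (f o num den : ℕ → ℕ) (v : ℕ) : Prop :=
  0 < den v ∧ 3 * num v * den (f v) = (o v * den (f v) + num (f v)) * den v

/-- The quotient x satisfies 3 x(v) = o(v) + x(f v). With digits 0 and 1 in base 3 there are no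
carries: all values lie in [0, 1/2], so o(v) = 0 gives x(v) ≤ 1/6 and o(v) = 1 gives x(v) ≥ 1/3.
Base 2 would not separate 0111… from 1000…. -/
theorem code_eq_iff {num den : ℕ → ℕ} (hf : ∀ v < N, f v < N) (ho : ∀ v, o v ≤ 1)
    (h : ∀ v < N, IsCode f o num den v) {u v : ℕ} (hu : u < N) (hv : v < N) :
    num u * den v = num v * den u ↔ ∀ l, o (f^[l] u) = o (f^[l] v) := by
  set x : ℕ → ℚ := fun v => num v / den v with hx
  have hpos : ∀ v < N, (0 : ℚ) < den v := fun v hv => by exact_mod_cast (h v hv).1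
  have hstep : ∀ v < N, 3 * x v = o v + x (f v) := fun v hv => by
    have e : (3 * num v * den (f v) : ℚ) = (o v * den (f v) + num (f v)) * den v := by
      exact_mod_cast (h v hv).2
    have := hpos v hv
    have := hpos _ (hf v hv)
    simp only [hx]
    field_simp
    linarith
  have h0 : ∀ v, 0 ≤ x v := fun v => by positivity
  have ho' : ∀ v, (o v : ℚ) ≤ 1 := fun v => by exact_mod_cast ho v
  -- Maximum principle: at a node m of maximal value, 3 x(m) ≤ 1 + x(m).
  have h1 : ∀ v < N, x v ≤ 1 / 2 := by
    obtain ⟨m, hm, hmax⟩ := Finset.exists_max_image (Finset.range N) x ⟨u, by simpa using hu⟩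
    simp only [Finset.mem_range] at hm hmax
    intro v hv
    linarith [hmax v hv, hmax _ (hf m hm), hstep m hm, ho' m]
  have hit : ∀ l, ∀ v < N, f^[l] v < N := fun l => by
    induction l with
    | zero => exact fun v hv => hv
    | succ l ih => exact fun v hv => by rw [iterate_succ_apply]; exact ih _ (hf v hv)
  rw [show num u * den v = num v * den u ↔ x u = x v by
    simp only [hx]
    rw [div_eq_div_iff (hpos u hu).ne' (hpos v hv).ne']
    exact_mod_cast Iff.rfl]
  constructor
  · intro he
    have key : ∀ l, x (f^[l] u) = x (f^[l] v) := fun l => by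
      induction l with
      | zero => exact he
      | succ l ih =>
        have a1 := hstep _ (hit l u hu)
        have a2 := hstep _ (hit l v hv)
        rw [iterate_succ_apply', iterate_succ_apply']
        have b1 := h1 _ (hf _ (hit l u hu))
        have b2 := h1 _ (hf _ (hit l v hv))
        have c1 := h0 (f (f^[l] u))
        have c2 := h0 (f (f^[l] v))
        have d1 := ho (f^[l] u)
        have d2 := ho (f^[l] v)
        rw [ih] at a1
        -- Different digits are impossible because the tails differ by at most 1/2; equal digits
        -- leave equal tails.
        interval_cases o (f^[l] u) <;> interval_cases o (f^[l] v) <;> push_cast at a1 a2 <;> linarith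
    intro l
    have a1 := hstep _ (hit l u hu)
    have a2 := hstep _ (hit l v hv)
    have a3 := key (l + 1)
    rw [iterate_succ_apply', iterate_succ_apply'] at a3
    rw [key l, a3] at a1
    exact_mod_cast (show (o (f^[l] u) : ℚ) = o (f^[l] v) by linarith)
  · intro he
    -- With equal digits a difference triples at every step, yet it stays bounded; so it is zero.
    have key : ∀ l, (3 : ℚ) ^ l * (x u - x v) = x (f^[l] u) - x (f^[l] v) := fun l => by
      induction l with
      | zero => simp
      | succ l ih =>
        have a1 := hstep _ (hit l u hu)
        have a2 := hstep _ (hit l v hv)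
        rw [he l] at a1
        rw [iterate_succ_apply', iterate_succ_apply', pow_succ]
        linarith
    by_contra hne
    have hd : 0 < |x u - x v| := abs_pos.2 (sub_ne_zero.2 hne)
    obtain ⟨l, hl⟩ := pow_unbounded_of_one_lt (1 / |x u - x v|) (show (1 : ℚ) < 3 by norm_num)
    have e := congrArg abs (key l)
    rw [abs_mul, abs_of_pos (show (0 : ℚ) < 3 ^ l by positivity)] at e
    have : |x (f^[l] u) - x (f^[l] v)| ≤ 1 := by
      rw [abs_le]
      constructor <;> linarith [h0 (f^[l] u), h0 (f^[l] v), h1 _ (hit l u hu), h1 _ (hit l v hv)]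
    rw [div_lt_iff₀ hd] at hl
    linarith

variable {deg ord : ℕ → ℕ} {k : ℕ}

/-- The nodes of a functional graph that are not peeled lie on cycles. -/
theorem Peeled.periodic (P : Peeled N 1 (fun v _ => f v) (fun _ _ => True) deg ord k) {v : ℕ}
    (hv : v < N) (hd : deg v ≠ 0) : v ∈ periodicPts f ∧ deg (f v) ≠ 0 := by
  classical
  have hpre : ∀ t, ∃ q, (t < N → q < N) ∧ (t < N → deg t ≠ 0 → deg q ≠ 0 ∧ f q = t) := fun t => by
    by_cases h : t < N ∧ deg t ≠ 0
    · obtain ⟨q, hq, _, _, _, h2, h3⟩ := P.live t h.1 h.2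
      exact ⟨q, fun _ => hq, fun _ _ => ⟨h3, h2⟩⟩
    · exact ⟨t, fun h => h, fun h1 h2 => absurd ⟨h1, h2⟩ h⟩
  choose pre hlt hpre using hpre
  have hmem : ∀ i, pre^[i] v < N ∧ deg (pre^[i] v) ≠ 0 ∧ ∀ j, f^[i] (pre^[i + j] v) = pre^[j] v := by
    intro i
    induction i with
    | zero => exact ⟨hv, hd, fun j => by simp⟩
    | succ i ih =>
      have hm : ∀ j, pre^[j] v < N ∧ deg (pre^[j] v) ≠ 0 := fun j => by
        induction j with
        | zero => exact ⟨hv, hd⟩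
        | succ j ih =>
          rw [iterate_succ_apply']
          exact ⟨hlt _ ih.1, (hpre _ ih.1 ih.2).1⟩
      refine ⟨(hm _).1, (hm _).2, fun j => ?_⟩
      rw [iterate_succ_apply, show i + 1 + j = (i + j) + 1 by omega,
        iterate_succ_apply' pre, (hpre _ (hm _).1 (hm _).2).2, ih.2.2]
  -- Two backward iterates coincide. Applying f^i brings the coincidence back to `v` itself, so that
  -- `v` lies on the cycle and is not merely connected to one.
  obtain ⟨i, j, hij, _, he⟩ := exists_iterate_eq hlt hv
  obtain ⟨l, rfl⟩ : ∃ l, j = i + (l + 1) := ⟨j - i - 1, by omega⟩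
  have e1 : v = pre^[l + 1] v := by
    have a := (hmem i).2.2 0
    have b := (hmem i).2.2 (l + 1)
    rw [← he] at b
    exact a.symm.trans b
  have e2 := (hmem (l + 1)).2.2 0
  have e3 := (hmem 1).2.2 l
  rw [add_comm 1 l, ← e1] at e3
  rw [add_zero, ← e1] at e2
  exact ⟨⟨l + 1, by omega, e2⟩, by rw [show f v = pre^[l] v from e3]; exact (hmem l).2.1⟩

end Codes

/-! ### Computing the codes -/

section Program

variable {I : Input} {N : ℕ} {f o deg ord : ℕ → ℕ} {k : ℕ}

/-- Execute `c` for the peeled nodes, from the last to the first one. -/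
def reversePass (c : Prog) : Prog :=
  .for vp (.var vo) (.seq (.assign vq (.read aOrd (.sub (.sub (.var vo) (.const 1)) (.var vp)))) c)

/-- The list has every node after its predecessors, so in reverse order each node is treated after
its successor. The set of treated nodes starts with the survivors, that is the cycles, is closed
under `f`, and ends as everything. -/
theorem wp_reversePass {c : Prog} {T : ℕ} {Inv : (ℕ → Prop) → Mem → Prop}
    {σ : Mem} (P : Peeled N 1 (fun v _ => f v) (fun _ _ => True) deg ord k)
    (hf : ∀ v < N, f v < N) (h0 : Inv (fun v => deg v ≠ 0) σ)
    (hvar : ∀ S τ, Inv S τ → τ.var vo = k ∧ τ.rd aOrd = ord)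
    (hvp : ∀ S τ j, Inv S τ → Inv S (τ.setVar vp j))
    (hbody : ∀ S v τ, v < N → ¬ S v → S (f v) → (∀ u < N, S u → S (f u)) → Inv S τ →
      wp I c (fun υ t => υ.var vp = τ.var vp ∧ Inv (fun u => S u ∨ u = v) υ ∧ t ≤ T)
        (τ.setVar vq v)) :
    wp I (reversePass c) (fun τ t => ∃ S, (∀ v < N, S v) ∧ Inv S τ ∧ t ≤ N * (T + 20) + 10) σ := by
  have hlive : ∀ v < N, deg v ≠ 0 → deg (f v) ≠ 0 := fun v hv h => (P.periodic hv h).2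
  set S : ℕ → ℕ → Prop := fun j v => deg v ≠ 0 ∨ ∃ i, k ≤ i + j ∧ i < k ∧ ord i = v with hS
  have hS0 : S 0 = fun v => deg v ≠ 0 := by
    funext v; simp only [hS, eq_iff_iff, or_iff_left_iff_imp]
    rintro ⟨i, h1, h2, _⟩; omega
  refine (wp_for (H := k) (T := T + 10) (Inv := fun j τ => τ.var vp = j ∧ Inv (S j) τ)
    ⟨by simp, hvp _ _ _ (by rw [hS0]; exact h0)⟩ (fun j τ h => by rw [eval_var, (hvar _ _ h.2).1])
    (fun j τ h => h.1) ?_).mono ?_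
  · rintro j τ hj ⟨h1, h2⟩
    obtain ⟨e1, e2⟩ := hvar _ _ h2
    rw [wp_seq, wp_assign]
    simp only [evals, h1, e1, e2]
    set i := k - 1 - j with hi
    have hik : i < k := by omega
    have hv := P.ord_lt i hik
    have hz := (P.mem _ hv).2 ⟨i, hik, rfl⟩
    have key : ∀ u < N, f u = ord i → ∃ l < i, ord l = u := fun u hu hfu =>
      P.pred i hik u hu 0 (by omega) trivial hfu
    have hinj : ∀ a < k, ∀ b < k, ord a = ord b → a = b := fun a ha b hb h => by
      rcases lt_trichotomy a b with hl | hl | hl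
      · exact absurd h (P.ord_inj b hb a hl)
      · exact hl
      · exact absurd h.symm (P.ord_inj a ha b hl)
    -- The successor of a listed node survives or is listed later: by `pred`, the list has that
    -- node, as its predecessor, before it.
    have hnext : ∀ l < k, S (k - l - 1) (f (ord l)) := fun l hl => by
      by_cases hd : deg (f (ord l)) = 0
      · obtain ⟨l', hl', e⟩ := (P.mem _ (hf _ (P.ord_lt l hl))).1 hd
        obtain ⟨m, hm, e'⟩ := P.pred l' hl' _ (P.ord_lt l hl) 0 (by omega) trivial e.symm
        have := hinj _ (hm.trans hl') _ hl e'
        exact Or.inr ⟨l', by omega, hl', e⟩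
      · exact Or.inl hd
    refine (hbody (S j) (ord i) τ hv ?_ ?_ ?_ h2).mono ?_
    · rintro (h | ⟨l, h3, h4, h5⟩)
      · exact h hz
      · have := hinj _ h4 _ hik h5; omega
    · have := hnext i hik
      rwa [show k - i - 1 = j from by clear this; omega] at this
    · rintro u hu (h | ⟨l, h3, h4, rfl⟩)
      · exact Or.inl (hlive u hu h)
      · rcases hnext l h4 with h | ⟨m, h5, h6, h7⟩
        · exact Or.inl h
        · exact Or.inr ⟨m, by omega, h6, h7⟩
    · rintro υ t ⟨h3, h4, ht⟩
      refine ⟨by rw [h3, h1], ⟨by simp, hvp _ _ _ ?_⟩, by simp; omega⟩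
      convert h4 using 1
      funext u
      simp only [hS, eq_iff_iff, or_assoc]
      refine or_congr_right ⟨?_, ?_⟩
      · rintro ⟨l, h5, h6, h7⟩
        rcases eq_or_ne l i with rfl | hne
        · exact Or.inr h7.symm
        · exact Or.inl ⟨l, by omega, h6, h7⟩
      · rintro (⟨l, h5, h6, h7⟩ | rfl)
        · exact ⟨l, by omega, h6, h7⟩
        · exact ⟨i, by omega, hik, rfl⟩
  · rintro τ t ⟨⟨_, h⟩, ht⟩
    refine ⟨S k, fun v hv => ?_, h, ht.trans ?_⟩
    · by_cases hd : deg v = 0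
      · obtain ⟨i, hi, e⟩ := (P.mem v hv).1 hd
        exact Or.inr ⟨i, by omega, hi, e⟩
      · exact Or.inl hd
    · simp only [cost]
      have := Nat.mul_le_mul_right (T + 20) P.le
      have e : k * (T + 10 + 1 + 7) ≤ k * (T + 20) := Nat.mul_le_mul_left _ (by omega)
      omega

/-- The expressions `fE` and `oE` compute the successor and the digit of the node `vq`, whatever the
contents of the working memory. -/
structure MapExprs (I : Input) (N : ℕ) (f o : ℕ → ℕ) (fE oE : Exp) (σ : Mem) :
    Prop where
  lt : ∀ v < N, f v < N
  len : N ≤ σ.len aNum ∧ N ≤ σ.len aDen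
  step : ∀ τ, Frame [vq, vx, vm, vt, vA, vB, vp] [aNum, aDen] σ τ → τ.var vq < N →
    fE.eval I τ = f (τ.var vq)
  digit : ∀ τ, Frame [vq, vx, vm, vt, vA, vB, vp] [aNum, aDen] σ τ → τ.var vq < N →
    oE.eval I τ = o (τ.var vq)

/-- Compute the codes on the cycle of the node `vx`. -/
def codeCycle (fE oE : Exp) : Prog :=
  .seq (.assign vq (.var vx)) <| .seq (.assign vA (.const 0)) <| .seq (.assign vB (.const 1)) <|
  .seq (.assign vm (.const 0)) <|
  .seq (.loop (.add (.eq (.var vm) (.const 0)) (.sub (.const 1) (.eq (.var vq) (.var vx))))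
    (.seq (.assign vA (.add (.mul (.const 3) (.var vA)) oE)) <|
     .seq (.assign vB (.mul (.const 3) (.var vB))) <|
     .seq (.assign vm (.add (.var vm) (.const 1))) (.assign vq fE))) <|
  .for vt (.var vm) <|
    .seq (.write aNum (.var vq) (.var vA)) <|
    .seq (.write aDen (.var vq) (.sub (.var vB) (.const 1))) <|
    .seq (.assign vA (.sub (.mul (.const 3) (.var vA)) (.mul oE (.sub (.var vB) (.const 1)))))
    (.assign vq fE)

theorem iterate_lt (hf : ∀ v < N, f v < N) {v : ℕ} (hv : v < N) (i : ℕ) : f^[i] v < N := by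
  induction i with
  | zero => exact hv
  | succ i ih => rw [iterate_succ_apply']; exact hf _ ih

theorem iterate_mem_periodicPts {v : ℕ} (hv : v ∈ periodicPts f) (i : ℕ) :
    f^[i] v ∈ periodicPts f ∧ cycleDen f (f^[i] v) = cycleDen f v := by
  induction i with
  | zero => exact ⟨hv, rfl⟩
  | succ i ih =>
    rw [iterate_succ_apply', cycleDen_apply ih.1]
    obtain ⟨m, hm, h⟩ := ih.1
    exact ⟨⟨m, hm, h.apply⟩, ih.2⟩

-- A first round along the cycle finds its length and the code of the starting node; a second round
-- rotates this code from node to node. The time is proportional to the length of the cycle.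
open Classical in
theorem wp_codeCycle {fE oE : Exp} {σ0 σ : Mem} {v : ℕ}
    (hM : MapExprs I N f o fE oE σ0)
    (hs : Frame [vq, vx, vm, vt, vA, vB, vp] [aNum, aDen] σ0 σ)
    (hv : σ.var vx = v) (hvN : v < N) (hper : v ∈ periodicPts f) :
    wp I (codeCycle fE oE) (fun τ t => Frame [vq, vm, vt, vA, vB] [aNum, aDen] σ τ ∧
      (∀ u, τ.rd aNum u = if ∃ i < minimalPeriod f v, f^[i] v = u then cycleNum f o u
        else σ.rd aNum u) ∧
      (∀ u, τ.rd aDen u = if ∃ i < minimalPeriod f v, f^[i] v = u then cycleDen f u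
        else σ.rd aDen u) ∧
      t ≤ minimalPeriod f v * (3 * (fE.cost + oE.cost) + 100) + 40) σ := by
  set c := minimalPeriod f v with hc
  have hc0 : 0 < c := minimalPeriod_pos_of_mem_periodicPts hper
  have hcyc : f^[c] v = v := iterate_minimalPeriod
  have ext : ∀ {τ : Mem}, Frame [vq, vm, vt, vA, vB] [aNum, aDen] σ τ →
      Frame [vq, vx, vm, vt, vA, vB, vp] [aNum, aDen] σ0 τ := fun h =>
    hs.trans (h.weaken (ys := [vq, vx, vm, vt, vA, vB, vp]) (bs := [aNum, aDen]))
  simp only [steps, codeCycle]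
  refine (wp_loop (Inv := fun τ => ∃ j ≤ c, Frame [vq, vm, vt, vA, vB] [] σ τ ∧
    τ.var vm = j ∧ τ.var vq = f^[j] v ∧ τ.var vA = horner f o v j ∧ τ.var vB = 3 ^ j)
    (Φ := fun τ => (c - τ.var vm) * (fE.cost + oE.cost + 40)) ?_ ?_).mono ?_
  · rintro τ ⟨j, hj, h1, h2, h3, h4, h5⟩ hgo
    have hlt : j < c := by
      refine lt_of_le_of_ne hj fun e => hgo ?_
      simp [h1.var vx, h2, h3, hv, e, hcyc, hc0.ne']
    have hN : τ.var vq < N := by rw [h3]; exact iterate_lt hM.lt hvN j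
    have s1 := h1.weaken (ys := [vq, vm, vt, vA, vB]) (bs := [aNum, aDen])
    simp only [evals, steps]
    rw [hM.digit _ (ext s1) hN]
    refine ⟨⟨j + 1, hlt, h1.setVar.setVar.setVar.setVar, by simp [h2], ?_, by simp [h4, h3, horner], by simp [h5, pow_succ']⟩, ?_⟩
    · rw [hM.step _ (ext (s1.setVar.setVar.setVar))
        (by simpa using hN)]
      simp [h3, iterate_succ_apply']
    · simp only [cost, var_setVar, Fin.reduceEq, if_false, if_true, h2]
      obtain ⟨r, hr⟩ : ∃ r, c = j + 1 + r := ⟨c - (j + 1), by omega⟩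
      rw [show c - (j + 1) = r by omega, show c - j = r + 1 by omega, add_mul r 1]
      omega
  · exact ⟨0, by omega, (((Frame.rfl.setVar).setVar).setVar).setVar, by simp, by simp [hv], by simp [horner], by simp⟩
  rintro σ1 t1 ⟨⟨j, hj, h1, h2, h3, h4, h5⟩, hend, ht1⟩
  -- The summand `vm = 0` in the test forces a first iteration; after that the loop stops at the
  -- first return, which takes exactly the minimal period.
  have hjc : j = c := by
    by_contra hne
    simp only [evals, h2, h3, h1.var vx, hv] at hend
    have hj0 : j ≠ 0 := fun e => by simp [e] at hend
    rw [if_neg (show ¬ f^[j] v = v from not_isPeriodicPt_of_pos_of_lt_minimalPeriod hj0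
      (lt_of_le_of_ne hj hne))] at hend
    omega
  clear_value c
  subst hjc
  have s1 := h1.weaken (ys := [vq, vm, vt, vA, vB]) (bs := [aNum, aDen])
  have hD : 3 ^ j - 1 = cycleDen f v := by rw [cycleDen, hc]
  -- After the first round `vq` is back at `v`. The numerator is carried on as 3 num - o (3^c - 1),
  -- by `cycleNum_rotate`, while the denominator stays the same.
  refine (wp_for (H := j) (T := fE.cost + 2 * oE.cost + 40) (Inv := fun l τ => τ.var vt = l ∧
    Frame [vq, vm, vt, vA, vB] [aNum, aDen] σ τ ∧ τ.var vm = j ∧ τ.var vq = f^[l] v ∧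
    τ.var vA = cycleNum f o (f^[l] v) ∧ τ.var vB = 3 ^ j ∧
    (∀ u, τ.rd aNum u = if ∃ i < l, f^[i] v = u then cycleNum f o u else σ.rd aNum u) ∧
    (∀ u, τ.rd aDen u = if ∃ i < l, f^[i] v = u then cycleDen f u else σ.rd aDen u))
    ?_ (fun l τ h => by rw [eval_var, h.2.2.1]) (fun l τ h => h.1) ?_).mono ?_
  · refine ⟨by simp, s1.setVar, by simp [h2], ?_, ?_, by simp [h5], ?_, ?_⟩
    · simp [h3, hcyc]
    · simp [h4, cycleNum, hc]
    · simp [h1.rd aNum]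
    · simp [h1.rd aDen]
  · rintro l τ hl ⟨g1, g2, g3, g4, g5, g6, g7, g8⟩
    have hN : f^[l] v < N := iterate_lt hM.lt hvN l
    obtain ⟨hp, hd⟩ := iterate_mem_periodicPts hper l
    have l1 : f^[l] v < τ.len aNum := by rw [(ext g2).len]; exact hN.trans_le hM.len.1
    have l2 : f^[l] v < (τ.wr aNum (f^[l] v) (cycleNum f o (f^[l] v))).len aDen := by
      rw [len_wr, (ext g2).len]; exact hN.trans_le hM.len.2
    have s2 := (g2.wr (a := aNum) (i := f^[l] v) (v := cycleNum f o (f^[l] v))).wr (a := aDen) (i := f^[l] v) (v := cycleDen f v)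
    simp only [evals, wp_seq, wp_assign, wp_write, var_wr, g4, g5, g6, hD]
    rw [hM.digit _ (ext s2) (by simpa [g4] using hN)]
    have s3 := s2.setVar (x := vA) (v := 3 * cycleNum f o (f^[l] v) -
      o ((((τ.wr aNum (f^[l] v) (cycleNum f o (f^[l] v))).wr aDen (f^[l] v) (cycleDen f v))).var vq)
        * cycleDen f v)
    rw [hM.step _ (ext s3) (by simpa [g4] using hN)]
    have upd : ∀ {r r' w : ℕ → ℕ} {x : ℕ}, (∀ u, r u = if ∃ i < l, f^[i] v = u then w u else r' u) →
        x = w (f^[l] v) → ∀ u, update r (f^[l] v) x u =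
          if ∃ i < l + 1, f^[i] v = u then w u else r' u := by
      intro r r' w x h hx u
      by_cases hu : u = f^[l] v
      · rw [hu, update_self, if_pos ⟨l, by omega, rfl⟩, hx]
      · rw [update_of_ne hu, h]
        refine if_congr ⟨fun ⟨i, hi, e⟩ => ⟨i, by omega, e⟩, fun ⟨i, hi, e⟩ => ⟨i, ?_, e⟩⟩ rfl rfl
        exact lt_of_le_of_ne (by omega) fun e' => hu (by rw [← e, e'])
    refine ⟨by simp [g1], ⟨by simp, s3.setVar.setVar, by simp [g3], ?_, ?_,
      by simp [g6], ?_, ?_⟩, by simp; omega⟩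
    · simp [g4, iterate_succ_apply']
    · have := cycleNum_rotate (o := o) hp
      rw [hd] at this
      simp [g4, iterate_succ_apply', this]
    · intro u
      simp only [rd_setVar, rd_wr, Fin.reduceEq, if_false, if_true, if_pos l1]
      exact upd g7 rfl u
    · intro u
      simp only [rd_setVar]
      rw [rd_wr_self _ _ l2]
      simp only [rd_wr, Fin.reduceEq, if_false]
      exact upd g8 hd.symm u
  · rintro σ2 t2 ⟨⟨_, g2, _, _, _, _, g7, g8⟩, ht2⟩
    refine ⟨g2, g7, g8, ?_⟩
    simp only [var_setVar, if_true, Fin.reduceEq, if_false, eval_const, Nat.sub_zero, cost] at ht1 ht2 ⊢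
    have e1 : j * (3 * (fE.cost + oE.cost) + 100) = j * (fE.cost + oE.cost + 40) +
      j * (fE.cost + 2 * oE.cost + 40 + 1 + 7) + j * (fE.cost + 12) := by ring
    omega

end Program


section Program

variable {I : Input} {N : ℕ} {f o deg ord : ℕ → ℕ} {k : ℕ}

/-- Compute the codes on all cycles. -/
def codeCycles (fE oE : Exp) : Prog :=
  .for vx (.var vN) <| .ite
    (.mul (.lt (.const 0) (.read aDeg (.var vx))) (.eq (.read aDen (.var vx)) (.const 0)))
    (codeCycle fE oE) .skip

/-- Compute the codes of all nodes, after peeling. -/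
def codes (fE oE : Exp) : Prog :=
  .seq (codeCycles fE oE) <| reversePass <|
    .seq (.write aNum (.var vq) (.add (.mul oE (.read aDen fE)) (.read aNum fE)))
      (.write aDen (.var vq) (.mul (.const 3) (.read aDen fE)))

/-- A denominator 0, the initial content of the array, means that no code is stored. The coded nodes
are closed under `f`, so a cycle is coded completely or not at all, and the number of zero
denominators serves as the potential that pays for each cycle once. -/
theorem wp_codeCycles {fE oE : Exp} {σ : Mem} (hM : MapExprs I N f o fE oE σ)
    (hN : σ.var vN = N) (h0 : ∀ u, σ.rd aDen u = 0)
    (P : Peeled N 1 (fun v _ => f v) (fun _ _ => True) (σ.rd aDeg) ord k) :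
    wp I (codeCycles fE oE) (fun τ t => Frame [vq, vx, vm, vt, vA, vB, vp] [aNum, aDen] σ τ ∧
      (∀ u < N, σ.rd aDeg u ≠ 0 → IsCode f o (τ.rd aNum) (τ.rd aDen) u) ∧
      t ≤ (3 * (fE.cost + oE.cost) + 200) * N + 10) σ := by
  classical
  set B := 3 * (fE.cost + oE.cost) + 100 with hB
  let Z : (ℕ → ℕ) → ℕ := fun r => ((Finset.range N).filter fun u => r u = 0).card
  refine (wp_for_amortized (H := N) (T := 60)
    (Φ := fun τ => B * Z (τ.rd aDen))
    (Inv := fun j τ => τ.var vx = j ∧ Frame [vq, vx, vm, vt, vA, vB, vp] [aNum, aDen] σ τ ∧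
      (∀ u, τ.rd aDen u ≠ 0 → u < N ∧ σ.rd aDeg u ≠ 0 ∧ τ.rd aDen u = cycleDen f u ∧
        τ.rd aNum u = cycleNum f o u) ∧
      (∀ u i, τ.rd aDen u ≠ 0 → τ.rd aDen (f^[i] u) ≠ 0) ∧
      ∀ u < j, σ.rd aDeg u ≠ 0 → τ.rd aDen u ≠ 0)
    ?_ rfl (fun j τ h => by rw [eval_var, h.2.1.var _, hN])
    (fun j τ h => h.1) ?_).mono ?_
  · exact ⟨by simp, Frame.rfl.setVar, fun u h => absurd (h0 u) h,
      fun u _ h => absurd (h0 u) h, by simp⟩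
  · rintro v τ hv ⟨h1, h2, h3, h4, h5⟩
    have hdeg : τ.rd aDeg = σ.rd aDeg := h2.rd _
    rw [wp_ite]
    simp only [evals, h1, hdeg]
    by_cases hgo : σ.rd aDeg v ≠ 0 ∧ τ.rd aDen v = 0
    · rw [if_neg (by simp [hgo.2]; omega)]
      have hper := (P.periodic hv hgo.1).1
      refine (wp_codeCycle hM h2 h1 hv hper).mono ?_
      rintro υ t ⟨g1, g2, g3, ht⟩
      set c := minimalPeriod f v with hc
      have hlive : ∀ i, σ.rd aDeg (f^[i] v) ≠ 0 := fun i => by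
        induction i with
        | zero => exact hgo.1
        | succ i ih =>
          rw [iterate_succ_apply']
          exact (P.periodic (iterate_lt hM.lt hv i) ih).2
      have hne : ∀ u, (∃ i < c, f^[i] v = u) → cycleDen f u ≠ 0 := by
        rintro u ⟨i, _, rfl⟩
        exact (cycleDen_pos (iterate_mem_periodicPts hper i).1).ne'
      have hall : ∀ i, ∃ l < c, f^[l] v = f^[i] v := fun i =>
        ⟨i % c, Nat.mod_lt _ (minimalPeriod_pos_of_mem_periodicPts hper),
          iterate_mod_minimalPeriod_eq⟩
      refine ⟨by rw [g1.var _, h1], ⟨by simp, (h2.trans (g1.weaken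
        (ys := [vq, vx, vm, vt, vA, vB, vp]) (bs := [aNum, aDen]))).setVar, fun u hu => ?_, fun u i hu => ?_,
        fun u hu hd => ?_⟩, ?_⟩
      · rw [rd_setVar, g3] at hu ⊢
        rw [rd_setVar, g2]
        split_ifs at hu ⊢ with h
        · obtain ⟨i, _, rfl⟩ := h
          exact ⟨iterate_lt hM.lt hv i, hlive i, rfl, rfl⟩
        · exact h3 u hu
      · rw [rd_setVar, g3] at hu ⊢
        by_cases h' : ∃ l < c, f^[l] v = f^[i] u
        · rw [if_pos h']; exact hne _ h'
        · rw [if_neg h']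
          split_ifs at hu with h
          · obtain ⟨l, _, rfl⟩ := h
            rw [← iterate_add_apply] at h'
            exact absurd (hall (i + l)) h'
          · exact h4 u i hu
      · rw [rd_setVar, g3]
        split_ifs with h
        · exact hne _ h
        · rcases Nat.lt_succ_iff_lt_or_eq.1 hu with hu | rfl
          · exact h5 u hu hd
          · exact absurd (hall 0) h
      -- All nodes of this cycle had denominator 0 before: a coded one would, by closure under `f`,
      -- force a code at `v`.
      · have hcard : Z (υ.rd aDen) + c ≤ Z (τ.rd aDen) := by
          have hinj : Set.InjOn (fun i => f^[i] v) (Finset.range c : Set ℕ) := by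
            rw [Finset.coe_range]; exact iterate_injOn_Iio_minimalPeriod
          have := Finset.card_image_of_injOn hinj
          rw [Finset.card_range] at this
          refine (congrArg (Z _ + ·) this.symm).trans_le ?_
          simp only [Z]
          rw [← Finset.card_union_of_disjoint]
          · refine Finset.card_le_card fun u hu => ?_
            simp only [Finset.mem_union, Finset.mem_filter, Finset.mem_range, Finset.mem_image] at hu ⊢
            rcases hu with ⟨hu, hz⟩ | ⟨i, hi, rfl⟩
            · rw [g3] at hz
              split_ifs at hz with h
              · exact absurd hz (hne _ h)
              · exact ⟨hu, hz⟩
            · refine ⟨iterate_lt hM.lt hv i, by_contra fun h => ?_⟩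
              have := h4 _ (c - i) h
              rw [← iterate_add_apply, Nat.sub_add_cancel hi.le,
                iterate_minimalPeriod] at this
              exact this hgo.2
          · rw [Finset.disjoint_left]
            intro u hu hu'
            simp only [Finset.mem_filter, Finset.mem_range, Finset.mem_image] at hu hu'
            rw [g3, if_pos hu'] at hu
            exact hne _ hu' hu.2
        have := Nat.mul_le_mul_left B hcard
        rw [mul_add, mul_comm B c] at this
        rw [← hB] at ht
        simp only [rd_setVar, cost]
        omega
    · rw [if_pos (by simp; tauto), wp_skip]
      refine ⟨h1, ⟨by simp, h2.setVar, h3, h4, fun u hu hd => ?_⟩,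
        by simp only [rd_setVar, cost]; omega⟩
      rcases Nat.lt_succ_iff_lt_or_eq.1 hu with hu | rfl
      · exact h5 u hu hd
      · rw [rd_setVar]; tauto
  · rintro τ t ⟨⟨_, h2, h3, h4, h5⟩, ht⟩
    refine ⟨h2, fun u hu hd => ?_, ?_⟩
    · have hper := (P.periodic hu hd).1
      have a := h3 u (h5 u hu hd)
      have b := h3 (f u) (h4 u 1 (h5 u hu hd))
      refine ⟨Nat.pos_of_ne_zero (h5 u hu hd), ?_⟩
      rw [a.2.2.1, a.2.2.2, b.2.2.1, b.2.2.2, cycleDen_apply hper, cycleNum_rotate hper]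
    · have : B * Z (σ.rd aDen) ≤ B * N :=
        Nat.mul_le_mul_left _ ((Finset.card_filter_le _ _).trans (by simp))
      simp only [cost] at ht
      rw [show 3 * (fE.cost + oE.cost) + 200 = B + 100 by omega, add_mul]
      omega

/-- Off the cycles, 3 x(v) = o(v) + x(f v) is solved by the denominator 3 den(f v) and the numerator
o(v) den(f v) + num(f v), without division. -/
theorem wp_codes {fE oE : Exp} {σ : Mem} (hM : MapExprs I N f o fE oE σ)
    (hN : σ.var vN = N) (h0 : ∀ u, σ.rd aDen u = 0)
    (P : Peeled N 1 (fun v _ => f v) (fun _ _ => True) (σ.rd aDeg) (σ.rd aOrd) (σ.var vo)) :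
    wp I (codes fE oE) (fun τ t => Frame [vq, vx, vm, vt, vA, vB, vp] [aNum, aDen] σ τ ∧
      (∀ u < N, IsCode f o (τ.rd aNum) (τ.rd aDen) u) ∧
      t ≤ (6 * (fE.cost + oE.cost) + 300) * N + 20) σ := by
  rw [codes, wp_seq]
  refine (wp_codeCycles hM hN h0 P).mono ?_
  rintro σ1 t1 ⟨s1, h₁, ht1⟩
  refine (wp_reversePass (T := 3 * fE.cost + oE.cost + 20)
    (Inv := fun S τ => Frame [vq, vx, vm, vt, vA, vB, vp] [aNum, aDen] σ τ ∧
      ∀ u < N, S u → IsCode f o (τ.rd aNum) (τ.rd aDen) u) P hM.lt ⟨s1, h₁⟩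
    (fun S τ h => ⟨h.1.var _, h.1.rd _⟩)
    (fun S τ j h => ⟨h.1.setVar, h.2⟩) ?_).mono ?_
  · rintro S v τ hv hSv hSf hcl ⟨s, h⟩
    have s2 := s.setVar (x := vq) (v := v)
    have hfv := hM.lt v hv
    have hne : f v ≠ v := fun e => hSv (by rwa [e] at hSf)
    have l1 : v < τ.len aNum := by rw [s.len]; exact hv.trans_le hM.len.1
    have l2 : v < τ.len aDen := by rw [s.len]; exact hv.trans_le hM.len.2
    simp only [evals, steps]
    rw [hM.digit _ s2 (by simpa using hv), hM.step _ s2 (by simpa using hv),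
      hM.step _ (s2.wr) (by simpa using hv)]
    simp only [var_setVar, if_true, var_wr, rd_setVar]
    refine ⟨by simp, ⟨s2.wr.wr, ?_⟩, by simp; omega⟩
    rw [rd_wr_self _ _ (by simpa using l2), rd_wr, if_neg (by decide),
      rd_wr_self _ _ (by simpa using l1), rd_wr, if_neg (by decide), rd_setVar, rd_setVar]
    rintro u hu (hS | rfl)
    · have h1 : u ≠ v := fun e => hSv (e ▸ hS)
      have h2 : f u ≠ v := fun e => hSv (e ▸ hcl u hu hS)
      unfold IsCode
      rw [update_of_ne h1, update_of_ne h1, update_of_ne h2,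
        update_of_ne h2]
      exact h u hu hS
    · have := (h _ hfv hSf).1
      unfold IsCode
      rw [update_self, update_self, update_of_ne hne,
        update_of_ne hne]
      exact ⟨by omega, by ring⟩
  · rintro τ t ⟨S, hS, ⟨s, h⟩, ht⟩
    refine ⟨s, fun u hu => h u hu (hS u hu), ?_⟩
    have : N * (3 * fE.cost + oE.cost + 20 + 20) ≤ (3 * (fE.cost + oE.cost) + 100) * N := by
      rw [mul_comm]; exact Nat.mul_le_mul_right _ (by omega)
    have e : (6 * (fE.cost + oE.cost) + 300) * N = (3 * (fE.cost + oE.cost) + 200) * N +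
      (3 * (fE.cost + oE.cost) + 100) * N := by ring
    omega

end Program


/-! ## Exploration of a graph, and checks of all pairs -/

notation "aIn" => (14 : Fin 20)

/-- Invariant of the exploration from `r`: the marked nodes are listed in `ord`, the successors of
the first `h` of them and `x` successors of the next one are marked. -/
structure Exploring (N K : ℕ) (G : ℕ → ℕ → ℕ) (r : ℕ) (mark ord : ℕ → ℕ) (o h x : ℕ) : Prop where
  ord_lt : ∀ j < o, ord j < N
  ord_inj : ∀ j < o, ∀ i < j, ord i ≠ ord j
  reach : ∀ j < o, Reach K G r (ord j)
  root : mark r ≠ 0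
  le_one : ∀ u, mark u ≤ 1
  mem : ∀ u, mark u ≠ 0 ↔ ∃ j < o, ord j = u
  succ : ∀ j ≤ h, j < o → ∀ y < K, j < h ∨ y < x → mark (G (ord j) y) ≠ 0

namespace Exploring

variable {N K : ℕ} {G : ℕ → ℕ → ℕ} {r : ℕ} {mark ord : ℕ → ℕ} {o h x : ℕ}

theorem skip (E : Exploring N K G r mark ord o h x) (hm : mark (G (ord h) x) ≠ 0) :
    Exploring N K G r mark ord o h (x + 1) :=
  { E with
    succ := fun j hj hjo y hy hor => by have := E.succ j hj hjo y hy; grind }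

theorem next (E : Exploring N K G r mark ord o h K) : Exploring N K G r mark ord o (h + 1) 0 :=
  { E with succ := fun j _ hjo y hy _ => E.succ j (by omega) hjo y hy (Or.inr hy) }

theorem add (E : Exploring N K G r mark ord o h x) (ho : h < o) (hx : x < K)
    (hm : mark (G (ord h) x) = 0) (hG : G (ord h) x < N) :
    o < N ∧ Exploring N K G r (update mark (G (ord h) x) 1)
      (update ord o (G (ord h) x)) (o + 1) h (x + 1) := by
  set u := G (ord h) x with hu
  have hold : ∀ j < o, update ord o u j = ord j := fun j hj =>
    update_of_ne hj.ne _ _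
  have hnew : ∀ j < o, ord j ≠ u := fun j hj e => (E.mem u).2 ⟨j, hj, e⟩ hm
  have hmono : ∀ v, mark v ≠ 0 → update mark u 1 v ≠ 0 := fun v hv => by
    rw [update_apply]; split_ifs; exacts [one_ne_zero, hv]
  have E' : Exploring N K G r (update mark u 1) (update ord o u) (o + 1) h
      (x + 1) := by
    refine ⟨fun j hj => ?_, fun j hj i hi => ?_, fun j hj => ?_, hmono _ E.root, fun v => ?_,
      fun v => ?_, fun j hj _ y hy hor => ?_⟩
    · have := E.ord_lt j; grind
    · have := E.ord_inj j; grind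
    · rcases Nat.lt_succ_iff_lt_or_eq.1 hj with hj | rfl
      · rw [hold j hj]; exact E.reach j hj
      · rw [update_self]; exact (E.reach h ho).tail ⟨x, hx, rfl⟩
    · have := E.le_one v; grind
    · have := E.mem v; by_cases hv : v = u
      · exact ⟨fun _ => ⟨o, by grind⟩, by grind⟩
      · rw [update_of_ne hv, this]
        exact ⟨fun ⟨j, hj, e⟩ => ⟨j, by grind⟩, fun ⟨j, hj, e⟩ => ⟨j, by grind⟩⟩
    · have := E.succ j hj; grind
  exact ⟨le_of_forall_ne E'.ord_lt E'.ord_inj, E'⟩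

theorem mark_eq_one_iff (E : Exploring N K G r mark ord o o 0) {u : ℕ} :
    mark u = 1 ↔ Reach K G r u := by
  have h1 := E.le_one u
  rw [show mark u = 1 ↔ mark u ≠ 0 by omega]
  constructor
  · rintro h
    obtain ⟨j, hj, rfl⟩ := (E.mem u).1 h
    exact E.reach j hj
  · intro h
    induction h with
    | refl => exact E.root
    | tail _ h ih =>
      obtain ⟨y, hy, rfl⟩ := h
      obtain ⟨j, hj, rfl⟩ := (E.mem _).1 (ih (E.le_one _))
      exact E.succ j hj.le hj y hy (Or.inl hj)

end Exploring

section Program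

variable {I : Input} {N K : ℕ} {G : ℕ → ℕ → ℕ}

/-- Mark the nodes that are reachable from the node `r` in `aIn`. -/
def explore (r hK tgt : Exp) : Prog :=
  .seq (.write aIn r (.const 1)) <| .seq (.write aOrd (.const 0) r) <|
  .seq (.assign vo (.const 1)) <| .seq (.assign vp (.const 0)) <| .loop (.lt (.var vp) (.var vo)) <|
  .seq (.assign vq (.read aOrd (.var vp))) <| .seq (.for vx hK <| .seq (.assign vu tgt) <|
    .ite (.read aIn (.var vu)) .skip <| .seq (.write aIn (.var vu) (.const 1)) <|
    .seq (.write aOrd (.var vo) (.var vu)) (.assign vo (.add (.var vo) (.const 1)))) <|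
  .assign vp (.add (.var vp) (.const 1))

theorem wp_explore {r kE tgt : Exp} {r0 : ℕ} {σ : Mem} (hr : ∀ τ, r.eval I τ = r0)
    (hK : ∀ τ, kE.eval I τ = K) (ht : ∀ τ : Mem, τ.var vq < N → τ.var vx < K →
      tgt.eval I τ = G (τ.var vq) (τ.var vx)) (hG : ∀ q < N, ∀ x < K, G q x < N) (hr0 : r0 < N)
    (h0 : ∀ u, σ.rd aIn u = 0) (l1 : N ≤ σ.len aIn) (l2 : N ≤ σ.len aOrd) :
    wp I (explore r kE tgt) (fun τ t => Frame [vq, vx, vu, vo, vp] [aIn, aOrd] σ τ ∧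
      (∀ u, τ.rd aIn u = 1 ↔ Reach K G r0 u) ∧
      t ≤ N * (K * (tgt.cost + kE.cost + 30) + kE.cost + 30) + 2 * r.cost + 20) σ := by
  simp only [evals, steps, explore, hr]
  have s := Frame.refl [vq, vx, vu, vo, vp] [aIn, aOrd] σ
  refine (wp_loop (Inv := fun τ => Frame [vq, vx, vu, vo, vp] [aIn, aOrd] σ τ ∧
      Exploring N K G r0 (τ.rd aIn) (τ.rd aOrd) (τ.var vo) (τ.var vp) 0 ∧ τ.var vp ≤ τ.var vo)
    (Φ := fun τ => (N - τ.var vp) * (K * (tgt.cost + kE.cost + 30) + kE.cost + 30)) ?_ ?_).mono ?_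
  · rintro τ ⟨s, E, hle⟩ hgo
    have hlt : τ.var vp < τ.var vo := by
      by_contra hc
      exact hgo (by simp [hc])
    have hq := E.ord_lt _ hlt
    set h := τ.var vp with hh
    set q := τ.rd aOrd h with hqd
    simp only [evals, steps]
    refine (wp_for (H := K) (T := tgt.cost + 22) (Inv := fun i υ => υ.var vx = i ∧
      υ.var vq = q ∧ υ.var vp = h ∧ Frame [vq, vx, vu, vo, vp] [aIn, aOrd] σ υ ∧
      Exploring N K G r0 (υ.rd aIn) (υ.rd aOrd) (υ.var vo) h i ∧ h < υ.var vo ∧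
      υ.rd aOrd h = q) ⟨by simp, by simp [hqd, hh], by simp [hh],
        s.setVar.setVar, by simpa using E, by simpa using hlt, by simp [hqd]⟩
      (fun _ υ _ => hK υ) (fun j υ h => h.1) ?_).mono ?_
    · rintro i υ hi ⟨h1, h2, h3, h4, h5, h6, h7⟩
      have hGq := hG q hq i hi
      simp only [evals, wp_seq, wp_assign, wp_ite, ht υ (by omega) (by omega), h1, h2, var_setVar, if_true, rd_setVar]
      by_cases hm : υ.rd aIn (G q i) = 0
      · obtain ⟨ho, E'⟩ := h5.add h6 hi (by rw [h7]; exact hm) (by rw [h7]; exact hGq)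
        rw [h7] at E'
        have m1 : G q i < (υ.setVar vu (G q i)).len aIn := by
          rw [len_setVar, h4.len]; omega
        have m2 : υ.var vo < ((υ.setVar vu (G q i)).wr aIn (G q i) 1).len aOrd := by
          rw [len_wr, len_setVar, h4.len]; omega
        have e1 := rd_wr_self _ 1 m1
        have e2 := rd_wr_self _ (G q i) m2
        rw [if_pos hm]
        simp only [wp_seq, wp_write, wp_assign, eval_var, eval_const, eval_add,
          var_wr, var_setVar, if_true, Fin.reduceEq, if_false, rd_setVar, h1, e2, cost]
        refine ⟨trivial, ⟨trivial, h2, h3, h4.setVar.wr.wr.setVar.setVar, ?_, by omega, ?_⟩, by omega⟩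
        · rw [rd_wr, if_neg (by decide), e1, rd_wr, if_neg (by decide)]
          exact E'
        · rw [update_of_ne (by omega), rd_wr, if_neg (by decide)]
          exact h7
      · rw [if_neg hm, wp_skip]
        exact ⟨by simp [h1], ⟨by simp, by simp [h2], by simp [h3], h4.setVar.setVar, by simpa using h5.skip (by rw [h7]; exact hm), by simpa using h6,
          by simpa using h7⟩, by simp⟩
    · rintro υ t ⟨⟨h1, h2, h3, h4, h5, h6, h7⟩, ht⟩
      have hN := le_of_forall_ne h5.ord_lt h5.ord_inj
      simp only [evals, rd_setVar, var_setVar, if_true, Fin.reduceEq, if_false, h3, cost]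
      refine ⟨⟨h4.setVar, h5.next, h6⟩, ?_⟩
      obtain ⟨r, hr⟩ : ∃ r, N = h + 1 + r := ⟨N - (h + 1), by omega⟩
      rw [show N - (h + 1) = r by omega, show N - h = r + 1 by omega, add_mul r 1]
      have := Nat.mul_le_mul_left K (show tgt.cost + 22 + kE.cost + 7 ≤ tgt.cost + kE.cost + 30 by omega)
      omega
  · refine ⟨s.wr.wr.setVar.setVar, ?_, by simp⟩
    have e1 := rd_wr_self (a := aIn) σ 1 (hr0.trans_le l1)
    have e2 := rd_wr_self (a := aOrd) (i := 0) (σ.wr aIn r0 1) r0 (by rw [len_wr]; omega)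
    simp only [rd_setVar, var_setVar, Fin.reduceEq, if_true, if_false, e2]
    rw [rd_wr, if_neg (by decide), e1]
    refine ⟨fun j hj => ?_, fun j hj i hi => by omega, fun j hj => ?_, by simp, fun u => ?_,
      fun u => ?_, fun j hj _ y _ h => by omega⟩
    · obtain rfl : j = 0 := by omega
      simpa using hr0
    · obtain rfl : j = 0 := by omega
      exact Relation.ReflTransGen.refl (a := r0)
    · rw [update_apply]; split_ifs; exacts [le_rfl, by simp [h0]]
    · rw [update_apply, h0]
      constructor
      · intro h; exact ⟨0, one_pos, by simp at h ⊢; exact h.symm⟩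
      · rintro ⟨j, hj, rfl⟩
        obtain rfl : j = 0 := by omega
        simp
  · rintro τ t ⟨⟨s, E, hle⟩, hend, ht⟩
    have : ¬ τ.var vp < τ.var vo := fun hc => by simp [hc] at hend
    rw [show τ.var vp = τ.var vo by omega] at E
    refine ⟨s, fun u => E.mark_eq_one_iff, ?_⟩
    simp only [var_setVar, if_true, Nat.sub_zero, cost] at ht ⊢
    omega

/-- Violations are counted in the entry `g q`, so an entry that was 0 stays 0 exactly if no
condition assigned to it fails. A constant `g` gives one global verdict, the identity one verdict
per state. -/
theorem wp_checkAll {hN hK i e : Exp} {a : Fin 20} {g : ℕ → ℕ} {C : ℕ → ℕ → Prop}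
    {σ : Mem} (hN' : ∀ τ, hN.eval I τ = N) (hK' : ∀ τ, hK.eval I τ = K)
    (hg : ∀ q < N, g q < σ.len a) (hi : ∀ τ, i.eval I τ = g (τ.var vq))
    (he : ∀ τ, Frame [vq, vx] [a] σ τ → τ.var vq < N → τ.var vx < K →
      (e.eval I τ = 0 ↔ C (τ.var vq) (τ.var vx))) :
    wp I (countEdges hN hK a i e) (fun τ t => Frame [vq, vx] [a] σ τ ∧
      (∀ j, τ.rd a j = 0 ↔ σ.rd a j = 0 ∧ ∀ q < N, g q = j → ∀ x < K, C q x) ∧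
      t ≤ N * (K * (2 * i.cost + e.cost + hK.cost + 20) + hK.cost + hN.cost + 12) + hN.cost + 5)
      σ := by
  refine (wp_countEdges (G := fun q _ => g q) (A := fun q x => ¬ C q x) (fun τ _ => hN' τ)
    (fun τ _ => hK' τ) (fun τ _ _ _ => hi τ) (fun τ s hq hx => by rw [he τ s hq hx, not_not])
    fun q hq _ _ _ => hg q hq).mono fun τ t ⟨s, h, ht⟩ => ⟨s, fun j => ?_, ht⟩
  rw [h, Nat.add_eq_zero_iff, inDegree_eq_zero]
  exact and_congr_right fun _ => ⟨fun h q hq e x hx => by_contra fun hc => h q hq x hx hc e trivial,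
    fun h q hq x hx hc e _ => hc (h q hq e x hx)⟩

end Program


/-! ## The checks for a minimal automaton -/

section Check

variable (n b : ℕ) (t : ℕ → ℕ → ℕ) (F : ℕ → Prop) (s0 : ℕ) (deg : ℕ → ℕ)

/-- The condition that is checked at the letter `x` of the node `v`. -/
def LocalCheck (v x : ℕ) : Prop :=
  if v < 2 * n then Reach (b + 1) (dotGraph n b t s0) (2 * n) v →
    if v < n then (F v → deg v = 0) ∧ (x + 1 < b → SameLabel n b t F (n + t v x) (t v (x + 1)))
    else if x < b then
      x + 1 < b → (NodeAcc n b t F (n + t (v - n) x) ↔ NodeAcc n b t F (t (v - n) (x + 1)))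
    else IsSink b t F (t (v - n) b)
  else if x = 0 then t (t s0 x) x = t s0 x ∧ SameLabel n b t F (n + t s0 (b - 1)) (t s0 x)
  else if x + 1 = b then t (t s0 x) x = t s0 x else IsSink b t F (t s0 x)

variable {n b t F s0 deg} {mark ord : ℕ → ℕ} {o : ℕ}

/-- All conditions are distributed over the pairs of a node and a letter. The condition `start` is
attached to the letter 0 of the root, and the one on cycles, which does not depend on the letter, is
simply repeated at each letter. -/
theorem localCriterion_iff (hb : 2 ≤ b)
    (hd : (∀ q < n, Reach (b + 1) (dotGraph n b t s0) (2 * n) q → ∀ w : ℕ → ℕ, (∀ j, w j < b) →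
      ¬ OmegaAcc t F q w) ↔
      ∀ q < n, Reach (b + 1) (dotGraph n b t s0) (2 * n) q → F q → deg q = 0) :
    LocalCriterion n b t F s0 ↔
      ∀ v < 2 * n + 1, ∀ x < b + 1, LocalCheck n b t F s0 deg v x := by
  constructor
  · intro h v hv x hx
    unfold LocalCheck
    split_ifs with h1 h2 h3 h4 h5
    · exact fun hr => ⟨hd.1 h.digits v h2 hr, h.int_carry v h2 hr x⟩
    · intro hr
      rw [← Nat.add_sub_of_le (not_lt.1 h2)] at hr
      exact h.frac_carry (v - n) (by omega) hr x
    · intro hr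
      rw [← Nat.add_sub_of_le (not_lt.1 h2)] at hr
      exact h.dot (v - n) (by omega) hr
    · subst h4
      exact ⟨h.twice 0 (Or.inl rfl), h.start⟩
    · exact h.twice x (Or.inr (by omega))
    · exact h.first x hx h4 (by omega)
  · intro h
    have hroot := h (2 * n) (by omega)
    have hint := fun q (hq : q < n) => h q (by omega)
    have hfrac := fun q (hq : q < n) => h (n + q) (by omega)
    unfold LocalCheck at hroot hint hfrac
    simp only [lt_irrefl, if_false] at hroot
    refine ⟨fun x hx h0 h1 => ?_, fun x hx => ?_, ?_, hd.2 fun q hq hr => ?_, fun q hq hr x hx => ?_,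
      fun q hq hr => ?_, fun q hq hr x hx => ?_⟩
    · simpa [h0, show x + 1 ≠ b by omega] using hroot x hx
    · rcases hx with rfl | rfl
      · exact (hroot 0 (by omega)).1
      · have := hroot (b - 1) (by omega)
        rwa [if_neg (by omega), if_pos (by omega)] at this
    · exact (hroot 0 (by omega)).2
    · have := hint q hq 0 (by omega)
      rw [if_pos (by omega), if_pos hq] at this
      exact (this hr).1
    · have := hint q hq x (by omega)
      rw [if_pos (by omega), if_pos hq] at this
      exact (this hr).2 hx
    · have := hfrac q hq b (by omega)
      rw [if_pos (by omega), if_neg (by omega), if_neg (by omega), Nat.add_sub_cancel_left] at this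
      exact this hr
    · have := hfrac q hq x (by omega)
      rw [if_pos (by omega), if_neg (by omega), if_pos (by omega), Nat.add_sub_cancel_left] at this
      exact this hr hx

/-- A word of digits accepted from a reachable state visits some reachable accepting state
infinitely often, and this state survives. Conversely, behind an accepting survivor there is a cycle
of digits in its block; blocks respect the marks because that cycle must itself be reachable. -/
theorem Peeled.digits_iff (W : WeakTable n (b + 1) t F)
    (P : Peeled n b t (BlockEdge t F id mark) deg ord o)
    (hm : ∀ u, mark u = 1 ↔ Reach (b + 1) (dotGraph n b t s0) (2 * n) u) :
    (∀ q < n, Reach (b + 1) (dotGraph n b t s0) (2 * n) q → ∀ w : ℕ → ℕ, (∀ j, w j < b) →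
      ¬ OmegaAcc t F q w) ↔
      ∀ q < n, Reach (b + 1) (dotGraph n b t s0) (2 * n) q → F q → deg q = 0 := by
  have hr : ∀ p q, Reach b t p q → Reach (b + 1) t p q := fun p q h =>
    Relation.ReflTransGen.mono (fun _ _ ⟨x, hx, e⟩ => ⟨x, by omega, e⟩) _ _ h
  have W' : WeakTable n b t F := ⟨fun q hq x hx => W.lt q hq x (by omega),
    fun p hp q hq h1 h2 => W.weak p hp q hq (hr _ _ h1) (hr _ _ h2)⟩
  simp only [← hm]
  constructor
  · intro h q hq hmq hF
    by_contra hd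
    obtain ⟨r, hr, h1, h2, u, hu0, hu, hur⟩ := P.exists_cycle hq hd
    refine h r hr (h1.trans hmq) (periodicWord u) (periodicWord_lt hu0 hu) ?_
    refine Filter.frequently_atTop.2 fun m => ⟨m * u.length,
      Nat.le_mul_of_pos_right _ (List.length_pos_iff.2 hu0), ?_⟩
    rw [omegaRun_periodic, iterate_fixed hur]
    exact h2.2 hF
  · intro h q hq hmq w hw hacc
    have hmark : ∀ i, mark (omegaRun t q w i) = 1 := fun i => by
      induction i with
      | zero => exact hmq
      | succ i ih =>
        rw [hm] at ih ⊢
        exact ih.tail ⟨w i, (hw i).trans (by omega), by simp [dotGraph, W'.run_lt hq hw i, hw i, omegaRun]⟩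
    obtain ⟨p, hp, hFp, hpf⟩ := exists_frequently_eq (W'.run_lt hq hw) hacc
    obtain ⟨d, e⟩ := P.live_of_return W' hq hw (i0 := 0) (fun i _ => (hmark i).trans (hmark 0).symm) hpf
    exact d (h p hp (e.trans (hmark 0)) hFp)

/-- A constant word is unchanged when its first letter is dropped. -/
theorem nodeAcc_extremeStep (ht : ∀ q x, t q x < n) (v : ℕ) :
    NodeAcc n b t F (extremeStep n b t v) ↔ NodeAcc n b t F v := by
  have h : ∀ q c, OmegaAcc t F q (fun _ => c) ↔ OmegaAcc t F (t q c) fun _ => c := fun q c =>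
    omegaAcc_tail t F q _ 1
  unfold extremeStep NodeAcc
  split_ifs with h1 h2 h2
  · exact (h _ _).symm
  · exact absurd (ht _ _) h2
  · omega
  · rw [Nat.add_sub_cancel_left]; exact (h _ _).symm

/-- On a cycle the run on the constant word returns to its first state, so by weakness that state
alone decides. All other nodes inherit the value of their successor. -/
theorem nodeAcc_of_periodic (hb : 2 ≤ b) (W : WeakTable n (b + 1) t F) (ht : ∀ q x, t q x < n)
    {v : ℕ} (hv : v < 2 * n) (h : v ∈ periodicPts (extremeStep n b t)) :
    NodeAcc n b t F v ↔ F (if v < n then v else v - n) := by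
  obtain ⟨k, hk, hkv⟩ := h
  have key : ∀ q c a, q < n → c < b → (∀ p < n, extremeStep n b t (a + p) = a + t p c) → v = a + q →
      (OmegaAcc t F q (fun _ => c) ↔ F q) := by
    intro q c a hq hc hs hva
    have hrun : ∀ i, (extremeStep n b t)^[i] v = a + omegaRun t q (fun _ => c) i ∧
        omegaRun t q (fun _ => c) i < n := fun i => by
      induction i with
      | zero => exact ⟨hva, hq⟩
      | succ i ih =>
        rw [iterate_succ_apply', ih.1, hs _ ih.2]
        exact ⟨rfl, ht _ _⟩
    refine W.acc_iff hq (fun _ => by omega) (Filter.frequently_atTop.2 fun m => ⟨m * k,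
      Nat.le_mul_of_pos_right _ hk, ?_⟩)
    have := (hrun (m * k)).1
    rw [(hkv.const_mul m : _)] at this
    omega
  unfold NodeAcc
  split_ifs with h1
  · exact key v 0 0 h1 (by omega) (fun p hp => by simp [extremeStep, hp]) (by omega)
  · exact key (v - n) (b - 1) n (by omega) (by omega) (fun p hp => by simp [extremeStep]) (by omega)

end Check

/-! ### Saturation of a minimal automaton -/

section Saturated

variable {n b : ℕ}

/-- For d = 1 the code of a letter is its digit and the only weight is 1. A sign is thus the number
0 or b-1, and a single component has to be considered for carries. -/
theorem DBA.saturatedLanguage_iff_local (hb : 2 ≤ b) (M : DBA (Fin n) (Letter b 1))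
    (hM : M.Minimal) : SaturatedLanguage {w | M.Accepts w} ↔
      LocalCriterion n b M.toInput.trans (fun q => M.toInput.acc q = 1) M.init := by
  have ht := M.toInput_trans_lt
  have hmin : ∀ p < n, ∀ q < n, SameLanguage (b + 1) M.toInput.trans (fun q => M.toInput.acc q = 1) p q →
      p = q := by
    intro p hp q hq h
    by_contra hpq
    refine hM ⟨p, hp⟩ ⟨q, hq⟩ (by simpa using hpq) (Set.ext fun w => ?_)
    have := h (fun j => letterCode (w j)) fun j => by simpa using letterCode_lt (w j)
    exact ((M.acceptsFrom_iff ⟨p, hp⟩ w).trans this).trans (M.acceptsFrom_iff ⟨q, hq⟩ w).symm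
  have hsgn' : ∀ a : Fin 1 → Fin b, (if letterCode (some a) = 0 ∨ letterCode (some a) = b - 1 then 1
      else 0) = 1 ↔ ∀ i, IsSignDigit (a i) := fun a => by
    have h := digitOf_letterCode a 0
    have hlt := letterCode_some_lt a
    rw [pow_one] at hlt
    simp only [Fin.val_zero, pow_zero, digitOf, Nat.div_one, Nat.mod_eq_of_lt hlt] at h
    simp [Fin.forall_fin_one, IsSignDigit, h, imp_iff_not_or]
  have hs := M.sign_iff (sgn := fun x => if x = 0 ∨ x = b - 1 then 1 else 0)
    (fun x hx => by simp at hx; rw [pow_one]; omega) hsgn'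
  have hc := M.carry_iff hb 0
  simp only [pow_one, Fin.val_zero, pow_zero, ite_eq_left_iff, zero_ne_one, imp_false, not_not] at hs hc
  rw [saturatedLanguage_iff hb]
  constructor
  · intro h
    obtain ⟨h1, h2⟩ := hs.1 ⟨h.encoding, h.sign⟩
    exact WordCriterion.local hmin ht hb ⟨h1, h2, hc.1 (h.carry 0)⟩
  · intro h
    have w := WordCriterion.of_local ht M.init.isLt hb h
    have h' := hs.2 ⟨w.encoding, w.sign⟩
    refine ⟨h'.1, h'.2, fun i => ?_⟩
    rw [Subsingleton.elim i 0]
    exact hc.2 w.carry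

end Saturated


/-! ## The decision program for a minimal automaton -/

-- These names share arrays with the first program; the two programs are never combined.
notation "aSink" => (6 : Fin 20)
notation "aCyc" => (7 : Fin 20)
notation "aRes" => (8 : Fin 20)

section Program

variable {I : Input} {n b : ℕ} {t : ℕ → ℕ → ℕ} {s0 : ℕ} {σ : Mem}

/-- The successor of the node `v`: by the letter `x` in the first half, by `y` in the second. -/
def stepE (v x y : Exp) : Exp :=
  .iflt v .states (.trans v x) (.add .states (.trans (.sub v .states) y))

/-- The value is `0` if and only if the two values agree. -/
def neqE (e f : Exp) : Exp := .sub (.const 1) (.eq e f)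

theorem eval_neqE {e f : Exp} : (neqE e f).eval I σ = 0 ↔ e.eval I σ = f.eval I σ := by
  simp only [evals, neqE]
  split_ifs with h <;> simp [h]

/-- The value is `0` if and only if the two nodes have the same code. -/
def codeNeqE (u v : Exp) : Exp :=
  neqE (.mul (.read aNum u) (.read aDen v)) (.mul (.read aNum v) (.read aDen u))

def dotGraphE : Exp :=
  .iflt (.var vq) (timesStates 2)
    (.iflt (.var vx) .base (stepE (.var vq) (.var vx) (.var vx))
      (.iflt (.var vq) .states (.add .states (.trans (.var vq) .base)) (.var vq)))
    (.iflt (.var vx) .base (.trans .init (.var vx)) (.var vq))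

def extremeE : Exp := stepE (.var vq) (.const 0) (.sub .base (.const 1))

def dotE : Exp := stepE (.var vq) .base .base

/-- The condition at a letter of a node before the dot. -/
def intCheckE : Exp :=
  .add (.mul (.acc (.var vq)) (.read aCyc (.var vq)))
    (.mul (.lt (.add (.var vx) (.const 1)) .base)
      (codeNeqE (.add .states (.trans (.var vq) (.var vx)))
        (.trans (.var vq) (.add (.var vx) (.const 1)))))

/-- The condition at a letter of a node after the dot. -/
def fracCheckE : Exp :=
  .iflt (.var vx) .base (.mul (.lt (.add (.var vx) (.const 1)) .base)
      (neqE (.read aW (.add .states (.trans (.sub (.var vq) .states) (.var vx))))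
        (.read aW (.trans (.sub (.var vq) .states) (.add (.var vx) (.const 1))))))
    (.read aSink (.trans (.sub (.var vq) .states) .base))

/-- The condition at a letter of the root. -/
def rootCheckE : Exp :=
  .ifeq (.var vx) (.const 0)
    (.add (neqE (.trans (.trans .init (.var vx)) (.var vx)) (.trans .init (.var vx)))
      (codeNeqE (.add .states (.trans .init (.sub .base (.const 1)))) (.trans .init (.var vx))))
    (.ifeq (.add (.var vx) (.const 1)) .base
      (neqE (.trans (.trans .init (.var vx)) (.var vx)) (.trans .init (.var vx)))
      (.read aSink (.trans .init (.var vx))))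

def checkE : Exp :=
  .iflt (.var vq) (timesStates 2)
    (.mul (.eq (.read aIn (.var vq)) (.const 1)) (.iflt (.var vq) .states intCheckE fracCheckE))
    rootCheckE

def findSinks : Prog :=
  countEdges .states (.add .base (.const 1)) aSink (.var vq)
    (.add (.acc (.var vq)) (neqE (.trans (.var vq) (.var vx)) (.var vq)))

/-- Find the accepting states on cycles of digits. -/
def findCycles : Prog :=
  .seq (.assign vN .states) <| .seq (.assign vK .base) <|
  .seq (peel (.trans (.var vq) (.var vx)) (.mul
    (.eq (.read aIn (.var vq)) (.read aIn (.trans (.var vq) (.var vx))))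
    (.eq (.acc (.var vq)) (.acc (.trans (.var vq) (.var vx)))))) <|
  .for vq .states (.write aCyc (.var vq) (.read aDeg (.var vq)))

/-- Peel the graph of the extreme digits, and find the nodes that accept their extreme word. -/
def findNodeAcc : Prog :=
  .seq (.assign vN (timesStates 2)) <| .seq (.assign vK (.const 1)) <|
  .seq (peel extremeE (.const 1)) <|
  .seq (.for vq (timesStates 2) (.write aW (.var vq)
    (.acc (.iflt (.var vq) .states (.var vq) (.sub (.var vq) .states))))) <|
  reversePass (.write aW (.var vq) (.read aW extremeE))

def decideSaturated : Prog :=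
  .seq findSinks <| .seq (explore (timesStates 2) (.add .base (.const 1)) dotGraphE) <|
  .seq findCycles <| .seq findNodeAcc <| .seq (codes extremeE (.read aW dotE)) <|
  .seq (countEdges (.add (timesStates 2) (.const 1)) (.add .base (.const 1)) aRes (.const 0) checkE) <|
  .assign vAns (.eq (.read aRes (.const 0)) (.const 0))

theorem createFree_decideSaturated : decideSaturated.createFree := by
  simp [decideSaturated, findSinks, countEdges, explore, findCycles, peel, peelCount, peelStart,
    findNodeAcc, reversePass, codes, codeCycles, codeCycle]

/-- The input is an automaton over the letters `0, …, b`. -/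
structure InputIs (I : Input) (n b : ℕ) (t : ℕ → ℕ → ℕ) (s0 : ℕ) : Prop where
  states : I.states = n
  base : I.base = b
  trans : I.trans = t
  init : I.init = s0
  acc_le : ∀ q, I.acc q ≤ 1
  lt : ∀ q x, t q x < n

theorem eval_timesStates (hI : InputIs I n b t s0) : (timesStates 2 : Exp).eval I σ = 2 * n := by
  simp [timesStates, hI.states]

theorem eval_extremeE (hI : InputIs I n b t s0) :
    extremeE.eval I σ = extremeStep n b t (σ.var vq) := by
  simp [extremeE, stepE, extremeStep, hI.states, hI.base, hI.trans]

theorem eval_dotE (hI : InputIs I n b t s0) : dotE.eval I σ = dotStep n b t (σ.var vq) := by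
  simp [dotE, stepE, dotStep, hI.states, hI.base, hI.trans]

theorem eval_dotGraphE (hI : InputIs I n b t s0) :
    dotGraphE.eval I σ = dotGraph n b t s0 (σ.var vq) (σ.var vx) := by
  simp only [evals, dotGraphE, stepE, dotGraph, hI.states, hI.base, hI.trans, hI.init, eval_iflt, eval_timesStates hI, eval_init]
  split_ifs <;> first | rfl | omega

theorem extremeStep_lt (ht : ∀ q x, t q x < n) (v : ℕ) : extremeStep n b t v < 2 * n := by
  unfold extremeStep; split_ifs
  · have := ht v 0; omega
  · have := ht (v - n) (b - 1); omega

theorem dotStep_lt (ht : ∀ q x, t q x < n) (v : ℕ) : dotStep n b t v < 2 * n := by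
  unfold dotStep; split_ifs
  · have := ht v b; omega
  · have := ht (v - n) b; omega

theorem wp_findSinks (hI : InputIs I n b t s0) (h0 : ∀ a i, σ.rd a i = 0) (hl : ∀ a, n ≤ σ.len a) :
    wp I findSinks (fun τ T => Frame [vq, vx] [aSink] σ τ ∧
      (∀ q < n, τ.rd aSink q = 0 ↔ IsSink b t (fun q => I.acc q = 1) q) ∧
      T ≤ n * ((b + 1) * 40 + 40) + 10) σ := by
  refine (wp_checkAll (N := n) (K := b + 1) (g := id) (C := fun q x => ¬ I.acc q = 1 ∧ t q x = q)
    (fun τ => by simp [hI.states]) (fun τ => by simp [hI.base]) (fun q hq => hq.trans_le (hl _))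
    (fun τ => rfl) fun τ s _ _ => ?_).mono ?_
  · have := hI.acc_le (τ.var vq)
    rw [eval_add, Nat.add_eq_zero_iff, eval_neqE]
    simp only [evals, hI.trans]
    exact and_congr_left fun _ => by omega
  · rintro τ T ⟨s, h, hT⟩
    refine ⟨s, fun q hq => ?_, ?_⟩
    · rw [h]
      constructor
      · rintro ⟨_, h⟩
        exact ⟨(h q hq rfl 0 (by omega)).1, fun x hx => (h q hq rfl x hx).2⟩
      · rintro h
        exact ⟨h0 _ _, fun q' _ e x hx => by
          simp only [id] at e
          subst e
          exact ⟨h.1, h.2 x hx⟩⟩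
    · simp only [cost, neqE] at hT
      nlinarith [Nat.zero_le (n * b)]

/-- With `vK` set to the base, only digits count as edges and the dot is left out. The result is
copied to `aCyc`, since the next peeling overwrites `aDeg`. -/
theorem wp_findCycles (hI : InputIs I n b t s0) (hl : ∀ a, n ≤ σ.len a) :
    wp I findCycles (fun τ T =>
      Frame [vN, vK, vq, vx, vu, vo, vp] [aDeg, aOrd, aCyc] σ τ ∧
      (∃ ord o, Peeled n b t (BlockEdge t (fun q => I.acc q = 1) id (σ.rd aIn)) (τ.rd aCyc) ord o) ∧
      T ≤ n * ((b + 1) * 300 + 40) + 60) σ := by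
  simp only [evals, steps, findCycles, hI.states, hI.base]
  have s1 := ((Frame.refl [vN, vK, vq, vx, vu, vo, vp] [aDeg, aOrd, aCyc] σ).setVar (x := vN) (v := n)).setVar (x := vK) (v := b)
  set σ1 := (σ.setVar vN n).setVar vK b with hσ1
  have E : EdgeExprs I n b t (BlockEdge t (fun q => I.acc q = 1) id (σ.rd aIn))
      (.trans (.var vq) (.var vx)) (.mul
        (.eq (.read aIn (.var vq)) (.read aIn (.trans (.var vq) (.var vx))))
        (.eq (.acc (.var vq)) (.acc (.trans (.var vq) (.var vx))))) σ1 := by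
    refine ⟨by simp [hσ1], by simp [hσ1], hl _, hl _, fun q _ x _ _ => hI.lt q x,
      fun τ _ _ _ => by simp [hI.trans], fun τ s _ _ => ?_⟩
    have h1 := hI.acc_le (τ.var vq)
    have h2 := hI.acc_le (t (τ.var vq) (τ.var vx))
    have e : τ.rd aIn = σ.rd aIn := s.rd aIn
    simp only [evals, hI.trans, e, BlockEdge, id, mul_eq_zero, ite_eq_right_iff, one_ne_zero, imp_false]
    rw [not_and_or]
    exact or_congr_right (not_congr (by omega))
  refine (wp_peel E).mono ?_
  rintro σ2 T2 ⟨s2, P, hT2⟩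
  have s3 := s1.trans (s2.weaken (ys := [vN, vK, vq, vx, vu, vo, vp]) (bs := [aDeg, aOrd, aCyc]))
  refine (wp_fill (H := n) (g := σ2.rd aDeg) (fun τ _ => by simp [hI.states])
    (fun j _ τ s hj _ _ => by simp [hj, s.rd aDeg]) (by rw [s3.len]; exact hl _)).mono ?_
  rintro σ3 T3 ⟨s4, h, _, hT3⟩
  refine ⟨s3.trans (s4.weaken (ys := [vN, vK, vq, vx, vu, vo, vp]) (bs := [aDeg, aOrd, aCyc])), ⟨_, _, P.ord_lt, P.ord_inj, fun v hv => ?_,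
    P.pred, fun v hv hd => ?_, P.le⟩, ?_⟩
  · rw [h v hv]; exact P.mem v hv
  · rw [h v hv] at hd
    obtain ⟨q, hq, x, hx, h1, h2, h3⟩ := P.live v hv hd
    exact ⟨q, hq, x, hx, h1, h2, by rw [h q hq]; exact h3⟩
  · simp only [cost] at hT2 hT3 ⊢
    nlinarith [Nat.zero_le (n * b)]

-- First every node gets the acceptance of its own state, which is right on the cycles; then the
-- reverse pass replaces the value of each peeled node by that of its successor.
open Classical in
theorem wp_findNodeAcc (hI : InputIs I n b t s0) (hb : 2 ≤ b)
    (W : WeakTable n (b + 1) t (fun q => I.acc q = 1)) (hl : ∀ a, 2 * n ≤ σ.len a) :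
    wp I findNodeAcc (fun τ T =>
      Frame [vN, vK, vq, vx, vu, vo, vp] [aDeg, aOrd, aW] σ τ ∧ τ.var vN = 2 * n ∧
      Peeled (2 * n) 1 (fun v _ => extremeStep n b t v) (fun _ _ => True) (τ.rd aDeg) (τ.rd aOrd)
        (τ.var vo) ∧
      (∀ v < 2 * n, τ.rd aW v = if NodeAcc n b t (fun q => I.acc q = 1) v then 1 else 0) ∧
      T ≤ 2000 * n + 100) σ := by
  have hf := extremeStep_lt (b := b) hI.lt
  simp only [evals, steps, findNodeAcc, eval_timesStates hI]
  have s1 := ((Frame.refl [vN, vK, vq, vx, vu, vo, vp] [aDeg, aOrd, aW] σ).setVar (x := vN) (v := 2 * n)).setVar (x := vK) (v := 1)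
  set σ1 := (σ.setVar vN (2 * n)).setVar vK 1 with hσ1
  have E : EdgeExprs I (2 * n) 1 (fun v _ => extremeStep n b t v) (fun _ _ => True) extremeE
      (.const 1) σ1 :=
    ⟨by simp [hσ1], by simp [hσ1], hl _, hl _, fun q _ x _ _ => hf q,
      fun τ _ _ _ => eval_extremeE hI, fun τ _ _ _ => by simp⟩
  refine (wp_peel E).mono ?_
  rintro σ2 T2 ⟨s2, P, hT2⟩
  have s3 := s1.trans (s2.weaken (ys := [vN, vK, vq, vx, vu, vo, vp]) (bs := [aDeg, aOrd, aW]))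
  refine (wp_fill (H := 2 * n) (g := fun v => I.acc (if v < n then v else v - n))
    (fun τ _ => eval_timesStates hI) (fun j _ τ s hj _ _ => by simp [hj, hI.states])
    (by rw [s3.len]; exact hl _)).mono ?_
  rintro σ3 T3 ⟨s4, h, _, hT3⟩
  refine (wp_reversePass (T := 40) (Inv := fun S τ => Frame [vq, vp] [aW] σ2 τ ∧
    ∀ u < 2 * n, S u → τ.rd aW u = if NodeAcc n b t (fun q => I.acc q = 1) u then 1 else 0) P
    (fun v _ => hf v) ⟨s4.weaken, fun u hu hd => ?_⟩
    (fun S τ h => ⟨h.1.var _, h.1.rd _⟩)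
    (fun S τ j h => ⟨h.1.setVar, h.2⟩) ?_).mono ?_
  · have := hI.acc_le (if u < n then u else u - n)
    have key := nodeAcc_of_periodic hb W hI.lt hu (P.periodic hu hd).1
    rw [h u hu]
    generalize (if u < n then u else u - n) = w at key this ⊢
    split_ifs with h1 <;> simp only [key] at h1 <;> omega
  · rintro S v τ hv hSv hSf - ⟨s, h⟩
    have l : v < (τ.setVar vq v).len aW := by
      rw [len_setVar, s.len, s3.len]; exact hv.trans_le (hl _)
    rw [wp_write, eval_read, eval_extremeE hI, eval_var, var_setVar, if_pos rfl, rd_setVar]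
    refine ⟨by simp, ⟨s.setVar.wr, ?_⟩, by simp [extremeE, stepE, iflt]⟩
    rw [rd_wr_self _ _ l, rd_setVar, h _ (hf v) hSf]
    rintro u hu (hS | rfl)
    · have hne : u ≠ v := fun e => hSv (e ▸ hS)
      rw [update_of_ne hne]; exact h u hu hS
    · rw [update_self]; simp only [nodeAcc_extremeStep hI.lt]
  · rintro σ4 T4 ⟨S, hS, ⟨s5, h'⟩, hT4⟩
    refine ⟨s3.trans (s5.weaken), ?_, ?_,
      fun v hv => h' v hv (hS v hv), ?_⟩
    · rw [s5.var _, s2.var _]; simp [hσ1]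
    · rw [s5.var _, s5.rd _, s5.rd _]; exact P
    · simp only [cost, extremeE, stepE, iflt, timesStates] at hT2 hT3 hT4 ⊢
      omega

/-- Transitions are evaluated whenever they are needed and never stored, so arrays of length 2n + 1
suffice. The phases that range over all letters cost O(n b), those on the graph of extreme digits
O(n). -/
theorem wp_decideSaturated (hI : InputIs I n b t s0) (hb : 2 ≤ b) (hn : 1 ≤ n)
    (W : WeakTable n (b + 1) t (fun q => I.acc q = 1)) (hl : ∀ a, σ.len a = 2 * n + 1)
    (h0 : ∀ a i, σ.rd a i = 0) :
    wp I decideSaturated (fun τ T =>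
      (LocalCriterion n b t (fun q => I.acc q = 1) s0 → τ.var 0 = 1) ∧
      (¬ LocalCriterion n b t (fun q => I.acc q = 1) s0 → τ.var 0 = 0) ∧
      T ≤ 100000 * (n * b)) σ := by
  classical
  have hf := extremeStep_lt (b := b) hI.lt
  set F : ℕ → Prop := fun q => I.acc q = 1 with hF
  rw [decideSaturated, wp_seq]
  refine (wp_findSinks hI h0 fun a => by rw [hl]; omega).mono ?_
  rintro σ1 T1 ⟨s1, h₁, hT1⟩
  rw [wp_seq]
  refine (wp_explore (N := 2 * n + 1) (K := b + 1) (G := dotGraph n b t s0) (r0 := 2 * n)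
    (fun τ => eval_timesStates hI) (fun τ => by simp [hI.base]) (fun τ _ _ => eval_dotGraphE hI)
    (fun q hq x hx => ?_) (by omega) (fun u => by rw [s1.rd _, h0])
    (by rw [s1.len, hl]) (by rw [s1.len, hl])).mono ?_
  · have h1 := hI.lt q x
    have h2 := hI.lt q b
    have h3 := hI.lt (q - n) x
    have h4 := hI.lt s0 x
    unfold dotGraph; split_ifs <;> omega
  rintro σ2 T2 ⟨s2, h₂, hT2⟩
  have f2 := fun a => (s2.len a).trans ((s1.len a).trans (hl a))
  rw [wp_seq]
  refine (wp_findCycles hI fun a => by rw [f2]; omega).mono ?_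
  rintro σ3 T3 ⟨s3, ⟨ord, o, h₃⟩, hT3⟩
  have f3 := fun a => (s3.len a).trans (f2 a)
  rw [wp_seq]
  refine (wp_findNodeAcc hI hb W fun a => by rw [f3]; omega).mono ?_
  rintro σ4 T4 ⟨s4, hN, P, h₄, hT4⟩
  have f4 := fun a => (s4.len a).trans (f3 a)
  set o : ℕ → ℕ := fun v => if NodeAcc n b t F (dotStep n b t v) then 1 else 0 with ho
  rw [wp_seq]
  refine (wp_codes (N := 2 * n) (f := extremeStep n b t) (o := o) (fE := extremeE)
    (oE := .read aW dotE) ⟨fun v _ => hf v, ⟨by rw [f4]; omega, by rw [f4]; omega⟩,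
      fun τ _ _ => eval_extremeE hI, fun τ s _ => ?_⟩ hN (fun u => by
      rw [s4.rd _, s3.rd _, s2.rd _, s1.rd _, h0]) P).mono ?_
  · rw [eval_read, eval_dotE hI, s.rd _, h₄ _ (dotStep_lt hI.lt _)]
  rintro σ5 T5 ⟨s5, h5, hT5⟩
  have f5 := fun a => (s5.len a).trans (f4 a)
  rw [wp_seq]
  refine (wp_checkAll (N := 2 * n + 1) (K := b + 1) (g := fun _ => 0)
    (C := LocalCheck n b t F s0 (σ3.rd aCyc)) (fun τ => by simp [eval_timesStates hI])
    (fun τ => by simp [hI.base]) (fun q _ => by rw [f5]; omega) (fun τ => rfl) ?_).mono ?_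
  · intro τ s hv hx
    -- `r1` to `r5` translate the stored arrays into the conditions of `LocalCheck`; the phases in
    -- between and the check itself do not touch these arrays.
    have r1 : ∀ q < n, (τ.rd aSink q = 0 ↔ IsSink b t F q) := fun q hq => by
      rw [← h₁ q hq, s.rd _, s5.rd _, s4.rd _, s3.rd _,
        s2.rd _]
    have r2 : ∀ u, (τ.rd aIn u = 1 ↔ Reach (b + 1) (dotGraph n b t s0) (2 * n) u) := fun u => by
      rw [← h₂ u, s.rd _, s5.rd _, s4.rd _, s3.rd _]
    have r3 : τ.rd aCyc = σ3.rd aCyc := by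
      rw [s.rd _, s5.rd _, s4.rd _]
    have r4 : ∀ u < 2 * n, ∀ v < 2 * n, (τ.rd aW u = τ.rd aW v ↔
        (NodeAcc n b t F u ↔ NodeAcc n b t F v)) := fun u hu v hv => by
      rw [s.rd _, s5.rd _, h₄ u hu, h₄ v hv]
      split_ifs <;> simp_all
    have r5 : ∀ u < 2 * n, ∀ v < 2 * n, (τ.rd aNum u * τ.rd aDen v = τ.rd aNum v * τ.rd aDen u ↔
        SameLabel n b t F u v) := fun u hu v hv => by
      rw [s.rd _, s.rd _, code_eq_iff (fun v _ => hf v)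
        (fun v => by simp only [ho]; split_ifs <;> simp) h5 hu hv]
      refine forall_congr' fun l => ?_
      simp only [ho]
      split_ifs <;> simp_all
    have ht := hI.lt
    have ha : I.acc (τ.var vq) ≠ 0 ↔ F (τ.var vq) := by
      have := hI.acc_le (τ.var vq); simp only [hF]; omega
    have hn' : ∀ q x, n + t q x < 2 * n := fun q x => by have := ht q x; omega
    have ht' : ∀ q x, t q x < 2 * n := fun q x => by have := ht q x; omega
    have hif : ∀ (p : Prop) [Decidable p], (if p then 1 else 0) = 0 ↔ ¬ p := fun p _ => by simp
    simp only [checkE, eval_iflt, eval_timesStates hI, eval_var, LocalCheck]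
    by_cases h1 : τ.var vq < 2 * n
    · rw [if_pos h1, if_pos h1]
      simp only [evals, mul_eq_zero, hif, r2, eval_iflt, hI.states, ← imp_iff_not_or]
      refine imp_congr_right fun _ => ?_
      split_ifs with h2 h3
      · simp only [evals, intCheckE, codeNeqE, Nat.add_eq_zero_iff, mul_eq_zero, eval_neqE, hI.base, hif, hI.states, hI.trans, r3, r5 _ (hn' _ _) _ (ht' _ _), ← imp_iff_not_or]
        exact and_congr_left fun _ => by rw [← ha]; tauto
      · simp only [evals, fracCheckE, eval_iflt, mul_eq_zero, eval_neqE, hI.base, if_pos h3, hif, hI.states, hI.trans, r4 _ (hn' _ _) _ (ht' _ _), ← imp_iff_not_or]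
      · simp only [evals, fracCheckE, eval_iflt, hI.states, hI.base, hI.trans, if_neg h3, r1 _ (ht _ _)]
    · rw [if_neg h1, if_neg h1]
      simp only [evals, rootCheckE, codeNeqE, eval_ifeq, hI.base]
      split_ifs <;>
      simp only [evals, Nat.add_eq_zero_iff, eval_neqE, eval_init, hI.states, hI.base, hI.trans, hI.init, r5 _ (hn' _ _) _ (ht' _ _), r1 _ (ht _ _)]
  · rintro σ6 T6 ⟨s6, h6, hT6⟩
    have hiff : σ6.rd aRes 0 = 0 ↔ LocalCriterion n b t F s0 := by
      rw [h6, s5.rd _, s4.rd _, s3.rd _, s2.rd _,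
        s1.rd _, localCriterion_iff hb (h₃.digits_iff W h₂)]
      simp [h0]
    rw [wp_assign]
    simp only [evals, steps]
    refine ⟨fun h => if_pos (hiff.2 h), fun h => if_neg (mt hiff.1 h), ?_⟩
    have e1 : n ≤ n * b := Nat.le_mul_of_pos_right _ (by omega)
    have e2 : b ≤ n * b := Nat.le_mul_of_pos_left _ (by omega)
    simp only [cost, extremeE, dotE, stepE, iflt, ifeq, timesStates, dotGraphE, checkE,
      intCheckE, fracCheckE, rootCheckE, neqE, codeNeqE] at hT1 hT2 hT3 hT4 hT5 hT6 ⊢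
    nlinarith

end Program


/-- The size 2n + 1 of the arrays needs no preparation, so the preliminary part is `skip`. -/
theorem exists_decidesSaturated : ∃ (k m : ℕ) (P : Cmd (k + 1) m) (C : ℝ),
    ∀ (b n : ℕ), 2 ≤ b → ∀ M : DBA (Fin n) (Letter b 1), M.Weak → M.Minimal →
      DecidesWithin P M.toInput (SaturatedLanguage {w | M.Accepts w}) (C * (n * b)) (C * n) := by
  refine ⟨39, 20, .seq .skip (.seq (createAll (.add (timesStates 2) (.const 1)) (List.finRange 20))
    decideSaturated), 200000, fun b n hb M hM hM' => ?_⟩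
  have hn : 1 ≤ n := M.init.pos
  have hnR : (1 : ℝ) ≤ n := by exact_mod_cast hn
  have hbR : (2 : ℝ) ≤ b := by exact_mod_cast hb
  have W := hM.weakTable
  rw [pow_one] at W
  have hI : InputIs M.toInput n b M.toInput.trans M.init :=
    ⟨rfl, rfl, rfl, rfl, M.toInput_acc_le, M.toInput_trans_lt⟩
  refine decidesWithin_of_wp (k := 39) (T0 := 1) (S := 2 * n + 1) (R := fun _ => True)
    (T := 100000 * (n * b)) (by simp) createFree_decideSaturated (by simp)
    (fun σ _ => by simp [timesStates, DBA.toInput]) (fun σ _ hl h0 => ?_) ?_ ?_ rfl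
  · rw [M.saturatedLanguage_iff_local hb hM']
    exact wp_decideSaturated hI hb hn W hl h0
  · simp only [timesStates, cost]
    push_cast
    nlinarith
  · push_cast
    nlinarith

theorem mainTheorem8 :
    (∃ (k m : ℕ) (P : Cmd (k + 1) m) (C : ℝ),
      ∀ (b d n : ℕ), 2 ≤ b → 1 ≤ d →
      ∀ M : DBA (Fin n) (Letter b d), M.Weak →
        DecidesWithin P M.toInput M.IsRVA
          (C * (n * Real.log (n + 1) * d * (b : ℝ) ^ d)) (C * (n * (b : ℝ) ^ d))) ∧
    (∃ (k m : ℕ) (P : Cmd (k + 1) m) (C : ℝ),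
      ∀ (b n : ℕ), 2 ≤ b →
      ∀ M : DBA (Fin n) (Letter b 1), M.Weak → M.Minimal →
        DecidesWithin P M.toInput (SaturatedLanguage {w | M.Accepts w})
          (C * (n * b)) (C * n)) :=
  ⟨exists_decidesRVA, exists_decidesSaturated⟩
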